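/- **Setting.** Let $\nu>0$, $t>0$, and consider in $\mathbb R^3\times(0,t)$ the Navier--Stokes equations $$v_{,t}+v\cdot\nabla v-\nu\Delta v+\nabla p=f,\qquad \operatorname{div}v=0,\qquad v|_{t=0}=v(0).$$ Let $(v,p)$ be a regular axially symmetric solution ($v,p,f$ axially symmetric): $v$ is smooth on $\mathbb R^3\times[0,t]$ with all its space derivatives in $L_\infty(0,t;L_2(\mathbb R^3))$, and $p$ is smooth on $\mathbb R^3\times(0,t)$ with $\nabla p\in L_1(0,t;L_2(\mathbb R^3))$. For a vector field $w$ write $w_r,w_\varphi,w_z$ for its cylindrical components, which are functions of $(r,z)$ and time. Put $$\omega=\operatorname{rot}v,\quad F=\operatorname{rot}f,\quad u=rv_\varphi,\quad f_0=rf_\varphi,\quad \Phi=\omega_r/r,\quad \Gamma=\omega_\varphi/r .$$ Let $r_0>0$, let $\zeta=\zeta(r)$ be a smooth function with $\zeta=1$ for $r\le r_0$ and $\zeta=0$ for $r\ge 2r_0$, and write $\tilde g=g\zeta$. **Norms.** On $\bar{\mathbb R}^3=\{(r,z):r>0,\ z\in\mathbb R\}$ we use the measure $dx=r\,dr\,dz$.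 For functions on $\bar{\mathbb R}^3$, $|g|_p$ is the norm of $L_p(\bar{\mathbb R}^3)$. For functions on $\bar{\mathbb R}^3_t=\bar{\mathbb R}^3\times(0,t)$, $|g|_{p,q}$ is the norm of $L_q(0,t;L_p(\bar{\mathbb R}^3))$, $|g|_p=|g|_{p,p}$, $|\nabla g|=(g_{,r}^2+g_{,z}^2)^{1/2}$ and $\|g\|_V=|g|_{2,\infty}+|\nabla g|_{2}$. Let $\tilde X=(\|\tilde\Phi\|_V^2+\|\tilde\Gamma\|_V^2)^{1/2}$. **Constants determined by the data.** For $\varepsilon_0\in(0,1)$ put $$D_1^2=3|f|_{2,1}^2+2|v(0)|_2^2,\qquad D_2=|f_0|_{\infty,1}+|u(0)|_\infty,$$ $$D_4=D_1D_2+|u_{,z}(0)|_2+|f_0|_2,\qquad D_5=D_1+D_1D_2+|u_{,r}(0)|_2+|f_0|_2,$$ $$D_{11}=(D_1+D_4+D_5)D_2,\qquad D_{12}=(D_1+D_4)D_2^{1-\varepsilon_0}\frac{r_0^{\varepsilon_0}}{\varepsilon_0},\qquad D_9=D_1D_2^{2(1-\varepsilon_0)}\frac{r_0^{2\varepsilon_0}}{\varepsilon_0^2},$$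 $$D_8=D_1D_{11}+D_1(D_1+D_4+D_5)(D_2+1)+|\tilde F_r|_{6/5,2}^2+|\tilde F_z|_{6/5,2}^2+|\tilde\omega_r(0)|_2^2+|\tilde\omega_z(0)|_2^2,$$ and let "data" stand for the list $(D_1,D_2,D_4,D_5,D_8,D_9,D_{11},D_{12})$. **Lemma 5.1.** Given $\nu,r_0,\zeta$, there are a constant $c>0$ and a positive function $\phi$ of the data, nondecreasing in each argument, both depending only on $\nu,r_0,\zeta$, such that for every $\varepsilon_0\in(0,1)$, every $t>0$ and every regular axially symmetric solution as above whose data are all finite, $$\begin{aligned} &\|\tilde\omega_r\|_V^2+\|\tilde\omega_z\|_V^2+\nu\Big|\frac{\tilde\omega_r}{r}\Big|_2^2\\ &\quad\le c\big(D_{11}+D_{12}|v_\varphi|_\infty^{\varepsilon_0}+D_9|v_\varphi|_\infty^{2\varepsilon_0}\big)|\nabla\tilde\Gamma|_2 +c\big(D_{12}D_1|v_\varphi|_\infty^{\varepsilon_0}+D_9D_1|v_\varphi|_\infty^{2\varepsilon_0}\big)+cD_8\\ &\quad\le\phi(\mathrm{data})\big(1+|v_\varphi|_\infty^{2\varepsilon_0}\big)|\nabla\tilde\Gamma|_2+\phi(\mathrm{data})\big(1+|v_\varphi|_\infty^{2\varepsilon_0}\big).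 \end{aligned}$$ As a consequence, with $\delta=\varepsilon_0$, $$|\tilde\Phi|_2^2\le\phi(\mathrm{data})\big(1+|v_\varphi|_\infty^{2\delta}\big)(\tilde X+1).$$ All norms over time are over $(0,t)$; $|v_\varphi|_\infty$, $|\nabla\tilde\Gamma|_2$, $|\tilde\omega_r/r|_2$ and $|\tilde\Phi|_2$ are norms over $\bar{\mathbb R}^3_t$. -/

import Mathlib

open MeasureTheory Set
open scoped ENNReal NNReal ContDiff

noncomputable section

namespace AxiNS

/-- Euclidean three-space, with Cartesian coordinates `x 0, x 1, x 2`. -/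
abbrev E3 : Type := EuclideanSpace ℝ (Fin 3)

/-- The partial derivative of a scalar function in the `j`-th Cartesian direction. -/
def pd (j : Fin 3) (g : E3 → ℝ) (x : E3) : ℝ :=
  fderiv ℝ g x (EuclideanSpace.single j 1)

/-- The rotation (curl) of a vector field. -/
def curl (w : E3 → E3) (x : E3) : E3 :=
  !₂[pd 1 (fun y => w y 2) x - pd 2 (fun y => w y 1) x,
     pd 2 (fun y => w y 0) x - pd 0 (fun y => w y 2) x,
     pd 0 (fun y => w y 1) x - pd 1 (fun y => w y 0) x]

/-- The rotation by the angle `θ` about the third axis. -/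
def rotZ (θ : ℝ) (x : E3) : E3 :=
  !₂[Real.cos θ * x 0 - Real.sin θ * x 1, Real.sin θ * x 0 + Real.cos θ * x 1, x 2]

/-- Axial symmetry of a vector field: its cylindrical components do not depend on the angle. -/
def AxisymVec (w : E3 → E3) : Prop :=
  ∀ θ x, w (rotZ θ x) = rotZ θ (w x)

/-- Axial symmetry of a scalar function. -/
def AxisymScal (g : E3 → ℝ) : Prop :=
  ∀ θ x, g (rotZ θ x) = g x

/-- `(v, p)` is a regular axially symmetric solution on `[0, t]` of the Navier-Stokes equations in
the whole space, with viscosity `ν` and external force `f`; the initial velocity is `v 0`.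
Regular means: `v` is smooth up to `t = 0` with all its space derivatives in
`L_∞(0, t; L_2(ℝ³))` (so that it vanishes at infinity), and `p` is smooth for positive times
with `∇p` in `L_1(0, t; L_2(ℝ³))`. -/
structure IsRegularSolution (ν t : ℝ) (v : ℝ → E3 → E3) (p : ℝ → E3 → ℝ)
    (f : ℝ → E3 → E3) : Prop where
  smooth_v : ContDiffOn ℝ ∞ (fun y : ℝ × E3 => v y.1 y.2) (Icc 0 t ×ˢ univ)
  smooth_p : ContDiffOn ℝ ∞ (fun y : ℝ × E3 => p y.1 y.2) (Ioo 0 t ×ˢ univ)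
  axisym_v : ∀ s ∈ Icc 0 t, AxisymVec (v s)
  axisym_p : ∀ s ∈ Ioo 0 t, AxisymScal (p s)
  axisym_f : ∀ s ∈ Ioo 0 t, AxisymVec (f s)
  sobolev_v : ∀ n : ℕ, ∃ C : ℝ≥0, ∀ s ∈ Icc 0 t,
    eLpNorm (fun x => ‖iteratedFDeriv ℝ n (v s) x‖) 2 volume ≤ C
  grad_p : ∫⁻ s in Ioo 0 t, eLpNorm (fun x => ‖fderiv ℝ (p s) x‖) 2 volume < ⊤
  momentum : ∀ s ∈ Ioo 0 t, ∀ x : E3, ∀ i : Fin 3,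
    deriv (fun τ => v τ x i) s + ∑ j, v s x j * pd j (fun y => v s y i) x
      - ν * ∑ j, pd j (pd j (fun y => v s y i)) x + pd i (p s) x = f s x i
  divfree : ∀ s ∈ Icc 0 t, ∀ x : E3, ∑ j, pd j (fun y => v s y j) x = 0

/-! ### Cylindrical components

A point of the half-plane is `q = (r, z)`. A quantity on the half-plane which depends on time is a
function `ℝ → ℝ × ℝ → ℝ`, time first. -/

/-- The point with cylindrical coordinates `r`, `φ = 0`, `z`. There the unit vectors
`e_r`, `e_φ`, `e_z` are the three Cartesian unit vectors. -/
def pt (q : ℝ × ℝ) : E3 := !₂[q.1, 0, q.2]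

/-- The radial component of an axially symmetric field. -/
def compR (w : ℝ → E3 → E3) (s : ℝ) (q : ℝ × ℝ) : ℝ := w s (pt q) 0

/-- The angular component of an axially symmetric field. -/
def compPhi (w : ℝ → E3 → E3) (s : ℝ) (q : ℝ × ℝ) : ℝ := w s (pt q) 1

/-- The axial component of an axially symmetric field. -/
def compZ (w : ℝ → E3 → E3) (s : ℝ) (q : ℝ × ℝ) : ℝ := w s (pt q) 2

/-- The curl of a time dependent field, at each time. -/
def rot (w : ℝ → E3 → E3) (s : ℝ) : E3 → E3 := curl (w s)

/-- `∂_r` on the half-plane. -/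
def dr (g : ℝ → ℝ × ℝ → ℝ) (s : ℝ) (q : ℝ × ℝ) : ℝ := deriv (fun r => g s (r, q.2)) q.1

/-- `∂_z` on the half-plane. -/
def dz (g : ℝ → ℝ × ℝ → ℝ) (s : ℝ) (q : ℝ × ℝ) : ℝ := deriv (fun z => g s (q.1, z)) q.2

/-- `|∇g| = (g_{,r}² + g_{,z}²)^{1/2}`. -/
def gradAbs (g : ℝ → ℝ × ℝ → ℝ) (s : ℝ) (q : ℝ × ℝ) : ℝ := √(dr g s q ^ 2 + dz g s q ^ 2)

/-- Multiplication by a function `ζ(r)` of the radius. -/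
def cut (ζ : ℝ → ℝ) (g : ℝ → ℝ × ℝ → ℝ) (s : ℝ) (q : ℝ × ℝ) : ℝ := g s q * ζ q.1

/-- Division by the radius. -/
def overR (g : ℝ → ℝ × ℝ → ℝ) (s : ℝ) (q : ℝ × ℝ) : ℝ := g s q / q.1

/-- Multiplication by the radius. -/
def timesR (g : ℝ → ℝ × ℝ → ℝ) (s : ℝ) (q : ℝ × ℝ) : ℝ := q.1 * g s q

/-- `ζ` is a smooth cut-off function with `ζ = 1` for `r ≤ r₀` and `ζ = 0` for `r ≥ 2 r₀`. -/
structure IsCutoff (r₀ : ℝ) (ζ : ℝ → ℝ) : Prop where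
  smooth : ContDiff ℝ ∞ ζ
  one : ∀ r ≤ r₀, ζ r = 1
  zero : ∀ r, 2 * r₀ ≤ r → ζ r = 0

/-! ### Norms, with values in `[0, ∞]` -/

/-- The measure `r dr dz` on the half-plane `r > 0`. -/
def cyl : Measure (ℝ × ℝ) :=
  (volume.restrict (Ioi 0 ×ˢ univ)).withDensity (fun q => ENNReal.ofReal q.1)

/-- The norm of `L_p` over the half-plane. -/
def spNorm {V : Type*} [NormedAddCommGroup V] (p : ℝ≥0∞) (g : ℝ × ℝ → V) : ℝ≥0∞ :=
  eLpNorm g p cyl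

/-- The norm of `L_q(0, t; L_p)`. -/
def mixNorm {V : Type*} [NormedAddCommGroup V] (p q : ℝ≥0∞) (t : ℝ)
    (g : ℝ → ℝ × ℝ → V) : ℝ≥0∞ :=
  eLpNorm (fun s => spNorm p (g s)) q (volume.restrict (Ioo 0 t))

/-- The energy norm `‖g‖_{L_∞(0,t;L_2)} + ‖∇g‖_{L_2(0,t;L_2)}`. -/
def vNorm (t : ℝ) (g : ℝ → ℝ × ℝ → ℝ) : ℝ≥0∞ :=
  mixNorm 2 ∞ t g + mixNorm 2 2 t (gradAbs g)

/-! ### Derived quantities of a solution -/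

/-- The swirl `u = r v_φ`. -/
def swirl (v : ℝ → E3 → E3) : ℝ → ℝ × ℝ → ℝ := timesR (compPhi v)

/-- `f_0 = r f_φ`. -/
def f0 (f : ℝ → E3 → E3) : ℝ → ℝ × ℝ → ℝ := timesR (compPhi f)

/-- `ω̃_r = ω_r ζ`. -/
def omR (ζ : ℝ → ℝ) (v : ℝ → E3 → E3) : ℝ → ℝ × ℝ → ℝ := cut ζ (compR (rot v))

/-- `ω̃_z = ω_z ζ`. -/
def omZ (ζ : ℝ → ℝ) (v : ℝ → E3 → E3) : ℝ → ℝ × ℝ → ℝ := cut ζ (compZ (rot v))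

/-- `Φ̃ = (ω_r / r) ζ`. -/
def PhiT (ζ : ℝ → ℝ) (v : ℝ → E3 → E3) : ℝ → ℝ × ℝ → ℝ := cut ζ (overR (compR (rot v)))

/-- `Γ̃ = (ω_φ / r) ζ`. -/
def GammaT (ζ : ℝ → ℝ) (v : ℝ → E3 → E3) : ℝ → ℝ × ℝ → ℝ := cut ζ (overR (compPhi (rot v)))

/-- `X̃ = (‖Φ̃‖_V² + ‖Γ̃‖_V²)^{1/2}`. -/
def XT (ζ : ℝ → ℝ) (t : ℝ) (v : ℝ → E3 → E3) : ℝ≥0∞ :=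
  (vNorm t (PhiT ζ v) ^ 2 + vNorm t (GammaT ζ v) ^ 2) ^ (1 / 2 : ℝ)

/-- `|v_φ|_∞` over `(0, t)`. -/
def supVphi (t : ℝ) (v : ℝ → E3 → E3) : ℝ≥0∞ := mixNorm ∞ ∞ t (compPhi v)

/-- `‖ω̃_r‖_V² + ‖ω̃_z‖_V² + ν |ω̃_r / r|_2²`. -/
def lhs (ν : ℝ) (ζ : ℝ → ℝ) (t : ℝ) (v : ℝ → E3 → E3) : ℝ≥0∞ :=
  vNorm t (omR ζ v) ^ 2 + vNorm t (omZ ζ v) ^ 2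
    + ENNReal.ofReal ν * mixNorm 2 2 t (overR (omR ζ v)) ^ 2

/-! ### The constants determined by the data -/

/-- `D_1 = (3 |f|_{2,1}² + 2 |v(0)|_2²)^{1/2}`. -/
def D1 (t : ℝ) (v f : ℝ → E3 → E3) : ℝ≥0∞ :=
  (3 * mixNorm 2 1 t (fun s q => f s (pt q)) ^ 2
    + 2 * spNorm 2 (fun q => v 0 (pt q)) ^ 2) ^ (1 / 2 : ℝ)

/-- `D_2 = |f_0|_{∞,1} + |u(0)|_∞`. -/
def D2 (t : ℝ) (v f : ℝ → E3 → E3) : ℝ≥0∞ :=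
  mixNorm ∞ 1 t (f0 f) + spNorm ∞ (swirl v 0)

/-- `D_4 = D_1 D_2 + |u_{,z}(0)|_2 + |f_0|_2`. -/
def D4 (t : ℝ) (v f : ℝ → E3 → E3) : ℝ≥0∞ :=
  D1 t v f * D2 t v f + spNorm 2 (dz (swirl v) 0) + mixNorm 2 2 t (f0 f)

/-- `D_5 = D_1 + D_1 D_2 + |u_{,r}(0)|_2 + |f_0|_2`. -/
def D5 (t : ℝ) (v f : ℝ → E3 → E3) : ℝ≥0∞ :=
  D1 t v f + D1 t v f * D2 t v f + spNorm 2 (dr (swirl v) 0) + mixNorm 2 2 t (f0 f)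

/-- `D_{11} = (D_1 + D_4 + D_5) D_2`. -/
def D11 (t : ℝ) (v f : ℝ → E3 → E3) : ℝ≥0∞ :=
  (D1 t v f + D4 t v f + D5 t v f) * D2 t v f

/-- `D_{12} = (D_1 + D_4) D_2^{1-ε} r₀^ε / ε`. -/
def D12 (r₀ ε t : ℝ) (v f : ℝ → E3 → E3) : ℝ≥0∞ :=
  (D1 t v f + D4 t v f) * D2 t v f ^ (1 - ε) * ENNReal.ofReal (r₀ ^ ε / ε)

/-- `D_9 = D_1 D_2^{2(1-ε)} r₀^{2ε} / ε²`. -/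
def D9 (r₀ ε t : ℝ) (v f : ℝ → E3 → E3) : ℝ≥0∞ :=
  D1 t v f * D2 t v f ^ (2 * (1 - ε)) * ENNReal.ofReal (r₀ ^ (2 * ε) / ε ^ 2)

/-- `D_8 = D_1 D_{11} + D_1 (D_1 + D_4 + D_5)(D_2 + 1) + |F̃_r|_{6/5,2}² + |F̃_z|_{6/5,2}²
+ |ω̃_r(0)|_2² + |ω̃_z(0)|_2²`, where `F = rot f`. -/
def D8 (ζ : ℝ → ℝ) (t : ℝ) (v f : ℝ → E3 → E3) : ℝ≥0∞ :=
  D1 t v f * D11 t v f + D1 t v f * (D1 t v f + D4 t v f + D5 t v f) * (D2 t v f + 1)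
    + mixNorm (6 / 5) 2 t (cut ζ (compR (rot f))) ^ 2
    + mixNorm (6 / 5) 2 t (cut ζ (compZ (rot f))) ^ 2
    + spNorm 2 (omR ζ v 0) ^ 2 + spNorm 2 (omZ ζ v 0) ^ 2

/-- The list of the constants determined by the data that the estimate involves. -/
def data (r₀ : ℝ) (ζ : ℝ → ℝ) (ε t : ℝ) (v f : ℝ → E3 → E3) : Fin 8 → ℝ≥0∞ :=
  ![D1 t v f, D2 t v f, D4 t v f, D5 t v f, D8 ζ t v f, D9 r₀ ε t v f, D11 t v f,
    D12 r₀ ε t v f]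

end AxiNS

end

open AxiNS

noncomputable section

namespace AxiNS

open Filter (Tendsto atTop)
open EuclideanSpace (single proj)
open Real (norm_eq_abs rpow_nonneg sq_sqrt norm_of_nonneg volume_Ioo enorm_of_nonneg exp cos sin
  sqrt_nonneg)
open intervalIntegral (integral_of_le integral_eq_sub_of_hasDerivAt)
open MeasureTheory.Measure (volume_eq_prod restrict_univ prod_restrict)
open Pi (ofNat_apply)
open ENNReal (ofReal ofReal_le_ofReal ofReal_mul ofReal_add rpow_natCast rpow_mul ofReal_pow
  ofReal_ne_top toReal_nonneg rpow_le_rpow coe_ne_top toReal_mono ofReal_toReal measurable_ofReal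
  continuous_ofReal coe_rpow_of_nonneg coe_mul toReal_ofReal ofReal_one ofReal_add_le
  lintegral_mul_le_Lp_mul_Lq)

local notation "ℝ²" => ℝ × ℝ
local notation "ℝ²₊" => SProd.sprod (Ioi (0 : ℝ)) (univ : Set ℝ)
local notation "𝒞" => ContDiff ℝ ∞

/-! ### Calculus of the half-plane derivatives -/

/-- Time dependent functions on the half-plane. -/
abbrev Fam : Type := ℝ → ℝ² → ℝ

/-- Smoothness in space at each time. -/
def Sm (g : Fam) : Prop := ∀ s, 𝒞 (g s)

/-- A function of the radius as a family. -/
def Z (φ : ℝ → ℝ) : Fam := fun _ q => φ q.1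

/-- A function of the height as a family. -/
def X (χ : ℝ → ℝ) : Fam := fun _ q => χ q.2

/-- The radius as a family. -/
def R : Fam := fun _ q => q.1

lemma Sm.differentiable {g : Fam} (hg : Sm g) (s : ℝ) : Differentiable ℝ (g s) :=
  (hg s).differentiable (by simp)

lemma Sm.hasDerivAt_r' {g : Fam} (hg : Sm g) (s : ℝ) (q : ℝ²) :
    HasDerivAt (fun r => g s (r, q.2)) (fderiv ℝ (g s) q (1, 0)) q.1 := by
  have h1 : HasDerivAt (fun r : ℝ => (r, q.2)) ((1 : ℝ), (0 : ℝ)) q.1 :=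
    (hasDerivAt_id q.1).prodMk (hasDerivAt_const _ _)
  exact ((hg.differentiable s) q).hasFDerivAt.comp_hasDerivAt q.1 h1

lemma Sm.hasDerivAt_z' {g : Fam} (hg : Sm g) (s : ℝ) (q : ℝ²) :
    HasDerivAt (fun z => g s (q.1, z)) (fderiv ℝ (g s) q (0, 1)) q.2 := by
  have h1 : HasDerivAt (fun z : ℝ => (q.1, z)) ((0 : ℝ), (1 : ℝ)) q.2 :=
    (hasDerivAt_const _ _).prodMk (hasDerivAt_id q.2)
  exact ((hg.differentiable s) q).hasFDerivAt.comp_hasDerivAt q.2 h1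

lemma Sm.dr_eq {g : Fam} (hg : Sm g) (s : ℝ) (q : ℝ²) :
    dr g s q = fderiv ℝ (g s) q (1, 0) := (hg.hasDerivAt_r' s q).deriv

lemma Sm.dz_eq {g : Fam} (hg : Sm g) (s : ℝ) (q : ℝ²) :
    dz g s q = fderiv ℝ (g s) q (0, 1) := (hg.hasDerivAt_z' s q).deriv

lemma Sm.hasDerivAt_r {g : Fam} (hg : Sm g) (s : ℝ) (q : ℝ²) :
    HasDerivAt (fun r => g s (r, q.2)) (dr g s q) q.1 := by
  rw [hg.dr_eq]; exact hg.hasDerivAt_r' s q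

lemma Sm.hasDerivAt_z {g : Fam} (hg : Sm g) (s : ℝ) (q : ℝ²) :
    HasDerivAt (fun z => g s (q.1, z)) (dz g s q) q.2 := by
  rw [hg.dz_eq]; exact hg.hasDerivAt_z' s q

lemma Sm.dr {g : Fam} (hg : Sm g) : Sm (dr g) := by
  intro s
  have : AxiNS.dr g s = fun q => fderiv ℝ (g s) q (1, 0) := funext fun q => hg.dr_eq s q
  rw [this]
  exact ((hg s).fderiv_right (m := ∞) (by simp)).clm_apply contDiff_const

lemma Sm.dz {g : Fam} (hg : Sm g) : Sm (dz g) := by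
  intro s
  have : AxiNS.dz g s = fun q => fderiv ℝ (g s) q (0, 1) := funext fun q => hg.dz_eq s q
  rw [this]
  exact ((hg s).fderiv_right (m := ∞) (by simp)).clm_apply contDiff_const

lemma Sm.add {f g : Fam} (hf : Sm f) (hg : Sm g) : Sm (f + g) := fun s => (hf s).add (hg s)
lemma Sm.sub {f g : Fam} (hf : Sm f) (hg : Sm g) : Sm (f - g) := fun s => (hf s).sub (hg s)
lemma Sm.mul {f g : Fam} (hf : Sm f) (hg : Sm g) : Sm (f * g) := fun s => (hf s).mul (hg s)
lemma Sm.neg {f : Fam} (hf : Sm f) : Sm (-f) := fun s => (hf s).neg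
lemma Sm.smul {f : Fam} (hf : Sm f) (c : ℝ) : Sm (c • f) := fun s => (hf s).const_smul c
lemma Sm.Z {φ : ℝ → ℝ} (h : 𝒞 φ) : Sm (Z φ) := fun _ => h.comp contDiff_fst
lemma Sm.X {φ : ℝ → ℝ} (h : 𝒞 φ) : Sm (X φ) := fun _ => h.comp contDiff_snd
lemma Sm.R : Sm R := fun _ => contDiff_fst

lemma dr_add {f g : Fam} (hf : Sm f) (hg : Sm g) : dr (f + g) = dr f + dr g := by
  funext s q; exact ((hf.hasDerivAt_r s q).add (hg.hasDerivAt_r s q)).deriv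
lemma dr_sub {f g : Fam} (hf : Sm f) (hg : Sm g) : dr (f - g) = dr f - dr g := by
  funext s q; exact ((hf.hasDerivAt_r s q).sub (hg.hasDerivAt_r s q)).deriv
lemma dr_neg {f : Fam} (hf : Sm f) : dr (-f) = -dr f := by
  funext s q; exact (hf.hasDerivAt_r s q).neg.deriv
lemma dr_mul {f g : Fam} (hf : Sm f) (hg : Sm g) : dr (f * g) = dr f * g + f * dr g := by
  funext s q; exact ((hf.hasDerivAt_r s q).mul (hg.hasDerivAt_r s q)).deriv
lemma dr_smul {f : Fam} (hf : Sm f) (c : ℝ) : dr (c • f) = c • dr f := by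
  funext s q; exact ((hf.hasDerivAt_r s q).const_smul c).deriv
lemma dz_add {f g : Fam} (hf : Sm f) (hg : Sm g) : dz (f + g) = dz f + dz g := by
  funext s q; exact ((hf.hasDerivAt_z s q).add (hg.hasDerivAt_z s q)).deriv
lemma dz_sub {f g : Fam} (hf : Sm f) (hg : Sm g) : dz (f - g) = dz f - dz g := by
  funext s q; exact ((hf.hasDerivAt_z s q).sub (hg.hasDerivAt_z s q)).deriv
lemma dz_neg {f : Fam} (hf : Sm f) : dz (-f) = -dz f := by
  funext s q; exact (hf.hasDerivAt_z s q).neg.deriv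
lemma dz_mul {f g : Fam} (hf : Sm f) (hg : Sm g) : dz (f * g) = dz f * g + f * dz g := by
  funext s q; exact ((hf.hasDerivAt_z s q).mul (hg.hasDerivAt_z s q)).deriv
lemma dz_smul {f : Fam} (hf : Sm f) (c : ℝ) : dz (c • f) = c • dz f := by
  funext s q; exact ((hf.hasDerivAt_z s q).const_smul c).deriv
lemma dr_Z (φ : ℝ → ℝ) : dr (Z φ) = Z (deriv φ) := rfl
lemma dz_Z (φ : ℝ → ℝ) : dz (Z φ) = 0 := by
  funext s q; exact deriv_const q.2 (φ q.1)
lemma dz_X (φ : ℝ → ℝ) : dz (X φ) = X (deriv φ) := rfl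
lemma dr_X (φ : ℝ → ℝ) : dr (X φ) = 0 := by
  funext s q; exact deriv_const q.1 (φ q.2)
lemma dr_R : dr R = 1 := by
  funext s q; exact deriv_id _
lemma dz_R : dz R = 0 := by
  funext s q; exact deriv_const q.2 q.1

lemma dz_dr {g : Fam} (hg : Sm g) : dz (dr g) = dr (dz g) := by
  funext s q
  rw [hg.dr.dz_eq, hg.dz.dr_eq]
  have h1 : AxiNS.dr g s = fun q => fderiv ℝ (g s) q (1, 0) := funext fun q => hg.dr_eq s q
  have h2 : AxiNS.dz g s = fun q => fderiv ℝ (g s) q (0, 1) := funext fun q => hg.dz_eq s q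
  rw [h1, h2]
  have hd : DifferentiableAt ℝ (fderiv ℝ (g s)) q :=
    ((hg s).fderiv_right (m := ∞) (by simp)).differentiable (by simp) q
  rw [fderiv_clm_apply hd (differentiableAt_const _), fderiv_clm_apply hd (differentiableAt_const _)]
  have := ((hg s).contDiffAt (x := q)).isSymmSndFDerivAt
    (by simp only [minSmoothness_of_isRCLikeNormedField]; exact WithTop.coe_le_coe.2 (le_top (a := (2 : ℕ∞))))
  simpa using this (0, 1) (1, 0)

lemma contDiff_deriv {φ : ℝ → ℝ} (h : 𝒞 φ) : 𝒞 (deriv φ) := (contDiff_infty_iff_deriv.1 h).2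

/-! ### Families with uniformly controlled derivatives on a strip -/

/-- Bounds on the strip `0 ≤ r ≤ ρ`, uniform in time and `L_p` in the height. -/
def Dec (ρ : ℝ) (p : ℕ) (g : Fam) : Prop :=
  ∃ C : ℝ, ∃ m : ℝ → ℝ → ℝ, (∀ s, Measurable (m s)) ∧ (∀ s z, 0 ≤ m s z ∧ m s z ≤ C) ∧
    (∀ s, Integrable (fun z => m s z ^ p) ∧ ∫ z, m s z ^ p ≤ C) ∧
    ∀ s q, 0 ≤ q.1 → q.1 ≤ ρ → |g s q| ≤ m s q.2

/-- Bounds for all derivatives up to a given order. -/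
def AdmN (ρ : ℝ) (p : ℕ) : ℕ → Fam → Prop
  | 0, g => Dec ρ p g
  | n + 1, g => Dec ρ p g ∧ AdmN ρ p n (dr g) ∧ AdmN ρ p n (dz g)

/-- Smooth families with bounds for all derivatives on the strip `0 ≤ r ≤ ρ`. -/
structure Adm (ρ : ℝ) (p : ℕ) (g : Fam) : Prop where
  sm : Sm g
  bd : ∀ n, AdmN ρ p n g

lemma AdmN.dec {ρ p n g} (h : AdmN ρ p n g) : Dec ρ p g := by
  cases n with
  | zero => exact h
  | succ n => exact h.1

lemma AdmN.of_succ {ρ p n g} (h : AdmN ρ p (n + 1) g) : AdmN ρ p n g := by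
  induction n generalizing g with
  | zero => exact h.1
  | succ n ih => exact ⟨h.1, ih h.2.1, ih h.2.2⟩

lemma Adm.dec {ρ p g} (h : Adm ρ p g) : Dec ρ p g := h.bd 0
lemma Adm.dr {ρ p g} (h : Adm ρ p g) : Adm ρ p (dr g) := ⟨h.sm.dr, fun n => (h.bd (n + 1)).2.1⟩
lemma Adm.dz {ρ p g} (h : Adm ρ p g) : Adm ρ p (dz g) := ⟨h.sm.dz, fun n => (h.bd (n + 1)).2.2⟩

lemma Dec.mono {ρ p} {f g : Fam} (hg : Dec ρ p g)
    (h : ∀ s q, 0 ≤ q.1 → q.1 ≤ ρ → |f s q| ≤ |g s q|) : Dec ρ p f := by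
  obtain ⟨C, m, h1, h2, h3, h4⟩ := hg
  exact ⟨C, m, h1, h2, h3, fun s q hq hq' => (h s q hq hq').trans (h4 s q hq hq')⟩

lemma Dec.smul {ρ p g} (hg : Dec ρ p g) (c : ℝ) : Dec ρ p (c • g) := by
  obtain ⟨C, m, h1, h2, h3, h4⟩ := hg
  refine ⟨max (|c| * C) (|c| ^ p * C), fun s z => |c| * m s z, fun s => (h1 s).const_mul _,
    fun s z => ⟨mul_nonneg (abs_nonneg _) (h2 s z).1, ?_⟩, fun s => ⟨?_, ?_⟩, ?_⟩
  · exact (mul_le_mul_of_nonneg_left (h2 s z).2 (abs_nonneg _)).trans (le_max_left _ _)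
  · simp only [mul_pow]; exact (h3 s).1.const_mul _
  · simp only [mul_pow]
    rw [integral_const_mul]
    exact (mul_le_mul_of_nonneg_left (h3 s).2 (by positivity)).trans (le_max_right _ _)
  · intro s q hq hq'
    simp only [Pi.smul_apply, smul_eq_mul, abs_mul]
    exact mul_le_mul_of_nonneg_left (h4 s q hq hq') (abs_nonneg _)

lemma Dec.add {ρ p} {f g : Fam} (hf : Dec ρ p f) (hg : Dec ρ p g) : Dec ρ p (f + g) := by
  obtain ⟨C, m, h1, h2, h3, h4⟩ := hf
  obtain ⟨C', m', h1', h2', h3', h4'⟩ := hg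
  have key : ∀ s z, (m s z + m' s z) ^ p ≤ 2 ^ (p - 1) * (m s z ^ p + m' s z ^ p) :=
    fun s z => add_pow_le (h2 s z).1 (h2' s z).1 p
  have hI : ∀ s, Integrable (fun z => 2 ^ (p - 1) * (m s z ^ p + m' s z ^ p)) :=
    fun s => ((h3 s).1.add (h3' s).1).const_mul _
  have hm : ∀ s, Measurable (fun z => m s z + m' s z) := fun s => (h1 s).add (h1' s)
  refine ⟨max (C + C') (2 ^ (p - 1) * (C + C')), fun s z => m s z + m' s z, hm,
    fun s z => ⟨add_nonneg (h2 s z).1 (h2' s z).1,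
      (add_le_add (h2 s z).2 (h2' s z).2).trans (le_max_left _ _)⟩, fun s => ?_, ?_⟩
  · have hint : Integrable (fun z => (m s z + m' s z) ^ p) := by
      refine (hI s).mono' ((hm s).pow_const p).aestronglyMeasurable (ae_of_all _ fun z => ?_)
      rw [norm_of_nonneg (pow_nonneg (add_nonneg (h2 s z).1 (h2' s z).1) _)]
      exact key s z
    refine ⟨hint, (integral_mono hint (hI s) (key s)).trans ?_⟩
    rw [integral_const_mul, integral_add (h3 s).1 (h3' s).1]
    exact (mul_le_mul_of_nonneg_left (add_le_add (h3 s).2 (h3' s).2) (by positivity)).trans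
      (le_max_right _ _)
  · intro s q hq hq'
    exact (abs_add_le _ _).trans (add_le_add (h4 s q hq hq') (h4' s q hq hq'))

lemma Dec.mul {ρ} {p : ℕ} {f g : Fam} (hp : 1 ≤ p) (hf : Dec ρ 2 f) (hg : Dec ρ 2 g) :
    Dec ρ p (f * g) := by
  obtain ⟨C, m, h1, h2, h3, h4⟩ := hf
  obtain ⟨C', m', h1', h2', h3', h4'⟩ := hg
  obtain ⟨k, rfl⟩ : ∃ k, p = k + 1 := ⟨p - 1, by omega⟩
  have hC : 0 ≤ C := (h2 0 0).1.trans (h2 0 0).2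
  have hC' : 0 ≤ C' := (h2' 0 0).1.trans (h2' 0 0).2
  have key : ∀ s z, (m s z * m' s z) ^ (k + 1) ≤ (C * C') ^ k * (m s z ^ 2 + m' s z ^ 2) := by
    intro s z
    have a1 := h2 s z
    have a2 := h2' s z
    have a3 : (m s z * m' s z) ^ k ≤ (C * C') ^ k :=
      pow_le_pow_left₀ (mul_nonneg a1.1 a2.1) (mul_le_mul a1.2 a2.2 a2.1 hC) _
    rw [pow_succ]
    have a4 : m s z * m' s z ≤ m s z ^ 2 + m' s z ^ 2 := by nlinarith [sq_nonneg (m s z - m' s z)]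
    exact mul_le_mul a3 a4 (mul_nonneg a1.1 a2.1) (by positivity)
  have hI : ∀ s, Integrable (fun z => (C * C') ^ k * (m s z ^ 2 + m' s z ^ 2)) :=
    fun s => ((h3 s).1.add (h3' s).1).const_mul _
  have hm : ∀ s, Measurable (fun z => m s z * m' s z) := fun s => (h1 s).mul (h1' s)
  refine ⟨max (C * C') ((C * C') ^ k * (C + C')), fun s z => m s z * m' s z, hm,
    fun s z => ⟨mul_nonneg (h2 s z).1 (h2' s z).1,
      (mul_le_mul (h2 s z).2 (h2' s z).2 (h2' s z).1 hC).trans (le_max_left _ _)⟩, fun s => ?_, ?_⟩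
  · have hint : Integrable (fun z => (m s z * m' s z) ^ (k + 1)) := by
      refine (hI s).mono' ((hm s).pow_const _).aestronglyMeasurable (ae_of_all _ fun z => ?_)
      rw [norm_of_nonneg (pow_nonneg (mul_nonneg (h2 s z).1 (h2' s z).1) _)]
      exact key s z
    refine ⟨hint, (integral_mono hint (hI s) (key s)).trans ?_⟩
    rw [integral_const_mul, integral_add (h3 s).1 (h3' s).1]
    exact (mul_le_mul_of_nonneg_left (add_le_add (h3 s).2 (h3' s).2) (by positivity)).trans
      (le_max_right _ _)
  · intro s q hq hq'
    simp only [Pi.mul_apply, abs_mul]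
    exact mul_le_mul (h4 s q hq hq') (h4' s q hq hq') (abs_nonneg _) (h2 s q.2).1

lemma AdmN.add {ρ p n} {f g : Fam} (sf : Sm f) (sg : Sm g) (hf : AdmN ρ p n f)
    (hg : AdmN ρ p n g) : AdmN ρ p n (f + g) := by
  induction n generalizing f g with
  | zero => exact Dec.add hf hg
  | succ n ih =>
    refine ⟨hf.1.add hg.1, ?_, ?_⟩
    · rw [dr_add sf sg]; exact ih sf.dr sg.dr hf.2.1 hg.2.1
    · rw [dz_add sf sg]; exact ih sf.dz sg.dz hf.2.2 hg.2.2

lemma Adm.add {ρ p} {f g : Fam} (hf : Adm ρ p f) (hg : Adm ρ p g) : Adm ρ p (f + g) :=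
  ⟨hf.sm.add hg.sm, fun n => (hf.bd n).add hf.sm hg.sm (hg.bd n)⟩

lemma AdmN.smul {ρ p n} {f : Fam} (c : ℝ) (sf : Sm f) (hf : AdmN ρ p n f) : AdmN ρ p n (c • f) := by
  induction n generalizing f with
  | zero => exact Dec.smul hf c
  | succ n ih =>
    refine ⟨hf.1.smul c, ?_, ?_⟩
    · rw [dr_smul sf]; exact ih sf.dr hf.2.1
    · rw [dz_smul sf]; exact ih sf.dz hf.2.2

lemma Adm.smul {ρ p} {f : Fam} (hf : Adm ρ p f) (c : ℝ) : Adm ρ p (c • f) :=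
  ⟨hf.sm.smul c, fun n => (hf.bd n).smul c hf.sm⟩

lemma Adm.neg {ρ p} {f : Fam} (hf : Adm ρ p f) : Adm ρ p (-f) := by
  have := hf.smul (-1); rwa [neg_one_smul] at this

lemma Adm.sub {ρ p} {f g : Fam} (hf : Adm ρ p f) (hg : Adm ρ p g) : Adm ρ p (f - g) := by
  rw [sub_eq_add_neg]; exact hf.add hg.neg

lemma AdmN.mul {ρ p n} {f g : Fam} (hp : 1 ≤ p) (sf : Sm f) (sg : Sm g) (hf : AdmN ρ 2 n f)
    (hg : AdmN ρ 2 n g) : AdmN ρ p n (f * g) := by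
  induction n generalizing f g with
  | zero => exact Dec.mul hp hf hg
  | succ n ih =>
    refine ⟨hf.1.mul hp hg.1, ?_, ?_⟩
    · rw [dr_mul sf sg]
      exact (ih sf.dr sg hf.2.1 hg.of_succ).add (sf.dr.mul sg) (sf.mul sg.dr)
        (ih sf sg.dr hf.of_succ hg.2.1)
    · rw [dz_mul sf sg]
      exact (ih sf.dz sg hf.2.2 hg.of_succ).add (sf.dz.mul sg) (sf.mul sg.dz)
        (ih sf sg.dz hf.of_succ hg.2.2)

lemma Adm.mul2 {ρ} {f g : Fam} (hf : Adm ρ 2 f) (hg : Adm ρ 2 g) : Adm ρ 2 (f * g) :=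
  ⟨hf.sm.mul hg.sm, fun n => (hf.bd n).mul (by norm_num) hf.sm hg.sm (hg.bd n)⟩

lemma Adm.mul {ρ} {f g : Fam} (hf : Adm ρ 2 f) (hg : Adm ρ 2 g) : Adm ρ 1 (f * g) :=
  ⟨hf.sm.mul hg.sm, fun n => (hf.bd n).mul le_rfl hf.sm hg.sm (hg.bd n)⟩

lemma Dec.Z_mul {ρ p} {φ : ℝ → ℝ} {f : Fam} (hφ : Continuous φ) (hf : Dec ρ p f) :
    Dec ρ p (Z φ * f) := by
  obtain ⟨C, hC⟩ := (isCompact_Icc (a := 0) (b := ρ)).exists_bound_of_continuousOn hφ.continuousOn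
  refine (hf.smul C).mono fun s q hq hq' => ?_
  simp only [Z, Pi.mul_apply, Pi.smul_apply, smul_eq_mul, abs_mul]
  have := hC q.1 ⟨hq, hq'⟩
  exact mul_le_mul_of_nonneg_right (this.trans (le_abs_self C)) (abs_nonneg _)

lemma AdmN.Z_mul {ρ p n} {φ : ℝ → ℝ} {f : Fam} (hφ : 𝒞 φ) (sf : Sm f)
    (hf : AdmN ρ p n f) : AdmN ρ p n (Z φ * f) := by
  induction n generalizing f φ with
  | zero => exact Dec.Z_mul hφ.continuous hf
  | succ n ih =>
    refine ⟨hf.1.Z_mul hφ.continuous, ?_, ?_⟩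
    · rw [dr_mul (Sm.Z hφ) sf, dr_Z]
      exact (ih (contDiff_deriv hφ) sf hf.of_succ).add ((Sm.Z (contDiff_deriv hφ)).mul sf)
        ((Sm.Z hφ).mul sf.dr) (ih hφ sf.dr hf.2.1)
    · rw [dz_mul (Sm.Z hφ) sf, dz_Z, zero_mul, zero_add]
      exact ih hφ sf.dz hf.2.2

lemma Adm.Z_mul {ρ p} {φ : ℝ → ℝ} {f : Fam} (hf : Adm ρ p f) (hφ : 𝒞 φ) : Adm ρ p (Z φ * f) :=
  ⟨(Sm.Z hφ).mul hf.sm, fun n => (hf.bd n).Z_mul hφ hf.sm⟩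

lemma Adm.R_mul {ρ p} {f : Fam} (hf : Adm ρ p f) : Adm ρ p (R * f) := hf.Z_mul (φ := id) contDiff_id

lemma AdmN.X {ρ n} {χ : ℝ → ℝ} {p : ℕ} (hp : 1 ≤ p) (hχ : 𝒞 χ)
    (hs : HasCompactSupport χ) : AdmN ρ p n (X χ) := by
  induction n generalizing χ with
  | zero =>
    obtain ⟨C, hC⟩ := hs.exists_bound_of_continuous hχ.continuous
    have hi : Integrable (fun z => |χ z| ^ p) := by
      refine Continuous.integrable_of_hasCompactSupport (hχ.continuous.abs.pow p) ?_
      refine hs.mono fun z hz => ?_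
      contrapose! hz
      simp only [Function.mem_support, not_not] at hz
      simp [hz]; omega
    refine ⟨max C (∫ z, |χ z| ^ p), fun _ z => |χ z|, fun _ => hχ.continuous.abs.measurable,
      fun s z => ⟨abs_nonneg _, (hC z).trans (le_max_left _ _)⟩, fun _ => ⟨hi, le_max_right _ _⟩,
      fun s q _ _ => le_rfl⟩
  | succ n ih =>
    refine ⟨(ih hχ hs).dec, ?_, ih (contDiff_deriv hχ) hs.deriv⟩
    rw [dr_X]
    have : (0 : Fam) = (0 : ℝ) • AxiNS.X χ := by simp
    rw [this]
    exact (ih hχ hs).smul 0 (Sm.X hχ)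

lemma Adm.X {ρ} {χ : ℝ → ℝ} {p : ℕ} (hp : 1 ≤ p) (hχ : 𝒞 χ)
    (hs : HasCompactSupport χ) : Adm ρ p (X χ) :=
  ⟨Sm.X hχ, fun _ => AdmN.X hp hχ hs⟩

/-- The radial component of the vorticity of the swirl `R β`. -/
local notation "ξ[" b "]" => -(R * dz b)
/-- The axial component of the vorticity of the swirl `R β`. -/
local notation "η[" b "]" => 2 * b + R * dr b

/-! ### Radial averages -/

/-- The weighted radial average `∫₀¹ θⁿ g(θr, z) dθ`. -/
def avg (n : ℕ) (g : Fam) : Fam := fun s q => ∫ θ in (0 : ℝ)..1, θ ^ n * g s (θ * q.1, q.2)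

lemma avg_integrand_continuous {g : Fam} (hg : Sm g) (n : ℕ) (s : ℝ) (q : ℝ²) :
    Continuous (fun θ : ℝ => θ ^ n * g s (θ * q.1, q.2)) := by
  have := (hg s).continuous
  fun_prop

lemma avg_hasFDerivAt {g : Fam} (hg : Sm g) (n : ℕ) (s : ℝ) (q : ℝ²) :
    HasFDerivAt (avg n g s) ((avg (n + 1) (dr g) s q) • ContinuousLinearMap.fst ℝ ℝ ℝ
      + (avg n (dz g) s q) • ContinuousLinearMap.snd ℝ ℝ ℝ) q := by
  set F' : ℝ² → ℝ → (ℝ² →L[ℝ] ℝ) := fun x θ =>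
    (θ ^ (n + 1) * dr g s (θ * x.1, x.2)) • ContinuousLinearMap.fst ℝ ℝ ℝ
      + (θ ^ n * dz g s (θ * x.1, x.2)) • ContinuousLinearMap.snd ℝ ℝ ℝ with hF'
  have hgc := (hg s).continuous
  have hrc := (hg.dr s).continuous
  have hzc := (hg.dz s).continuous
  have hcont : Continuous (fun y : (ℝ²) × ℝ => F' y.1 y.2) := by
    simp only [hF']; fun_prop
  obtain ⟨C, hC⟩ := ((isCompact_closedBall q 1).prod (isCompact_Icc (a := (0 : ℝ))
    (b := 1))).exists_bound_of_continuousOn hcont.continuousOn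
  have hmain := intervalIntegral.hasFDerivAt_integral_of_dominated_of_fderiv_le (𝕜 := ℝ)
    (μ := volume) (a := 0) (b := 1) (F := fun x θ => θ ^ n * g s (θ * x.1, x.2)) (F' := F')
    (x₀ := q) (bound := fun _ => C) (Metric.ball_mem_nhds q one_pos)
    (Filter.Eventually.of_forall fun x => (avg_integrand_continuous hg n s x).aestronglyMeasurable)
    ((avg_integrand_continuous hg n s q).intervalIntegrable _ _)
    (by
      have : Continuous (F' q) := hcont.comp (by fun_prop : Continuous fun θ : ℝ => (q, θ))
      exact this.aestronglyMeasurable)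
    (ae_of_all _ fun θ hθ x hx => by
      rw [uIoc_of_le zero_le_one] at hθ
      exact hC (x, θ) ⟨Metric.ball_subset_closedBall hx, hθ.1.le, hθ.2⟩)
    (by simp)
    (ae_of_all _ fun θ _ x _ => by
      have h1 : HasFDerivAt (fun x : ℝ² => (θ * x.1, x.2))
          ((θ • ContinuousLinearMap.fst ℝ ℝ ℝ).prod (ContinuousLinearMap.snd ℝ ℝ ℝ)) x :=
        (hasFDerivAt_fst.const_mul θ).prodMk hasFDerivAt_snd
      have h2 := ((hg.differentiable s) (θ * x.1, x.2)).hasFDerivAt.comp x h1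
      have h3 := h2.const_mul (θ ^ n)
      refine h3.congr_fderiv ?_
      ext
      · simp only [hF', hg.dr_eq, hg.dz_eq]
        have e : fderiv ℝ (g s) (θ * x.1, x.2) (θ, 0)
            = θ * fderiv ℝ (g s) (θ * x.1, x.2) (1, 0) := by
          have e2 : ((θ : ℝ), (0 : ℝ)) = θ • ((1 : ℝ), (0 : ℝ)) := by simp
          rw [e2, map_smul, smul_eq_mul]
        simp [e]
        ring
      · simp [hF', hg.dr_eq, hg.dz_eq])
  refine hmain.congr_fderiv ?_
  simp only [hF']
  have i1 : IntervalIntegrable (fun θ : ℝ => θ ^ (n + 1) * dr g s (θ * q.1, q.2)) volume 0 1 :=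
    (avg_integrand_continuous hg.dr (n + 1) s q).intervalIntegrable _ _
  have i2 : IntervalIntegrable (fun θ : ℝ => θ ^ n * dz g s (θ * q.1, q.2)) volume 0 1 :=
    (avg_integrand_continuous hg.dz n s q).intervalIntegrable _ _
  rw [intervalIntegral.integral_add, intervalIntegral.integral_smul_const,
    intervalIntegral.integral_smul_const]
  · rfl
  · exact (Continuous.intervalIntegrable
      ((avg_integrand_continuous hg.dr (n + 1) s q).smul continuous_const) _ _)
  · exact (Continuous.intervalIntegrable
      ((avg_integrand_continuous hg.dz n s q).smul continuous_const) _ _)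

lemma Sm.avg {g : Fam} (hg : Sm g) (n : ℕ) : Sm (avg n g) := by
  intro s
  suffices h : ∀ k : ℕ, ∀ (n : ℕ) (g : Fam), Sm g → ContDiff ℝ k (AxiNS.avg n g s) from
    contDiff_infty.2 fun k => h k n g hg
  intro k
  induction k with
  | zero =>
    intro n g hg
    exact contDiff_zero.2 (continuous_iff_continuousAt.2 fun q =>
      (avg_hasFDerivAt hg n s q).continuousAt)
  | succ k ih =>
    intro n g hg
    have : ((k + 1 : ℕ) : WithTop ℕ∞) = (k : WithTop ℕ∞) + 1 := by norm_cast
    rw [this, contDiff_succ_iff_fderiv]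
    refine ⟨fun q => (avg_hasFDerivAt hg n s q).differentiableAt, by simp, ?_⟩
    have h2 : fderiv ℝ (AxiNS.avg n g s) = fun q =>
        (AxiNS.avg (n + 1) (AxiNS.dr g) s q) • ContinuousLinearMap.fst ℝ ℝ ℝ
          + (AxiNS.avg n (AxiNS.dz g) s q) • ContinuousLinearMap.snd ℝ ℝ ℝ :=
      funext fun q => (avg_hasFDerivAt hg n s q).fderiv
    rw [h2]
    exact ((ih (n + 1) _ hg.dr).smul contDiff_const).add ((ih n _ hg.dz).smul contDiff_const)

lemma dr_avg {g : Fam} (hg : Sm g) (n : ℕ) : dr (avg n g) = avg (n + 1) (dr g) := by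
  funext s q
  rw [(hg.avg n).dr_eq, (avg_hasFDerivAt hg n s q).fderiv]
  simp

lemma dz_avg {g : Fam} (hg : Sm g) (n : ℕ) : dz (avg n g) = avg n (dz g) := by
  funext s q
  rw [(hg.avg n).dz_eq, (avg_hasFDerivAt hg n s q).fderiv]
  simp

lemma Dec.avg {ρ p} {g : Fam} (hg : Dec ρ p g) (n : ℕ) : Dec ρ p (avg n g) := by
  obtain ⟨C, m, h1, h2, h3, h4⟩ := hg
  refine ⟨C, m, h1, h2, h3, fun s q hq hq' => ?_⟩
  have := intervalIntegral.norm_integral_le_of_norm_le_const (a := 0) (b := 1) (C := m s q.2)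
    (f := fun θ : ℝ => θ ^ n * g s (θ * q.1, q.2)) (by
      intro θ hθ
      rw [uIoc_of_le zero_le_one] at hθ
      rw [norm_mul, norm_eq_abs, norm_eq_abs]
      have hθ1 : |θ ^ n| ≤ 1 := by
        rw [abs_of_nonneg (pow_nonneg hθ.1.le _)]; exact pow_le_one₀ hθ.1.le hθ.2
      have := h4 s (θ * q.1, q.2) (mul_nonneg hθ.1.le hq)
        ((mul_le_of_le_one_left hq hθ.2).trans hq')
      calc |θ ^ n| * |g s (θ * q.1, q.2)| ≤ 1 * m s q.2 :=
            mul_le_mul hθ1 this (abs_nonneg _) zero_le_one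
        _ = m s q.2 := one_mul _)
  simpa [AxiNS.avg] using this

lemma AdmN.avg {ρ p k} {g : Fam} (sg : Sm g) (hg : AdmN ρ p k g) (n : ℕ) :
    AdmN ρ p k (avg n g) := by
  induction k generalizing g n with
  | zero => exact Dec.avg hg n
  | succ k ih =>
    refine ⟨hg.1.avg n, ?_, ?_⟩
    · rw [dr_avg sg]; exact ih sg.dr hg.2.1 _
    · rw [dz_avg sg]; exact ih sg.dz hg.2.2 _

lemma Adm.avg {ρ p} {g : Fam} (hg : Adm ρ p g) (n : ℕ) : Adm ρ p (avg n g) :=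
  ⟨hg.sm.avg n, fun k => (hg.bd k).avg hg.sm n⟩

/-- Division by the radius of a family that vanishes on the axis. -/
lemma R_mul_avg_dr {g : Fam} (hg : Sm g) (h0 : ∀ s z, g s (0, z) = 0) : R * avg 0 (dr g) = g := by
  funext s q
  have hd : ∀ θ ∈ uIcc (0 : ℝ) 1, HasDerivAt (fun θ : ℝ => g s (θ * q.1, q.2))
      (q.1 * dr g s (θ * q.1, q.2)) θ := by
    intro θ _
    have h1 := hg.hasDerivAt_r s (θ * q.1, q.2)
    have h2 := HasDerivAt.comp θ (h₂ := fun r => g s (r, q.2)) h1 ((hasDerivAt_id θ).mul_const q.1)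
    simpa [mul_comm, Function.comp_def] using h2
  have hc : Continuous (fun θ : ℝ => q.1 * dr g s (θ * q.1, q.2)) := by
    have := (hg.dr s).continuous
    fun_prop
  have := integral_eq_sub_of_hasDerivAt hd (hc.intervalIntegrable _ _)
  simp only [one_mul, zero_mul, h0, sub_zero] at this
  rw [intervalIntegral.integral_const_mul] at this
  simpa [avg, R] using this

/-! ### Integration on the strip -/

/-- The measure `r dr dz` on the strip `0 < r < ρ`. -/
def strip (ρ : ℝ) : Measure (ℝ²) := cyl.restrict (Iio ρ ×ˢ univ)

lemma strip_eq (ρ : ℝ) : strip ρ = ((volume : Measure (ℝ²)).restrict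
    (Ioo 0 ρ ×ˢ univ)).withDensity (fun q => ofReal q.1) := by
  have hm : MeasurableSet (Iio ρ ×ˢ (univ : Set ℝ)) := measurableSet_Iio.prod MeasurableSet.univ
  rw [strip, cyl, restrict_withDensity hm, Measure.restrict_restrict hm, prod_inter_prod,
    Set.inter_comm (Iio ρ), Ioi_inter_Iio, univ_inter]

lemma ae_strip {ρ : ℝ} {P : ℝ² → Prop} (h : ∀ q : ℝ², 0 < q.1 → q.1 < ρ → P q) :
    ∀ᵐ q ∂strip ρ, P q := by
  rw [strip_eq]
  refine (withDensity_absolutelyContinuous _ _).ae_le ?_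
  filter_upwards [ae_restrict_mem (measurableSet_Ioo.prod MeasurableSet.univ)] with q hq
  exact h q hq.1.1 hq.1.2

lemma ae_cyl {P : ℝ² → Prop} (h : ∀ q : ℝ², 0 < q.1 → P q) : ∀ᵐ q ∂cyl, P q := by
  refine (withDensity_absolutelyContinuous _ _).ae_le ?_
  filter_upwards [ae_restrict_mem (measurableSet_Ioi.prod MeasurableSet.univ)] with q hq
  exact h q hq.1

lemma integral_strip (ρ : ℝ) (f : ℝ² → ℝ) :
    ∫ q, f q ∂strip ρ = ∫ q in Ioo 0 ρ ×ˢ univ, q.1 * f q := by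
  rw [strip_eq, integral_withDensity_eq_integral_toReal_smul (by fun_prop) (by simp)]
  refine setIntegral_congr_fun (measurableSet_Ioo.prod MeasurableSet.univ) fun q hq => ?_
  simp [toReal_ofReal hq.1.1.le]

lemma integrable_strip_iff (ρ : ℝ) (f : ℝ² → ℝ) :
    Integrable f (strip ρ) ↔ IntegrableOn (fun q => q.1 * f q) (Ioo 0 ρ ×ˢ univ) := by
  rw [strip_eq, integrable_withDensity_iff_integrable_smul' (by fun_prop) (by simp)]
  refine integrable_congr ?_
  filter_upwards [ae_restrict_mem (measurableSet_Ioo.prod MeasurableSet.univ)] with q hq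
  simp [toReal_ofReal hq.1.1.le]

lemma volume_restrict_strip (ρ : ℝ) : (volume : Measure (ℝ²)).restrict (Ioo 0 ρ ×ˢ univ)
    = ((volume : Measure ℝ).restrict (Ioo 0 ρ)).prod (volume : Measure ℝ) := by
  rw [volume_eq_prod, ← prod_restrict, restrict_univ]

lemma integrable_strip_of_le {ρ : ℝ} {f : ℝ² → ℝ} {ψ m : ℝ → ℝ}
    (hf : ContinuousOn f (Ioo 0 ρ ×ˢ univ)) (hψ : IntegrableOn (fun r => r * ψ r) (Ioo 0 ρ))
    (hm : Integrable m) (h : ∀ q : ℝ², 0 < q.1 → q.1 < ρ → |f q| ≤ ψ q.1 * m q.2) :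
    Integrable f (strip ρ) := by
  have hS : MeasurableSet (Ioo 0 ρ ×ˢ (univ : Set ℝ)) := measurableSet_Ioo.prod MeasurableSet.univ
  rw [integrable_strip_iff]
  have hb : IntegrableOn (fun q : ℝ² => (q.1 * ψ q.1) * m q.2) (Ioo 0 ρ ×ˢ univ) := by
    rw [IntegrableOn, volume_restrict_strip]
    exact Integrable.mul_prod hψ hm
  refine Integrable.mono' hb ((continuousOn_fst.mul hf).aestronglyMeasurable hS) ?_
  filter_upwards [ae_restrict_mem hS] with q hq
  rw [norm_mul, norm_of_nonneg hq.1.1.le, mul_assoc]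
  exact mul_le_mul_of_nonneg_left (h q hq.1.1 hq.1.2) hq.1.1.le

lemma Adm.cont {ρ p} {g : Fam} (hg : Adm ρ p g) (s : ℝ) : Continuous (g s) := (hg.sm s).continuous

lemma Adm.integrable {ρ} {g : Fam} (hg : Adm ρ 1 g) (s : ℝ) : Integrable (g s) (strip ρ) := by
  obtain ⟨C, m, h1, h2, h3, h4⟩ := hg.dec
  refine integrable_strip_of_le (ψ := fun _ => 1) (m := m s) (hg.cont s).continuousOn ?_ ?_ ?_
  · simp only [mul_one]
    exact (continuous_id.integrableOn_Icc (a := 0) (b := ρ)).mono_set Ioo_subset_Icc_self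
  · simpa using (h3 s).1
  · intro q hq hq'; simpa using h4 s q hq.le hq'.le

lemma Adm.memLp {ρ} {g : Fam} (hg : Adm ρ 2 g) (s : ℝ) : MemLp (g s) 2 (strip ρ) := by
  rw [memLp_two_iff_integrable_sq (hg.cont s).aestronglyMeasurable]
  have := (hg.mul hg).integrable s
  refine this.congr (ae_of_all _ fun q => ?_)
  simp [pow_two]

lemma strip_ibp_r {ρ : ℝ} (hρ : 0 < ρ) {K F : ℝ² → ℝ}
    (hc : ∀ z, ContinuousOn (fun r => K (r, z)) (Icc 0 ρ))
    (hd : ∀ z, ∀ r ∈ Ioo 0 ρ, HasDerivAt (fun r' => K (r', z)) (r * F (r, z)) r)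
    (hF : Integrable F (strip ρ)) : ∫ q, F q ∂strip ρ = ∫ z, (K (ρ, z) - K (0, z)) := by
  have hI := (integrable_strip_iff ρ F).1 hF
  rw [IntegrableOn, volume_restrict_strip] at hI
  rw [integral_strip, volume_restrict_strip, integral_prod_symm _ hI]
  refine integral_congr_ae ?_
  filter_upwards [hI.prod_left_ae] with z hz
  rw [← intervalIntegral.integral_eq_sub_of_hasDerivAt_of_le hρ.le (hc z) (hd z),
    integral_of_le hρ.le, integral_Ioc_eq_integral_Ioo]
  rw [intervalIntegrable_iff_integrableOn_Ioc_of_le hρ.le]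
  exact (integrableOn_Ioc_iff_integrableOn_Ioo).2 hz

lemma strip_ibp_z {ρ : ℝ} {K F : ℝ² → ℝ}
    (hd : ∀ r ∈ Ioo 0 ρ, ∀ z, HasDerivAt (fun z' => K (r, z')) (F (r, z)) z)
    (hK : Integrable K (strip ρ)) (hF : Integrable F (strip ρ)) : ∫ q, F q ∂strip ρ = 0 := by
  have hI := (integrable_strip_iff ρ F).1 hF
  have hJ := (integrable_strip_iff ρ K).1 hK
  rw [IntegrableOn, volume_restrict_strip] at hI hJ
  rw [integral_strip, volume_restrict_strip, integral_prod _ hI]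
  rw [integral_eq_zero_of_ae]
  filter_upwards [hI.prod_right_ae, hJ.prod_right_ae, ae_restrict_mem measurableSet_Ioo]
    with r h1 h2 hr
  exact integral_eq_zero_of_hasDerivAt_of_integrable (fun z => (hd r hr z).const_mul r) h1 h2

/-- Divergence theorem on the strip. -/
lemma strip_div {ρ : ℝ} (hρ : 0 < ρ) {K₁ K₂ F₁ : Fam} (h₁ : Sm K₁) (hF : R * F₁ = dr K₁)
    (hF₁ : Adm ρ 1 F₁) (h₂ : Adm ρ 1 K₂) (hz : ∀ s z, K₁ s (ρ, z) = 0) (s : ℝ) :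
    ∫ q, (F₁ s q + dz K₂ s q) ∂strip ρ = -∫ z, K₁ s (0, z) := by
  rw [integral_add (hF₁.integrable s) (h₂.dz.integrable s),
    strip_ibp_z (K := K₂ s) (fun r _ z => h₂.sm.hasDerivAt_z s (r, z)) (h₂.integrable s)
      (h₂.dz.integrable s),
    strip_ibp_r hρ (K := K₁ s) (fun z => (((h₁ s).continuous).comp
      (by fun_prop : Continuous fun r : ℝ => (r, z))).continuousOn) (fun z r _ => ?_)
      (hF₁.integrable s)]
  · simp [hz, integral_neg]
  · have := h₁.hasDerivAt_r s (r, z)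
    rw [← hF] at this
    exact this

/-! ### The `L₂` norm on the strip -/

/-- The `L₂` norm on the strip as a real number. -/
def nn (ρ : ℝ) (f : ℝ² → ℝ) : ℝ := (eLpNorm f 2 (strip ρ)).toReal

lemma nn_nonneg {ρ f} : 0 ≤ nn ρ f := toReal_nonneg

lemma nn_mono {ρ} {f g : ℝ² → ℝ} (hg : MemLp g 2 (strip ρ))
    (h : ∀ q : ℝ², 0 < q.1 → q.1 < ρ → |f q| ≤ |g q|) : nn ρ f ≤ nn ρ g :=
  toReal_mono hg.2.ne (eLpNorm_mono_ae (ae_strip h))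

lemma nn_add_le {ρ} {f g : ℝ² → ℝ} (hf : MemLp f 2 (strip ρ)) (hg : MemLp g 2 (strip ρ)) :
    nn ρ (f + g) ≤ nn ρ f + nn ρ g := by
  rw [nn, nn, nn, ← ENNReal.toReal_add hf.2.ne hg.2.ne]
  exact toReal_mono (by simp [hf.2.ne, hg.2.ne]) (eLpNorm_add_le hf.1 hg.1 (by norm_num))

lemma nn_smul {ρ} {f : ℝ² → ℝ} (c : ℝ) : nn ρ (c • f) = |c| * nn ρ f := by
  rw [nn, eLpNorm_const_smul, ENNReal.toReal_mul]; simp [nn]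

lemma nn_sq {ρ} {f : ℝ² → ℝ} (hf : MemLp f 2 (strip ρ)) : nn ρ f ^ 2 = ∫ q, f q ^ 2 ∂strip ρ := by
  rw [nn, hf.eLpNorm_eq_integral_rpow_norm (by norm_num) (by norm_num)]
  have h0 : 0 ≤ ∫ q, f q ^ 2 ∂strip ρ := integral_nonneg fun q => sq_nonneg _
  simp only [ENNReal.toReal_ofNat, Real.rpow_two, norm_eq_abs, sq_abs]
  rw [toReal_ofReal (by positivity), ← Real.rpow_natCast, ← Real.rpow_mul h0]
  norm_num

lemma integrable_mul {ρ} {f g : ℝ² → ℝ} (hf : MemLp f 2 (strip ρ))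
    (hg : MemLp g 2 (strip ρ)) : Integrable (fun q => f q * g q) (strip ρ) :=
  hf.integrable_mul hg

lemma abs_integral_mul_le {ρ} {f g : ℝ² → ℝ} (hf : MemLp f 2 (strip ρ))
    (hg : MemLp g 2 (strip ρ)) : ∫ q, |f q * g q| ∂strip ρ ≤ nn ρ f * nn ρ g := by
  have h := integral_mul_norm_le_Lp_mul_Lq (μ := strip ρ) (f := f) (g := g)
    (Real.HolderConjugate.two_two) (by simpa using hf) (by simpa using hg)
  simp only [Real.rpow_two, norm_eq_abs, sq_abs] at h
  rw [← nn_sq hf, ← nn_sq hg, ← Real.sqrt_eq_rpow, Real.sqrt_sq nn_nonneg,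
    ← Real.sqrt_eq_rpow, Real.sqrt_sq nn_nonneg] at h
  simpa [abs_mul] using h

/-- The Cauchy-Schwarz inequality for an integrand bounded by a product. -/
lemma abs_integral_le_nn {ρ} {F f g : ℝ² → ℝ} (hf : MemLp f 2 (strip ρ))
    (hg : MemLp g 2 (strip ρ)) (h : ∀ q : ℝ², 0 < q.1 → q.1 < ρ → |F q| ≤ |f q| * |g q|) :
    |∫ q, F q ∂strip ρ| ≤ nn ρ f * nn ρ g := by
  refine le_trans ?_ (abs_integral_mul_le hf hg)
  refine (norm_integral_le_of_norm_le (f := F) (integrable_mul hf hg).abs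
    (ae_strip fun q hq hq' => ?_))
  rw [norm_eq_abs, abs_mul]; exact h q hq hq'

section

lemma Sm.ofNat (n : ℕ) [n.AtLeastTwo] : Sm (ofNat(n) : Fam) := fun _ => contDiff_const
lemma Sm.zero : Sm (0 : Fam) := fun _ => contDiff_const
lemma dr_ofNat (n : ℕ) [n.AtLeastTwo] : dr (ofNat(n) : Fam) = 0 := by
  funext s q; exact deriv_const q.1 _
lemma dz_ofNat (n : ℕ) [n.AtLeastTwo] : dz (ofNat(n) : Fam) = 0 := by
  funext s q; exact deriv_const q.2 _
lemma Sm.sq {f : Fam} (hf : Sm f) : Sm (f ^ 2) := by rw [pow_two]; exact hf.mul hf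
lemma dr_sq {f : Fam} (hf : Sm f) : dr (f ^ 2) = 2 * f * dr f := by
  rw [pow_two, dr_mul hf hf]; ring
lemma dz_sq {f : Fam} (hf : Sm f) : dz (f ^ 2) = 2 * f * dz f := by
  rw [pow_two, dz_mul hf hf]; ring
lemma dr_dz {f : Fam} (hf : Sm f) : dr (dz f) = dz (dr f) := (dz_dr hf).symm

lemma Adm.ofNat_mul {ρ p} {f : Fam} (hf : Adm ρ p f) (n : ℕ) [n.AtLeastTwo] :
    Adm ρ p ((ofNat(n) : Fam) * f) := by
  have : ((ofNat(n) : Fam) * f) = (ofNat(n) : ℝ) • f := by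
    funext s q; simp
  rw [this]; exact hf.smul _

lemma Adm.sq2 {ρ} {f : Fam} (hf : Adm ρ 2 f) : Adm ρ 2 (f ^ 2) := by
  rw [pow_two]; exact hf.mul2 hf

lemma Adm.sq {ρ} {f : Fam} (hf : Adm ρ 2 f) : Adm ρ 1 (f ^ 2) := by
  rw [pow_two]; exact hf.mul hf

/-- Derived data of a cut-off function: `ζ' = r ζ₁`. -/
structure CutData (ρ : ℝ) (ζ ζ₁ : ℝ → ℝ) (C : ℝ) : Prop where
  pos : 0 < ρ
  smooth : 𝒞 ζ
  smooth₁ : 𝒞 ζ₁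
  deriv_eq : ∀ r, deriv ζ r = r * ζ₁ r
  zero : ∀ r, ρ ≤ r → ζ r = 0
  C_ge : 1 ≤ C
  bd : ∀ r, |ζ r| ≤ C
  bd₁ : ∀ r, |ζ₁ r| ≤ C
  bd_sq : ∀ r, |ζ₁ r| ≤ C * r ^ 2
  bd_deriv : ∀ r, |deriv ζ r| ≤ C
  bd_deriv_one : ∀ r, 0 ≤ r → |deriv ζ r| ≤ C * r
  bd_deriv₁ : ∀ r, 0 ≤ r → |deriv ζ₁ r| ≤ C * r
  bd_deriv₂ : ∀ r, |deriv (deriv ζ) r| ≤ C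

lemma IsCutoff.exists_cutData {r₀ : ℝ} (hr₀ : 0 < r₀) {ζ : ℝ → ℝ} (hζ : IsCutoff r₀ ζ) :
    ∃ ζ₁ C, CutData (2 * r₀) ζ ζ₁ C := by
  have hd : ∀ g : ℝ → ℝ, (∀ r ∉ Icc r₀ (2 * r₀), g r = 0) →
      ∀ r ∉ Icc r₀ (2 * r₀), deriv g r = 0 := fun g hg r hr => by
    have : g =ᶠ[nhds r] fun _ => 0 := by
      filter_upwards [isClosed_Icc.isOpen_compl.mem_nhds hr] with x hx using hg x hx
    rw [this.deriv_eq, deriv_const]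
  have hz : ∀ r ∉ Icc r₀ (2 * r₀), deriv ζ r = 0 := fun r hr => by
    rcases lt_or_ge r r₀ with h | h
    · have : ζ =ᶠ[nhds r] fun _ => 1 := by
        filter_upwards [Iio_mem_nhds h] with x hx using hζ.one x (le_of_lt hx)
      rw [this.deriv_eq, deriv_const]
    · have : ζ =ᶠ[nhds r] fun _ => 0 := by
        filter_upwards [Ioi_mem_nhds (not_le.1 fun h' => hr ⟨h, h'⟩)] with x hx
          using hζ.zero x (le_of_lt hx)
      rw [this.deriv_eq, deriv_const]
  have hds : 𝒞 (deriv ζ) := contDiff_deriv hζ.smooth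
  set ζ₁ : ℝ → ℝ := fun r => deriv ζ r / r with hζ₁
  have hz1 : ∀ r ∉ Icc r₀ (2 * r₀), ζ₁ r = 0 := fun r hr => by simp [hζ₁, hz r hr]
  have hs1 : 𝒞 ζ₁ := contDiff_iff_contDiffAt.2 fun r => by
    by_cases hr : r < r₀
    · have : ζ₁ =ᶠ[nhds r] fun _ => 0 := by
        filter_upwards [Iio_mem_nhds hr] with x hx using hz1 x fun h => not_le.2 hx h.1
      exact contDiffAt_const.congr_of_eventuallyEq this
    · exact hds.contDiffAt.div contDiffAt_id (hr₀.trans_le (not_lt.1 hr)).ne'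
  have bd : ∀ g : ℝ → ℝ, Continuous g → ∃ M, 0 ≤ M ∧ ∀ r ∈ Icc r₀ (2 * r₀), |g r| ≤ M :=
    fun g hg => by
      obtain ⟨M, hM⟩ := isCompact_Icc.exists_bound_of_continuousOn hg.continuousOn
      exact ⟨M, (norm_nonneg _).trans (hM r₀ ⟨le_rfl, by linarith⟩), hM⟩
  have key : ∀ g : ℝ → ℝ, Continuous g → (∀ r ∉ Icc r₀ (2 * r₀), g r = 0) →
      ∃ C, 0 ≤ C ∧ ∀ r, |g r| ≤ C ∧ (0 ≤ r → |g r| ≤ C * r) ∧ |g r| ≤ C * r ^ 2 := fun g hg h0 => by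
    obtain ⟨M, M0, hM⟩ := bd g hg
    refine ⟨M * (1 + 1 / r₀ + 1 / r₀ ^ 2), by positivity, fun r => ?_⟩
    by_cases hr : r ∈ Icc r₀ (2 * r₀)
    · have h1 : 1 ≤ r / r₀ := (one_le_div hr₀).2 hr.1
      have h2 : 1 ≤ r ^ 2 / r₀ ^ 2 := by rw [← div_pow]; exact one_le_pow₀ h1
      have h3 : 0 < r := hr₀.trans_le hr.1
      have e1 : M * (1 + 1 / r₀ + 1 / r₀ ^ 2) * r = M * (r + r / r₀ + r / r₀ ^ 2) := by ring
      have e2 : M * (1 + 1 / r₀ + 1 / r₀ ^ 2) * r ^ 2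
        = M * (r ^ 2 + r ^ 2 / r₀ + r ^ 2 / r₀ ^ 2) := by ring
      have i2 : ∀ x : ℝ, 1 ≤ x → |g r| ≤ M * x := fun x hx =>
        (hM r hr).trans (le_mul_of_one_le_right M0 hx)
      rw [e1, e2]
      refine ⟨i2 _ ?_, fun _ => i2 _ ?_, i2 _ ?_⟩
      · rw [add_assoc]; exact le_add_of_nonneg_right (by positivity)
      · have : 0 < r + r / r₀ ^ 2 := by positivity
        linarith
      · have : 0 < r ^ 2 + r ^ 2 / r₀ := by positivity
        linarith
    · rw [h0 r hr, abs_zero]; exact ⟨by positivity, fun _ => by positivity, by positivity⟩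
  obtain ⟨A, hA0, hA⟩ := key _ hds.continuous hz
  obtain ⟨B, hB0, hB⟩ := key _ hs1.continuous hz1
  obtain ⟨D, hD0, hD⟩ := key _ (contDiff_deriv hs1).continuous (hd _ hz1)
  obtain ⟨J, hJ0, hJ⟩ := key _ (contDiff_deriv hds).continuous (hd _ hz)
  obtain ⟨E, hE0, hE⟩ := bd _ hζ.smooth.continuous
  refine ⟨ζ₁, 1 + E + A + B + D + J, by linarith, hζ.smooth, hs1, fun r => ?_, hζ.zero, by linarith,
    fun r => ?_, fun r => (hB r).1.trans (by linarith), fun r => (hB r).2.2.trans (by gcongr; linarith),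
    fun r => (hA r).1.trans (by linarith), fun r hr => ((hA r).2.1 hr).trans (by gcongr; linarith),
    fun r hr => ((hD r).2.1 hr).trans (by gcongr; linarith), fun r => (hJ r).1.trans (by linarith)⟩
  · rcases eq_or_ne r 0 with rfl | h
    · rw [hz 0 fun h => hr₀.not_ge h.1, zero_mul]
    · rw [hζ₁, mul_div_cancel₀ _ h]
  · rcases lt_or_ge r r₀ with h | h
    · rw [hζ.one r h.le, abs_one]; linarith
    · rcases le_or_gt r (2 * r₀) with h' | h'
      · exact (hE r ⟨h, h'⟩).trans (by linarith)
      · rw [hζ.zero r h'.le, abs_zero]; linarith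

lemma CutData.Z_deriv {ρ ζ ζ₁ C} (H : CutData ρ ζ ζ₁ C) : Z (deriv ζ) = R * Z ζ₁ := by
  funext s q; exact H.deriv_eq q.1

lemma CutData.Z_mul_eq_zero {ρ ζ ζ₁ C} (H : CutData ρ ζ ζ₁ C) (g : Fam) (s : ℝ) {q : ℝ²}
    (hq : ρ ≤ q.1) : (Z ζ * g) s q = 0 := by
  rw [Pi.mul_apply, Pi.mul_apply, Z, H.zero _ hq, zero_mul]

/-- Families describing an axially symmetric solenoidal field on a strip. -/
structure Flow (ρ : ℝ) (h β w κ l : Fam) : Prop where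
  adm_h : Adm ρ 2 h
  adm_b : Adm ρ 2 β
  adm_w : Adm ρ 2 w
  adm_k : Adm ρ 2 κ
  adm_l : Adm ρ 2 l
  div : dz w = -(2 * h + R * dr h)
  dr_w : dr w = R * κ
  dr_h : dr h = R * l

variable {ρ : ℝ} {ζ ζ₁ : ℝ → ℝ} {C : ℝ} {h β w κ l : Fam}

lemma hess_identity (H : CutData ρ ζ ζ₁ C) (hh : Adm ρ 2 h) (hl : Adm ρ 2 l)
    (e : dr h = R * l) (s : ℝ) :
    ∫ q, ((Z ζ ^ 2 * (dr (dr h) ^ 2 + 9 * l ^ 2 + dz (dz h) ^ 2 + 2 * dz (dr h) ^ 2)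
      - 6 * Z ζ * Z ζ₁ * dr h ^ 2 + 4 * Z ζ * Z ζ₁ * dz h ^ 2
      + 4 * Z ζ * (R * Z ζ₁) * dz (dr h) * dz h : Fam) s q) ∂strip ρ
      ≤ ∫ q, (Z ζ ^ 2 * (dr (dr h) + 3 * l + dz (dz h)) ^ 2 : Fam) s q ∂strip ρ := by
  have sζ := Sm.Z H.smooth
  have sζ1 := Sm.Z H.smooth₁
  have sh := hh.sm
  have sl := hl.sm
  have hrr : dr (dr h) = l + R * dr l := by
    rw [e, dr_mul Sm.R sl, dr_R, one_mul]
  have hrz : dz (dr h) = R * dz l := by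
    rw [e, dz_mul Sm.R sl, dz_R, zero_mul, zero_add]
  set K₁ : Fam := Z ζ ^ 2 * (3 * dr h ^ 2 - 2 * dz h ^ 2 - 2 * R * dz (dr h) * dz h) with hK₁
  set K₂ : Fam := Z ζ * (Z ζ * (6 * (l * dz h) + 2 * (dr (dr h) * dz h))) with hK₂
  set F₁ : Fam := Z ζ * (Z ζ₁ * (6 * dr h ^ 2 - 4 * dz h ^ 2 - 4 * (R * (dz (dr h) * dz h))))
    + Z ζ * (Z ζ * (6 * (l * dr (dr h)) - 6 * (dz h * dz l) - 2 * (dz (dr (dr h)) * dz h)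
      - 2 * dz (dr h) ^ 2)) with hF₁
  have hRF : R * F₁ = dr K₁ := by
    rw [hK₁, hF₁]
    simp (maxDischargeDepth := 40) only [dr_mul, dr_sub, dr_sq, dr_dz, dr_ofNat, dr_R,
      dr_Z, H.Z_deriv, dz_mul, dz_add, dz_R, e, Sm.mul, Sm.sub, Sm.sq, Sm.dr, Sm.dz,
      Sm.ofNat, Sm.R, zero_mul, zero_add, one_mul, sζ, sh, sl]
    ring
  have hζ := H.smooth
  have hζ1 := H.smooth₁
  have aF₁ : Adm ρ 1 F₁ := by
    simp (maxDischargeDepth := 40) only [Adm.Z_mul, Adm.R_mul, Adm.ofNat_mul, Adm.add, Adm.sub,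
      Adm.sq, Adm.mul, Adm.dr, Adm.dz, hζ, hζ1, hh, hl, hF₁]
  have aK₂ : Adm ρ 1 K₂ := by
    simp (maxDischargeDepth := 40) only [Adm.Z_mul, Adm.ofNat_mul, Adm.add,
      Adm.mul, Adm.dr, Adm.dz, hζ, hh, hl, hK₂]
  have sK₁ : Sm K₁ := by
    rw [hK₁]
    simp (maxDischargeDepth := 40) only [Sm.mul, Sm.sub, Sm.sq, Sm.dr, Sm.dz, Sm.ofNat, Sm.R, sζ,
      sh]
  have aB : Adm ρ 1 (Z ζ * (Z ζ * (dr (dr h) + 3 * l + dz (dz h)) ^ 2)) := by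
    simp (maxDischargeDepth := 40) only [Adm.Z_mul, Adm.ofNat_mul, Adm.add,
      Adm.sq, Adm.dr, Adm.dz, hζ, hh, hl]
  have hdiv := strip_div (ρ := ρ) (by linarith [H.pos]) sK₁ hRF aF₁ aK₂
    (fun s z => by simp [hK₁, Z, H.zero]) s
  have hneg : 0 ≤ ∫ q, (F₁ s q + dz K₂ s q) ∂strip ρ := by
    rw [hdiv, ← integral_neg]
    refine integral_nonneg fun z => ?_
    simp only [hK₁, e, Pi.mul_apply, Pi.sub_apply, Pi.pow_apply, ofNat_apply, R]
    have := sq_nonneg (Z ζ s (0, z) * dz h s (0, z))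
    nlinarith
  have hA : (Z ζ ^ 2 * (dr (dr h) ^ 2 + 9 * l ^ 2 + dz (dz h) ^ 2 + 2 * dz (dr h) ^ 2)
      - 6 * Z ζ * Z ζ₁ * dr h ^ 2 + 4 * Z ζ * Z ζ₁ * dz h ^ 2
      + 4 * Z ζ * (R * Z ζ₁) * dz (dr h) * dz h : Fam)
      = Z ζ * (Z ζ * (dr (dr h) + 3 * l + dz (dz h)) ^ 2) - (F₁ + dz K₂) := by
    rw [hK₂, hF₁]
    simp (maxDischargeDepth := 40) only [dr_mul, dr_R,
      dz_Z, dz_ofNat, dz_mul, dz_add, dz_R, e, Sm.mul, Sm.add,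
      Sm.dr, Sm.dz, Sm.ofNat, Sm.R, zero_mul, zero_add, one_mul,
      sζ, sh, sl]
    ring
  have hB : (Z ζ ^ 2 * (dr (dr h) + 3 * l + dz (dz h)) ^ 2 : Fam)
      = Z ζ * (Z ζ * (dr (dr h) + 3 * l + dz (dz h)) ^ 2) := by ring
  rw [hA, hB]
  have := integral_sub (aB.integrable s) ((aF₁.add aK₂.dz).integrable s)
  simp only [Pi.sub_apply] at this ⊢
  rw [this]
  have e2 : ∫ q, (F₁ + dz K₂) s q ∂strip ρ = ∫ q, (F₁ s q + dz K₂ s q) ∂strip ρ := rfl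
  rw [e2]
  linarith

/-- Second derivatives in terms of the operator `∂_r² + (3/r) ∂_r + ∂_z²`. -/
lemma hess_bound (H : CutData ρ ζ ζ₁ C) (hh : Adm ρ 2 h) (hl : Adm ρ 2 l)
    (e : dr h = R * l) (s : ℝ) {d : ℝ} (hd1 : nn ρ ((R * dr h) s) ≤ 2 * d)
    (hd2 : nn ρ ((R * dz h) s) ≤ d) {k : Fam}
    (hk : k = dr (dr h) ∨ k = l ∨ k = dz (dz h) ∨ k = dz (dr h)) :
    nn ρ ((Z ζ * k) s) ≤ nn ρ ((Z ζ * (dr (dr h) + 3 * l + dz (dz h))) s) + 6 * C * d := by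
  have hd0 : 0 ≤ d := nn_nonneg.trans hd2
  have hζ := H.smooth
  have ak : Adm ρ 2 k := by
    rcases hk with rfl | rfl | rfl | rfl
    exacts [hh.dr.dr, hl, hh.dz.dz, hh.dr.dz]
  have hC := H.C_ge
  have m1 := (ak.Z_mul hζ).memLp s
  have m2 : MemLp ((Z ζ * (dr (dr h) + 3 * l + dz (dz h))) s) 2 (strip ρ) := (((hh.dr.dr.add (hl.ofNat_mul 3)).add hh.dz.dz).Z_mul hζ).memLp s
  have m3 := hh.dr.R_mul.memLp s
  have m4 := hh.dz.R_mul.memLp s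
  have key := hess_identity H hh hl e s
  have j1 : Integrable (fun q => (Z ζ * k) s q ^ 2) (strip ρ) := m1.integrable_sq
  have j3 : Integrable (fun q => 6 * C ^ 2 * (R * dr h) s q ^ 2) (strip ρ) :=
    m3.integrable_sq.const_mul _
  have j4 : Integrable (fun q => 8 * C ^ 2 * (R * dz h) s q ^ 2) (strip ρ) :=
    m4.integrable_sq.const_mul _
  have j13 : Integrable (fun q => (Z ζ * k) s q ^ 2 - 6 * C ^ 2 * (R * dr h) s q ^ 2)
      (strip ρ) := j1.sub j3
  have i1 : Integrable (fun q => (Z ζ * k) s q ^ 2 - 6 * C ^ 2 * (R * dr h) s q ^ 2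
      - 8 * C ^ 2 * (R * dz h) s q ^ 2) (strip ρ) :=
    j13.sub j4
  have hle : ∫ q, ((Z ζ * k) s q ^ 2 - 6 * C ^ 2 * (R * dr h) s q ^ 2
      - 8 * C ^ 2 * (R * dz h) s q ^ 2) ∂strip ρ
      ≤ nn ρ ((Z ζ * (dr (dr h) + 3 * l + dz (dz h))) s) ^ 2 := by
    rw [nn_sq m2]
    refine le_trans (integral_mono_ae i1 ?_ (ae_strip fun q hq hq' => ?_)) (key.trans (le_of_eq ?_))
    · have : Adm ρ 1 (Z ζ * (Z ζ * (dr (dr h) ^ 2 + 9 * l ^ 2 + dz (dz h) ^ 2 + 2 * dz (dr h) ^ 2))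
          - 6 * (Z ζ * (Z ζ₁ * dr h ^ 2)) + 4 * (Z ζ * (Z ζ₁ * dz h ^ 2))
          + 4 * (Z ζ * (R * (Z ζ₁ * (dz (dr h) * dz h))))) := by
        have hζ1 := H.smooth₁
        simp (maxDischargeDepth := 40) only [Adm.Z_mul, Adm.R_mul, Adm.ofNat_mul, Adm.add, Adm.sub,
      Adm.sq, Adm.mul, Adm.dr, Adm.dz, hζ, hζ1, hh, hl]
      refine (this.integrable s).congr (ae_of_all _ fun q => ?_)
      simp only [Pi.mul_apply, Pi.add_apply, Pi.sub_apply, Pi.pow_apply, ofNat_apply]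
      ring
    · have hk2 : k s q ^ 2 ≤ dr (dr h) s q ^ 2 + l s q ^ 2 + dz (dz h) s q ^ 2
          + dz (dr h) s q ^ 2 := by
        rcases hk with e1 | e1 | e1 | e1 <;> rw [e1] <;>
          linarith [sq_nonneg (dr (dr h) s q), sq_nonneg (l s q), sq_nonneg (dz (dz h) s q),
            sq_nonneg (dz (dr h) s q)]
      simp only [Pi.mul_apply, Pi.add_apply, Pi.sub_apply, Pi.pow_apply, ofNat_apply, Z, R]
      have b1 : |ζ q.1 * ζ₁ q.1| ≤ C ^ 2 * q.1 ^ 2 := by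
        rw [abs_mul]
        calc _ ≤ C * (C * q.1 ^ 2) := mul_le_mul (H.bd _) (H.bd_sq _) (abs_nonneg _) (by linarith)
          _ = _ := by ring
      have b2 : (q.1 * ζ₁ q.1) ^ 2 ≤ C ^ 2 * q.1 ^ 2 := by
        have := H.bd_deriv_one q.1 hq.le
        rw [H.deriv_eq] at this
        calc _ = |q.1 * ζ₁ q.1| ^ 2 := (sq_abs _).symm
          _ ≤ (C * q.1) ^ 2 := pow_le_pow_left₀ (abs_nonneg _) this 2
          _ = _ := by ring
      have b1' := abs_le.1 b1
      have t1 : ζ q.1 * ζ₁ q.1 * dr h s q ^ 2 ≤ C ^ 2 * q.1 ^ 2 * dr h s q ^ 2 :=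
        mul_le_mul_of_nonneg_right b1'.2 (sq_nonneg _)
      have t2 : -(C ^ 2 * q.1 ^ 2) * dz h s q ^ 2 ≤ ζ q.1 * ζ₁ q.1 * dz h s q ^ 2 :=
        mul_le_mul_of_nonneg_right b1'.1 (sq_nonneg _)
      have t3 : (q.1 * ζ₁ q.1) ^ 2 * dz h s q ^ 2 ≤ C ^ 2 * q.1 ^ 2 * dz h s q ^ 2 :=
        mul_le_mul_of_nonneg_right b2 (sq_nonneg _)
      have t4 := sq_nonneg (ζ q.1 * dz (dr h) s q + 2 * (q.1 * ζ₁ q.1) * dz h s q)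
      have t5 : ζ q.1 ^ 2 * k s q ^ 2 ≤ ζ q.1 ^ 2 * (dr (dr h) s q ^ 2 + l s q ^ 2
          + dz (dz h) s q ^ 2 + dz (dr h) s q ^ 2) := mul_le_mul_of_nonneg_left hk2 (sq_nonneg _)
      have t6 : 0 ≤ ζ q.1 ^ 2 * l s q ^ 2 := by positivity
      nlinarith
    · refine integral_congr_ae (ae_of_all _ fun q => ?_)
      simp only [Pi.mul_apply, Pi.add_apply, Pi.pow_apply, ofNat_apply]
      ring
  rw [integral_sub j13 j4, integral_sub j1 j3,
    integral_const_mul, integral_const_mul, ← nn_sq m1, ← nn_sq m3, ← nn_sq m4] at hle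
  have n0 : 0 ≤ nn ρ ((Z ζ * (dr (dr h) + 3 * l + dz (dz h))) s) := nn_nonneg
  refine abs_le_of_sq_le_sq' ?_ (by positivity) |>.2
  have q1 : nn ρ ((R * dr h) s) ^ 2 ≤ 4 * d ^ 2 := by
    calc _ ≤ (2 * d) ^ 2 := pow_le_pow_left₀ nn_nonneg hd1 2
      _ = _ := by ring
  have q2 : nn ρ ((R * dz h) s) ^ 2 ≤ d ^ 2 := pow_le_pow_left₀ nn_nonneg hd2 2
  have q3 := mul_le_mul_of_nonneg_left q1 (by positivity : 0 ≤ 6 * C ^ 2)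
  have q4 := mul_le_mul_of_nonneg_left q2 (by positivity : 0 ≤ 8 * C ^ 2)
  have q5 : 0 ≤ nn ρ ((Z ζ * (dr (dr h) + 3 * l + dz (dz h))) s) * (C * d) := by positivity
  nlinarith [sq_nonneg (C * d)]

end

/-! ### Weighted inequalities of Hardy type -/

lemma integrableOn_rpow {ρ α : ℝ} (hα : -1 < α) : IntegrableOn (fun r : ℝ => r ^ α) (Ioo 0 ρ) := by
  rcases le_or_gt ρ 0 with h | h
  · rw [Ioo_eq_empty (not_lt.2 h)]; exact integrableOn_empty
  · exact (integrableOn_Ioc_iff_integrableOn_Ioo).1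
      ((intervalIntegrable_iff_integrableOn_Ioc_of_le h.le).1
        (intervalIntegral.intervalIntegrable_rpow' hα))

lemma integrableOn_mul_rpow {ρ α : ℝ} (hα : -2 < α) :
    IntegrableOn (fun r : ℝ => r * r ^ α) (Ioo 0 ρ) := by
  refine (integrableOn_rpow (ρ := ρ) (α := α + 1) (by linarith)).congr_fun (fun r hr => ?_)
    measurableSet_Ioo
  simp only [Real.rpow_add hr.1, Real.rpow_one, mul_comm]

lemma continuousOn_weight {ρ α : ℝ} {f : ℝ² → ℝ} (hf : Continuous f) :
    ContinuousOn (fun q : ℝ² => q.1 ^ α * f q) (Ioo 0 ρ ×ˢ univ) := by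
  refine ContinuousOn.mul (ContinuousOn.rpow_const continuousOn_fst fun q hq => ?_) hf.continuousOn
  exact Or.inl hq.1.1.ne'

lemma Adm.integrable_weight {ρ α : ℝ} {f : Fam} (hf : Adm ρ 1 f) (hα : -2 < α) (s : ℝ) :
    Integrable (fun q => q.1 ^ α * f s q) (strip ρ) := by
  obtain ⟨C, m, h1, h2, h3, h4⟩ := hf.dec
  refine integrable_strip_of_le (continuousOn_weight (hf.cont s)) (integrableOn_mul_rpow hα)
    (m := m s) (by simpa using (h3 s).1) fun q hq hq' => ?_
  rw [abs_mul, abs_of_nonneg (rpow_nonneg hq.le _)]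
  exact mul_le_mul_of_nonneg_left (h4 s q hq.le hq'.le) (rpow_nonneg hq.le _)

lemma Adm.memLp_weight {ρ α : ℝ} {f : Fam} (hf : Adm ρ 2 f) (hα : -1 < α) (s : ℝ) :
    MemLp (fun q => q.1 ^ α * f s q) 2 (strip ρ) := by
  have hm : AEStronglyMeasurable (fun q : ℝ² => q.1 ^ α * f s q) (strip ρ) := by
    rw [strip_eq]
    exact ((continuousOn_weight (hf.cont s)).aestronglyMeasurable (μ := volume)
      (measurableSet_Ioo.prod MeasurableSet.univ)).mono_ac (withDensity_absolutelyContinuous _ _)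
  rw [memLp_two_iff_integrable_sq hm]
  refine (hf.sq.integrable_weight (α := 2 * α) (by linarith) s).congr (ae_strip fun q hq _ => ?_)
  have : q.1 ^ (2 * α) = (q.1 ^ α) ^ 2 := by
    rw [← Real.rpow_natCast, ← Real.rpow_mul hq.le]; norm_num; ring_nf
  simp only [Pi.pow_apply, this]; ring

/-- Radial integration by parts with a power weight. -/
lemma weight_ibp {ρ α : ℝ} {f : Fam} (hρ : 0 < ρ) (hα : 0 < α) (hf : Adm ρ 1 f)
    (h0 : ∀ s z, f s (ρ, z) = 0) (s : ℝ) :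
    α * ∫ q, q.1 ^ (α - 2) * f s q ∂strip ρ = -∫ q, q.1 ^ (α - 1) * dr f s q ∂strip ρ := by
  have i1 := (hf.integrable_weight (α := α - 2) (by linarith) s).const_mul α
  have i2 := hf.dr.integrable_weight (α := α - 1) (by linarith) s
  have := strip_ibp_r hρ (K := fun q => q.1 ^ α * f s q)
    (F := fun q => α * (q.1 ^ (α - 2) * f s q) + q.1 ^ (α - 1) * dr f s q)
    (fun z => by
      refine ContinuousOn.mul (ContinuousOn.rpow_const continuousOn_id fun _ _ => Or.inr hα.le) ?_
      exact ((hf.cont s).comp (by fun_prop : Continuous fun r : ℝ => (r, z))).continuousOn)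
    (fun z r hr => by
      have h1 := (Real.hasDerivAt_rpow_const (x := r) (p := α) (Or.inl hr.1.ne')).mul
        (hf.sm.hasDerivAt_r s (r, z))
      refine h1.congr_deriv ?_
      have e1 : r ^ (α - 1) = r * r ^ (α - 2) := by
        rw [show α - 1 = 1 + (α - 2) by ring, Real.rpow_add hr.1, Real.rpow_one]
      have e2 : r ^ α = r * r ^ (α - 1) := by
        rw [← Real.rpow_one_add' hr.1.le (by linarith)]; congr 1; ring
      simp only
      rw [e2, e1]; ring)
    (i1.add i2)
  rw [integral_add i1 i2, integral_const_mul] at this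
  simp only [h0, mul_zero, Real.zero_rpow hα.ne', zero_mul, sub_zero, integral_zero] at this
  linarith

lemma abs_integral_le_sum {ρ} {n : ℕ} {F : ℝ² → ℝ} {f g : Fin n → ℝ² → ℝ}
    (hf : ∀ i, MemLp (f i) 2 (strip ρ)) (hg : ∀ i, MemLp (g i) 2 (strip ρ))
    (h : ∀ q : ℝ², 0 < q.1 → q.1 < ρ → |F q| ≤ ∑ i, |f i q| * |g i q|) :
    |∫ q, F q ∂strip ρ| ≤ ∑ i, nn ρ (f i) * nn ρ (g i) := by
  have hi : ∀ i ∈ Finset.univ, Integrable (fun q => |f i q * g i q|) (strip ρ) :=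
    fun i _ => (integrable_mul (hf i) (hg i)).abs
  calc |∫ q, F q ∂strip ρ| ≤ ∫ q, ∑ i, |f i q * g i q| ∂strip ρ := by
        refine norm_integral_le_of_norm_le (f := F) (integrable_finsetSum _ hi)
          (ae_strip fun q hq hq' => ?_)
        simp only [norm_eq_abs, abs_mul]; exact h q hq hq'
    _ = ∑ i, ∫ q, |f i q * g i q| ∂strip ρ := integral_finsetSum _ hi
    _ ≤ _ := Finset.sum_le_sum fun i _ => abs_integral_mul_le (hf i) (hg i)

lemma rpow_le_width {r ρ ε : ℝ} (hr : 0 < r) (hr' : r < ρ) (hε : 0 < ε) : r ^ ε ≤ ρ ^ ε :=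
  Real.rpow_le_rpow hr.le hr'.le hε.le

lemma rpow_sub_one_mul {r ε : ℝ} (hr : 0 < r) : r ^ (ε - 1) * r = r ^ ε := by
  rw [Real.rpow_sub_one hr.ne']; field_simp

/-- The Hardy inequality with the weight `r^{ε-1}`. -/
lemma hardy {ρ ε : ℝ} {f : Fam} (hρ : 0 < ρ) (hε : 0 < ε) (hf : Adm ρ 2 f)
    (h0 : ∀ s z, f s (ρ, z) = 0) (s : ℝ) :
    nn ρ (fun q => q.1 ^ (ε - 1) * f s q) ≤ ρ ^ ε / ε * nn ρ (dr f s) := by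
  have m1 := hf.memLp_weight (α := ε - 1) (by linarith) s
  have m2 := hf.dr.memLp s
  have m3 := hf.dr.memLp_weight (α := ε) (by linarith) s
  have h1 := weight_ibp hρ (α := 2 * ε) (by linarith) hf.sq (fun s z => by simp [h0]) s
  have e1 : ∫ q, q.1 ^ (2 * ε - 2) * (f ^ 2) s q ∂strip ρ
      = nn ρ (fun q => q.1 ^ (ε - 1) * f s q) ^ 2 := by
    rw [nn_sq m1]
    refine integral_congr_ae (ae_strip fun q hq _ => ?_)
    have : q.1 ^ (2 * ε - 2) = (q.1 ^ (ε - 1)) ^ 2 := by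
      rw [← Real.rpow_natCast, ← Real.rpow_mul hq.le]; congr 1; push_cast; ring
    simp only [Pi.pow_apply, this]; ring
  have e2 : |∫ q, q.1 ^ (2 * ε - 1) * dr (f ^ 2) s q ∂strip ρ|
      ≤ 2 * (nn ρ (fun q => q.1 ^ (ε - 1) * f s q) * nn ρ (fun q => q.1 ^ ε * dr f s q)) := by
    have := abs_integral_le_nn (ρ := ρ)
      (F := fun q => 2⁻¹ * (q.1 ^ (2 * ε - 1) * dr (f ^ 2) s q)) m1 m3 (fun q hq hq' => by
        have : q.1 ^ (2 * ε - 1) = q.1 ^ (ε - 1) * q.1 ^ ε := by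
          rw [← Real.rpow_add hq]; congr 1; ring
        rw [← abs_mul, dr_sq hf.sm]
        simp only [Pi.mul_apply, ofNat_apply, this]
        refine le_of_eq (congrArg _ ?_); ring)
    rw [integral_const_mul, abs_mul] at this
    norm_num at this
    linarith
  have e3 : nn ρ (fun q => q.1 ^ ε * dr f s q) ≤ ρ ^ ε * nn ρ (dr f s) := by
    have h0 : (0 : ℝ) ≤ ρ ^ ε := rpow_nonneg hρ.le _
    rw [← abs_of_nonneg h0, ← nn_smul]
    refine nn_mono (m2.const_smul _) fun q hq hq' => ?_
    simp only [Pi.smul_apply, smul_eq_mul, abs_mul, abs_of_nonneg h0,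
      abs_of_nonneg (rpow_nonneg hq.le ε)]
    exact mul_le_mul_of_nonneg_right (rpow_le_width hq hq' hε) (abs_nonneg _)
  rw [e1] at h1
  set A := nn ρ (fun q => q.1 ^ (ε - 1) * f s q)
  have hA : 0 ≤ A := nn_nonneg
  have h2 : 2 * ε * A ^ 2 ≤ 2 * (A * (ρ ^ ε * nn ρ (dr f s))) := by
    rw [h1]
    refine (neg_le_abs _).trans (e2.trans ?_)
    exact mul_le_mul_of_nonneg_left (mul_le_mul_of_nonneg_left e3 hA) (by norm_num)
  rcases hA.eq_or_lt with h | h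
  · rw [← h]
    exact mul_nonneg (div_nonneg (rpow_nonneg hρ.le _) hε.le) nn_nonneg
  · rw [div_mul_eq_mul_div, le_div_iff₀ hε]
    nlinarith

section

/-- `L₂` bounds for the first derivatives of the velocity and for the gradient of `ζ Γ` at time `s`,
together with the pointwise bounds for the swirl. -/
structure Bounds (ρ : ℝ) (ζ ζ₁ : ℝ → ℝ) (C : ℝ) (h β w κ l : Fam) (s d g : ℝ) : Prop where
  cut : CutData ρ ζ ζ₁ C
  flow : Flow ρ h β w κ l
  nh : nn ρ (h s) ≤ d
  nb : nn ρ (β s) ≤ d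
  ar : nn ρ (dr (R * h) s) ≤ d
  az : nn ρ (dz (R * h) s) ≤ d
  br : nn ρ (dr (R * β) s) ≤ d
  bz : nn ρ (dz (R * β) s) ≤ d
  wr : nn ρ (dr w s) ≤ d
  gr : nn ρ (dr (Z ζ * (dz h - κ)) s) ≤ g
  gz : nn ρ (dz (Z ζ * (dz h - κ)) s) ≤ g

variable {ρ : ℝ} {ζ ζ₁ : ℝ → ℝ} {C : ℝ} {h β w κ l : Fam} {s d g : ℝ}

lemma nn_sub_le {ρ} {f g : ℝ² → ℝ} (hf : MemLp f 2 (strip ρ)) (hg : MemLp g 2 (strip ρ)) :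
    nn ρ (f - g) ≤ nn ρ f + nn ρ g := by
  have h1 : f - g = f + (-1 : ℝ) • g := by simp [sub_eq_add_neg]
  rw [h1]
  refine (nn_add_le hf (hg.const_smul _)).trans ?_
  rw [nn_smul]; simp

lemma nn_le_mul {ρ c : ℝ} {f g : ℝ² → ℝ} (hc : 0 ≤ c) (hg : MemLp g 2 (strip ρ))
    (h : ∀ q : ℝ², 0 < q.1 → q.1 < ρ → |f q| ≤ c * |g q|) : nn ρ f ≤ c * nn ρ g := by
  rw [← abs_of_nonneg hc, ← nn_smul]
  refine nn_mono (hg.const_smul _) fun q hq hq' => ?_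
  simpa [abs_mul, abs_of_nonneg hc] using h q hq hq'

lemma rpow_two_mul {r : ℝ} (hr : 0 ≤ r) (ε : ℝ) : r ^ (2 * ε) = (r ^ ε) ^ 2 := by
  rw [← Real.rpow_natCast, ← Real.rpow_mul hr]; congr 1; push_cast; ring

/-- The stretching term of the vorticity equation. -/
def stretch (h β κ : Fam) : Fam := ξ[β] ^ 2 * (h + R * dr h) + ξ[β] * η[β] * (R * dz h + R * κ)
    - η[β] ^ 2 * (2 * h + R * dr h)

/-- The stretching term after integration by parts. -/
def stretchIbp (ζ : ℝ → ℝ) (h β κ x y : Fam) : Fam :=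
  (R * β) * (Z ζ ^ 2 * (dz x * (h + R * dr h) + x * (dz h + R * dz (dr h)) + 2 * (dz y * (R * dz h))
    + 2 * (y * (R * dz (dz h))) - dz y * (R * (dz h - κ)) - y * (R * dz (dz h - κ))
    + dr y * (2 * h + R * dr h) + y * (3 * dr h + R * dr (dr h)))
    + 2 * (Z ζ * (Z (deriv ζ) * (y * (2 * h + R * dr h)))))

lemma integral_stretch {ρ : ℝ} {ζ ζ₁ : ℝ → ℝ} {C : ℝ} {h β w κ l : Fam} (H : CutData ρ ζ ζ₁ C)
    (F : Flow ρ h β w κ l) (s : ℝ) :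
    ∫ q, (Z ζ ^ 2 * stretch h β κ) s q ∂strip ρ
      = ∫ q, stretchIbp ζ h β κ ξ[β] η[β] s q ∂strip ρ := by
  have hζ := H.smooth
  have sζ := Sm.Z hζ
  have hζ1 := contDiff_deriv H.smooth
  have sζ1 := Sm.Z hζ1
  have ah := F.adm_h
  have ab := F.adm_b
  have ak := F.adm_k
  have sh := ah.sm
  have sb := ab.sm
  have sk := ak.sm
  set x : Fam := ξ[β] with hx
  set y : Fam := η[β] with hy
  have ax : Adm ρ 2 x := ab.dz.R_mul.neg
  have ay : Adm ρ 2 y := (ab.ofNat_mul 2).add ab.dr.R_mul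
  have sx := ax.sm
  have sy := ay.sm
  set M : Fam := Z ζ * (Z ζ * (y * (2 * h + R * dr h))) with hM
  set K₁ : Fam := -(R * (R * (β * M))) with hK₁
  set F₁ : Fam := -(β * (2 * M) + β * (R * dr M) + dr β * (R * M)) with hF₁
  set K₂ : Fam := -((R * β) * (Z ζ * (Z ζ * (x * (h + R * dr h) + 2 * (y * (R * dz h))
    - y * (R * (dz h - κ)))))) with hK₂
  have aM : Adm ρ 2 M := by
    simp (maxDischargeDepth := 40) only [hM, Adm.Z_mul, Adm.R_mul, Adm.ofNat_mul, Adm.add,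
      Adm.mul2, Adm.dr, hζ, ah, ay]
  have sM := aM.sm
  have aF₁ : Adm ρ 1 F₁ :=
    ((ab.mul (aM.ofNat_mul 2)).add (ab.mul aM.dr.R_mul) |>.add (ab.dr.mul aM.R_mul)).neg
  have aK₂ : Adm ρ 1 K₂ := by
    refine (Adm.mul ab.R_mul ?_).neg
    simp (maxDischargeDepth := 40) only [Adm.Z_mul, Adm.R_mul, Adm.ofNat_mul, Adm.add, Adm.sub,
      Adm.mul2, Adm.dr, Adm.dz, hζ, ah, ay, ax, ak]
  have hKF : R * F₁ = dr K₁ := by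
    rw [hK₁, hF₁]
    simp (maxDischargeDepth := 40) only [dr_neg, dr_mul, dr_R, Sm.mul, Sm.R, sM, sb]
    ring
  have hdiv := strip_div (by linarith [H.pos]) (Sm.R.mul (Sm.R.mul (sb.mul sM))).neg hKF aF₁ aK₂
    (fun s z => by simp [hM, Z, H.zero]) s
  have h0 : ∫ z, K₁ s (0, z) = 0 := by simp [hK₁, R]
  rw [h0, neg_zero] at hdiv
  have aI : Adm ρ 1 (stretchIbp ζ h β κ x y) := by
    rw [stretchIbp, pow_two, mul_assoc (Z ζ)]
    refine Adm.mul ab.R_mul ?_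
    simp (maxDischargeDepth := 60) only [Adm.Z_mul, Adm.R_mul, Adm.ofNat_mul, Adm.add, Adm.sub,
      Adm.mul2, Adm.dr, Adm.dz, hζ, hζ1, ah, ay, ax, ak]
  have hid : Z ζ ^ 2 * stretch h β κ = stretchIbp ζ h β κ x y + (F₁ + dz K₂) := by
    rw [hF₁, hK₂, hM, stretchIbp, stretch, ← hx, ← hy]
    simp (maxDischargeDepth := 60) only [dr_mul, dr_add, dr_R, dr_Z, dr_ofNat,
      dz_neg, dz_mul, dz_add, dz_sub, dz_R, dz_Z, dz_ofNat, Sm.mul, Sm.add, Sm.sub,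
      Sm.dr, Sm.dz, Sm.ofNat, Sm.R, sζ, sx, sy, sh, sb, sk]
    linear_combination (Z ζ ^ 2 * (x * (h + R * dr h) + 2 * (y * (R * dz h))
      - y * (R * (dz h - κ)))) * hx - (Z ζ ^ 2 * (y * (2 * h + R * dr h))) * hy
  rw [hid]
  change ∫ q, (stretchIbp ζ h β κ x y s q + (F₁ s q + dz K₂ s q)) ∂strip ρ = _
  rw [integral_add (f := fun q => stretchIbp ζ h β κ x y s q)
    (g := fun q => F₁ s q + dz K₂ s q) (aI.integrable s)
    ((aF₁.integrable s).add (aK₂.dz.integrable s)), hdiv, add_zero]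

/-- `F` is dominated by an integrable function with integral at most `c`. -/
def IntBd (ρ : ℝ) (F : ℝ² → ℝ) (c : ℝ) : Prop :=
  ∃ G, Integrable G (strip ρ) ∧ (∀ q : ℝ², 0 < q.1 → q.1 < ρ → |F q| ≤ G q) ∧ ∫ q, G q ∂strip ρ ≤ c

lemma IntBd.abs_le {ρ F c} (h : IntBd ρ F c) : |∫ q, F q ∂strip ρ| ≤ c := by
  obtain ⟨G, h1, h2, h3⟩ := h
  refine le_trans ?_ h3
  exact norm_integral_le_of_norm_le (f := F) h1 (ae_strip h2)

lemma IntBd.add {ρ F F' c c'} (h : IntBd ρ F c) (h' : IntBd ρ F' c') :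
    IntBd ρ (F + F') (c + c') := by
  obtain ⟨G, h1, h2, h3⟩ := h
  obtain ⟨G', h1', h2', h3'⟩ := h'
  refine ⟨fun q => G q + G' q, h1.add h1', fun q hq hq' => ?_, ?_⟩
  · exact (abs_add_le _ _).trans (add_le_add (h2 q hq hq') (h2' q hq hq'))
  · rw [integral_add h1 h1']; exact add_le_add h3 h3'

lemma IntBd.neg {ρ F c} (h : IntBd ρ F c) : IntBd ρ (-F) c := by
  obtain ⟨G, h1, h2, h3⟩ := h
  exact ⟨G, h1, fun q hq hq' => by rw [Pi.neg_apply, abs_neg]; exact h2 q hq hq', h3⟩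

lemma intBd_mul {ρ k A A' : ℝ} {F f g : ℝ² → ℝ} (hk : 0 ≤ k) (hf : MemLp f 2 (strip ρ))
    (hg : MemLp g 2 (strip ρ)) (h : ∀ q : ℝ², 0 < q.1 → q.1 < ρ → |F q| ≤ k * (|f q| * |g q|))
    (hA : nn ρ f ≤ A) (hA' : nn ρ g ≤ A') : IntBd ρ F (k * (A * A')) := by
  refine ⟨fun q => k * |f q * g q|, (integrable_mul hf hg).abs.const_mul k, fun q hq hq' => ?_, ?_⟩
  · show |F q| ≤ k * |f q * g q|
    rw [abs_mul]; exact h q hq hq'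
  · rw [integral_const_mul]
    exact mul_le_mul_of_nonneg_left ((abs_integral_mul_le hf hg).trans
      (mul_le_mul hA hA' nn_nonneg (nn_nonneg.trans hA))) hk

lemma integral_transport {ρ : ℝ} {ζ ζ₁ : ℝ → ℝ} {C : ℝ} {h β : Fam} (H : CutData ρ ζ ζ₁ C)
    (ah : Adm ρ 2 h) (ab : Adm ρ 2 β) (s : ℝ) :
    ∫ q, (Z ζ * Z (deriv ζ) * (R * h * (ξ[β] ^ 2 + η[β] ^ 2)) : Fam) s q ∂strip ρ
      = ∫ q, ((R * β) * (Z ζ * Z (deriv ζ) * (R * dz h * ξ[β])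
          + Z ζ * Z (deriv ζ) * (R * h * dz ξ[β])
          - (Z (deriv ζ) ^ 2 + Z ζ * Z (deriv (deriv ζ))) * (R * h * η[β])
          - Z ζ * Z (deriv ζ) * ((h + R * dr h) * η[β])
          - Z ζ * Z (deriv ζ) * (R * h * dr η[β])) : Fam) s q ∂strip ρ := by
  have hζ := H.smooth
  have sζ := Sm.Z hζ
  have hζ1 := contDiff_deriv H.smooth
  have sζ1 := Sm.Z hζ1
  have hζ2 := contDiff_deriv hζ1
  have sζ2 := Sm.Z hζ2
  have sh := ah.sm
  have sb := ab.sm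
  set x : Fam := ξ[β] with hx
  set y : Fam := η[β] with hy
  have ax : Adm ρ 2 x := ab.dz.R_mul.neg
  have ay : Adm ρ 2 y := (ab.ofNat_mul 2).add ab.dr.R_mul
  have sx := ax.sm
  have sy := ay.sm
  set N : Fam := Z ζ * (Z (deriv ζ) * (R * (h * y))) with hN
  set K₁ : Fam := R * (R * (β * N)) with hK₁
  set F₁ : Fam := β * (2 * N) + β * (R * dr N) + dr β * (R * N) with hF₁
  set K₂ : Fam := -((R * β) * (Z ζ * (Z (deriv ζ) * (R * (h * x))))) with hK₂
  have aN : Adm ρ 2 N := by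
    simp (maxDischargeDepth := 40) only [hN, Adm.Z_mul, Adm.R_mul, Adm.mul2, hζ, hζ1, ah, ay]
  have sN := aN.sm
  have aF₁ : Adm ρ 1 F₁ :=
    (ab.mul (aN.ofNat_mul 2)).add (ab.mul aN.dr.R_mul) |>.add (ab.dr.mul aN.R_mul)
  have aK₂ : Adm ρ 1 K₂ := by
    refine (Adm.mul ab.R_mul ?_).neg
    simp (maxDischargeDepth := 40) only [Adm.Z_mul, Adm.R_mul, Adm.mul2, hζ, hζ1, ah, ax]
  have hKF : R * F₁ = dr K₁ := by
    rw [hK₁, hF₁]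
    simp (maxDischargeDepth := 40) only [dr_mul, dr_R, Sm.mul, Sm.R, sN, sb]
    ring
  have hdiv := strip_div (by linarith [H.pos]) (Sm.R.mul (Sm.R.mul (sb.mul sN))) hKF aF₁ aK₂
    (fun s z => by simp [hN, Z, H.zero]) s
  have h0 : ∫ z, K₁ s (0, z) = 0 := by simp [hK₁, R]
  rw [h0, neg_zero] at hdiv
  set I : Fam := (R * β) * (Z ζ * Z (deriv ζ) * (R * dz h * x) + Z ζ * Z (deriv ζ) * (R * h * dz x)
          - (Z (deriv ζ) ^ 2 + Z ζ * Z (deriv (deriv ζ))) * (R * h * y)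
          - Z ζ * Z (deriv ζ) * ((h + R * dr h) * y) - Z ζ * Z (deriv ζ) * (R * h * dr y)) with hI
  have aI : Adm ρ 1 I := by
    have e : I = (R * β) * (Z ζ * (Z (deriv ζ) * (R * (dz h * x)))
          + Z ζ * (Z (deriv ζ) * (R * (h * dz x)))
          - (Z (deriv ζ) * (Z (deriv ζ) * (R * (h * y)))
          + Z ζ * (Z (deriv (deriv ζ)) * (R * (h * y))))
          - Z ζ * (Z (deriv ζ) * ((h + R * dr h) * y)) - Z ζ * (Z (deriv ζ) * (R * (h * dr y)))) := by
      rw [hI]; ring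
    rw [e]
    refine Adm.mul ab.R_mul ?_
    simp (maxDischargeDepth := 60) only [Adm.Z_mul, Adm.R_mul, Adm.add, Adm.sub,
      Adm.mul2, Adm.dr, Adm.dz, hζ, hζ1, hζ2, ah, ay, ax]
  have hid : Z ζ * Z (deriv ζ) * (R * h * (x ^ 2 + y ^ 2)) = I + (F₁ + dz K₂) := by
    rw [hF₁, hK₂, hN, hI]
    simp (maxDischargeDepth := 60) only [dr_mul, dr_R, dr_Z, dz_neg, dz_mul, dz_R, dz_Z, Sm.mul,
      Sm.R, sζ, sζ1, sx, sy, sh, sb]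
    linear_combination (Z ζ * Z (deriv ζ) * (R * h * x)) * hx
      + (Z ζ * Z (deriv ζ) * (R * h * y)) * hy
  rw [hid]
  change ∫ q, (I s q + (F₁ s q + dz K₂ s q)) ∂strip ρ = _
  rw [integral_add (f := fun q => I s q) (g := fun q => F₁ s q + dz K₂ s q) (aI.integrable s)
    ((aF₁.integrable s).add (aK₂.dz.integrable s)), hdiv, add_zero]

/-- The rate of change of the localized enstrophy without the force term. -/
def vortRate (ν : ℝ) (ζ : ℝ → ℝ) (h β κ : Fam) : Fam := Z ζ ^ 2 * stretch h β κ
    + Z ζ * Z (deriv ζ) * (R * h * (ξ[β] ^ 2 + η[β] ^ 2))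
    - ν • (Z ζ ^ 2 * (dr ξ[β] ^ 2 + dz ξ[β] ^ 2 + dr η[β] ^ 2 + dz η[β] ^ 2 + dz β ^ 2))
    - (2 * ν) • (Z ζ * Z (deriv ζ) * (ξ[β] * dr ξ[β] + η[β] * dr η[β]))

/-- The localized dissipation of the vorticity. -/
def vortDiss (ρ : ℝ) (ζ : ℝ → ℝ) (β : Fam) (s : ℝ) : ℝ :=
  nn ρ ((Z ζ * dr ξ[β]) s) ^ 2 + nn ρ ((Z ζ * dz ξ[β]) s) ^ 2
    + nn ρ ((Z ζ * dr η[β]) s) ^ 2 + nn ρ ((Z ζ * dz η[β]) s) ^ 2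
    + nn ρ ((Z ζ * dz β) s) ^ 2

lemma vortDiss_bounds (ρ : ℝ) (ζ : ℝ → ℝ) (β : Fam) (s : ℝ) : 0 ≤ vortDiss ρ ζ β s
    ∧ nn ρ ((Z ζ * dr ξ[β]) s) ^ 2 + nn ρ ((Z ζ * dz ξ[β]) s) ^ 2 ≤ vortDiss ρ ζ β s
    ∧ nn ρ ((Z ζ * dr η[β]) s) ^ 2 + nn ρ ((Z ζ * dz η[β]) s) ^ 2 ≤ vortDiss ρ ζ β s
    ∧ nn ρ ((Z ζ * dz β) s) ^ 2 ≤ vortDiss ρ ζ β s := by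
  rw [vortDiss]
  refine ⟨by positivity, ?_, ?_, ?_⟩ <;> linarith [sq_nonneg (nn ρ ((Z ζ * dr ξ[β]) s)),
    sq_nonneg (nn ρ ((Z ζ * dz ξ[β]) s)), sq_nonneg (nn ρ ((Z ζ * dr η[β]) s)),
    sq_nonneg (nn ρ ((Z ζ * dz η[β]) s)), sq_nonneg (nn ρ ((Z ζ * dz β) s))]

lemma adm_vortRate {ρ : ℝ} {ζ : ℝ → ℝ} {h β κ : Fam} (hζ : 𝒞 ζ) (ah : Adm ρ 2 h)
    (ab : Adm ρ 2 β) (ak : Adm ρ 2 κ) (ν : ℝ) : Adm ρ 1 (Z ζ ^ 2 * stretch h β κ)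
      ∧ Adm ρ 1 (Z ζ * Z (deriv ζ) * (R * h * (ξ[β] ^ 2 + η[β] ^ 2)))
      ∧ Adm ρ 1 (Z ζ * Z (deriv ζ) * (ξ[β] * dr ξ[β] + η[β] * dr η[β]))
      ∧ Adm ρ 1 (vortRate ν ζ h β κ) := by
  have hζ1 := contDiff_deriv hζ
  set x : Fam := ξ[β] with hx
  set y : Fam := η[β] with hy
  have ax : Adm ρ 2 x := ab.dz.R_mul.neg
  have ay : Adm ρ 2 y := (ab.ofNat_mul 2).add ab.dr.R_mul
  have a1 : Adm ρ 1 (Z ζ ^ 2 * stretch h β κ) := by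
    have e : Z ζ ^ 2 * stretch h β κ = Z ζ * (Z ζ * (x * (x * (h + R * dr h))
        + x * (y * (R * dz h + R * κ)) - y * (y * (2 * h + R * dr h)))) := by
      rw [stretch, ← hx, ← hy]; ring
    rw [e]
    simp (maxDischargeDepth := 60) only [Adm.Z_mul, Adm.R_mul, Adm.ofNat_mul, Adm.add, Adm.sub,
      Adm.mul2, Adm.mul, Adm.dr, Adm.dz, hζ, ah, ay, ax, ak]
  have a2 : Adm ρ 1 (Z ζ * Z (deriv ζ) * (R * h * (x ^ 2 + y ^ 2))) := by
    have e : Z ζ * Z (deriv ζ) * (R * h * (x ^ 2 + y ^ 2))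
        = Z ζ * (Z (deriv ζ) * (R * (h * (x * x + y * y)))) := by ring
    rw [e]
    simp (maxDischargeDepth := 60) only [Adm.Z_mul, Adm.R_mul, Adm.add, Adm.mul2, Adm.mul, hζ, hζ1,
      ah, ay, ax]
  have a3 : Adm ρ 1 (Z ζ * Z (deriv ζ) * (x * dr x + y * dr y)) := by
    rw [mul_assoc]
    exact (((ax.mul ax.dr).add (ay.mul ay.dr)).Z_mul hζ1).Z_mul hζ
  have a4 : Adm ρ 1 (Z ζ ^ 2 * (dr x ^ 2 + dz x ^ 2 + dr y ^ 2 + dz y ^ 2 + dz β ^ 2)) := by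
    rw [pow_two (Z ζ), mul_assoc]
    exact (((((ax.dr.sq.add ax.dz.sq).add ay.dr.sq).add ay.dz.sq).add ab.dz.sq).Z_mul hζ).Z_mul hζ
  exact ⟨a1, a2, a3, ((a1.add a2).sub (a4.smul ν)).sub (a3.smul (2 * ν))⟩

lemma integral_vortRate {ρ : ℝ} {ζ : ℝ → ℝ} {h β κ : Fam} (hζ : 𝒞 ζ) (ah : Adm ρ 2 h)
    (ab : Adm ρ 2 β) (ak : Adm ρ 2 κ) (ν s : ℝ) :
    ∫ q, vortRate ν ζ h β κ s q ∂strip ρ = ∫ q, (Z ζ ^ 2 * stretch h β κ) s q ∂strip ρ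
      + ∫ q, (Z ζ * Z (deriv ζ) * (R * h * (ξ[β] ^ 2 + η[β] ^ 2)) : Fam) s q
        ∂strip ρ - ν * vortDiss ρ ζ β s
      - 2 * ν * ∫ q, (Z ζ * Z (deriv ζ) * (ξ[β] * dr ξ[β]
        + η[β] * dr η[β]) : Fam) s q ∂strip ρ := by
  obtain ⟨a1, a2, a3, -⟩ := adm_vortRate hζ ah ab ak ν
  have ax : Adm ρ 2 ξ[β] := ab.dz.R_mul.neg
  have ay : Adm ρ 2 η[β] := (ab.ofNat_mul 2).add ab.dr.R_mul
  set x : Fam := ξ[β] with hx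
  set y : Fam := η[β] with hy
  have m1 := ax.dr.Z_mul hζ
  have m2 := ax.dz.Z_mul hζ
  have m3 := ay.dr.Z_mul hζ
  have m4 := ay.dz.Z_mul hζ
  have m5 := ab.dz.Z_mul hζ
  have e : ∀ q, vortRate ν ζ h β κ s q = (Z ζ ^ 2 * stretch h β κ) s q
      + (Z ζ * Z (deriv ζ) * (R * h * (x ^ 2 + y ^ 2))) s q
      - ν * ((Z ζ * dr x) s q ^ 2 + (Z ζ * dz x) s q ^ 2 + (Z ζ * dr y) s q ^ 2
        + (Z ζ * dz y) s q ^ 2 + (Z ζ * dz β) s q ^ 2)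
      - 2 * ν * (Z ζ * Z (deriv ζ) * (x * dr x + y * dr y)) s q := by
    intro q
    simp only [vortRate, ← hx, ← hy, Pi.add_apply, Pi.sub_apply, Pi.mul_apply, Pi.pow_apply,
      Pi.smul_apply, smul_eq_mul]
    ring
  have i : ∀ {f : Fam}, Adm ρ 2 f → Integrable (fun q => f s q ^ 2) (strip ρ) :=
    fun hf => hf.sq.integrable s
  have i12 : Integrable (fun q => (Z ζ * dr x) s q ^ 2 + (Z ζ * dz x) s q ^ 2) (strip ρ) :=
    (i m1).add (i m2)
  have i13 : Integrable (fun q => (Z ζ * dr x) s q ^ 2 + (Z ζ * dz x) s q ^ 2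
    + (Z ζ * dr y) s q ^ 2) (strip ρ) := i12.add (i m3)
  have i14 : Integrable (fun q => (Z ζ * dr x) s q ^ 2 + (Z ζ * dz x) s q ^ 2
    + (Z ζ * dr y) s q ^ 2 + (Z ζ * dz y) s q ^ 2) (strip ρ) := i13.add (i m4)
  have i15 : Integrable (fun q => (Z ζ * dr x) s q ^ 2 + (Z ζ * dz x) s q ^ 2
    + (Z ζ * dr y) s q ^ 2 + (Z ζ * dz y) s q ^ 2 + (Z ζ * dz β) s q ^ 2) (strip ρ) :=
    i14.add (i m5)
  have j1 : Integrable (fun q => (Z ζ ^ 2 * stretch h β κ) s q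
      + (Z ζ * Z (deriv ζ) * (R * h * (x ^ 2 + y ^ 2))) s q) (strip ρ) :=
    (a1.integrable s).add (a2.integrable s)
  have j2 : Integrable (fun q => (Z ζ ^ 2 * stretch h β κ) s q
      + (Z ζ * Z (deriv ζ) * (R * h * (x ^ 2 + y ^ 2))) s q
      - ν * ((Z ζ * dr x) s q ^ 2 + (Z ζ * dz x) s q ^ 2 + (Z ζ * dr y) s q ^ 2
        + (Z ζ * dz y) s q ^ 2 + (Z ζ * dz β) s q ^ 2)) (strip ρ) := j1.sub (i15.const_mul ν)
  simp only [e]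
  rw [integral_sub j2 ((a3.integrable s).const_mul _), integral_sub j1 (i15.const_mul ν),
    integral_add (a1.integrable s) (a2.integrable s), integral_const_mul, integral_const_mul,
    integral_add i14 (i m5), integral_add i13 (i m4), integral_add i12 (i m3),
    integral_add (i m1) (i m2), vortDiss, ← nn_sq (m1.memLp s), ← nn_sq (m2.memLp s),
    ← nn_sq (m3.memLp s), ← nn_sq (m4.memLp s), ← nn_sq (m5.memLp s)]

end

section

variable {ρ : ℝ} {ζ ζ₁ : ℝ → ℝ} {C : ℝ} {h β w κ l : Fam} {s d g : ℝ}

namespace Bounds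

variable (B : Bounds ρ ζ ζ₁ C h β w κ l s d g)
include B

lemma r_pos : 0 < ρ := by linarith [B.cut.pos]
lemma d_nonneg : 0 ≤ d := nn_nonneg.trans B.nh
lemma g_nonneg : 0 ≤ g := nn_nonneg.trans B.gr
lemma C_pos : 0 < C := by linarith [B.cut.C_ge]

lemma rhr : nn ρ ((R * dr h) s) ≤ 2 * d := by
  have hh := B.flow.adm_h
  have e : (R * dr h) s = dr (R * h) s - h s := by
    rw [dr_mul Sm.R hh.sm, dr_R, one_mul]; simp
  rw [e]
  refine (nn_sub_le (hh.R_mul.dr.memLp s) (hh.memLp s)).trans ?_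
  linarith [B.ar, B.nh]

lemma rhz : nn ρ ((R * dz h) s) ≤ d := by
  have hh := B.flow.adm_h
  have e : (R * dz h) s = dz (R * h) s := by
    rw [dz_mul Sm.R hh.sm, dz_R, zero_mul, zero_add]
  rw [e]; exact B.az

lemma hess {k : Fam} (hk : k = dr (dr h) ∨ k = l ∨ k = dz (dz h) ∨ k = dz (dr h)) :
    nn ρ ((Z ζ * k) s) ≤ g + 6 * C * d := by
  have F := B.flow
  refine (hess_bound B.cut F.adm_h F.adm_l F.dr_h s B.rhr B.rhz hk).trans
    (add_le_add_left (le_trans ?_ B.gz) _)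
  refine nn_mono ((((F.adm_h.dz.sub F.adm_k).Z_mul B.cut.smooth).dz).memLp s) fun q hq _ => ?_
  have e1 : dz (Z ζ * (dz h - κ)) = Z ζ * (dz (dz h) - dz κ) := by
    rw [dz_mul (Sm.Z B.cut.smooth) (F.adm_h.dz.sm.sub F.adm_k.sm), dz_Z, zero_mul, zero_add,
      dz_sub F.adm_h.dz.sm F.adm_k.sm]
  have e2 : R * dz κ = -(R * (3 * l + dr (dr h))) := by
    have : R * dz κ = dz (dr w) := by
      rw [F.dr_w, dz_mul Sm.R F.adm_k.sm, dz_R, zero_mul, zero_add]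
    rw [this, dz_dr F.adm_w.sm, F.div, dr_neg (((Sm.ofNat 2).mul F.adm_h.sm).add
      (Sm.R.mul F.adm_h.dr.sm)), dr_add ((Sm.ofNat 2).mul F.adm_h.sm) (Sm.R.mul F.adm_h.dr.sm),
      dr_mul (Sm.ofNat 2) F.adm_h.sm, dr_ofNat, dr_mul Sm.R F.adm_h.dr.sm, dr_R]
    nth_rw 1 2 [F.dr_h]
    ring
  have e3 : dz κ s q = -(3 * l s q + dr (dr h) s q) := by
    have := congrFun (congrFun e2 s) q
    simp only [Pi.mul_apply, Pi.neg_apply, Pi.add_apply, ofNat_apply, R] at this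
    have h0 : q.1 ≠ 0 := hq.ne'
    have h1 : q.1 * (dz κ s q + (3 * l s q + dr (dr h) s q)) = 0 := by linarith
    rcases mul_eq_zero.1 h1 with h2 | h2
    · exact absurd h2 h0
    · linarith
  rw [e1]
  simp only [Pi.mul_apply, Pi.sub_apply, Pi.add_apply, ofNat_apply, e3]
  refine le_of_eq (congrArg _ ?_); ring

variable {ε : ℝ}

lemma width_nonneg (ε : ℝ) : 0 ≤ ρ ^ ε := rpow_nonneg B.r_pos.le _

/-- Weighted bounds of second derivatives. -/
lemma hess_weight (hε : 0 < ε) {k : Fam}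
    (hk : k = dr (dr h) ∨ k = l ∨ k = dz (dz h) ∨ k = dz (dr h)) :
    nn ρ (fun q => q.1 ^ (ε - 1) * (Z ζ * (R * k)) s q) ≤ ρ ^ ε * (g + 6 * C * d) := by
  have F := B.flow
  have ak : Adm ρ 2 k := by
    rcases hk with rfl | rfl | rfl | rfl
    exacts [F.adm_h.dr.dr, F.adm_l, F.adm_h.dz.dz, F.adm_h.dr.dz]
  refine le_trans (nn_le_mul (B.width_nonneg ε) ((ak.Z_mul B.cut.smooth).memLp s)
    fun q hq hq' => ?_) (mul_le_mul_of_nonneg_left (B.hess hk) (B.width_nonneg ε))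
  simp only [Pi.mul_apply, R]
  have e : q.1 ^ (ε - 1) * (Z ζ s q * (q.1 * k s q)) = q.1 ^ ε * (Z ζ s q * k s q) := by
    rw [← rpow_sub_one_mul (ε := ε) hq]; ring
  rw [e, abs_mul, abs_of_nonneg (rpow_nonneg hq.le _)]
  exact mul_le_mul_of_nonneg_right (rpow_le_width hq hq' hε) (abs_nonneg _)

lemma hr_weight (hε : 0 < ε) : nn ρ (fun q => q.1 ^ (ε - 1) * (Z ζ * dr h) s q)
      ≤ ρ ^ ε * (g + 6 * C * d) := by
  rw [B.flow.dr_h]; exact B.hess_weight hε (Or.inr (Or.inl rfl))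

lemma hz_weight (hε : 0 < ε) : nn ρ (fun q => q.1 ^ (ε - 1) * (Z ζ * dz h) s q)
      ≤ ρ ^ ε / ε * (g + 7 * C * d) := by
  have F := B.flow
  have hC := B.C_pos
  refine (hardy B.r_pos hε (F.adm_h.dz.Z_mul B.cut.smooth) (fun s z => by
    simp [Z, B.cut.zero]) s).trans ?_
  refine mul_le_mul_of_nonneg_left ?_ (div_nonneg (B.width_nonneg ε) hε.le)
  have e : dr (Z ζ * dz h) s = (Z (deriv ζ) * dz h) s + (Z ζ * dz (dr h)) s := by
    rw [dr_mul (Sm.Z B.cut.smooth) F.adm_h.dz.sm, dr_Z, dr_dz F.adm_h.sm]; rfl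
  rw [e]
  refine (nn_add_le ((F.adm_h.dz.Z_mul (contDiff_deriv B.cut.smooth)).memLp s)
    ((F.adm_h.dr.dz.Z_mul B.cut.smooth).memLp s)).trans ?_
  have h1 := B.hess (k := dz (dr h)) (by simp)
  have h2 : nn ρ ((Z (deriv ζ) * dz h) s) ≤ C * nn ρ ((R * dz h) s) := by
    refine nn_le_mul hC.le (F.adm_h.dz.R_mul.memLp s) fun q hq _ => ?_
    simp only [Pi.mul_apply, abs_mul, R, Z, abs_of_pos hq]
    have := mul_le_mul_of_nonneg_right (B.cut.bd_deriv_one q.1 hq.le) (abs_nonneg (dz h s q))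
    linarith
  have h3 := mul_le_mul_of_nonneg_left B.rhz hC.le
  linarith

/-- The weighted `L₂` norm of the radial velocity. -/
lemma h_weight (hε : 0 < ε) : nn ρ (fun q => q.1 ^ (ε - 1) * (Z ζ * h) s q) ^ 2
      ≤ ρ ^ (2 * ε) / ε * (7 * C ^ 2 * (d * (g + d))) := by
  have F := B.flow
  have hC := B.C_pos
  have hC1 := B.cut.C_ge
  have hd := B.d_nonneg
  have hg := B.g_nonneg
  have hζ := B.cut.smooth
  have aζ := F.adm_h.Z_mul hζ
  have m1 := aζ.memLp_weight (α := ε - 1) (by linarith) s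
  rw [nn_sq m1]
  have h1 := weight_ibp B.r_pos (α := 2 * ε) (by linarith) aζ.sq (fun s z => by
    simp [Z, B.cut.zero]) s
  have e1 : ∫ q, q.1 ^ (2 * ε - 2) * ((Z ζ * h) ^ 2) s q ∂strip ρ
      = ∫ q, (q.1 ^ (ε - 1) * (Z ζ * h) s q) ^ 2 ∂strip ρ := by
    refine integral_congr_ae (ae_strip fun q hq _ => ?_)
    have : q.1 ^ (2 * ε - 2) = (q.1 ^ (ε - 1)) ^ 2 := by
      rw [← Real.rpow_natCast, ← Real.rpow_mul hq.le]; congr 1; push_cast; ring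
    simp only [Pi.pow_apply, this]; ring
  rw [e1] at h1
  set I := ∫ q, (q.1 ^ (ε - 1) * (Z ζ * h) s q) ^ 2 ∂strip ρ
  have h2 : |∫ q, q.1 ^ (2 * ε - 1) * dr ((Z ζ * h) ^ 2) s q ∂strip ρ|
      ≤ 2 * ρ ^ (2 * ε) * C * d * (g + 6 * C * d) + 2 * ρ ^ (2 * ε) * C ^ 2 * d * d := by
    have hw := B.width_nonneg (2 * ε)
    have := abs_integral_le_sum (ρ := ρ) (n := 2)
      (F := fun q => q.1 ^ (2 * ε - 1) * dr ((Z ζ * h) ^ 2) s q)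
      (f := ![(2 * ρ ^ (2 * ε) * C) • h s, (2 * ρ ^ (2 * ε) * C ^ 2) • h s])
      (g := ![(Z ζ * l) s, h s])
      (by
        intro i; fin_cases i
        · exact (F.adm_h.memLp s).const_smul _
        · exact (F.adm_h.memLp s).const_smul _)
      (by
        intro i; fin_cases i
        · exact (F.adm_l.Z_mul hζ).memLp s
        · exact F.adm_h.memLp s)
      (fun q hq hq' => by
        rw [dr_sq aζ.sm, dr_mul (Sm.Z hζ) F.adm_h.sm, dr_Z, B.cut.Z_deriv, F.dr_h]
        simp only [Fin.sum_univ_two, Matrix.cons_val_zero, Matrix.cons_val_one, Pi.mul_apply,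
          Pi.add_apply, ofNat_apply, Pi.smul_apply, smul_eq_mul, R, Z]
        have e2 : q.1 ^ (2 * ε - 1) * (2 * (ζ q.1 * h s q) * (q.1 * ζ₁ q.1 * h s q
            + ζ q.1 * (q.1 * l s q))) = q.1 ^ (2 * ε) * (2 * ζ q.1 * h s q * (ζ q.1 * l s q)
              + 2 * (ζ q.1 * ζ₁ q.1) * h s q * h s q) := by
          rw [← rpow_sub_one_mul (ε := 2 * ε) hq]; ring
        rw [e2, abs_mul, abs_of_nonneg (rpow_nonneg hq.le _)]
        have p1 : |2 * ζ q.1 * h s q * (ζ q.1 * l s q) + 2 * (ζ q.1 * ζ₁ q.1) * h s q * h s q|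
            ≤ 2 * C * |h s q| * |ζ q.1 * l s q| + 2 * C ^ 2 * |h s q| * |h s q| := by
          refine (abs_add_le _ _).trans (add_le_add ?_ ?_)
          · rw [abs_mul, abs_mul, abs_mul, abs_two]
            gcongr
            exact B.cut.bd _
          · rw [abs_mul, abs_mul, abs_mul, abs_two, abs_mul]
            gcongr
            rw [pow_two]
            exact mul_le_mul (B.cut.bd _) (B.cut.bd₁ _) (abs_nonneg _) hC.le
        refine (mul_le_mul (rpow_le_width hq hq' (by linarith)) p1 (abs_nonneg _) hw).trans
          (le_of_eq ?_)
        have a1 : |2 * ρ ^ (2 * ε) * C * h s q| = 2 * ρ ^ (2 * ε) * C * |h s q| := by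
          rw [abs_mul, abs_of_nonneg (by positivity)]
        have a2 : |2 * ρ ^ (2 * ε) * C ^ 2 * h s q| = 2 * ρ ^ (2 * ε) * C ^ 2 * |h s q| := by
          rw [abs_mul, abs_of_nonneg (by positivity)]
        rw [a1, a2]; ring)
    simp only [Fin.sum_univ_two, Matrix.cons_val_zero, Matrix.cons_val_one, nn_smul] at this
    refine this.trans (add_le_add ?_ ?_)
    · rw [abs_of_nonneg (by positivity)]
      exact mul_le_mul (mul_le_mul_of_nonneg_left B.nh (by positivity))
        (B.hess (by simp)) nn_nonneg (by positivity)
    · rw [abs_of_nonneg (by positivity)]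
      exact mul_le_mul (mul_le_mul_of_nonneg_left B.nh (by positivity)) B.nh nn_nonneg (by positivity)
  have h3 : 2 * ε * I ≤ 2 * (ρ ^ (2 * ε) * (7 * C ^ 2 * (d * (g + d)))) := by
    rw [h1]
    refine (neg_le_abs _).trans (h2.trans ?_)
    have hw := B.width_nonneg (2 * ε)
    have k1 : C * d * (g + 6 * C * d) + C ^ 2 * d * d ≤ 7 * C ^ 2 * (d * (g + d)) := by
      have : C * (d * g) ≤ C ^ 2 * (d * g) := by
        apply mul_le_mul_of_nonneg_right _ (by positivity); nlinarith
      have : 0 ≤ C ^ 2 * (d * g) := by positivity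
      nlinarith
    nlinarith [mul_le_mul_of_nonneg_left k1 hw]
  rw [div_mul_eq_mul_div, le_div_iff₀ hε]
  linarith

lemma rhr_weight (hε : 0 < ε) : nn ρ (fun q => q.1 ^ (ε - 1) * (Z ζ * (R * dr h)) s q) ^ 2
      ≤ ρ ^ (2 * ε) * (14 * C ^ 2 * (d * (g + d))) := by
  have F := B.flow
  have hC := B.C_pos
  have hC1 := B.cut.C_ge
  have hd := B.d_nonneg
  have hg := B.g_nonneg
  have hζ := B.cut.smooth
  have hw := B.width_nonneg (2 * ε)
  rw [nn_sq ((F.adm_h.dr.R_mul.Z_mul hζ).memLp_weight (by linarith) s)]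
  have := abs_integral_le_nn (ρ := ρ) (F := fun q => (q.1 ^ (ε - 1) * (Z ζ * (R * dr h)) s q) ^ 2)
    ((F.adm_h.dr.R_mul.memLp s).const_smul (ρ ^ (2 * ε) * C)) ((F.adm_l.Z_mul hζ).memLp s)
    (fun q hq hq' => by
      have e1 : (q.1 ^ (ε - 1) * (Z ζ * (R * dr h)) s q) ^ 2
          = q.1 ^ (2 * ε) * ζ q.1 * (q.1 * dr h s q) * (ζ q.1 * l s q) := by
        rw [rpow_two_mul hq.le, ← rpow_sub_one_mul (ε := ε) hq, F.dr_h]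
        simp only [Pi.mul_apply, R, Z]; ring
      rw [e1]
      simp only [Pi.mul_apply, Pi.smul_apply, smul_eq_mul, abs_mul, R, Z]
      rw [abs_of_nonneg (rpow_nonneg hq.le _), abs_of_nonneg hw, abs_of_pos hC]
      gcongr
      exact B.cut.bd _)
  refine (le_abs_self _).trans (this.trans ?_)
  rw [nn_smul, abs_of_nonneg (by positivity)]
  calc _ ≤ ρ ^ (2 * ε) * C * (2 * d) * (g + 6 * C * d) :=
        mul_le_mul (mul_le_mul_of_nonneg_left B.rhr (by positivity)) (B.hess (by simp)) nn_nonneg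
          (by positivity)
    _ ≤ _ := by
      rw [mul_assoc, mul_assoc]
      refine mul_le_mul_of_nonneg_left ?_ hw
      have : C * (d * g) ≤ C ^ 2 * (d * g) :=
        mul_le_mul_of_nonneg_right (by nlinarith) (by positivity)
      have : 0 ≤ C ^ 2 * (d * g) := by positivity
      have : 0 ≤ C ^ 2 * (d * d) := by positivity
      nlinarith

lemma two_integral_sq {f : Fam} (hf : Adm ρ 2 f) (h0 : ∀ s z, f s (ρ, z) = 0) :
    ∫ q, f s q ^ 2 ∂strip ρ = -∫ q, (R * f) s q * dr f s q ∂strip ρ := by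
  have := weight_ibp B.r_pos (α := 2) (by norm_num) hf.sq (fun s z => by simp [h0]) s
  rw [dr_sq hf.sm] at this
  norm_num at this
  have e : ∫ q : ℝ², q.1 * (2 * f s q * dr f s q) ∂strip ρ
      = 2 * ∫ q, (R * f) s q * dr f s q ∂strip ρ := by
    rw [← integral_const_mul]
    refine integral_congr_ae (ae_of_all _ fun q => ?_)
    simp only [Pi.mul_apply, R]; ring
  rw [e] at this
  linarith

lemma weight_R_sq (hε : 0 < ε) {f : Fam} (hf : Adm ρ 2 f) :
    nn ρ (fun q => q.1 ^ (ε - 1) * (R * f) s q) ^ 2 ≤ ρ ^ (2 * ε) * ∫ q, f s q ^ 2 ∂strip ρ := by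
  have hw := B.width_nonneg ε
  have h1 : nn ρ (fun q => q.1 ^ (ε - 1) * (R * f) s q) ≤ ρ ^ ε * nn ρ (f s) := by
    refine nn_le_mul hw (hf.memLp s) fun q hq hq' => ?_
    have e : q.1 ^ (ε - 1) * (R * f) s q = q.1 ^ ε * f s q := by
      rw [← rpow_sub_one_mul (ε := ε) hq]; simp only [Pi.mul_apply, R]; ring
    rw [e, abs_mul, abs_of_nonneg (rpow_nonneg hq.le _)]
    exact mul_le_mul_of_nonneg_right (rpow_le_width hq hq' hε) (abs_nonneg _)
  rw [← nn_sq (hf.memLp s), rpow_two_mul B.r_pos.le, ← mul_pow]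
  exact pow_le_pow_left₀ nn_nonneg h1 2

lemma rhz_weight (hε : 0 < ε) : nn ρ (fun q => q.1 ^ (ε - 1) * (Z ζ * (R * dz h)) s q) ^ 2
      ≤ ρ ^ (2 * ε) * (14 * C ^ 2 * (d * (g + d))) := by
  have F := B.flow
  have hC := B.C_pos
  have hC1 := B.cut.C_ge
  have hd := B.d_nonneg
  have hg := B.g_nonneg
  have hζ := B.cut.smooth
  have e : Z ζ * (R * dz h) = R * (Z ζ * dz h) := by ring
  rw [e]
  have hf := F.adm_h.dz.Z_mul hζ
  refine (B.weight_R_sq hε hf).trans (mul_le_mul_of_nonneg_left ?_ (B.width_nonneg _))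
  rw [B.two_integral_sq hf (fun s z => by simp [Z, B.cut.zero])]
  have := abs_integral_le_sum (ρ := ρ) (n := 2)
    (F := fun q => (R * (Z ζ * dz h)) s q * dr (Z ζ * dz h) s q)
    (f := ![C ^ 2 • (R * dz h) s, C • (R * dz h) s])
    (g := ![(R * dz h) s, (Z ζ * dz (dr h)) s])
    (by
      intro i; fin_cases i
      · exact (F.adm_h.dz.R_mul.memLp s).const_smul _
      · exact (F.adm_h.dz.R_mul.memLp s).const_smul _)
    (by
      intro i; fin_cases i
      · exact F.adm_h.dz.R_mul.memLp s
      · exact (F.adm_h.dr.dz.Z_mul hζ).memLp s)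
    (fun q hq hq' => by
      rw [dr_mul (Sm.Z hζ) F.adm_h.dz.sm, dr_Z, dr_dz F.adm_h.sm]
      simp only [Fin.sum_univ_two, Matrix.cons_val_zero, Matrix.cons_val_one, Pi.mul_apply,
        Pi.add_apply, Pi.smul_apply, smul_eq_mul, R, Z]
      rw [mul_add]
      have b1 := B.cut.bd q.1
      have b2 := B.cut.bd_deriv_one q.1 hq.le
      refine (abs_add_le _ _).trans (add_le_add ?_ ?_)
      · simp only [abs_mul, abs_pow, abs_of_pos hC, abs_of_pos hq]
        calc q.1 * (|ζ q.1| * |dz h s q|) * (|deriv ζ q.1| * |dz h s q|)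
            ≤ q.1 * (C * |dz h s q|) * (C * q.1 * |dz h s q|) := by gcongr
          _ = _ := by ring
      · simp only [abs_mul, abs_of_pos hC, abs_of_pos hq]
        calc q.1 * (|ζ q.1| * |dz h s q|) * (|ζ q.1| * |dz (dr h) s q|)
            ≤ q.1 * (C * |dz h s q|) * (|ζ q.1| * |dz (dr h) s q|) := by gcongr
          _ = _ := by ring)
  refine (neg_le_abs _).trans (this.trans ?_)
  simp only [Fin.sum_univ_two, Matrix.cons_val_zero, Matrix.cons_val_one, nn_smul,
    abs_pow, abs_of_pos hC]
  have k1 : C ^ 2 * nn ρ ((R * dz h) s) * nn ρ ((R * dz h) s) ≤ C ^ 2 * d * d :=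
    mul_le_mul (mul_le_mul_of_nonneg_left B.rhz (by positivity)) B.rhz nn_nonneg (by positivity)
  have k2 : C * nn ρ ((R * dz h) s) * nn ρ ((Z ζ * dz (dr h)) s) ≤ C * d * (g + 6 * C * d) :=
    mul_le_mul (mul_le_mul_of_nonneg_left B.rhz hC.le) (B.hess (by simp)) nn_nonneg (by positivity)
  have : C * (d * g) ≤ C ^ 2 * (d * g) := mul_le_mul_of_nonneg_right (by nlinarith) (by positivity)
  have : 0 ≤ C ^ 2 * (d * g) := by positivity
  have : 0 ≤ C ^ 2 * (d * d) := by positivity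
  nlinarith

lemma nn_R_cut_vort : nn ρ ((R * (Z ζ * (dz h - κ))) s) ≤ C * (2 * d) := by
  have F := B.flow
  have e : (dz (R * h) - dr w) = R * (dz h - κ) := by
    rw [dz_mul Sm.R F.adm_h.sm, dz_R, F.dr_w]; ring
  have m1 := F.adm_h.R_mul.dz.memLp s
  have m2 := F.adm_w.dr.memLp s
  refine (nn_le_mul B.C_pos.le (m1.sub m2) fun q hq _ => ?_).trans
    (mul_le_mul_of_nonneg_left ((nn_sub_le m1 m2).trans (by linarith [B.az, B.wr])) B.C_pos.le)
  have e2 := congrFun (congrFun e s) q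
  simp only [Pi.mul_apply, Pi.sub_apply] at e2 ⊢
  rw [e2, mul_left_comm, abs_mul]
  exact mul_le_mul_of_nonneg_right (B.cut.bd _) (abs_nonneg _)

lemma vort_weight (hε : 0 < ε) : nn ρ (fun q => q.1 ^ (ε - 1) * (Z ζ * (R * (dz h - κ))) s q) ^ 2
      ≤ ρ ^ (2 * ε) * (14 * C ^ 2 * (d * (g + d))) := by
  have F := B.flow
  have hC := B.C_pos
  have hC1 := B.cut.C_ge
  have hd := B.d_nonneg
  have hg := B.g_nonneg
  have hζ := B.cut.smooth
  have e : Z ζ * (R * (dz h - κ)) = R * (Z ζ * (dz h - κ)) := by ring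
  rw [e]
  have hf := (F.adm_h.dz.sub F.adm_k).Z_mul hζ
  refine (B.weight_R_sq hε hf).trans (mul_le_mul_of_nonneg_left ?_ (B.width_nonneg _))
  rw [B.two_integral_sq hf (fun s z => by simp [Z, B.cut.zero])]
  refine (neg_le_abs _).trans ((abs_integral_le_nn (hf.R_mul.memLp s) (hf.dr.memLp s)
    fun q _ _ => (abs_mul _ _).le).trans ?_)
  calc _ ≤ C * (2 * d) * g := mul_le_mul B.nn_R_cut_vort B.gr nn_nonneg (by positivity)
    _ ≤ _ := by
      have : C * (d * g) ≤ C ^ 2 * (d * g) :=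
        mul_le_mul_of_nonneg_right (by nlinarith) (by positivity)
      have : 0 ≤ C ^ 2 * (d * g) := by positivity
      have : 0 ≤ C ^ 2 * (d * d) := by positivity
      nlinarith

lemma nn_x : nn ρ (ξ[β] s) ≤ d := by
  have e : ξ[β] s = (-1 : ℝ) • dz (R * β) s := by
    rw [dz_mul Sm.R B.flow.adm_b.sm, dz_R, zero_mul, zero_add, neg_one_smul]; rfl
  rw [e, nn_smul]; simpa using B.bz

lemma nn_y : nn ρ (η[β] s) ≤ 2 * d := by
  have hb := B.flow.adm_b
  have e : η[β] s = dr (R * β) s + β s := by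
    rw [dr_mul Sm.R hb.sm, dr_R, one_mul]
    funext q
    simp only [Pi.add_apply, Pi.mul_apply, ofNat_apply]; ring
  rw [e]
  refine (nn_add_le (hb.R_mul.dr.memLp s) (hb.memLp s)).trans ?_
  linarith [B.br, B.nb]

lemma nn_cut_le {f : Fam} (hf : Adm ρ 2 f) {a : ℝ} (h : nn ρ (f s) ≤ a) :
    nn ρ ((Z ζ * f) s) ≤ C * a :=
  (nn_le_mul B.C_pos.le (hf.memLp s) fun q _ _ => by
    rw [Pi.mul_apply, Pi.mul_apply, abs_mul]
    exact mul_le_mul_of_nonneg_right (B.cut.bd _) (abs_nonneg _)).trans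
      (mul_le_mul_of_nonneg_left h B.C_pos.le)

lemma nn_cut_dz_vort : nn ρ ((Z ζ * dz (dz h - κ)) s) ≤ g := by
  have F := B.flow
  have e : Z ζ * dz (dz h - κ) = dz (Z ζ * (dz h - κ)) := by
    rw [dz_mul (Sm.Z B.cut.smooth) (F.adm_h.dz.sm.sub F.adm_k.sm), dz_Z, zero_mul, zero_add]
  rw [e]; exact B.gz

variable {K D : ℝ}

lemma swirl_mul_deriv_le {q : ℝ²} (hq : 0 < q.1) (hD : q.1 * |(R * β) s q| ≤ D) :
    |(R * β) s q| * |deriv ζ q.1| ≤ C * D := by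
  have hC := B.C_pos
  calc _ ≤ |(R * β) s q| * (C * q.1) := by gcongr; exact B.cut.bd_deriv_one q.1 hq.le
    _ = C * (q.1 * |(R * β) s q|) := by ring
    _ ≤ C * D := by gcongr

set_option maxHeartbeats 1000000 in
lemma stretch_bound (hε : 0 < ε) (hε1 : ε ≤ 1)
    (hK0 : 0 ≤ K) (hK : ∀ q : ℝ², 0 < q.1 → q.1 < ρ → |(R * β) s q| ≤ K * q.1 ^ (ε - 1))
    (hD0 : 0 ≤ D) (hD : ∀ q : ℝ², 0 < q.1 → q.1 < ρ → q.1 * |(R * β) s q| ≤ D)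
    {p₁ p₂ p₃ : ℝ} (h₁ : nn ρ ((Z ζ * dz ξ[β]) s) ≤ p₁)
    (h₂ : nn ρ ((Z ζ * dz η[β]) s) ≤ p₂)
    (h₃ : nn ρ ((Z ζ * dr η[β]) s) ≤ p₃) {δ : ℝ} (hδ : 0 < δ) :
    |∫ q, (Z ζ ^ 2 * stretch h β κ) s q ∂strip ρ| ≤ δ * (p₁ ^ 2 + p₂ ^ 2 + p₃ ^ 2)
      + 100 * C ^ 2 * ((1 / δ) * (K * (ρ ^ ε / ε)) ^ 2 * (d * (g + d))
        + K * (ρ ^ ε / ε) * (d * (g + d)) + D * (d * (g + d))) := by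
  have F := B.flow
  have hC := B.C_pos
  have hC1 := B.cut.C_ge
  have hd := B.d_nonneg
  have hg := B.g_nonneg
  have hζ := B.cut.smooth
  have hw := B.width_nonneg ε
  have ah := F.adm_h
  have ab := F.adm_b
  have ak := F.adm_k
  rw [integral_stretch B.cut F]
  set x : Fam := ξ[β] with hx
  set y : Fam := η[β] with hy
  have ax : Adm ρ 2 x := ab.dz.R_mul.neg
  have ay : Adm ρ 2 y := (ab.ofNat_mul 2).add ab.dr.R_mul
  set S : ℝ := √(ρ ^ (2 * ε) / ε ^ 2 * (14 * C ^ 2 * (d * (g + d)))) with hS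
  have hE : ρ ^ (2 * ε) / ε ^ 2 = (ρ ^ ε / ε) ^ 2 := by
    rw [rpow_two_mul B.r_pos.le, div_pow]
  set E := ρ ^ ε / ε with hEd
  have hE0 : 0 ≤ E := by positivity
  have hEw : ρ ^ ε ≤ E := by rw [hEd, le_div_iff₀ hε]; nlinarith
  have hS2 : S ^ 2 = E ^ 2 * (14 * C ^ 2 * (d * (g + d))) := by
    rw [hS, hE, sq_sqrt (by positivity)]
  have hS0 : 0 ≤ S := sqrt_nonneg _
  have hw2 : ρ ^ (2 * ε) ≤ E ^ 2 := by
    rw [rpow_two_mul B.r_pos.le]; exact pow_le_pow_left₀ hw hEw 2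
  have hw3 : ρ ^ (2 * ε) / ε ≤ E ^ 2 := by
    rw [← hE]
    refine div_le_div_of_nonneg_left (B.width_nonneg _) (by positivity) ?_
    nlinarith
  have toS : ∀ {f : ℝ² → ℝ}, nn ρ f ^ 2
      ≤ ρ ^ (2 * ε) * (14 * C ^ 2 * (d * (g + d))) → nn ρ f ≤ S := by
    intro f hf
    refine le_of_sq_le_sq ?_ hS0
    rw [hS2]
    exact hf.trans (mul_le_mul_of_nonneg_right hw2 (by positivity))
  have n1 : nn ρ (fun q => q.1 ^ (ε - 1) * (Z ζ * h) s q) ≤ S := by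
    refine le_of_sq_le_sq ?_ hS0
    rw [hS2]
    refine (B.h_weight hε).trans (mul_le_mul hw3 ?_ (by positivity) (by positivity))
    have : 0 ≤ C ^ 2 * (d * (g + d)) := by positivity
    linarith
  have n2 := toS (B.rhr_weight hε)
  have n3 := toS (B.rhz_weight hε)
  have n4 := toS (B.vort_weight hε)
  have wp : ∀ {f k : Fam} (hf : Adm ρ 2 f) (hk : Adm ρ 2 k) {A A' : ℝ},
      nn ρ ((Z ζ * f) s) ≤ A → nn ρ (fun q => q.1 ^ (ε - 1) * (Z ζ * k) s q) ≤ A' →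
      IntBd ρ ((R * β * (Z ζ ^ 2 * (f * k)) : Fam) s) (K * (A * A')) := by
    intro f k hf hk A A' hA hA'
    refine intBd_mul hK0 ((hf.Z_mul hζ).memLp s)
      ((hk.Z_mul hζ).memLp_weight (α := ε - 1) (by linarith) s) (fun q hq hq' => ?_) hA hA'
    have e : (R * β * (Z ζ ^ 2 * (f * k)) : Fam) s q
        = (R * β) s q * ((Z ζ * f) s q * (Z ζ * k) s q) := by
      simp only [Pi.mul_apply, Pi.pow_apply]; ring
    rw [e, abs_mul, abs_mul, abs_mul (q.1 ^ (ε - 1)), abs_of_nonneg (rpow_nonneg hq.le _)]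
    refine (mul_le_mul_of_nonneg_right (hK q hq hq') (by positivity)).trans (le_of_eq ?_)
    ring
  have nx := B.nn_cut_le ax B.nn_x
  have ny := B.nn_cut_le ay B.nn_y
  have ahr := ah.dr
  have ahz := ah.dz
  have t1 := wp ax.dz ah h₁ n1
  have t2 := wp ax.dz ahr.R_mul h₁ n2
  have t3 := wp ax ahz nx (B.hz_weight hε)
  have t4 := wp ax ahr.dz.R_mul nx (B.hess_weight hε (k := dz (dr h)) (by simp))
  have t5 := wp ay.dz ahz.R_mul h₂ n3
  have t6 := wp ay ahz.dz.R_mul ny (B.hess_weight hε (k := dz (dz h)) (by simp))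
  have t7 := wp ay.dz (ahz.sub ak).R_mul h₂ n4
  have t9 := wp ay.dr ah h₃ n1
  have t10 := wp ay.dr ahr.R_mul h₃ n2
  have t11 := wp ay ahr ny (B.hr_weight hε)
  have t12 := wp ay ahr.dr.R_mul ny (B.hess_weight hε (k := dr (dr h)) (by simp))
  have t8 : IntBd ρ ((R * β * (Z ζ ^ 2 * (y * (R * dz (dz h - κ)))) : Fam) s)
      (D * (C * (2 * d) * g)) := by
    refine intBd_mul hD0 ((ay.Z_mul hζ).memLp s) (((ahz.sub ak).dz.Z_mul hζ).memLp s)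
      (fun q hq hq' => ?_) ny B.nn_cut_dz_vort
    have e : (R * β * (Z ζ ^ 2 * (y * (R * dz (dz h - κ)))) : Fam) s q
        = q.1 * (R * β) s q * ((Z ζ * y) s q * (Z ζ * dz (dz h - κ)) s q) := by
      simp only [Pi.mul_apply, Pi.pow_apply, R]; ring
    rw [e, abs_mul, abs_mul q.1, abs_mul ((Z ζ * y) s q), abs_of_pos hq]
    exact mul_le_mul_of_nonneg_right (hD q hq hq') (by positivity)
  have t13 : IntBd ρ ((R * β * (2 * (Z ζ * (Z (deriv ζ) * (y * (2 * h + R * dr h))))) : Fam) s)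
      (2 * C * (C * D) * (2 * d * (4 * d))) := by
    have h2h : Adm ρ 2 (2 * h) := ah.ofNat_mul 2
    refine intBd_mul (by positivity) (ay.memLp s) ((h2h.add ahr.R_mul).memLp s)
      (fun q hq hq' => ?_) B.nn_y ?_
    · have e : (R * β * (2 * (Z ζ * (Z (deriv ζ) * (y * (2 * h + R * dr h))))) : Fam) s q
          = 2 * ζ q.1 * ((R * β) s q * deriv ζ q.1) * (y s q * (2 * h + R * dr h : Fam) s q) := by
        simp only [Pi.mul_apply, ofNat_apply, Z]; ring
      rw [e, abs_mul, abs_mul, abs_mul, abs_mul, abs_mul (y s q), abs_two]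
      have b1 := B.cut.bd q.1
      have b2 := B.swirl_mul_deriv_le hq (hD q hq hq')
      gcongr
    · refine (nn_add_le (h2h.memLp s) (ahr.R_mul.memLp s)).trans ?_
      have : (2 * h : Fam) s = (2 : ℝ) • h s := by funext q; simp
      rw [this, nn_smul, abs_two]
      linarith [B.nh, B.rhr]
  have key := (((((((((((((t1.add t2).add t3).add t4).add t5).add t5).add t6).add t6).add
    t7.neg).add t8.neg).add (t9.add t9)).add t10).add ((t11.add t11).add t11)).add t12).add t13
  have e : stretchIbp ζ h β κ x y = (R * β * (Z ζ ^ 2 * (dz x * h)))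
      + (R * β * (Z ζ ^ 2 * (dz x * (R * dr h)))) + (R * β * (Z ζ ^ 2 * (x * dz h)))
      + (R * β * (Z ζ ^ 2 * (x * (R * dz (dr h)))))
      + (R * β * (Z ζ ^ 2 * (dz y * (R * dz h)))) + (R * β * (Z ζ ^ 2 * (dz y * (R * dz h))))
      + (R * β * (Z ζ ^ 2 * (y * (R * dz (dz h))))) + (R * β * (Z ζ ^ 2 * (y * (R * dz (dz h)))))
      + -(R * β * (Z ζ ^ 2 * (dz y * (R * (dz h - κ)))))
      + -(R * β * (Z ζ ^ 2 * (y * (R * dz (dz h - κ)))))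
      + ((R * β * (Z ζ ^ 2 * (dr y * h))) + (R * β * (Z ζ ^ 2 * (dr y * h))))
      + (R * β * (Z ζ ^ 2 * (dr y * (R * dr h))))
      + ((R * β * (Z ζ ^ 2 * (y * dr h))) + (R * β * (Z ζ ^ 2 * (y * dr h)))
        + (R * β * (Z ζ ^ 2 * (y * dr h))))
      + (R * β * (Z ζ ^ 2 * (y * (R * dr (dr h)))))
      + (R * β * (2 * (Z ζ * (Z (deriv ζ) * (y * (2 * h + R * dr h)))))) := by
    rw [stretchIbp]; ring
  rw [e]
  refine key.abs_le.trans ?_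
  have hp₁ := nn_nonneg.trans h₁
  have hp₂ := nn_nonneg.trans h₂
  have hp₃ := nn_nonneg.trans h₃
  have y1 : K * (p₁ * S) + K * (p₁ * S) + K * (p₂ * S) + K * (p₂ * S) + K * (p₂ * S)
      + (K * (p₃ * S) + K * (p₃ * S)) + K * (p₃ * S)
      ≤ δ * (p₁ ^ 2 + p₂ ^ 2 + p₃ ^ 2) + 100 * C ^ 2 * ((1 / δ) * (K * E) ^ 2 * (d * (g + d))) := by
    have yy : ∀ p : ℝ, 0 ≤ p → 3 * (K * (p * S)) ≤ δ * p ^ 2 + (9 / 4) * (1 / δ) * (K * S) ^ 2 := by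
      intro p _
      have : 0 ≤ δ * (p - (3 / 2) * (1 / δ) * (K * S)) ^ 2 := by positivity
      have e : δ * (p - (3 / 2) * (1 / δ) * (K * S)) ^ 2
        = δ * p ^ 2 - 3 * (K * (p * S)) + (9 / 4) * (1 / δ) * (K * S) ^ 2 := by
        field_simp; ring
      linarith
    have z1 := yy p₁ hp₁
    have z2 := yy p₂ hp₂
    have z3 := yy p₃ hp₃
    have z0 : 0 ≤ K * (p₁ * S) := by positivity
    have z4 : (1 / δ) * (K * S) ^ 2 = 14 * (C ^ 2 * ((1 / δ) * (K * E) ^ 2 * (d * (g + d)))) := by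
      rw [mul_pow, hS2]; ring
    have z5 : 0 ≤ C ^ 2 * ((1 / δ) * (K * E) ^ 2 * (d * (g + d))) := by positivity
    linarith
  have hM : C * (d * (g + 7 * C * d)) ≤ 7 * C ^ 2 * (d * (g + d)) := by
    have : C * (d * g) ≤ C ^ 2 * (d * g) := mul_le_mul_of_nonneg_right (by nlinarith) (by positivity)
    have : 0 ≤ C ^ 2 * (d * g) := by positivity
    nlinarith
  have y2 : K * (C * d * (E * (g + 7 * C * d))) ≤ K * E * (7 * C ^ 2 * (d * (g + d))) := by
    calc _ = K * E * (C * (d * (g + 7 * C * d))) := by ring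
      _ ≤ _ := mul_le_mul_of_nonneg_left hM (by positivity)
  have y3 : K * (C * d * (ρ ^ ε * (g + 6 * C * d))) ≤ K * E * (7 * C ^ 2 * (d * (g + d))) := by
    refine le_trans ?_ y2
    have : g + 6 * C * d ≤ g + 7 * C * d := by nlinarith
    gcongr
  have y4 : K * (C * (2 * d) * (ρ ^ ε * (g + 6 * C * d)))
      = 2 * (K * (C * d * (ρ ^ ε * (g + 6 * C * d)))) := by ring
  rw [y4]
  have y5 : D * (C * (2 * d) * g) ≤ 2 * (C ^ 2 * (D * (d * g))) := by
    have : C * (D * (d * g)) ≤ C ^ 2 * (D * (d * g)) :=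
      mul_le_mul_of_nonneg_right (by nlinarith) (by positivity)
    linarith
  have y6 : 0 ≤ C ^ 2 * (D * (d * g)) := by positivity
  have y7 : 0 ≤ C ^ 2 * (D * (d * d)) := by positivity
  have y8 : 0 ≤ K * E * (C ^ 2 * (d * (g + d))) := by positivity
  have y9 : 100 * C ^ 2 * ((1 / δ) * (K * E) ^ 2 * (d * (g + d)) + K * E * (d * (g + d))
      + D * (d * (g + d))) = 100 * C ^ 2 * ((1 / δ) * (K * E) ^ 2 * (d * (g + d)))
      + 100 * (K * E * (C ^ 2 * (d * (g + d)))) + 100 * (C ^ 2 * (D * (d * g)))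
      + 100 * (C ^ 2 * (D * (d * d))) := by ring
  rw [y9]
  linarith

set_option maxHeartbeats 1000000 in
lemma transport_bound (hD0 : 0 ≤ D) (hD : ∀ q : ℝ², 0 < q.1 → q.1 < ρ → q.1 * |(R * β) s q| ≤ D)
    {p₁ p₃ : ℝ} (h₁ : nn ρ ((Z ζ * dz ξ[β]) s) ≤ p₁)
    (h₃ : nn ρ ((Z ζ * dr η[β]) s) ≤ p₃) {δ : ℝ} (hδ : 0 < δ) :
    |∫ q, (Z ζ * Z (deriv ζ) * (R * h * (ξ[β] ^ 2 + η[β] ^ 2)) : Fam) s q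
        ∂strip ρ| ≤ δ * (p₁ ^ 2 + p₃ ^ 2)
      + 20 * C ^ 2 * (1 / δ * D ^ 2 * d ^ 2 + D * d ^ 2) := by
  have F := B.flow
  have hC := B.C_pos
  have hC1 := B.cut.C_ge
  have hd := B.d_nonneg
  have hζ := B.cut.smooth
  have ah := F.adm_h
  have ab := F.adm_b
  rw [integral_transport B.cut ah ab]
  set x : Fam := ξ[β] with hx
  set y : Fam := η[β] with hy
  have ax : Adm ρ 2 x := ab.dz.R_mul.neg
  have ay : Adm ρ 2 y := (ab.ofNat_mul 2).add ab.dr.R_mul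
  have nx : nn ρ (x s) ≤ d := B.nn_x
  have ny : nn ρ (y s) ≤ 2 * d := B.nn_y
  have na : nn ρ ((h + R * dr h) s) ≤ 3 * d := by
    refine (nn_add_le (ah.memLp s) (ah.dr.R_mul.memLp s)).trans ?_
    linarith [B.nh, B.rhr]
  have tt : ∀ {f k : Fam} (hf : Adm ρ 2 f) (hk : Adm ρ 2 k) {A A' : ℝ}, nn ρ (f s) ≤ A →
      nn ρ (k s) ≤ A' →
      IntBd ρ ((R * β * (Z ζ * Z (deriv ζ) * (f * k)) : Fam) s) (C * (C * D) * (A * A')) := by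
    intro f k hf hk A A' hA hA'
    refine intBd_mul (by positivity) (hf.memLp s) (hk.memLp s) (fun q hq hq' => ?_) hA hA'
    have e : (R * β * (Z ζ * Z (deriv ζ) * (f * k)) : Fam) s q
        = ζ q.1 * ((R * β) s q * deriv ζ q.1) * (f s q * k s q) := by
      simp only [Pi.mul_apply, Z]; ring
    rw [e, abs_mul, abs_mul, abs_mul ((R * β) s q), abs_mul (f s q)]
    have := B.swirl_mul_deriv_le hq (hD q hq hq')
    have := B.cut.bd q.1
    gcongr
  have t1 := tt ah.dz.R_mul ax B.rhz nx
  have t4 := tt (ah.add ah.dr.R_mul) ay na ny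
  have t2 : ∀ {k : Fam} (ak : Adm ρ 2 k) {p : ℝ}, nn ρ ((Z ζ * k) s) ≤ p →
      IntBd ρ ((R * β * (Z ζ * Z (deriv ζ) * (R * h * k)) : Fam) s) (C * D * (d * p)) := by
    intro k ak p hp
    refine intBd_mul (by positivity) (ah.memLp s) ((ak.Z_mul hζ).memLp s) (fun q hq hq' => ?_)
      B.nh hp
    have e : (R * β * (Z ζ * Z (deriv ζ) * (R * h * k)) : Fam) s q
        = q.1 * (R * β) s q * deriv ζ q.1 * (h s q * (Z ζ * k) s q) := by
      simp only [Pi.mul_apply, Z, R]; ring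
    rw [e, abs_mul, abs_mul, abs_mul q.1, abs_mul (h s q), abs_of_pos hq, mul_comm C D]
    have := hD q hq hq'
    have := B.cut.bd_deriv q.1
    gcongr
  have t3 : IntBd ρ ((R * β * ((Z (deriv ζ) ^ 2 + Z ζ * Z (deriv (deriv ζ)))
      * (R * h * y)) : Fam) s) (D * (2 * C ^ 2) * (d * (2 * d))) := by
    refine intBd_mul (by positivity) (ah.memLp s) (ay.memLp s) (fun q hq hq' => ?_) B.nh ny
    have e : (R * β * ((Z (deriv ζ) ^ 2 + Z ζ * Z (deriv (deriv ζ))) * (R * h * y)) : Fam) s q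
        = q.1 * (R * β) s q * (deriv ζ q.1 ^ 2 + ζ q.1 * deriv (deriv ζ) q.1)
          * (h s q * y s q) := by
      simp only [Pi.mul_apply, Pi.add_apply, Pi.pow_apply, Z, R]; ring
    rw [e, abs_mul, abs_mul, abs_mul q.1, abs_mul (h s q), abs_of_pos hq]
    have k1 := hD q hq hq'
    have k2 : |deriv ζ q.1 ^ 2 + ζ q.1 * deriv (deriv ζ) q.1| ≤ 2 * C ^ 2 := by
      refine (abs_add_le _ _).trans ?_
      rw [abs_pow, abs_mul]
      have m1 := pow_le_pow_left₀ (abs_nonneg _) (B.cut.bd_deriv q.1) 2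
      have m2 := mul_le_mul (B.cut.bd q.1) (B.cut.bd_deriv₂ q.1) (abs_nonneg _) hC.le
      nlinarith
    gcongr
  have key := (((t1.add (t2 ax.dz h₁)).add t3.neg).add t4.neg).add (t2 ay.dr h₃).neg
  have e : (R * β) * (Z ζ * Z (deriv ζ) * (R * dz h * x) + Z ζ * Z (deriv ζ) * (R * h * dz x)
          - (Z (deriv ζ) ^ 2 + Z ζ * Z (deriv (deriv ζ))) * (R * h * y)
          - Z ζ * Z (deriv ζ) * ((h + R * dr h) * y) - Z ζ * Z (deriv ζ) * (R * h * dr y))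
      = R * β * (Z ζ * Z (deriv ζ) * (R * dz h * x)) + R * β * (Z ζ * Z (deriv ζ) * (R * h * dz x))
      + -(R * β * ((Z (deriv ζ) ^ 2 + Z ζ * Z (deriv (deriv ζ))) * (R * h * y)))
      + -(R * β * (Z ζ * Z (deriv ζ) * ((h + R * dr h) * y)))
      + -(R * β * (Z ζ * Z (deriv ζ) * (R * h * dr y))) := by ring
  rw [e]
  refine key.abs_le.trans ?_
  have yy : ∀ p : ℝ, C * D * (d * p) ≤ δ * p ^ 2 + C ^ 2 * (1 / δ * D ^ 2 * d ^ 2) := by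
    intro p
    have : 0 ≤ δ * (p - (1 / 2) * (1 / δ) * (C * D * d)) ^ 2 := by positivity
    have e : δ * (p - (1 / 2) * (1 / δ) * (C * D * d)) ^ 2
      = δ * p ^ 2 - C * D * (d * p) + (1 / 4) * (C ^ 2 * (1 / δ * D ^ 2 * d ^ 2)) := by
      field_simp; ring
    have : 0 ≤ C ^ 2 * (1 / δ * D ^ 2 * d ^ 2) := by positivity
    linarith
  have z1 := yy p₁
  have z3 := yy p₃
  have z5 : 0 ≤ C ^ 2 * (1 / δ * D ^ 2 * d ^ 2) := by positivity
  have z6 : 0 ≤ C ^ 2 * (D * d ^ 2) := by positivity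
  linarith

lemma viscous_bound {ν : ℝ} (hν : 0 < ν)
    {p₃ p₄ : ℝ} (h₃ : nn ρ ((Z ζ * dr η[β]) s) ≤ p₃)
    (h₄ : nn ρ ((Z ζ * dr ξ[β]) s) ≤ p₄) {δ : ℝ} (hδ : 0 < δ) :
    |∫ q, (Z ζ * Z (deriv ζ) * (ξ[β] * dr ξ[β] + η[β] * dr η[β]) : Fam) s q ∂strip ρ|
      ≤ δ * (p₃ ^ 2 + p₄ ^ 2) + 2 * C ^ 2 * (1 / δ * d ^ 2) := by
  have F := B.flow
  have hC := B.C_pos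
  have hd := B.d_nonneg
  have hζ := B.cut.smooth
  have ab := F.adm_b
  have nx := B.nn_x
  have ny := B.nn_y
  set x : Fam := ξ[β] with hx
  set y : Fam := η[β] with hy
  have ax : Adm ρ 2 x := ab.dz.R_mul.neg
  have ay : Adm ρ 2 y := (ab.ofNat_mul 2).add ab.dr.R_mul
  have t : ∀ {f : Fam} (af : Adm ρ 2 f) {A p : ℝ}, nn ρ (f s) ≤ A → nn ρ ((Z ζ * dr f) s) ≤ p →
      IntBd ρ ((Z ζ * Z (deriv ζ) * (f * dr f) : Fam) s) (C * (A * p)) := by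
    intro f af A p hA hp
    refine intBd_mul hC.le (af.memLp s) ((af.dr.Z_mul hζ).memLp s) (fun q hq hq' => ?_) hA hp
    have e : (Z ζ * Z (deriv ζ) * (f * dr f) : Fam) s q
        = deriv ζ q.1 * (f s q * (Z ζ * dr f) s q) := by
      simp only [Pi.mul_apply, Z]; ring
    rw [e, abs_mul, abs_mul (f s q)]
    exact mul_le_mul_of_nonneg_right (B.cut.bd_deriv q.1) (by positivity)
  have key := (t ax nx h₄).add (t ay ny h₃)
  have e : Z ζ * Z (deriv ζ) * (x * dr x + y * dr y)
      = Z ζ * Z (deriv ζ) * (x * dr x) + Z ζ * Z (deriv ζ) * (y * dr y) := by ring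
  rw [e]
  refine key.abs_le.trans ?_
  have yy : ∀ p c : ℝ, C * (c * d * p) ≤ δ * p ^ 2 + c ^ 2 * (1 / 4) * (C ^ 2 * (1 / δ * d ^ 2)) := by
    intro p c
    have : 0 ≤ δ * (p - (c / 2) * (1 / δ) * (C * d)) ^ 2 := by positivity
    have e : δ * (p - (c / 2) * (1 / δ) * (C * d)) ^ 2
      = δ * p ^ 2 - C * (c * d * p) + c ^ 2 * (1 / 4) * (C ^ 2 * (1 / δ * d ^ 2)) := by
      field_simp; ring
    linarith
  have z1 := yy p₃ 2
  have z2 := yy p₄ 1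
  have z5 : 0 ≤ C ^ 2 * (1 / δ * d ^ 2) := by positivity
  linarith

/-- The localized enstrophy estimate at a fixed time. -/
lemma vortRate_bound (hε : 0 < ε) (hε1 : ε ≤ 1) {ν : ℝ} (hν : 0 < ν)
    (hK0 : 0 ≤ K) (hK : ∀ q : ℝ², 0 < q.1 → q.1 < ρ → |(R * β) s q| ≤ K * q.1 ^ (ε - 1))
    (hD0 : 0 ≤ D) (hD : ∀ q : ℝ², 0 < q.1 → q.1 < ρ → q.1 * |(R * β) s q| ≤ D) :
    ∫ q, vortRate ν ζ h β κ s q ∂strip ρ + ν / 2 * vortDiss ρ ζ β s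
      ≤ 1000 * C ^ 2 * (1 + ν + 1 / ν) * ((K * (ρ ^ ε / ε)) ^ 2 * (d * (g + d))
        + K * (ρ ^ ε / ε) * (d * (g + d)) + D * (d * g) + (1 + D + D ^ 2) * d ^ 2) := by
  have F := B.flow
  rw [integral_vortRate B.cut.smooth F.adm_h F.adm_b F.adm_k]
  have t1 := B.stretch_bound hε hε1 hK0 hK hD0 hD le_rfl le_rfl le_rfl (δ := ν / 8) (by positivity)
  have t2 := B.transport_bound hD0 hD le_rfl le_rfl (δ := ν / 8) (by positivity)
  have t3 := B.viscous_bound hν le_rfl le_rfl (δ := 1 / 8) (by norm_num)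
  have t1' := (abs_le.1 t1).2
  have t2' := (abs_le.1 t2).2
  have t3' := mul_le_mul_of_nonneg_left (abs_le.1 t3).1 hν.le
  rw [vortDiss]
  set p₁ := nn ρ ((Z ζ * dz ξ[β]) s)
  set p₂ := nn ρ ((Z ζ * dz η[β]) s)
  set p₃ := nn ρ ((Z ζ * dr η[β]) s)
  set p₄ := nn ρ ((Z ζ * dr ξ[β]) s)
  set p₅ := nn ρ ((Z ζ * dz β) s)
  set E := ρ ^ ε / ε with hE
  have hE0 : 0 ≤ E := div_nonneg (B.width_nonneg ε) hε.le
  have hd := B.d_nonneg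
  have hg := B.g_nonneg
  have hC := B.C_pos
  have a0 : 0 ≤ C ^ 2 * ((K * E) ^ 2 * (d * (g + d))) := by positivity
  have a1 : 0 ≤ C ^ 2 * (K * E * (d * (g + d))) := by positivity
  have a2 : 0 ≤ C ^ 2 * (D * (d * g)) := by positivity
  have a3 : 0 ≤ C ^ 2 * (D * d ^ 2) := by positivity
  have a4 : 0 ≤ C ^ 2 * (D ^ 2 * d ^ 2) := by positivity
  have a5 : 0 ≤ C ^ 2 * d ^ 2 := by positivity
  have hi : 0 ≤ 1 / ν := by positivity
  have e8 : 1 / (ν / 8) = 8 * (1 / ν) := by field_simp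
  have e8' : (1 : ℝ) / (1 / 8) = 8 := by norm_num
  rw [e8] at t1' t2'
  rw [e8'] at t3'
  have q1 := sq_nonneg p₁
  have q2 := sq_nonneg p₂
  have q3 := sq_nonneg p₃
  have q4 := sq_nonneg p₄
  have q5 := sq_nonneg p₅
  have r1 := mul_nonneg hν.le q1
  have r2 := mul_nonneg hν.le q2
  have r3 := mul_nonneg hν.le q3
  have r4 := mul_nonneg hν.le q4
  have r5 := mul_nonneg hν.le q5
  have s0 := mul_nonneg hi a0
  have s1 := mul_nonneg hi a1
  have s2 := mul_nonneg hi a2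
  have s3 := mul_nonneg hi a3
  have s4 := mul_nonneg hi a4
  have s5 := mul_nonneg hi a5
  have u0 := mul_nonneg hν.le a0
  have u1 := mul_nonneg hν.le a1
  have u2 := mul_nonneg hν.le a2
  have u3 := mul_nonneg hν.le a3
  have u4 := mul_nonneg hν.le a4
  have u5 := mul_nonneg hν.le a5
  nlinarith only [t1', t2', t3', a0, a1, a2, a3, a4, a5, r1, r2, r3, r4, r5, s0, s1, s2, s3, s4, s5,
    u0, u1, u2, u3, u4, u5]

end Bounds

end

lemma lintegral_strip (ρ : ℝ) {F : ℝ² → ENNReal} (hF : Measurable F) :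
    ∫⁻ q, F q ∂strip ρ = ∫⁻ z, ∫⁻ r in Ioo 0 ρ, ofReal r * F (r, z) := by
  have hm : Measurable fun q : ℝ² => ofReal q.1 := by fun_prop
  rw [strip_eq, lintegral_withDensity_eq_lintegral_mul _ hm hF, volume_restrict_strip,
    lintegral_prod_symm _ (hm.mul hF).aemeasurable]
  rfl

lemma lintegral_strip' (ρ : ℝ) {F : ℝ² → ENNReal} (hF : Measurable F) :
    ∫⁻ q, F q ∂strip ρ = ∫⁻ r in Ioo 0 ρ, ofReal r * ∫⁻ z, F (r, z) := by
  have hm : Measurable fun q : ℝ² => ofReal q.1 := by fun_prop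
  rw [strip_eq, lintegral_withDensity_eq_lintegral_mul _ hm hF, volume_restrict_strip,
    lintegral_prod _ (hm.mul hF).aemeasurable]
  refine lintegral_congr fun r => ?_
  exact lintegral_const_mul (ofReal r) (f := fun z => F (r, z))
    (hF.comp (measurable_const.prodMk measurable_id))

lemma enorm_le_lintegral_dz {ρ : ℝ} {G : Fam} (hG : Adm ρ 1 G) (s : ℝ) {r : ℝ} (h0 : 0 ≤ r)
    (h1 : r ≤ ρ) (z : ℝ) : ‖G s (r, z)‖ₑ ≤ ∫⁻ z', ‖dz G s (r, z')‖ₑ := by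
  have hi : ∀ {F : Fam}, Adm ρ 1 F → Integrable fun z => F s (r, z) := by
    intro F hF
    obtain ⟨C, m, k1, k2, k3, k4⟩ := hF.dec
    have hm : Integrable (m s) := by simpa using (k3 s).1
    exact hm.mono' ((hF.cont s).comp (by fun_prop)).aestronglyMeasurable
      (ae_of_all _ fun z => k4 s (r, z) h0 h1)
  have hd : ∀ z, HasDerivAt (fun z => G s (r, z)) (dz G s (r, z)) z :=
    fun z => hG.sm.hasDerivAt_z s (r, z)
  have hlim := tendsto_zero_of_hasDerivAt_of_integrableOn_Iic (a := z) (fun z _ => hd z)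
    (hi hG.dz).integrableOn (hi hG).integrableOn
  have := integral_Iic_of_hasDerivAt_of_tendsto (hd z).continuousAt.continuousWithinAt
    (fun z _ => hd z) (hi hG.dz).integrableOn hlim
  rw [sub_zero] at this
  rw [← this]
  exact (enorm_integral_le_lintegral_enorm _).trans (setLIntegral_le_lintegral _ _)

lemma mul_enorm_le_lintegral_dr {ρ : ℝ} {G : Fam} (hG : Sm G) (s : ℝ) {r : ℝ} (h0 : 0 ≤ r)
    (h1 : r ≤ ρ) {z : ℝ} (hz : G s (ρ, z) = 0) :
    ofReal r * ‖G s (r, z)‖ₑ ≤ ∫⁻ r' in Ioo 0 ρ, ofReal r' * ‖dr G s (r', z)‖ₑ := by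
  have hd : ∀ r, HasDerivAt (fun r => G s (r, z)) (dr G s (r, z)) r :=
    fun r => hG.hasDerivAt_r s (r, z)
  have hc : Continuous fun r => dr G s (r, z) := (hG.dr s).continuous.comp (by fun_prop)
  have := integral_eq_sub_of_hasDerivAt (a := r) (b := ρ) (fun r _ => hd r)
    (hc.intervalIntegrable _ _)
  rw [hz, zero_sub, integral_of_le h1, integral_Ioc_eq_integral_Ioo] at this
  have e : ‖G s (r, z)‖ₑ = ‖∫ r' in Ioo r ρ, dr G s (r', z)‖ₑ := by rw [this, enorm_neg]
  rw [e]
  calc _ ≤ ofReal r * ∫⁻ r' in Ioo r ρ, ‖dr G s (r', z)‖ₑ := by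
        gcongr; exact enorm_integral_le_lintegral_enorm _
    _ = ∫⁻ r' in Ioo r ρ, ofReal r * ‖dr G s (r', z)‖ₑ :=
        (lintegral_const_mul _ hc.measurable.enorm).symm
    _ ≤ ∫⁻ r' in Ioo r ρ, ofReal r' * ‖dr G s (r', z)‖ₑ := by
        refine setLIntegral_mono' measurableSet_Ioo fun r' hr' => ?_
        gcongr; exact hr'.1.le
    _ ≤ _ := lintegral_mono_set (Ioo_subset_Ioo_left h0)

lemma lintegral_enorm_le_dr {ρ : ℝ} (hρ : 0 < ρ) {G : Fam} (hG : Sm G) (s : ℝ)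
    (hpos : ∀ q, 0 ≤ G s q) {z : ℝ} (hz : G s (ρ, z) = 0) :
    ∫⁻ r in Ioo 0 ρ, ‖G s (r, z)‖ₑ ≤ ∫⁻ r' in Ioo 0 ρ, ofReal r' * ‖dr G s (r', z)‖ₑ := by
  have hd : ∀ r, HasDerivAt (fun r => r * G s (r, z)) (1 * G s (r, z) + r * dr G s (r, z)) r :=
    fun r => (hasDerivAt_id r).mul (hG.hasDerivAt_r s (r, z))
  have hc : Continuous fun r => dr G s (r, z) := (hG.dr s).continuous.comp (by fun_prop)
  have hc0 : Continuous fun r => G s (r, z) := (hG s).continuous.comp (by fun_prop)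
  have := integral_eq_sub_of_hasDerivAt (a := 0) (b := ρ) (fun r _ => hd r)
    (((continuous_const.mul hc0).add (continuous_id.mul hc)).intervalIntegrable _ _)
  have c1 : Continuous fun r => 1 * G s (r, z) := continuous_const.mul hc0
  have c2 : Continuous fun r => r * dr G s (r, z) := continuous_id.mul hc
  rw [hz, mul_zero, zero_mul, sub_zero, intervalIntegral.integral_add (c1.intervalIntegrable _ _)
    (c2.intervalIntegrable _ _),
    integral_of_le hρ.le, integral_of_le hρ.le,
    integral_Ioc_eq_integral_Ioo, integral_Ioc_eq_integral_Ioo] at this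
  simp only [one_mul] at this
  have hi : IntegrableOn (fun r => G s (r, z)) (Ioo 0 ρ) :=
    (hc0.integrableOn_Icc (a := 0) (b := ρ)).mono_set Ioo_subset_Icc_self
  rw [← ofReal_integral_norm_eq_lintegral_enorm hi]
  have e1 : ∫ r in Ioo 0 ρ, ‖G s (r, z)‖ = ∫ r in Ioo 0 ρ, G s (r, z) :=
    integral_congr_ae (ae_of_all _ fun r => norm_of_nonneg (hpos _))
  have e2 : ∫ r in Ioo 0 ρ, G s (r, z) = -∫ r in Ioo 0 ρ, r * dr G s (r, z) := by linarith
  rw [e1, e2]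
  refine (ofReal_le_ofReal (neg_le_abs _)).trans ?_
  rw [← norm_eq_abs, ofReal_norm]
  refine (enorm_integral_le_lintegral_enorm _).trans
    (setLIntegral_mono' measurableSet_Ioo fun r hr => ?_)
  rw [enorm_mul, enorm_of_nonneg hr.1.le]

lemma eLpNorm_two_sq {α F : Type*} [MeasurableSpace α] [TopologicalSpace F] [ContinuousENorm F] {μ : Measure α}
    (f : α → F) : eLpNorm f 2 μ ^ 2 = ∫⁻ x, ‖f x‖ₑ ^ 2 ∂μ := by
  have := eLpNorm_nnreal_pow_eq_lintegral (f := f) (μ := μ) (p := 2) (by norm_num)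
  norm_num at this
  exact_mod_cast this

lemma sq_rpow_half (x : ENNReal) : (x ^ 2) ^ (1 / 2 : ℝ) = x := by
  rw [← rpow_natCast, ← rpow_mul, Nat.cast_ofNat, mul_one_div_cancel two_ne_zero, ENNReal.rpow_one]

lemma rpow_half_sq (x : ENNReal) : (x ^ (1 / 2 : ℝ)) ^ 2 = x := by
  rw [← rpow_natCast, ← rpow_mul, Nat.cast_ofNat, one_div_mul_cancel two_ne_zero, ENNReal.rpow_one]

lemma le_rpow_half {x y : ENNReal} (h : x ^ 2 ≤ y) : x ≤ y ^ (1 / 2 : ℝ) := by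
  rw [← sq_rpow_half x]; exact rpow_le_rpow h (by norm_num)

lemma lintegral_mul_le_sqrt {α : Type*} [MeasurableSpace α] {μ : Measure α} {f g : α → ENNReal}
    (hf : AEMeasurable f μ) (hg : AEMeasurable g μ) :
    ∫⁻ x, f x * g x ∂μ ≤ (∫⁻ x, f x ^ 2 ∂μ) ^ (1 / 2 : ℝ) * (∫⁻ x, g x ^ 2 ∂μ) ^ (1 / 2 : ℝ) := by
  have := lintegral_mul_le_Lp_mul_Lq μ (p := 2) (q := 2) (by constructor <;> norm_num) hf hg
  simpa using this

lemma real_enorm_sq (x : ℝ) : ‖x‖ₑ ^ 2 = ofReal (x ^ 2) := by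
  rw [← ofReal_norm, ← ofReal_pow (norm_nonneg _), norm_eq_abs, sq_abs]

lemma sobolev_aux {J N : ENNReal} (hJ : J ≠ ⊤)
    (h : J ≤ (4 * (J ^ (1 / 2 : ℝ) * N)) ^ (1 / 2 : ℝ) * (4 * (J ^ (1 / 2 : ℝ) * N))) :
    J ^ (1 / 6 : ℝ) ≤ 4 * N := by
  set K := J ^ (1 / 2 : ℝ) with hK
  have e : J = K ^ 2 := (rpow_half_sq J).symm
  rcases eq_or_ne K 0 with h0 | h0
  · rw [e, h0]; simp
  have hKt : K ≠ ⊤ := ENNReal.rpow_ne_top_of_nonneg (by norm_num) hJ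
  have h1 : K ^ 3 * K ≤ K ^ 3 * (4 * N) ^ 3 := by
    calc K ^ 3 * K = J ^ 2 := by rw [e]; ring
      _ ≤ ((4 * (K * N)) ^ (1 / 2 : ℝ)) ^ 2 * (4 * (K * N)) ^ 2 :=
          (pow_le_pow_left' h 2).trans_eq (mul_pow _ _ 2)
      _ = _ := by rw [rpow_half_sq]; ring
  have h2 : K ≤ (4 * N) ^ 3 :=
    (ENNReal.mul_le_mul_iff_right (pow_ne_zero 3 h0) (ENNReal.pow_ne_top hKt)).1 h1
  calc J ^ (1 / 6 : ℝ) = K ^ (1 / 3 : ℝ) := by rw [hK, ← rpow_mul]; norm_num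
    _ ≤ ((4 * N) ^ 3) ^ (1 / 3 : ℝ) := rpow_le_rpow h2 (by norm_num)
    _ = _ := by rw [← rpow_natCast, ← rpow_mul]; norm_num

/-- The Sobolev inequality in cylindrical coordinates. -/
lemma sobolev {ρ : ℝ} (hρ : 0 < ρ) {f : Fam} (hf : Adm ρ 2 f) (h0 : ∀ s z, f s (ρ, z) = 0) (s : ℝ)
    {N : ENNReal} (hr : eLpNorm (dr f s) 2 (strip ρ) ≤ N) (hz : eLpNorm (dz f s) 2 (strip ρ) ≤ N) :
    eLpNorm (f s) 6 (strip ρ) ≤ 4 * N := by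
  set G : Fam := f ^ 2 * f ^ 2 with hG
  have aG : Adm ρ 1 G := hf.sq2.mul hf.sq2
  have aJ : Adm ρ 1 (f * f ^ 2 * (f * f ^ 2)) := (hf.mul2 hf.sq2).mul (hf.mul2 hf.sq2)
  have hmf : Measurable (f s) := (hf.cont s).measurable
  set J : ENNReal := ∫⁻ q, ‖f s q‖ₑ ^ 6 ∂strip ρ with hJ
  have hJt : J ≠ ⊤ := by
    have := (aJ.integrable s).2.ne
    convert this using 3 with q
    rw [← enorm_pow]; congr 1
    simp only [Pi.mul_apply, Pi.pow_apply]; ring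
  have hX : eLpNorm (f s) 6 (strip ρ) = J ^ (1 / 6 : ℝ) := by
    rw [eLpNorm_eq_lintegral_rpow_enorm_toReal (by norm_num) (by norm_num), hJ]
    norm_num
  have hold : ∀ k : ℝ² → ℝ, Measurable k → eLpNorm k 2 (strip ρ) ≤ N →
      ∫⁻ q, ‖4 * f s q ^ 3 * k q‖ₑ ∂strip ρ ≤ 4 * (J ^ (1 / 2 : ℝ) * N) := by
    intro k hk hN
    calc _ = 4 * ∫⁻ q, ‖f s q ^ 3‖ₑ * ‖k q‖ₑ ∂strip ρ := by
          rw [← lintegral_const_mul' _ _ (by norm_num)]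
          refine lintegral_congr fun q => ?_
          rw [mul_assoc, enorm_mul, enorm_mul, enorm_of_nonneg (by norm_num)]; norm_num
      _ ≤ _ := mul_le_mul_right ((lintegral_mul_le_sqrt (hmf.pow_const 3).enorm.aemeasurable
          hk.enorm.aemeasurable).trans (mul_le_mul' (by simp only [hJ, enorm_pow, ← pow_mul]; rfl)
            (by rwa [← eLpNorm_two_sq, sq_rpow_half]))) 4
  have hGr : dr G = 4 * f ^ 3 * dr f := by
    rw [hG, dr_mul hf.sm.sq hf.sm.sq, dr_sq hf.sm]; ring
  have hGz : dz G = 4 * f ^ 3 * dz f := by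
    rw [hG, dz_mul hf.sm.sq hf.sm.sq, dz_sq hf.sm]; ring
  set A : ℝ → ENNReal := fun r => ∫⁻ z, ‖dz G s (r, z)‖ₑ with hA
  set B : ℝ → ENNReal := fun z => ∫⁻ r in Ioo 0 ρ, ofReal r * ‖dr G s (r, z)‖ₑ with hB
  have mz : Measurable fun q => ‖dz G s q‖ₑ := (aG.dz.cont s).measurable.enorm
  have mr : Measurable fun q => ‖dr G s q‖ₑ := (aG.dr.cont s).measurable.enorm
  have hAm : Measurable A := mz.lintegral_prod_right'
  have hAi : ∫⁻ r in Ioo 0 ρ, ofReal r * A r ≤ 4 * (J ^ (1 / 2 : ℝ) * N) := by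
    rw [hA, ← lintegral_strip' ρ mz, hGz]
    exact hold _ (hf.dz.cont s).measurable hz
  have hBi : ∫⁻ z, B z ≤ 4 * (J ^ (1 / 2 : ℝ) * N) := by
    rw [hB, ← lintegral_strip ρ mr, hGr]
    exact hold _ (hf.dr.cont s).measurable hr
  have hGpos : ∀ q, 0 ≤ G s q := fun q => by
    simp only [hG, Pi.mul_apply, Pi.pow_apply]; positivity
  have hG0 : ∀ z, G s (ρ, z) = 0 := fun z => by simp [hG, h0]
  have hGe : ∀ q, ‖G s q‖ₑ = ‖f s q‖ₑ ^ 4 := fun q => by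
    rw [← enorm_pow]; congr 1; simp only [hG, Pi.mul_apply, Pi.pow_apply]; ring
  have hmain : J ≤ (4 * (J ^ (1 / 2 : ℝ) * N)) ^ (1 / 2 : ℝ) * (4 * (J ^ (1 / 2 : ℝ) * N)) := by
    calc J = ∫⁻ z, ∫⁻ r in Ioo 0 ρ, ofReal r * ‖f s (r, z)‖ₑ ^ 6 :=
          lintegral_strip ρ (hmf.enorm.pow_const 6)
      _ ≤ ∫⁻ z, (∫⁻ r in Ioo 0 ρ, ofReal r * A r) ^ (1 / 2 : ℝ) * B z := by
          refine lintegral_mono fun z => ?_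
          have hfz : Measurable fun r => ‖f s (r, z)‖ₑ :=
            (hmf.comp (measurable_id.prodMk measurable_const)).enorm
          have mo : Measurable fun r : ℝ => ofReal r := by fun_prop
          have h2 : ∫⁻ r in Ioo 0 ρ, ofReal r * ‖f s (r, z)‖ₑ ^ 6 ≤ ∫⁻ r in Ioo 0 ρ,
              (ofReal r * A r) ^ (1 / 2 : ℝ) * (ofReal r * ‖f s (r, z)‖ₑ ^ 8) ^ (1 / 2 : ℝ) := by
            refine setLIntegral_mono' measurableSet_Ioo fun r hr => ?_
            have h3 := enorm_le_lintegral_dz aG s hr.1.le hr.2.le z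
            rw [hGe] at h3
            rw [← ENNReal.mul_rpow_of_nonneg _ _ (by norm_num)]
            refine le_rpow_half ?_
            calc (ofReal r * ‖f s (r, z)‖ₑ ^ 6) ^ 2
                = ofReal r * ‖f s (r, z)‖ₑ ^ 4 * (ofReal r * ‖f s (r, z)‖ₑ ^ 8) := by ring
              _ ≤ _ := by gcongr
          refine h2.trans ((lintegral_mul_le_sqrt ((mo.mul hAm).pow_const _).aemeasurable
            ((mo.mul (hfz.pow_const 8)).pow_const _).aemeasurable).trans ?_)
          simp only [rpow_half_sq]
          refine mul_le_mul_right ?_ _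
          rw [← sq_rpow_half (B z), pow_two]
          refine rpow_le_rpow ?_ (by norm_num)
          calc ∫⁻ r in Ioo 0 ρ, ofReal r * ‖f s (r, z)‖ₑ ^ 8 ≤ ∫⁻ r in Ioo 0 ρ, B z * ‖f s (r, z)‖ₑ ^ 4 := by
                refine setLIntegral_mono' measurableSet_Ioo fun r hr => ?_
                have h5 := mul_enorm_le_lintegral_dr aG.sm s hr.1.le hr.2.le (hG0 z)
                rw [hGe] at h5
                calc _ = ofReal r * ‖f s (r, z)‖ₑ ^ 4 * ‖f s (r, z)‖ₑ ^ 4 := by ring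
                  _ ≤ _ := by gcongr
            _ = B z * ∫⁻ r in Ioo 0 ρ, ‖f s (r, z)‖ₑ ^ 4 :=
                lintegral_const_mul _ (hfz.pow_const 4)
            _ ≤ _ := by
                have h6 := lintegral_enorm_le_dr hρ aG.sm s hGpos (hG0 z)
                simp only [hGe] at h6
                exact mul_le_mul_right h6 _
      _ = (∫⁻ r in Ioo 0 ρ, ofReal r * A r) ^ (1 / 2 : ℝ) * ∫⁻ z, B z := by
          refine lintegral_const_mul _ ?_
          have mo : Measurable fun q : ℝ² => ofReal q.1 := by fun_prop
          exact (mo.mul mr).lintegral_prod_left'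
      _ ≤ _ := mul_le_mul' (rpow_le_rpow hAi (by norm_num)) hBi
  rw [hX]
  exact sobolev_aux hJt hmain

section

/-- Restriction of a time dependent function on space to the half-plane `φ = 0`. -/
def onPlane (g : ℝ → E3 → ℝ) : Fam := fun s q => g s (pt q)

lemma pt_eq (q : ℝ²) : pt q = q.1 • single (0 : Fin 3) (1 : ℝ) + q.2 • single 2 1 := by
  ext i; fin_cases i <;> simp [pt]

lemma contDiff_pt : 𝒞 pt := by
  have : pt = fun q : ℝ² => q.1 • single (0 : Fin 3) (1 : ℝ) + q.2 • single 2 1 :=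
    funext pt_eq
  rw [this]
  exact (contDiff_fst.smul contDiff_const).add (contDiff_snd.smul contDiff_const)

lemma hasDerivAt_pt_r (r z : ℝ) :
    HasDerivAt (fun r => pt (r, z)) (single (0 : Fin 3) (1 : ℝ)) r := by
  have : (fun r => pt (r, z)) = fun r : ℝ => r • single (0 : Fin 3) (1 : ℝ) + z • single 2 1 :=
    funext fun r => pt_eq (r, z)
  rw [this]
  simpa using ((hasDerivAt_id r).smul_const (single (0 : Fin 3) (1 : ℝ))).add_const
    (z • single (2 : Fin 3) (1 : ℝ))

lemma hasDerivAt_pt_z (r z : ℝ) :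
    HasDerivAt (fun z => pt (r, z)) (single (2 : Fin 3) (1 : ℝ)) z := by
  have : (fun z => pt (r, z)) = fun z : ℝ => r • single (0 : Fin 3) (1 : ℝ) + z • single 2 1 :=
    funext fun z => pt_eq (r, z)
  rw [this]
  simpa using ((hasDerivAt_id z).smul_const (single (2 : Fin 3) (1 : ℝ))).const_add
    (r • single (0 : Fin 3) (1 : ℝ))

lemma Sm.onPlane {g : ℝ → E3 → ℝ} (hg : ∀ s, 𝒞 (g s)) : Sm (onPlane g) :=
  fun s => (hg s).comp contDiff_pt

lemma hasDerivAt_line {g : E3 → ℝ} (hg : Differentiable ℝ g) (j : Fin 3) (x : E3) (c : ℝ) :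
    HasDerivAt (fun c => g (x + c • single j 1)) (pd j g (x + c • single j 1)) c := by
  have h : HasDerivAt (fun c : ℝ => x + c • single j (1 : ℝ)) (single j (1 : ℝ)) c := by
    simpa using ((hasDerivAt_id c).smul_const (single j (1 : ℝ))).const_add x
  exact (hg _).hasFDerivAt.comp_hasDerivAt c h

lemma dr_onPlane {g : ℝ → E3 → ℝ} (hg : ∀ s, 𝒞 (g s)) :
    dr (onPlane g) = onPlane fun s => pd 0 (g s) := by
  funext s q
  exact (((hg s).differentiable (by simp) (pt q)).hasFDerivAt.comp_hasDerivAt q.1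
    (hasDerivAt_pt_r q.1 q.2)).deriv

lemma dz_onPlane {g : ℝ → E3 → ℝ} (hg : ∀ s, 𝒞 (g s)) :
    dz (onPlane g) = onPlane fun s => pd 2 (g s) := by
  funext s q
  exact (((hg s).differentiable (by simp) (pt q)).hasFDerivAt.comp_hasDerivAt q.2
    (hasDerivAt_pt_z q.1 q.2)).deriv

lemma contDiff_pd {g : E3 → ℝ} (hg : 𝒞 g) (j : Fin 3) : 𝒞 (pd j g) :=
  (hg.fderiv_right (m := ∞) (by simp)).clm_apply contDiff_const

lemma contDiff_coord {W : E3 → E3} (hW : 𝒞 W) (i : Fin 3) : 𝒞 fun x => W x i :=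
  (proj i : E3 →L[ℝ] ℝ).contDiff.comp hW

lemma pd_sub {g k : E3 → ℝ} (hg : Differentiable ℝ g) (hk : Differentiable ℝ k) (j : Fin 3)
    (x : E3) : pd j (fun x => g x - k x) x = pd j g x - pd j k x := by
  have : (fun x => g x - k x) = g - k := rfl
  rw [pd, this, fderiv_sub (hg x) (hk x)]; rfl

lemma differentiable_coord (i : Fin 3) : Differentiable ℝ fun x : E3 => x i :=
  (proj i : E3 →L[ℝ] ℝ).differentiable

lemma pd_coord_mul {k : E3 → ℝ} (hk : Differentiable ℝ k) (i j : Fin 3)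
    (x : E3) : pd j (fun x => x i * k x) x = (if i = j then 1 else 0) * k x + x i * pd j k x := by
  have h1 : HasFDerivAt (fun x : E3 => x i) (proj i : E3 →L[ℝ] ℝ) x :=
    (proj i : E3 →L[ℝ] ℝ).hasFDerivAt
  rw [pd, (h1.fun_mul (hk x).hasFDerivAt).fderiv]
  simp [pd]
  split_ifs <;> ring

lemma rotZ_pi (q : ℝ²) : rotZ Real.pi (pt q) = pt (-q.1, q.2) := by
  ext i; fin_cases i <;> simp [rotZ, pt]

lemma hasDerivAt_rotZ (x : E3) : HasDerivAt (fun θ => rotZ θ x) (x 0 • single (1 : Fin 3) (1 : ℝ)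
      - x 1 • single 0 1) 0 := by
  have e : (fun θ => rotZ θ x) = fun θ : ℝ =>
      (cos θ * x 0 - sin θ * x 1) • single (0 : Fin 3) (1 : ℝ)
      + (sin θ * x 0 + cos θ * x 1) • single (1 : Fin 3) (1 : ℝ)
      + x 2 • single (2 : Fin 3) (1 : ℝ) := by
    funext θ; ext i; fin_cases i <;> simp [rotZ]
  rw [e]
  have h1 := ((Real.hasDerivAt_cos 0).mul_const (x 0)).fun_sub
    ((Real.hasDerivAt_sin 0).mul_const (x 1))
  have h2 := ((Real.hasDerivAt_sin 0).mul_const (x 0)).fun_add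
    ((Real.hasDerivAt_cos 0).mul_const (x 1))
  have h3 := ((h1.smul_const (single (0 : Fin 3) (1 : ℝ))).fun_add
    (h2.smul_const (single (1 : Fin 3) (1 : ℝ)))).add_const
    (x 2 • single (2 : Fin 3) (1 : ℝ))
  refine h3.congr_deriv ?_
  simp
  rw [sub_eq_add_neg, add_comm]

/-- The infinitesimal rotation applied to a scalar function. -/
lemma hasDerivAt_comp_rotZ {g : E3 → ℝ} (hg : Differentiable ℝ g) (x : E3) :
    HasDerivAt (fun θ => g (rotZ θ x)) (x 0 * pd 1 g x - x 1 * pd 0 g x) 0 := by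
  have h0 : rotZ 0 x = x := by ext i; fin_cases i <;> simp [rotZ]
  have h1 := (hg (rotZ 0 x)).hasFDerivAt.comp_hasDerivAt (0 : ℝ) (hasDerivAt_rotZ x)
  rw [h0] at h1
  refine h1.congr_deriv ?_
  simp [pd, map_sub]

lemma AxisymScal.rot {g : E3 → ℝ} (hg : Differentiable ℝ g) (h : AxisymScal g) (x : E3) :
    x 0 * pd 1 g x - x 1 * pd 0 g x = 0 := by
  have h1 := hasDerivAt_comp_rotZ hg x
  have e : (fun θ => g (rotZ θ x)) = fun _ => g x := funext fun θ => h θ x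
  rw [e] at h1
  exact h1.unique (hasDerivAt_const _ _)

section

variable {W : E3 → E3} (hW : ∀ i, Differentiable ℝ fun x => W x i) (h : AxisymVec W)
include hW h

lemma AxisymVec.rot_zero (x : E3) :
    x 0 * pd 1 (fun y => W y 0) x - x 1 * pd 0 (fun y => W y 0) x = -W x 1 := by
  have h1 := hasDerivAt_comp_rotZ (hW 0) x
  have e : (fun θ => W (rotZ θ x) 0) = fun θ => cos θ * W x 0 - sin θ * W x 1 := by
    funext θ; rw [h θ x]; simp [rotZ]
  rw [e] at h1
  have h2 := ((Real.hasDerivAt_cos 0).mul_const (W x 0)).fun_sub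
    ((Real.hasDerivAt_sin 0).mul_const (W x 1))
  rw [h1.unique h2]; simp

lemma AxisymVec.rot_one (x : E3) :
    x 0 * pd 1 (fun y => W y 1) x - x 1 * pd 0 (fun y => W y 1) x = W x 0 := by
  have h1 := hasDerivAt_comp_rotZ (hW 1) x
  have e : (fun θ => W (rotZ θ x) 1) = fun θ => sin θ * W x 0 + cos θ * W x 1 := by
    funext θ; rw [h θ x]; simp [rotZ]
  rw [e] at h1
  have h2 := ((Real.hasDerivAt_sin 0).mul_const (W x 0)).fun_add
    ((Real.hasDerivAt_cos 0).mul_const (W x 1))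
  rw [h1.unique h2]; simp

lemma AxisymVec.rot_two (x : E3) :
    x 0 * pd 1 (fun y => W y 2) x - x 1 * pd 0 (fun y => W y 2) x = 0 := by
  have h1 := hasDerivAt_comp_rotZ (hW 2) x
  have e : (fun θ => W (rotZ θ x) 2) = fun θ => W x 2 := by
    funext θ; rw [h θ x]; simp [rotZ]
  rw [e] at h1
  exact h1.unique (hasDerivAt_const _ _)

end

/-- The second derivative in the angular direction on the half-plane. -/
lemma pd_one_one {g k : E3 → ℝ} (hg : 𝒞 g)
    (h : ∀ x : E3, x 0 * pd 1 g x - x 1 * pd 0 g x = k x) (q : ℝ²) :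
    q.1 * pd 1 (pd 1 g) (pt q) - pd 0 g (pt q) = pd 1 k (pt q) := by
  have d0 := (contDiff_pd hg 0).differentiable (by simp)
  have d1 := (contDiff_pd hg 1).differentiable (by simp)
  have e : k = fun x => x 0 * pd 1 g x - x 1 * pd 0 g x := funext fun x => (h x).symm
  rw [e, pd_sub (g := fun x => x 0 * pd 1 g x) (k := fun x => x 1 * pd 0 g x)
    ((differentiable_coord 0).mul d1) ((differentiable_coord 1).mul d0),
    pd_coord_mul d1, pd_coord_mul d0]
  simp [pt]

/-- A smooth axially symmetric field at each time. -/
structure AxiField (V : ℝ → E3 → E3) : Prop where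
  smooth : ∀ s, 𝒞 (V s)
  axi : ∀ s, AxisymVec (V s)

namespace AxiField

variable {V : ℝ → E3 → E3} (H : AxiField V)
include H

lemma coord (i : Fin 3) (s : ℝ) : 𝒞 fun x => V s x i := contDiff_coord (H.smooth s) i

lemma diff (s : ℝ) (i : Fin 3) : Differentiable ℝ fun x => V s x i :=
  (H.coord i s).differentiable (by simp)

lemma sm_R : Sm (compR V) := Sm.onPlane (H.coord 0)
lemma sm_Phi : Sm (compPhi V) := Sm.onPlane (H.coord 1)
lemma sm_Z : Sm (compZ V) := Sm.onPlane (H.coord 2)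

lemma dr_R : dr (compR V) = onPlane fun s => pd 0 fun x => V s x 0 := dr_onPlane (H.coord 0)
lemma dr_Phi : dr (compPhi V) = onPlane fun s => pd 0 fun x => V s x 1 := dr_onPlane (H.coord 1)
lemma dr_Z : dr (compZ V) = onPlane fun s => pd 0 fun x => V s x 2 := dr_onPlane (H.coord 2)
lemma dz_R : dz (compR V) = onPlane fun s => pd 2 fun x => V s x 0 := dz_onPlane (H.coord 0)
lemma dz_Phi : dz (compPhi V) = onPlane fun s => pd 2 fun x => V s x 1 := dz_onPlane (H.coord 1)
lemma dz_Z : dz (compZ V) = onPlane fun s => pd 2 fun x => V s x 2 := dz_onPlane (H.coord 2)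

lemma odd_R (s r z : ℝ) : compR V s (-r, z) = -compR V s (r, z) := by
  have := congrArg (fun x : E3 => x 0) (H.axi s Real.pi (pt (r, z)))
  rw [rotZ_pi] at this
  simpa [compR, rotZ] using this

lemma odd_Phi (s r z : ℝ) : compPhi V s (-r, z) = -compPhi V s (r, z) := by
  have := congrArg (fun x : E3 => x 1) (H.axi s Real.pi (pt (r, z)))
  rw [rotZ_pi] at this
  simpa [compPhi, rotZ] using this

lemma even_Z (s r z : ℝ) : compZ V s (-r, z) = compZ V s (r, z) := by
  have := congrArg (fun x : E3 => x 2) (H.axi s Real.pi (pt (r, z)))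
  rw [rotZ_pi] at this
  simpa [compZ, rotZ] using this

lemma pd_one_R (s : ℝ) (q : ℝ²) : q.1 * pd 1 (fun x => V s x 0) (pt q) = -compPhi V s q := by
  simpa [pt, compPhi] using (H.axi s).rot_zero (H.diff s) (pt q)

lemma pd_one_Phi (s : ℝ) (q : ℝ²) : q.1 * pd 1 (fun x => V s x 1) (pt q) = compR V s q := by
  simpa [pt, compR] using (H.axi s).rot_one (H.diff s) (pt q)

lemma pd_one_Z (s : ℝ) (q : ℝ²) : q.1 * pd 1 (fun x => V s x 2) (pt q) = 0 := by
  simpa [pt] using (H.axi s).rot_two (H.diff s) (pt q)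

lemma pd_one_one_R (s : ℝ) (q : ℝ²) : q.1 * pd 1 (pd 1 fun x => V s x 0) (pt q)
    = pd 0 (fun x => V s x 0) (pt q) - pd 1 (fun x => V s x 1) (pt q) := by
  have := pd_one_one (H.coord 0 s) ((H.axi s).rot_zero (H.diff s)) q
  have e : pd 1 (fun x => -V s x 1) (pt q) = -pd 1 (fun x => V s x 1) (pt q) := by
    rw [pd, fderiv_fun_neg]; rfl
  rw [e] at this
  linarith

lemma pd_one_one_Phi (s : ℝ) (q : ℝ²) : q.1 * pd 1 (pd 1 fun x => V s x 1) (pt q)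
    = pd 0 (fun x => V s x 1) (pt q) + pd 1 (fun x => V s x 0) (pt q) := by
  have := pd_one_one (H.coord 1 s) ((H.axi s).rot_one (H.diff s)) q
  linarith

lemma pd_one_one_Z (s : ℝ) (q : ℝ²) : q.1 * pd 1 (pd 1 fun x => V s x 2) (pt q)
    = pd 0 (fun x => V s x 2) (pt q) := by
  have := pd_one_one (H.coord 2 s) ((H.axi s).rot_two (H.diff s)) q
  have e : pd 1 (fun _ : E3 => (0 : ℝ)) (pt q) = 0 := by simp [pd]
  rw [e] at this
  linarith

lemma rot_R {s : ℝ} {q : ℝ²} (hq : q.1 ≠ 0) : compR (rot V) s q = -dz (compPhi V) s q := by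
  have h := H.pd_one_Z s q
  have h' : pd 1 (fun x => V s x 2) (pt q) = 0 := by
    rcases mul_eq_zero.1 h with h | h
    · exact absurd h hq
    · exact h
  rw [H.dz_Phi]
  simp [compR, AxiNS.rot, curl, onPlane, h']

lemma rot_Phi (s : ℝ) (q : ℝ²) : compPhi (rot V) s q = dz (compR V) s q - dr (compZ V) s q := by
  rw [H.dz_R, H.dr_Z]
  simp [compPhi, AxiNS.rot, curl, onPlane]

lemma rot_Z {s : ℝ} {q : ℝ²} (hq : q.1 ≠ 0) :
    compZ (rot V) s q = dr (compPhi V) s q + compPhi V s q / q.1 := by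
  have h := H.pd_one_R s q
  have h' : pd 1 (fun x => V s x 0) (pt q) = -compPhi V s q / q.1 := by
    rw [eq_div_iff hq]; linarith
  rw [H.dr_Phi]
  simp [compZ, AxiNS.rot, curl, onPlane, h']
  ring

end AxiField

end

section

/-! ### Integration over space -/

lemma lintegral_space {F : E3 → ENNReal} (hF : Measurable F) :
    ∫⁻ x, F x = ∫⁻ z : ℝ, ∫⁻ p : ℝ², F !₂[p.1, p.2, z] := by
  rw [← (PiLp.volume_preserving_toLp (Fin 3)).lintegral_comp hF]
  have h1 := (volume_preserving_piFinSuccAbove (fun _ : Fin 3 => ℝ) 2).symm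
  have hF' : Measurable fun y : Fin 3 → ℝ => F (WithLp.toLp 2 y) :=
    hF.comp (PiLp.volume_preserving_toLp (Fin 3)).measurable
  rw [← h1.lintegral_comp hF', volume_eq_prod]
  have h0 : Measurable fun y : ℝ × (Fin 2 → ℝ) => F (WithLp.toLp 2
      ((MeasurableEquiv.piFinSuccAbove (fun _ : Fin 3 => ℝ) 2).symm y)) := hF'.comp h1.measurable
  rw [lintegral_prod _ h0.aemeasurable]
  refine lintegral_congr fun z => ?_
  have h2 := (volume_preserving_finTwoArrow ℝ).symm
  have h3 : Measurable fun y : Fin 2 → ℝ => F (WithLp.toLp 2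
      ((MeasurableEquiv.piFinSuccAbove (fun _ : Fin 3 => ℝ) 2).symm (z, y))) :=
    (hF'.comp h1.measurable).comp (measurable_const.prodMk measurable_id)
  rw [← h2.lintegral_comp h3]
  refine lintegral_congr fun p => ?_
  congr 1
  ext i
  fin_cases i <;> rfl

lemma measurable_toSpace (z : ℝ) : Measurable fun p : ℝ² => (!₂[p.1, p.2, z] : E3) := by
  refine (PiLp.volume_preserving_toLp (Fin 3)).measurable.comp (measurable_pi_iff.2 fun i => ?_)
  fin_cases i
  · exact measurable_fst
  · exact measurable_snd
  · exact measurable_const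

lemma measurable_pt : Measurable pt := contDiff_pt.continuous.measurable

lemma lintegral_cyl {F : ℝ² → ENNReal} (hF : Measurable F) :
    ∫⁻ q, F q ∂cyl = ∫⁻ z, ∫⁻ r in Ioi 0, ofReal r * F (r, z) := by
  have hm : Measurable fun q : ℝ² => ofReal q.1 := by fun_prop
  have e : (volume : Measure (ℝ²)).restrict ℝ²₊
      = ((volume : Measure ℝ).restrict (Ioi 0)).prod (volume : Measure ℝ) := by
    rw [volume_eq_prod, ← prod_restrict, restrict_univ]
  rw [cyl, lintegral_withDensity_eq_lintegral_mul _ hm hF, e,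
    lintegral_prod_symm _ (hm.mul hF).aemeasurable]
  rfl

lemma lintegral_space_eq_cyl {F : E3 → ENNReal} (hF : Measurable F) (h : ∀ θ x, F (rotZ θ x) = F x) :
    ∫⁻ x, F x = ofReal (2 * Real.pi) * ∫⁻ q, F (pt q) ∂cyl := by
  have hpt : Measurable fun q : ℝ² => F (pt q) := hF.comp measurable_pt
  rw [lintegral_space hF, lintegral_cyl hpt]
  have hm : Measurable fun q : ℝ² => ofReal q.1 := by fun_prop
  rw [← lintegral_const_mul _ (by
    exact (hm.mul hpt).lintegral_prod_left')]
  refine lintegral_congr fun z => ?_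
  rw [← lintegral_comp_polarCoord_symm]
  have e1 : polarCoord.target = Ioi (0 : ℝ) ×ˢ Ioo (-Real.pi) Real.pi := rfl
  have hz : Measurable fun r : ℝ => ofReal r * F (pt (r, z)) :=
    (hm.mul hpt).comp (measurable_id.prodMk measurable_const)
  have hz' : Measurable fun p : ℝ² => ofReal p.1 * F (pt (p.1, z)) := hz.comp measurable_fst
  have e2 : ∀ p : ℝ², ofReal p.1 • F !₂[(polarCoord.symm p).1, (polarCoord.symm p).2, z]
      = ofReal p.1 * F (pt (p.1, z)) := by
    intro p
    rw [smul_eq_mul, ← h p.2 (pt (p.1, z))]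
    congr 2
    ext i
    fin_cases i <;> simp [rotZ, pt, polarCoord, mul_comm]
  simp only [e2]
  rw [e1, volume_eq_prod, ← prod_restrict, lintegral_prod_symm _ hz'.aemeasurable]
  simp only [lintegral_const, MeasurableSet.univ, Measure.restrict_apply, univ_inter,
    volume_Ioo]
  rw [mul_comm]
  congr 2; ring

/-! ### Pointwise bounds by square integrals -/

lemma enorm_sq_le_lintegral {H H' : ℝ → ℝ} (hd : ∀ x, HasDerivAt H (H' x) x) (hc : Continuous H')
    (x : ℝ) : ‖H x‖ₑ ^ 2 ≤ ∫⁻ y, (2 * ‖H y‖ₑ ^ 2 + ‖H' y‖ₑ ^ 2) := by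
  have hcH : Continuous H := continuous_iff_continuousAt.2 fun x => (hd x).continuousAt
  have h1 : ∀ y, HasDerivAt (fun y => (y - (x + 1)) * H y ^ 2)
      (1 * H y ^ 2 + (y - (x + 1)) * (2 * H y * H' y)) y := by
    intro y
    have := ((hasDerivAt_id y).sub_const (x + 1)).mul ((hd y).fun_pow 2)
    refine this.congr_deriv ?_
    simp
  have h2 := integral_eq_sub_of_hasDerivAt (a := x) (b := x + 1)
    (fun y _ => h1 y) (Continuous.intervalIntegrable (by fun_prop) _ _)
  have h3 : H x ^ 2 ≤ ∫ y in x..(x + 1), (2 * H y ^ 2 + H' y ^ 2) := by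
    have : H x ^ 2 = ∫ y in x..(x + 1), (1 * H y ^ 2 + (y - (x + 1)) * (2 * H y * H' y)) := by
      rw [h2]; ring
    rw [this]
    refine intervalIntegral.integral_mono_on (by linarith)
      (Continuous.intervalIntegrable (by fun_prop) _ _)
      (Continuous.intervalIntegrable (by fun_prop) _ _) fun y hy => ?_
    have k1 : (y - (x + 1)) ^ 2 ≤ 1 := by
      rw [sq_le_one_iff_abs_le_one, abs_le]; constructor <;> linarith [hy.1, hy.2]
    have k2 := sq_nonneg ((y - (x + 1)) * H y - H' y)
    nlinarith [sq_nonneg (H y)]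
  have e : ‖H x‖ₑ ^ 2 = ofReal (H x ^ 2) := by
    rw [← enorm_pow, enorm_of_nonneg (sq_nonneg _)]
  rw [e]
  refine (ofReal_le_ofReal h3).trans ?_
  rw [integral_of_le (by linarith), ofReal_integral_eq_lintegral_ofReal
      (Continuous.integrableOn_Ioc (by fun_prop)) (ae_of_all _ fun y => by positivity)]
  refine (setLIntegral_le_lintegral _ _).trans (lintegral_mono fun y => le_of_eq ?_)
  rw [ofReal_add (by positivity) (by positivity), ofReal_mul (by norm_num),
    ← enorm_pow, ← enorm_pow, enorm_of_nonneg (sq_nonneg _),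
    enorm_of_nonneg (sq_nonneg _)]
  norm_num

/-- The sum of squares that controls a function on horizontal planes. -/
def planeSq (g : E3 → ℝ) (x : E3) : ENNReal :=
  2 * (2 * ‖g x‖ₑ ^ 2 + ‖pd 1 g x‖ₑ ^ 2) + (2 * ‖pd 0 g x‖ₑ ^ 2 + ‖pd 1 (pd 0 g) x‖ₑ ^ 2)

lemma measurable_enorm_sq {g : E3 → ℝ} (hg : 𝒞 g) : Measurable fun x => ‖g x‖ₑ ^ 2 :=
  hg.continuous.measurable.enorm.pow_const 2

lemma measurable_planeSq {g : E3 → ℝ} (hg : 𝒞 g) : Measurable (planeSq g) := by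
  have h1 := measurable_enorm_sq hg
  have h2 := measurable_enorm_sq (contDiff_pd hg 1)
  have h3 := measurable_enorm_sq (contDiff_pd hg 0)
  have h4 := measurable_enorm_sq (contDiff_pd (contDiff_pd hg 0) 1)
  exact (((h1.const_mul 2).add h2).const_mul 2).add ((h3.const_mul 2).add h4)

lemma enorm_sq_le_line {g : E3 → ℝ} (hg : 𝒞 g) (j : Fin 3) (x : E3) (c : ℝ) :
    ‖g (x + c • single j 1)‖ₑ ^ 2 ≤ ∫⁻ y : ℝ, (2 * ‖g (x + y • single j 1)‖ₑ ^ 2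
        + ‖pd j g (x + y • single j 1)‖ₑ ^ 2) := by
  refine enorm_sq_le_lintegral (H := fun y => g (x + y • single j 1))
    (hasDerivAt_line (hg.differentiable (by simp)) j x) ?_ c
  exact (contDiff_pd hg j).continuous.comp (by fun_prop)

lemma toSpace_zero (c y z : ℝ) : (!₂[c, y, z] : E3) = !₂[0, y, z] + c • single 0 1 := by
  ext i; fin_cases i <;> simp

lemma toSpace_one (x c z : ℝ) : (!₂[x, c, z] : E3) = !₂[x, 0, z] + c • single 1 1 := by
  ext i; fin_cases i <;> simp

lemma toSpace_two (x y c : ℝ) : (!₂[x, y, c] : E3) = !₂[x, y, 0] + c • single 2 1 := by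
  ext i; fin_cases i <;> simp

lemma enorm_sq_le_plane {g : E3 → ℝ} (hg : 𝒞 g) (x y z : ℝ) :
    ‖g !₂[x, y, z]‖ₑ ^ 2 ≤ ∫⁻ p : ℝ², planeSq g !₂[p.1, p.2, z] := by
  have h0 : ∀ {k : E3 → ℝ} (hk : 𝒞 k) (x : ℝ), ‖k !₂[x, y, z]‖ₑ ^ 2
      ≤ ∫⁻ y : ℝ, (2 * ‖k !₂[x, y, z]‖ₑ ^ 2 + ‖pd 1 k !₂[x, y, z]‖ₑ ^ 2) := by
    intro k hk x
    have := enorm_sq_le_line hk 1 !₂[x, 0, z] y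
    simpa only [← toSpace_one] using this
  have h1 := enorm_sq_le_line hg 0 !₂[0, y, z] x
  simp only [← toSpace_zero] at h1
  refine h1.trans ?_
  have hm : Measurable fun p : ℝ² => planeSq g !₂[p.1, p.2, z] :=
    (measurable_planeSq hg).comp (measurable_toSpace z)
  rw [volume_eq_prod, lintegral_prod _ hm.aemeasurable]
  refine lintegral_mono fun x => ?_
  have mk : ∀ {k : E3 → ℝ} (hk : 𝒞 k), Measurable fun y : ℝ =>
      2 * ‖k !₂[x, y, z]‖ₑ ^ 2 + ‖pd 1 k !₂[x, y, z]‖ₑ ^ 2 := by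
    intro k hk
    exact (((measurable_enorm_sq hk).const_mul 2).add (measurable_enorm_sq (contDiff_pd hk 1))).comp
      ((measurable_toSpace z).comp (measurable_const.prodMk measurable_id))
  have e : ∫⁻ y, planeSq g !₂[x, y, z]
      = 2 * (∫⁻ y : ℝ, (2 * ‖g !₂[x, y, z]‖ₑ ^ 2 + ‖pd 1 g !₂[x, y, z]‖ₑ ^ 2))
        + ∫⁻ y : ℝ, (2 * ‖pd 0 g !₂[x, y, z]‖ₑ ^ 2 + ‖pd 1 (pd 0 g) !₂[x, y, z]‖ₑ ^ 2) := by
    rw [← lintegral_const_mul _ (mk hg), ← lintegral_add_left ((mk hg).const_mul 2)]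
    rfl
  rw [e]
  have := h0 hg x
  have := h0 (contDiff_pd hg 0) x
  gcongr

/-- Smooth functions on space with square integrable derivatives, uniformly in time. -/
structure SobU (g : ℝ → E3 → ℝ) : Prop where
  smooth : ∀ s, 𝒞 (g s)
  bd : ∀ n : ℕ, ∃ C : ℝ≥0, ∀ s,
    eLpNorm (fun x => ‖iteratedFDeriv ℝ n (g s) x‖) 2 volume ≤ C

namespace SobU

variable {g : ℝ → E3 → ℝ} (H : SobU g)
include H

lemma pd (j : Fin 3) : SobU fun s => pd j (g s) := by
  refine ⟨fun s => contDiff_pd (H.smooth s) j, fun n => ?_⟩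
  obtain ⟨C, hC⟩ := H.bd (n + 1)
  refine ⟨C, fun s => le_trans (eLpNorm_mono fun x => ?_) (hC s)⟩
  have h1 := norm_iteratedFDeriv_clm_apply_const (𝕜 := ℝ) (f := fderiv ℝ (g s))
    (c := (single j (1 : ℝ) : E3)) (x := x) (N := ∞) (n := n)
    (((H.smooth s).fderiv_right (m := ∞) (by simp)).contDiffAt) (by exact_mod_cast le_top)
  rw [norm_norm, norm_norm]
  refine h1.trans ?_
  rw [norm_iteratedFDeriv_fderiv]
  simp

lemma lintegral_sq : ∃ C : ℝ≥0, ∀ s, ∫⁻ x, ‖g s x‖ₑ ^ 2 ≤ C := by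
  obtain ⟨C, hC⟩ := H.bd 0
  refine ⟨C ^ 2, fun s => ?_⟩
  have h1 := hC s
  simp only [norm_iteratedFDeriv_zero] at h1
  rw [eLpNorm_norm, eLpNorm_eq_lintegral_rpow_enorm_toReal (by norm_num) (by norm_num)] at h1
  have h2 := rpow_le_rpow h1 (z := 2) (by norm_num)
  rw [← rpow_mul] at h2
  norm_num at h2
  simpa using h2

lemma lintegral_planeSq : ∃ C : ℝ≥0, ∀ s, ∫⁻ x, planeSq (g s) x ≤ C := by
  obtain ⟨C₁, h1⟩ := H.lintegral_sq
  obtain ⟨C₂, h2⟩ := (H.pd 1).lintegral_sq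
  obtain ⟨C₃, h3⟩ := (H.pd 0).lintegral_sq
  obtain ⟨C₄, h4⟩ := ((H.pd 0).pd 1).lintegral_sq
  refine ⟨2 * (2 * C₁ + C₂) + (2 * C₃ + C₄), fun s => ?_⟩
  have m1 := measurable_enorm_sq (H.smooth s)
  have m2 := measurable_enorm_sq ((H.pd 1).smooth s)
  have m3 := measurable_enorm_sq ((H.pd 0).smooth s)
  have m12 : Measurable fun x => 2 * ‖g s x‖ₑ ^ 2 + ‖AxiNS.pd 1 (g s) x‖ₑ ^ 2 :=
    (m1.const_mul 2).add m2
  simp only [planeSq]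
  rw [lintegral_add_left (m12.const_mul 2), lintegral_const_mul _ m12, lintegral_add_left (m1.const_mul 2),
    lintegral_const_mul _ m1, lintegral_add_left (m3.const_mul 2), lintegral_const_mul _ m3]
  push_cast
  have := h1 s
  have := h2 s
  have := h3 s
  have := h4 s
  gcongr

/-- The uniform bound. -/
lemma bounded : ∃ C : ℝ≥0, ∀ s x, ‖g s x‖ₑ ^ 2 ≤ C := by
  obtain ⟨C₁, h1⟩ := H.lintegral_planeSq
  obtain ⟨C₂, h2⟩ := (H.pd 2).lintegral_planeSq
  refine ⟨2 * C₁ + C₂, fun s x => ?_⟩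
  have e : x = !₂[x 0, x 1, x 2] := by ext i; fin_cases i <;> rfl
  rw [e]
  have h3 := enorm_sq_le_line (H.smooth s) 2 !₂[x 0, x 1, 0] (x 2)
  simp only [← toSpace_two] at h3
  refine h3.trans ?_
  have m1 := measurable_planeSq (H.smooth s)
  have m2 := measurable_planeSq ((H.pd 2).smooth s)
  have h4 := h1 s
  have h5 := h2 s
  push_cast
  calc _ ≤ ∫⁻ z, (2 * (∫⁻ p : ℝ², planeSq (g s) !₂[p.1, p.2, z])
        + ∫⁻ p : ℝ², planeSq (AxiNS.pd 2 (g s)) !₂[p.1, p.2, z]) := by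
        refine lintegral_mono fun z => ?_
        have k1 := enorm_sq_le_plane (H.smooth s) (x 0) (x 1) z
        have k2 := enorm_sq_le_plane ((H.pd 2).smooth s) (x 0) (x 1) z
        gcongr
    _ = ∫⁻ z, ∫⁻ p : ℝ², (2 * planeSq (g s) !₂[p.1, p.2, z]
        + planeSq (AxiNS.pd 2 (g s)) !₂[p.1, p.2, z]) := by
        refine lintegral_congr fun z => ?_
        have m3 : Measurable fun p : ℝ² => planeSq (g s) !₂[p.1, p.2, z] :=
          m1.comp (measurable_toSpace z)
        rw [lintegral_add_left (m3.const_mul 2), lintegral_const_mul _ m3]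
    _ = ∫⁻ x, (2 * planeSq (g s) x + planeSq (AxiNS.pd 2 (g s)) x) :=
        (lintegral_space ((m1.const_mul 2).add m2)).symm
    _ ≤ _ := by
        rw [lintegral_add_left (m1.const_mul 2), lintegral_const_mul _ m1]
        gcongr

lemma dec (ρ : ℝ) : Dec ρ 2 (onPlane g) := by
  obtain ⟨C₁, h1⟩ := H.lintegral_planeSq
  obtain ⟨C₂, h2⟩ := H.bounded
  set S : ℝ → ℝ → ENNReal := fun s z => min (∫⁻ p : ℝ², planeSq (g s) !₂[p.1, p.2, z]) C₂ with hS
  have hSm : ∀ s, Measurable (S s) := by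
    intro s
    refine Measurable.min ?_ measurable_const
    have hm : Measurable fun y : ℝ × ℝ² => planeSq (g s) !₂[y.2.1, y.2.2, y.1] := by
      refine (measurable_planeSq (H.smooth s)).comp
        ((PiLp.volume_preserving_toLp (Fin 3)).measurable.comp (measurable_pi_iff.2 fun i => ?_))
      fin_cases i
      · exact measurable_fst.comp measurable_snd
      · exact measurable_snd.comp measurable_snd
      · exact measurable_fst
    exact hm.lintegral_prod_right'
  have hSt : ∀ s z, S s z ≠ ⊤ := fun s z => ((min_le_right _ _).trans_lt ENNReal.coe_lt_top).ne
  have hSi : ∀ s, ∫⁻ z, S s z ≤ C₁ := by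
    intro s
    refine le_trans ?_ (h1 s)
    rw [lintegral_space (measurable_planeSq (H.smooth s))]
    exact lintegral_mono fun z => min_le_left _ _
  set m : ℝ → ℝ → ℝ := fun s z => √(S s z).toReal with hm
  have hm2 : ∀ s z, m s z ^ 2 = (S s z).toReal := fun s z => sq_sqrt toReal_nonneg
  refine ⟨max (√C₂) C₁, m, fun s => (hSm s).ennreal_toReal.sqrt, fun s z => ⟨sqrt_nonneg _, ?_⟩,
    fun s => ?_, fun s q _ _ => ?_⟩
  · refine le_trans (Real.sqrt_le_sqrt ?_) (le_max_left _ _)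
    have := toReal_mono (b := (C₂ : ENNReal)) coe_ne_top (min_le_right
      (∫⁻ p : ℝ², planeSq (g s) !₂[p.1, p.2, z]) C₂)
    simpa using this
  · simp only [hm2]
    refine ⟨integrable_toReal_of_lintegral_ne_top (hSm s).aemeasurable
      ((hSi s).trans_lt ENNReal.coe_lt_top).ne, ?_⟩
    rw [integral_toReal (hSm s).aemeasurable (ae_of_all _ fun z => (hSt s z).lt_top)]
    refine le_trans ?_ (le_max_right _ _)
    simpa using toReal_mono coe_ne_top (hSi s)
  · have k1 : ‖onPlane g s q‖ₑ ^ 2 ≤ S s q.2 :=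
      le_min (enorm_sq_le_plane (H.smooth s) q.1 0 q.2) (h2 s _)
    refine Real.le_sqrt_of_sq_le ?_
    have k2 := toReal_mono (hSt s q.2) k1
    rw [ENNReal.toReal_pow, toReal_enorm] at k2
    exact k2

lemma admN (ρ : ℝ) (n : ℕ) : AdmN ρ 2 n (onPlane g) := by
  induction n generalizing g with
  | zero => exact H.dec ρ
  | succ n ih =>
    refine ⟨H.dec ρ, ?_, ?_⟩
    · rw [dr_onPlane H.smooth]; exact ih (H.pd 0)
    · rw [dz_onPlane H.smooth]; exact ih (H.pd 2)

lemma adm (ρ : ℝ) : Adm ρ 2 (onPlane g) := ⟨Sm.onPlane H.smooth, H.admN ρ⟩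

end SobU

end

/-! ### Joint smoothness in time and space -/

/-- The time derivative. -/
def dt (g : Fam) : Fam := fun s q => deriv (fun τ => g τ q) s

/-- Joint smoothness on `I × O`. -/
def JS (I : Set ℝ) (O : Set ℝ²) (g : Fam) : Prop :=
  ContDiffOn ℝ ∞ (fun y : ℝ × ℝ² => g y.1 y.2) (I ×ˢ O)

lemma isOpen_half : IsOpen ℝ²₊ := isOpen_Ioi.prod isOpen_univ

namespace JS

variable {I : Set ℝ} {O : Set ℝ²} {f g : Fam}

lemma mono {I' O'} (h : JS I O g) (hI : I' ⊆ I) (hO : O' ⊆ O) : JS I' O' g :=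
  ContDiffOn.mono h (prod_mono hI hO)

lemma congr (h : JS I O g) (e : ∀ s ∈ I, ∀ q ∈ O, f s q = g s q) : JS I O f :=
  ContDiffOn.congr h fun y hy => e y.1 hy.1 y.2 hy.2

lemma add (hf : JS I O f) (hg : JS I O g) : JS I O (f + g) := ContDiffOn.add hf hg
lemma sub (hf : JS I O f) (hg : JS I O g) : JS I O (f - g) := ContDiffOn.sub hf hg
lemma mul (hf : JS I O f) (hg : JS I O g) : JS I O (f * g) := ContDiffOn.mul hf hg
lemma neg (hf : JS I O f) : JS I O (-f) := ContDiffOn.neg hf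
lemma smul (hf : JS I O f) (c : ℝ) : JS I O (c • f) := ContDiffOn.const_smul c hf

lemma sq (hf : JS I O f) : JS I O (f ^ 2) := ContDiffOn.pow hf 2

lemma restrict {a b : ℝ} (h : JS (Icc a b) O g) : JS (Ioo a b) O g :=
  h.mono Ioo_subset_Icc_self subset_rfl

lemma onHalf (h : JS I univ g) : JS I ℝ²₊ g := h.mono subset_rfl (subset_univ _)

lemma Z {φ : ℝ → ℝ} (h : 𝒞 φ) : JS I O (Z φ) := (h.comp (contDiff_fst.comp contDiff_snd)).contDiffOn

lemma X {φ : ℝ → ℝ} (h : 𝒞 φ) : JS I O (X φ) := (h.comp (contDiff_snd.comp contDiff_snd)).contDiffOn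

lemma R : JS I O R := (contDiff_fst.comp contDiff_snd).contDiffOn

lemma continuousOn (h : JS I O g) : ContinuousOn (fun y : ℝ × ℝ² => g y.1 y.2) (I ×ˢ O) :=
  ContDiffOn.continuousOn h

lemma continuousOn_time (h : JS I O g) {q : ℝ²} (hq : q ∈ O) : ContinuousOn (fun s => g s q) I :=
  h.continuousOn.comp (f := fun s => (s, q)) (by fun_prop) fun s hs => ⟨hs, hq⟩

lemma of_R_mul (h : JS I univ (AxiNS.R * g)) : JS I ℝ²₊ g := by
  have hi : JS I ℝ²₊ fun _ q => (q.1)⁻¹ := ContDiffOn.inv R fun y hy => ne_of_gt hy.2.1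
  refine (h.onHalf.mul hi).congr fun s _ q hq => ?_
  have : q.1 ≠ 0 := ne_of_gt hq.1
  simp only [Pi.mul_apply, AxiNS.R]
  field_simp

lemma dr_eq (h : JS I O g) (hO : IsOpen O) {s : ℝ} (hs : s ∈ I) {q : ℝ²} (hq : q ∈ O) :
    AxiNS.dr g s q = fderivWithin ℝ (fun y : ℝ × ℝ² => g y.1 y.2) (I ×ˢ O) (s, q) (0, (1, 0)) := by
  have h1 := (ContDiffOn.differentiableOn h (by simp) (s, q) ⟨hs, hq⟩).hasFDerivWithinAt
  have h2 : HasDerivAt (fun r : ℝ => (s, (r, q.2))) ((0 : ℝ), ((1 : ℝ), (0 : ℝ))) q.1 :=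
    (hasDerivAt_const _ _).prodMk ((hasDerivAt_id q.1).prodMk (hasDerivAt_const _ _))
  have h3 : {r : ℝ | (r, q.2) ∈ O} ∈ nhds q.1 :=
    (hO.preimage (by fun_prop : Continuous fun r : ℝ => (r, q.2))).mem_nhds hq
  have h4 : MapsTo (fun r : ℝ => (s, (r, q.2))) {r : ℝ | (r, q.2) ∈ O} (I ×ˢ O) :=
    fun r hr => ⟨hs, hr⟩
  exact ((h1.comp_hasDerivWithinAt q.1 h2.hasDerivWithinAt h4).hasDerivAt h3).deriv

lemma dz_eq (h : JS I O g) (hO : IsOpen O) {s : ℝ} (hs : s ∈ I) {q : ℝ²} (hq : q ∈ O) :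
    AxiNS.dz g s q = fderivWithin ℝ (fun y : ℝ × ℝ² => g y.1 y.2) (I ×ˢ O) (s, q) (0, (0, 1)) := by
  have h1 := (ContDiffOn.differentiableOn h (by simp) (s, q) ⟨hs, hq⟩).hasFDerivWithinAt
  have h2 : HasDerivAt (fun z : ℝ => (s, (q.1, z))) ((0 : ℝ), ((0 : ℝ), (1 : ℝ))) q.2 :=
    (hasDerivAt_const _ _).prodMk ((hasDerivAt_const _ _).prodMk (hasDerivAt_id q.2))
  have h3 : {z : ℝ | (q.1, z) ∈ O} ∈ nhds q.2 :=
    (hO.preimage (by fun_prop : Continuous fun z : ℝ => (q.1, z))).mem_nhds hq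
  have h4 : MapsTo (fun z : ℝ => (s, (q.1, z))) {z : ℝ | (q.1, z) ∈ O} (I ×ˢ O) :=
    fun r hr => ⟨hs, hr⟩
  exact ((h1.comp_hasDerivWithinAt q.2 h2.hasDerivWithinAt h4).hasDerivAt h3).deriv

lemma hasDerivAt_t' (h : JS I O g) (hI : IsOpen I) {s : ℝ} (hs : s ∈ I) {q : ℝ²} (hq : q ∈ O) :
    HasDerivAt (fun τ => g τ q)
      (fderivWithin ℝ (fun y : ℝ × ℝ² => g y.1 y.2) (I ×ˢ O) (s, q) (1, (0, 0))) s := by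
  have h1 := (ContDiffOn.differentiableOn h (by simp) (s, q) ⟨hs, hq⟩).hasFDerivWithinAt
  have h2 : HasDerivAt (fun τ : ℝ => (τ, q)) ((1 : ℝ), ((0 : ℝ), (0 : ℝ))) s :=
    (hasDerivAt_id s).prodMk (hasDerivAt_const _ _)
  have h4 : MapsTo (fun τ : ℝ => (τ, q)) I (I ×ˢ O) := fun r hr => ⟨hr, hq⟩
  exact (h1.comp_hasDerivWithinAt s h2.hasDerivWithinAt h4).hasDerivAt (hI.mem_nhds hs)

lemma hasDerivAt_t (h : JS I O g) (hI : IsOpen I) {s : ℝ} (hs : s ∈ I) {q : ℝ²} (hq : q ∈ O) :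
    HasDerivAt (fun τ => g τ q) (dt g s q) s := by
  have := h.hasDerivAt_t' hI hs hq
  rwa [dt, this.deriv]

lemma dt_eq (h : JS I O g) (hI : IsOpen I) {s : ℝ} (hs : s ∈ I) {q : ℝ²} (hq : q ∈ O) :
    dt g s q = fderivWithin ℝ (fun y : ℝ × ℝ² => g y.1 y.2) (I ×ˢ O) (s, q) (1, (0, 0)) :=
  (h.hasDerivAt_t' hI hs hq).deriv

lemma dr (h : JS I O g) (hI : UniqueDiffOn ℝ I) (hO : IsOpen O) : JS I O (dr g) :=
  ((ContDiffOn.fderivWithin (m := ∞) h (hI.prod hO.uniqueDiffOn) (by simp)).clm_apply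
    contDiffOn_const).congr fun y hy => h.dr_eq hO hy.1 hy.2

lemma dz (h : JS I O g) (hI : UniqueDiffOn ℝ I) (hO : IsOpen O) : JS I O (dz g) :=
  ((ContDiffOn.fderivWithin (m := ∞) h (hI.prod hO.uniqueDiffOn) (by simp)).clm_apply
    contDiffOn_const).congr fun y hy => h.dz_eq hO hy.1 hy.2

lemma dt (h : JS I O g) (hI : IsOpen I) (hO : IsOpen O) : JS I O (dt g) :=
  ((ContDiffOn.fderivWithin (m := ∞) h (hI.uniqueDiffOn.prod hO.uniqueDiffOn) (by simp)).clm_apply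
    contDiffOn_const).congr fun y hy => h.dt_eq hI hy.1 hy.2

lemma fderiv_fderiv_comm (h : JS I O g) (hI : IsOpen I) (hO : IsOpen O) {s : ℝ} (hs : s ∈ I)
    {q : ℝ²} (hq : q ∈ O) (u v : ℝ × ℝ²) {G H : Fam} (hG : JS I O G) (hH : JS I O H)
    (eG : ∀ s ∈ I, ∀ q ∈ O, G s q = fderivWithin ℝ (fun y : ℝ × ℝ² => g y.1 y.2) (I ×ˢ O) (s, q) u)
    (eH : ∀ s ∈ I, ∀ q ∈ O, H s q
      = fderivWithin ℝ (fun y : ℝ × ℝ² => g y.1 y.2) (I ×ˢ O) (s, q) v) :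
    fderivWithin ℝ (fun y : ℝ × ℝ² => G y.1 y.2) (I ×ˢ O) (s, q) v
      = fderivWithin ℝ (fun y : ℝ × ℝ² => H y.1 y.2) (I ×ˢ O) (s, q) u := by
  set F : ℝ × ℝ² → ℝ := fun y => g y.1 y.2
  have hU : IsOpen (I ×ˢ O) := hI.prod hO
  have hy : (s, q) ∈ I ×ˢ O := ⟨hs, hq⟩
  have hF : ContDiffAt ℝ ∞ F (s, q) := ContDiffOn.contDiffAt h (hU.mem_nhds hy)
  rw [fderivWithin_of_isOpen hU hy, fderivWithin_of_isOpen hU hy]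
  have e1 : (fun y : ℝ × ℝ² => G y.1 y.2) =ᶠ[nhds (s, q)] fun y => fderiv ℝ F y u := by
    filter_upwards [hU.mem_nhds hy] with y hy'
    rw [eG y.1 hy'.1 y.2 hy'.2, fderivWithin_of_isOpen hU hy']
  have e2 : (fun y : ℝ × ℝ² => H y.1 y.2) =ᶠ[nhds (s, q)] fun y => fderiv ℝ F y v := by
    filter_upwards [hU.mem_nhds hy] with y hy'
    rw [eH y.1 hy'.1 y.2 hy'.2, fderivWithin_of_isOpen hU hy']
  rw [e1.fderiv_eq, e2.fderiv_eq]
  have hd : DifferentiableAt ℝ (fderiv ℝ F) (s, q) :=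
    (hF.fderiv_right (m := ∞) (by simp)).differentiableAt (by simp)
  rw [fderiv_clm_apply hd (differentiableAt_const _), fderiv_clm_apply hd (differentiableAt_const _)]
  have := hF.isSymmSndFDerivAt
    (by simp only [minSmoothness_of_isRCLikeNormedField]; exact WithTop.coe_le_coe.2 (le_top (a := (2 : ℕ∞))))
  simpa using this v u

lemma dt_dz (h : JS I O g) (hI : IsOpen I) (hO : IsOpen O) {s : ℝ} (hs : s ∈ I)
    {q : ℝ²} (hq : q ∈ O) : AxiNS.dt (AxiNS.dz g) s q = AxiNS.dz (AxiNS.dt g) s q := by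
  have h1 := h.dz hI.uniqueDiffOn hO
  have h2 := h.dt hI hO
  rw [h1.dt_eq hI hs hq, h2.dz_eq hO hs hq]
  exact h.fderiv_fderiv_comm hI hO hs hq (0, (0, 1)) (1, (0, 0)) h1 h2
    (fun s hs q hq => h.dz_eq hO hs hq) (fun s hs q hq => h.dt_eq hI hs hq)

lemma dt_dr (h : JS I O g) (hI : IsOpen I) (hO : IsOpen O) {s : ℝ} (hs : s ∈ I)
    {q : ℝ²} (hq : q ∈ O) : AxiNS.dt (AxiNS.dr g) s q = AxiNS.dr (AxiNS.dt g) s q := by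
  have h1 := h.dr hI.uniqueDiffOn hO
  have h2 := h.dt hI hO
  rw [h1.dt_eq hI hs hq, h2.dr_eq hO hs hq]
  exact h.fderiv_fderiv_comm hI hO hs hq (0, (1, 0)) (1, (0, 0)) h1 h2
    (fun s hs q hq => h.dr_eq hO hs hq) (fun s hs q hq => h.dt_eq hI hs hq)

end JS

/-! ### The equations in cylindrical coordinates -/

lemma dt_onPlane_indicator {t : ℝ} {v : ℝ → E3 → E3} {s : ℝ} (hs : s ∈ Ioo 0 t) (q : ℝ²) (i : Fin 3) :
    dt (onPlane fun s x => (Icc 0 t).indicator v s x i) s q = deriv (fun τ => v τ (pt q) i) s := by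
  refine Filter.EventuallyEq.deriv_eq ?_
  filter_upwards [isOpen_Ioo.mem_nhds hs] with τ hτ
  rw [onPlane, indicator_of_mem (Ioo_subset_Icc_self hτ)]

namespace IsRegularSolution

variable {ν t : ℝ} {v : ℝ → E3 → E3} {p : ℝ → E3 → ℝ} {f : ℝ → E3 → E3}
  (H : IsRegularSolution ν t v p f)
include H

local notation "V₀" => indicator (Icc 0 t) v

lemma smooth_slice (s : ℝ) (hs : s ∈ Icc 0 t) : 𝒞 (v s) := by
  rw [← contDiffOn_univ]
  exact H.smooth_v.comp (f := fun x : E3 => (s, x)) (contDiff_prodMk_right s).contDiffOn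
    fun x _ => ⟨hs, mem_univ _⟩

lemma axiField : AxiField V₀ := by
  refine ⟨fun s => ?_, fun s => ?_⟩
  · by_cases hs : s ∈ Icc 0 t
    · rw [indicator_of_mem hs]; exact H.smooth_slice s hs
    · rw [indicator_of_notMem hs]; exact contDiff_const
  · by_cases hs : s ∈ Icc 0 t
    · rw [indicator_of_mem hs]; exact H.axisym_v s hs
    · rw [indicator_of_notMem hs]
      intro θ x; ext i; fin_cases i <;> simp [rotZ]

lemma sobU (i : Fin 3) : SobU fun s x => V₀ s x i := by
  refine ⟨H.axiField.coord i, fun n => ?_⟩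
  obtain ⟨C, hC⟩ := H.sobolev_v n
  refine ⟨C, fun s => ?_⟩
  by_cases hs : s ∈ Icc 0 t
  · rw [indicator_of_mem hs]
    refine le_trans (eLpNorm_mono fun x => ?_) (hC s hs)
    rw [norm_norm, norm_norm]
    have h1 := ContinuousLinearMap.norm_iteratedFDeriv_comp_left
      (proj i : E3 →L[ℝ] ℝ) (f := v s) (x := x) (N := ∞) (n := n)
      (H.smooth_slice s hs).contDiffAt (by exact_mod_cast le_top)
    refine h1.trans ?_
    have h2 : ‖(proj i : E3 →L[ℝ] ℝ)‖ ≤ 1 :=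
      ContinuousLinearMap.opNorm_le_bound _ zero_le_one fun y => by
        simpa using PiLp.norm_apply_le y i
    exact (mul_le_mul_of_nonneg_right h2 (norm_nonneg _)).trans (one_mul _).le
  · rw [indicator_of_notMem hs]
    have : (fun x : E3 => (0 : E3 → E3) x i) = fun _ => (0 : ℝ) := by funext x; simp
    rw [this]
    have e : (fun x : E3 => ‖iteratedFDeriv ℝ n (fun _ : E3 => (0 : ℝ)) x‖) = fun _ => 0 := by
      funext x
      rw [iteratedFDeriv_fun_zero]; simp
    rw [e, eLpNorm_zero']; simp

lemma js_aux (i : Fin 3) : JS (Icc 0 t) univ (onPlane fun s x => V₀ s x i) := by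
  have h1 : ContDiffOn ℝ ∞ (fun y : ℝ × ℝ² => v y.1 (pt y.2) i) (Icc 0 t ×ˢ univ) := by
    have h2 : ContDiffOn ℝ ∞ (fun y : ℝ × ℝ² => v y.1 (pt y.2)) (Icc 0 t ×ˢ univ) :=
      H.smooth_v.comp (f := fun y : ℝ × ℝ² => (y.1, pt y.2))
        (contDiff_fst.prodMk (contDiff_pt.comp contDiff_snd)).contDiffOn
        fun y hy => ⟨hy.1, mem_univ _⟩
    exact (proj i : E3 →L[ℝ] ℝ).contDiff.comp_contDiffOn h2
  exact h1.congr fun y hy => by rw [onPlane, indicator_of_mem hy.1]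

lemma js_R : JS (Icc 0 t) univ (compR V₀) := H.js_aux 0
lemma js_Phi : JS (Icc 0 t) univ (compPhi V₀) := H.js_aux 1
lemma js_Z : JS (Icc 0 t) univ (compZ V₀) := H.js_aux 2

lemma adm_R (ρ : ℝ) : Adm ρ 2 (compR V₀) := (H.sobU 0).adm ρ
lemma adm_Phi (ρ : ℝ) : Adm ρ 2 (compPhi V₀) := (H.sobU 1).adm ρ
lemma adm_Z (ρ : ℝ) : Adm ρ 2 (compZ V₀) := (H.sobU 2).adm ρ

lemma smooth_p_slice (s : ℝ) : 𝒞 ((Ioo 0 t).indicator p s) := by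
  by_cases hs : s ∈ Ioo 0 t
  · rw [indicator_of_mem hs, ← contDiffOn_univ]
    exact H.smooth_p.comp (f := fun x : E3 => (s, x)) (contDiff_prodMk_right s).contDiffOn
      fun x _ => ⟨hs, mem_univ _⟩
  · rw [indicator_of_notMem hs]; exact contDiff_const

lemma hasDerivAt_time {s : ℝ} (hs : s ∈ Ioo 0 t) (x : E3) (i : Fin 3) :
    HasDerivAt (fun τ => v τ x i)
      (fderivWithin ℝ (fun y : ℝ × E3 => v y.1 y.2) (Ioo 0 t ×ˢ univ) (s, x) (1, 0) i) s := by
  have h0 := H.smooth_v.mono (prod_mono (Ioo_subset_Icc_self (a := 0) (b := t)) (subset_refl univ))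
  have h1 := (h0.differentiableOn (by simp) (s, x) ⟨hs, mem_univ _⟩).hasFDerivWithinAt
  have h2 : HasDerivAt (fun τ : ℝ => (τ, x)) ((1 : ℝ), (0 : E3)) s :=
    (hasDerivAt_id s).prodMk (hasDerivAt_const _ _)
  have h4 : MapsTo (fun τ : ℝ => (τ, x)) (Ioo 0 t) (Ioo 0 t ×ˢ univ) := fun r hr => ⟨hr, mem_univ _⟩
  have h3 := (h1.comp_hasDerivWithinAt s h2.hasDerivWithinAt h4).hasDerivAt (isOpen_Ioo.mem_nhds hs)
  exact ((proj i : E3 →L[ℝ] ℝ).hasFDerivAt.comp_hasDerivAt s h3)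

lemma smooth_f {s : ℝ} (hs : s ∈ Ioo 0 t) (i : Fin 3) : 𝒞 fun x => f s x i := by
  have hv := fun i => contDiff_coord (H.smooth_slice s (Ioo_subset_Icc_self hs)) i
  have hp : 𝒞 (p s) := by
    have := H.smooth_p_slice s
    rwa [indicator_of_mem hs] at this
  have h0 := H.smooth_v.mono (prod_mono (Ioo_subset_Icc_self (a := 0) (b := t)) (subset_refl univ))
  have h1 := h0.fderivWithin (m := ∞) (isOpen_Ioo.prod isOpen_univ).uniqueDiffOn (by simp)
  have h2 : 𝒞 fun x => deriv (fun τ => v τ x i) s := by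
    have e : (fun x => deriv (fun τ => v τ x i) s) = fun x => fderivWithin ℝ
        (fun y : ℝ × E3 => v y.1 y.2) (Ioo 0 t ×ˢ univ) (s, x) (1, 0) i :=
      funext fun x => (H.hasDerivAt_time hs x i).deriv
    rw [e]
    refine (proj i : E3 →L[ℝ] ℝ).contDiff.comp (ContDiff.clm_apply ?_ contDiff_const)
    rw [← contDiffOn_univ]
    exact h1.comp (f := fun x : E3 => (s, x)) (contDiff_prodMk_right s).contDiffOn
      fun x _ => ⟨hs, mem_univ _⟩
  have e : (fun x => f s x i) = fun x => deriv (fun τ => v τ x i) s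
      + ∑ j, v s x j * pd j (fun y => v s y i) x
      - ν * ∑ j, pd j (pd j (fun y => v s y i)) x + pd i (p s) x :=
    funext fun x => (H.momentum s hs x i).symm
  rw [e]
  refine ((h2.add (ContDiff.sum fun j _ => (hv j).mul (contDiff_pd (hv i) j))).sub
    (contDiff_const.mul (ContDiff.sum fun j _ => contDiff_pd (contDiff_pd (hv i) j) j))).add
    (contDiff_pd hp i)

lemma axiField_f : AxiField ((Ioo 0 t).indicator f) := by
  refine ⟨fun s => ?_, fun s => ?_⟩
  · by_cases hs : s ∈ Ioo 0 t
    · rw [indicator_of_mem hs]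
      exact contDiff_euclidean.2 (H.smooth_f hs)
    · rw [indicator_of_notMem hs]; exact contDiff_const
  · by_cases hs : s ∈ Ioo 0 t
    · rw [indicator_of_mem hs]; exact H.axisym_f s hs
    · rw [indicator_of_notMem hs]
      intro θ x; ext i; fin_cases i <;> simp [rotZ]

lemma div_eq (s : ℝ) {q : ℝ²} (hq : q.1 ≠ 0) : dr (compR V₀) s q + compR V₀ s q / q.1
      + dz (compZ V₀) s q = 0 := by
  have A := H.axiField
  have h1 : ∑ j, pd j (fun y => V₀ s y j) (pt q) = 0 := by
    by_cases hs : s ∈ Icc 0 t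
    · rw [indicator_of_mem hs]; exact H.divfree s hs (pt q)
    · rw [indicator_of_notMem hs]
      refine Finset.sum_eq_zero fun j _ => ?_
      simp [pd]
  rw [Fin.sum_univ_three] at h1
  have h2 := A.pd_one_Phi s q
  have h3 : pd 1 (fun x => V₀ s x 1) (pt q) = compR V₀ s q / q.1 := by
    rw [eq_div_iff hq]; linarith
  rw [h3] at h1
  rw [A.dr_R, A.dz_Z]
  exact h1

lemma momentum_R {s : ℝ} (hs : s ∈ Ioo 0 t) {q : ℝ²} (hq : q.1 ≠ 0) {a b w P : Fam}
    (ha : a = compR V₀) (hb : b = compPhi V₀)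
    (hw : w = compZ V₀) (hP : P = onPlane ((Ioo 0 t).indicator p)) :
    compR f s q = dt a s q + a s q * dr a s q + w s q * dz a s q - b s q ^ 2 / q.1
      - ν * (dr (dr a) s q + dr a s q / q.1 - a s q / q.1 ^ 2 + dz (dz a) s q) + dr P s q := by
  have A := H.axiField
  have hs' := Ioo_subset_Icc_self hs
  have e := H.momentum s hs (pt q) 0
  have h1 := A.pd_one_R s q
  have h2 := A.pd_one_one_R s q
  have h3 := A.pd_one_Phi s q
  rw [← hb] at h1
  rw [← ha] at h3
  have e1 : pd 1 (fun x => V₀ s x 0) (pt q) = -b s q / q.1 := by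
    rw [eq_div_iff hq]; linarith
  have e3 : pd 1 (fun x => V₀ s x 1) (pt q) = a s q / q.1 := by
    rw [eq_div_iff hq]; linarith
  have ha' : a = onPlane fun s x => V₀ s x 0 := ha
  have e4 : dr a s q = pd 0 (fun x => V₀ s x 0) (pt q) := by rw [ha, A.dr_R]; rfl
  have e5 : dz a s q = pd 2 (fun x => V₀ s x 0) (pt q) := by rw [ha, A.dz_R]; rfl
  have e6 : dr (dr a) s q = pd 0 (pd 0 fun x => V₀ s x 0) (pt q) := by
    rw [ha, A.dr_R, dr_onPlane fun s => contDiff_pd (A.coord 0 s) 0]; rfl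
  have e7 : dz (dz a) s q = pd 2 (pd 2 fun x => V₀ s x 0) (pt q) := by
    rw [ha, A.dz_R, dz_onPlane fun s => contDiff_pd (A.coord 0 s) 2]; rfl
  have e2 : pd 1 (pd 1 fun x => V₀ s x 0) (pt q) = dr a s q / q.1 - a s q / q.1 ^ 2 := by
    rw [← e4, e3] at h2
    field_simp at h2 ⊢
    linarith
  have e8 : dr P s q = pd 0 (p s) (pt q) := by
    rw [hP, dr_onPlane H.smooth_p_slice, onPlane, indicator_of_mem hs]
  have e9 : dt a s q = deriv (fun τ => v τ (pt q) 0) s := by rw [ha']; exact dt_onPlane_indicator hs q 0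
  have e10 : a s q = v s (pt q) 0 := by rw [ha, compR, indicator_of_mem hs']
  have e11 : b s q = v s (pt q) 1 := by rw [hb, compPhi, indicator_of_mem hs']
  have e12 : w s q = v s (pt q) 2 := by rw [hw, compZ, indicator_of_mem hs']
  simp only [indicator_of_mem hs'] at e1 e2 e4 e5 e6 e7
  rw [compR, ← e, Fin.sum_univ_three, Fin.sum_univ_three, e1, e2, ← e4, ← e5, ← e6, ← e7, ← e8,
    ← e9, ← e10, ← e11, ← e12]
  ring

lemma momentum_Phi {s : ℝ} (hs : s ∈ Ioo 0 t) {q : ℝ²} (hq : q.1 ≠ 0) {a b w : Fam}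
    (ha : a = compR V₀) (hb : b = compPhi V₀)
    (hw : w = compZ V₀) :
    compPhi f s q = dt b s q + a s q * dr b s q + w s q * dz b s q + a s q * b s q / q.1
      - ν * (dr (dr b) s q + dr b s q / q.1 - b s q / q.1 ^ 2 + dz (dz b) s q) := by
  have A := H.axiField
  have hs' := Ioo_subset_Icc_self hs
  have e := H.momentum s hs (pt q) 1
  have h1 := A.pd_one_Phi s q
  have h2 := A.pd_one_one_Phi s q
  have h3 := A.pd_one_R s q
  rw [← ha] at h1
  rw [← hb] at h3
  have e1 : pd 1 (fun x => V₀ s x 1) (pt q) = a s q / q.1 := by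
    rw [eq_div_iff hq]; linarith
  have e3 : pd 1 (fun x => V₀ s x 0) (pt q) = -b s q / q.1 := by
    rw [eq_div_iff hq]; linarith
  have hb' : b = onPlane fun s x => V₀ s x 1 := hb
  have e4 : dr b s q = pd 0 (fun x => V₀ s x 1) (pt q) := by rw [hb, A.dr_Phi]; rfl
  have e5 : dz b s q = pd 2 (fun x => V₀ s x 1) (pt q) := by rw [hb, A.dz_Phi]; rfl
  have e6 : dr (dr b) s q = pd 0 (pd 0 fun x => V₀ s x 1) (pt q) := by
    rw [hb, A.dr_Phi, dr_onPlane fun s => contDiff_pd (A.coord 1 s) 0]; rfl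
  have e7 : dz (dz b) s q = pd 2 (pd 2 fun x => V₀ s x 1) (pt q) := by
    rw [hb, A.dz_Phi, dz_onPlane fun s => contDiff_pd (A.coord 1 s) 2]; rfl
  have e2 : pd 1 (pd 1 fun x => V₀ s x 1) (pt q) = dr b s q / q.1 - b s q / q.1 ^ 2 := by
    rw [← e4, e3] at h2
    field_simp at h2 ⊢
    linarith
  have e8 : pd 1 (p s) (pt q) = 0 := by
    have hd := (H.smooth_p_slice s).differentiable (by simp)
    rw [indicator_of_mem hs] at hd
    have := (H.axisym_p s hs).rot hd (pt q)
    simp [pt] at this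
    exact this.resolve_left hq
  have e9 : dt b s q = deriv (fun τ => v τ (pt q) 1) s := by rw [hb']; exact dt_onPlane_indicator hs q 1
  have e10 : a s q = v s (pt q) 0 := by rw [ha, compR, indicator_of_mem hs']
  have e11 : b s q = v s (pt q) 1 := by rw [hb, compPhi, indicator_of_mem hs']
  have e12 : w s q = v s (pt q) 2 := by rw [hw, compZ, indicator_of_mem hs']
  simp only [indicator_of_mem hs'] at e1 e2 e4 e5 e6 e7
  rw [compPhi, ← e, Fin.sum_univ_three, Fin.sum_univ_three, e1, e2, ← e4, ← e5, ← e6, ← e7, e8,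
    ← e9, ← e10, ← e11, ← e12]
  ring

lemma momentum_Z {s : ℝ} (hs : s ∈ Ioo 0 t) {q : ℝ²} (hq : q.1 ≠ 0) {a w P : Fam}
    (ha : a = compR V₀)
    (hw : w = compZ V₀) (hP : P = onPlane ((Ioo 0 t).indicator p)) :
    compZ f s q = dt w s q + a s q * dr w s q + w s q * dz w s q
      - ν * (dr (dr w) s q + dr w s q / q.1 + dz (dz w) s q) + dz P s q := by
  have A := H.axiField
  have hs' := Ioo_subset_Icc_self hs
  have e := H.momentum s hs (pt q) 2
  have h1 := A.pd_one_Z s q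
  have h2 := A.pd_one_one_Z s q
  have e1 : pd 1 (fun x => V₀ s x 2) (pt q) = 0 := (mul_eq_zero.1 h1).resolve_left hq
  have hw' : w = onPlane fun s x => V₀ s x 2 := hw
  have e4 : dr w s q = pd 0 (fun x => V₀ s x 2) (pt q) := by rw [hw, A.dr_Z]; rfl
  have e5 : dz w s q = pd 2 (fun x => V₀ s x 2) (pt q) := by rw [hw, A.dz_Z]; rfl
  have e6 : dr (dr w) s q = pd 0 (pd 0 fun x => V₀ s x 2) (pt q) := by
    rw [hw, A.dr_Z, dr_onPlane fun s => contDiff_pd (A.coord 2 s) 0]; rfl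
  have e7 : dz (dz w) s q = pd 2 (pd 2 fun x => V₀ s x 2) (pt q) := by
    rw [hw, A.dz_Z, dz_onPlane fun s => contDiff_pd (A.coord 2 s) 2]; rfl
  have e2 : pd 1 (pd 1 fun x => V₀ s x 2) (pt q) = dr w s q / q.1 := by
    rw [← e4] at h2
    rw [eq_div_iff hq]; linarith
  have e8 : dz P s q = pd 2 (p s) (pt q) := by
    rw [hP, dz_onPlane H.smooth_p_slice, onPlane, indicator_of_mem hs]
  have e9 : dt w s q = deriv (fun τ => v τ (pt q) 2) s := by rw [hw']; exact dt_onPlane_indicator hs q 2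
  have e10 : a s q = v s (pt q) 0 := by rw [ha, compR, indicator_of_mem hs']
  have e12 : w s q = v s (pt q) 2 := by rw [hw, compZ, indicator_of_mem hs']
  simp only [indicator_of_mem hs'] at e1 e2 e4 e5 e6 e7
  rw [compZ, ← e, Fin.sum_univ_three, Fin.sum_univ_three, e1, e2, ← e4, ← e5, ← e6, ← e7, ← e8,
    ← e9, ← e10, ← e12]
  ring

end IsRegularSolution

/-! ### Division of the velocity by the radius -/

lemma two_avg_one_add {g : Fam} (hg : Sm g) : 2 * avg 1 g + R * avg 2 (dr g) = g := by
  funext s q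
  have hd : ∀ θ ∈ uIcc (0 : ℝ) 1, HasDerivAt (fun θ : ℝ => θ ^ 2 * g s (θ * q.1, q.2))
      (2 * (θ ^ 1 * g s (θ * q.1, q.2)) + q.1 * (θ ^ 2 * dr g s (θ * q.1, q.2))) θ := by
    intro θ _
    have h1 := hg.hasDerivAt_r s (θ * q.1, q.2)
    have h2 := HasDerivAt.comp θ (h₂ := fun r => g s (r, q.2)) h1 ((hasDerivAt_id θ).mul_const q.1)
    refine ((hasDerivAt_pow 2 θ).mul h2).congr_deriv ?_
    simp only [Function.comp_def, Nat.cast_ofNat, Nat.add_one_sub_one, id]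
    ring
  have hc1 := avg_integrand_continuous hg 1 s q
  have hc2 := avg_integrand_continuous hg.dr 2 s q
  have := integral_eq_sub_of_hasDerivAt hd
    (((hc1.const_mul 2).add (hc2.const_mul q.1)).intervalIntegrable _ _)
  rw [intervalIntegral.integral_add ((hc1.const_mul 2).intervalIntegrable _ _)
    ((hc2.const_mul q.1).intervalIntegrable _ _), intervalIntegral.integral_const_mul,
    intervalIntegral.integral_const_mul] at this
  simpa [avg, R] using this

lemma zero_of_odd {g : Fam} (h : ∀ s r z, g s (-r, z) = -g s (r, z)) (s z : ℝ) : g s (0, z) = 0 := by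
  have := h s 0 z
  simp only [neg_zero] at this
  linarith

lemma dr_odd {g : Fam} (h : ∀ s r z, g s (-r, z) = g s (r, z)) (s r z : ℝ) :
    dr g s (-r, z) = -dr g s (r, z) := by
  have e : (fun r => g s (r, z)) = fun r => g s (-r, z) := funext fun r => (h s r z).symm
  simp only [dr]
  conv_rhs => rw [e]
  rw [deriv_comp_neg (f := fun r => g s (r, z))]
  simp

lemma dr_even {g : Fam} (h : ∀ s r z, g s (-r, z) = -g s (r, z)) (s r z : ℝ) :
    dr g s (-r, z) = dr g s (r, z) := by
  have e : (fun r => g s (r, z)) = fun r => -g s (-r, z) := funext fun r => by rw [h]; simp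
  simp only [dr]
  conv_rhs => rw [e]
  rw [deriv.fun_neg, deriv_comp_neg (f := fun r => g s (r, z))]
  simp

lemma avg_even {g : Fam} (h : ∀ s r z, g s (-r, z) = g s (r, z)) (n : ℕ) (s r z : ℝ) :
    avg n g s (-r, z) = avg n g s (r, z) := by
  simp only [avg, mul_neg, h]

lemma Adm.avg_dr {ρ p} {g : Fam} (hg : Adm ρ p g) (n : ℕ) : Adm ρ p (AxiNS.avg n (AxiNS.dr g)) :=
  hg.dr.avg n

/-- The components of an axially symmetric solenoidal field, together with their quotients by the
radius. -/
structure Parts (a b w h β κ l m : Fam) : Prop where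
  a_eq : a = R * h
  b_eq : b = R * β
  flow : ∀ ρ, Flow ρ h β w κ l
  dr_β : dr β = R * m
  adm_m : ∀ ρ, Adm ρ 2 m

lemma eq_of_eq_off_axis {f g : Fam} (hf : Sm f) (hg : Sm g)
    (h : ∀ s (q : ℝ²), q.1 ≠ 0 → f s q = g s q) : f = g := by
  funext s q
  have h1 : Continuous fun r : ℝ => f s (r, q.2) := (hf s).continuous.comp (by fun_prop)
  have h2 : Continuous fun r : ℝ => g s (r, q.2) := (hg s).continuous.comp (by fun_prop)
  have := Continuous.ext_on (dense_compl_singleton (0 : ℝ)) h1 h2 fun r hr => h s (r, q.2) hr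
  exact congrFun this q.1

lemma IsRegularSolution.exists_parts {ν t : ℝ} {v : ℝ → E3 → E3} {p : ℝ → E3 → ℝ}
    {f : ℝ → E3 → E3} (H : IsRegularSolution ν t v p f) :
    ∃ h β κ l m : Fam, Parts (compR ((Icc 0 t).indicator v)) (compPhi ((Icc 0 t).indicator v))
      (compZ ((Icc 0 t).indicator v)) h β κ l m := by
  have A := H.axiField
  have ha := R_mul_avg_dr A.sm_R (zero_of_odd A.odd_R)
  have hb := R_mul_avg_dr A.sm_Phi (zero_of_odd A.odd_Phi)
  have hw := R_mul_avg_dr A.sm_Z.dr (zero_of_odd (dr_odd A.even_Z))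
  have h_even := avg_even (dr_even A.odd_R) 0
  have b_even := avg_even (dr_even A.odd_Phi) 0
  have hh := R_mul_avg_dr (A.sm_R.dr.avg 0).dr (zero_of_odd (dr_odd h_even))
  have hβ := R_mul_avg_dr (A.sm_Phi.dr.avg 0).dr (zero_of_odd (dr_odd b_even))
  have sh := A.sm_R.dr.avg 0
  refine ⟨_, _, _, _, _, ha.symm, hb.symm, fun ρ => ⟨(H.adm_R ρ).avg_dr 0, (H.adm_Phi ρ).avg_dr 0,
    H.adm_Z ρ, (H.adm_Z ρ).dr.avg_dr 0, ((H.adm_R ρ).avg_dr 0).dr.avg_dr 0, ?_, hw.symm, hh.symm⟩,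
    hβ.symm, fun ρ => ((H.adm_Phi ρ).avg_dr 0).dr.avg_dr 0⟩
  refine eq_of_eq_off_axis A.sm_Z.dz (((Sm.ofNat 2).mul sh).add (Sm.R.mul sh.dr)).neg
    fun s q hq => ?_
  have h1 := H.div_eq s hq
  rw [← ha, dr_mul Sm.R sh, dr_R] at h1
  simp only [Pi.add_apply, Pi.mul_apply, R, mul_div_cancel_left₀ _ hq,
    Pi.neg_apply, ofNat_apply] at h1 ⊢
  linarith

/-- A smooth function times a cut-off in `z`. -/
lemma AdmN.X_mul {ρ : ℝ} {p n : ℕ} (hp : 1 ≤ p) {χ : ℝ → ℝ} (hχ : 𝒞 χ)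
    (hs : HasCompactSupport χ) {g : ℝ² → ℝ} (hg : 𝒞 g) :
    AdmN ρ p n (AxiNS.X χ * fun _ => g) := by
  induction n generalizing χ g with
  | zero =>
    obtain ⟨C, hC⟩ := (isCompact_Icc (a := (0 : ℝ)) (b := ρ)).prod hs |>.exists_bound_of_continuousOn
      hg.continuous.continuousOn
    have h1 : Adm ρ p (AxiNS.X χ) := Adm.X hp hχ hs
    refine (h1.smul C).dec.mono fun s q hq hq' => ?_
    by_cases hz : q.2 ∈ tsupport χ
    · have h2 := hC q ⟨⟨hq, hq'⟩, hz⟩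
      have : |(C • AxiNS.X χ : Fam) s q| = |C| * |χ q.2| := by simp [AxiNS.X, abs_mul]
      rw [this]
      have : |(AxiNS.X χ * fun _ => g : Fam) s q| = |g q| * |χ q.2| := by
        simp [AxiNS.X, abs_mul, mul_comm]
      rw [this]
      exact mul_le_mul_of_nonneg_right (h2.trans (le_abs_self C)) (abs_nonneg _)
    · have : χ q.2 = 0 := image_eq_zero_of_notMem_tsupport hz
      simp [AxiNS.X, this]
  | succ n ih =>
    have sg : Sm (fun _ => g) := fun _ => hg
    refine ⟨(ih hχ hs hg).dec, ?_, ?_⟩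
    · rw [dr_mul (Sm.X hχ) sg, dr_X, zero_mul, zero_add]
      exact ih hχ hs (sg.dr 0)
    · rw [dz_mul (Sm.X hχ) sg, dz_X]
      exact (ih (contDiff_deriv hχ) hs.deriv hg).add ((Sm.X (contDiff_deriv hχ)).mul sg)
        ((Sm.X hχ).mul sg.dz) (ih hχ hs (sg.dz 0))

lemma Adm.X_mul {ρ : ℝ} {p : ℕ} (hp : 1 ≤ p) {χ : ℝ → ℝ} (hχ : 𝒞 χ)
    (hs : HasCompactSupport χ) {g : ℝ² → ℝ} (hg : 𝒞 g) :
    Adm ρ p (AxiNS.X χ * fun _ => g) :=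
  ⟨(Sm.X hχ).mul fun _ => hg, fun _ => AdmN.X_mul hp hχ hs hg⟩

/-- Divergence theorem on the strip for a field that vanishes on the axis and at `r = ρ`. -/
lemma integral_div_eq_zero {ρ : ℝ} (hρ : 0 < ρ) {k K : Fam} (hk : Adm ρ 1 k) (hK : Adm ρ 1 K)
    (h0 : ∀ s z, k s (ρ, z) = 0) (s : ℝ) :
    ∫ q, (2 * k + R * dr k + dz K : Fam) s q ∂strip ρ = 0 := by
  have h1 : R * (2 * k + R * dr k) = dr (R * (R * k)) := by
    simp (maxDischargeDepth := 60) only [dr_mul, dr_R, Sm.mul, Sm.R, hk.sm]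
    ring
  have := strip_div hρ (Sm.R.mul (Sm.R.mul hk.sm)) h1 ((hk.ofNat_mul 2).add hk.dr.R_mul) hK
    (fun s z => by simp [h0]) s
  simpa [R] using this

section

/-! ### The energy identity at a fixed time -/

/-- A cut-off function on the half-plane, with `φ_{,r} = r φ₁`. -/
structure Bump (ρ : ℝ) (φ φ₁ : Fam) : Prop where
  pos : 0 < ρ
  adm : Adm ρ 2 φ
  adm₁ : Adm ρ 2 φ₁
  dr_eq : dr φ = R * φ₁
  zero : ∀ s z, φ s (ρ, z) = 0
  zero₁ : ∀ s z, φ₁ s (ρ, z) = 0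
  adm_mul : ∀ g : ℝ² → ℝ, 𝒞 g → ∀ p, 1 ≤ p → Adm ρ p (φ * fun _ => g)

/-- The kinetic energy density. -/
def kinE (h β w : Fam) : Fam := (1 / 2 : ℝ) • ((R * h) ^ 2 + (R * β) ^ 2 + w ^ 2)

/-- The dissipation density. -/
def dissE (h β w : Fam) : Fam :=
  dr (R * h) ^ 2 + dz (R * h) ^ 2 + dr (R * β) ^ 2 + dz (R * β) ^ 2 + dr w ^ 2 + dz w ^ 2
    + h ^ 2 + β ^ 2

lemma adm_sq_sum {ρ : ℝ} {h β w κ l : Fam} (F : Flow ρ h β w κ l) :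
    Adm ρ 1 (kinE h β w) ∧ Adm ρ 2 (kinE h β w) ∧ Adm ρ 1 (dissE h β w)
      ∧ Adm ρ 2 (dissE h β w) := by
  have ah := F.adm_h
  have ab := F.adm_b
  have aw := F.adm_w
  refine ⟨?_, ?_, ?_, ?_⟩
  · exact ((ah.R_mul.sq.add ab.R_mul.sq).add aw.sq).smul _
  · exact ((ah.R_mul.sq2.add ab.R_mul.sq2).add aw.sq2).smul _
  · exact (((((((ah.R_mul.dr.sq.add ah.R_mul.dz.sq).add ab.R_mul.dr.sq).add ab.R_mul.dz.sq).add
      aw.dr.sq).add aw.dz.sq).add ah.sq).add ab.sq)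
  · exact (((((((ah.R_mul.dr.sq2.add ah.R_mul.dz.sq2).add ab.R_mul.dr.sq2).add ab.R_mul.dz.sq2).add
      aw.dr.sq2).add aw.dz.sq2).add ah.sq2).add ab.sq2)

section slice

variable {ρ : ℝ} {φ φ₁ h β w κ l : Fam}

lemma integral_energy_transport (B : Bump ρ φ φ₁) (F : Flow ρ h β w κ l) (s : ℝ) :
    Integrable ((φ * (R * h * dr (kinE h β w) + w * dz (kinE h β w)) : Fam) s) (strip ρ) ∧
    ∫ q, (φ * (R * h * dr (kinE h β w) + w * dz (kinE h β w)) : Fam) s q ∂strip ρ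
      = -∫ q, (kinE h β w * (R * h * dr φ + w * dz φ) : Fam) s q ∂strip ρ := by
  obtain ⟨ae1, ae, -, -⟩ := adm_sq_sum F
  set e := kinE h β w
  have aφ := B.adm
  have ah := F.adm_h
  have aw := F.adm_w
  have sφ := aφ.sm
  have sh := ah.sm
  have sw := aw.sm
  have se := ae.sm
  have i1 : Adm ρ 1 (φ * (R * (h * dr e) + w * dz e)) :=
    aφ.mul ((ah.mul2 ae.dr).R_mul.add (aw.mul2 ae.dz))
  have i2 : Adm ρ 1 (e * (R * (h * dr φ) + w * dz φ)) :=
    ae.mul ((ah.mul2 aφ.dr).R_mul.add (aw.mul2 aφ.dz))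
  have hdiv := integral_div_eq_zero B.pos (k := h * (φ * e)) (K := w * (φ * e))
    (ah.mul (aφ.mul2 ae)) (aw.mul (aφ.mul2 ae)) (fun s z => by simp [B.zero]) s
  refine ⟨by simpa only [mul_assoc] using i1.integrable s, ?_⟩
  rw [eq_neg_iff_add_eq_zero, ← hdiv]
  simp only [mul_assoc]
  rw [← integral_add (i1.integrable s) (i2.integrable s)]
  congr 1
  suffices hs : φ * (R * (h * dr e) + w * dz e) + e * (R * (h * dr φ) + w * dz φ)
      = 2 * (h * (φ * e)) + R * dr (h * (φ * e)) + dz (w * (φ * e)) from congrFun hs s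
  simp (maxDischargeDepth := 60) only [dr_mul, dz_mul, Sm.mul, sφ, sh, sw, se]
  linear_combination (-(φ * e)) * F.div

lemma integral_energy_viscous (B : Bump ρ φ φ₁) (F : Flow ρ h β w κ l) (s : ℝ) :
    Integrable ((φ * (R * h * (dr (dr (R * h)) + dr h + dz (dz (R * h)))
        + R * β * (dr (dr (R * β)) + dr β + dz (dz (R * β)))
        + w * (dr (dr w) + κ + dz (dz w)) + dissE h β w) : Fam) s) (strip ρ) ∧
    ∫ q, (φ * (R * h * (dr (dr (R * h)) + dr h + dz (dz (R * h)))
        + R * β * (dr (dr (R * β)) + dr β + dz (dz (R * β)))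
        + w * (dr (dr w) + κ + dz (dz w)) + dissE h β w) : Fam) s q ∂strip ρ
      = ∫ q, (kinE h β w * (2 * φ₁ + R * dr φ₁ + dz (dz φ)) : Fam) s q ∂strip ρ := by
  obtain ⟨ae1, ae, aD1, aD⟩ := adm_sq_sum F
  have aφ := B.adm
  have aφ₁ := B.adm₁
  have ah := F.adm_h
  have ab := F.adm_b
  have aw := F.adm_w
  have ak := F.adm_k
  have sφ := aφ.sm
  have sφ₁ := aφ₁.sm
  have sh := ah.sm
  have sb := ab.sm
  have sw := aw.sm
  have sk := ak.sm
  have sR := Sm.R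
  set e₁ : Fam := h ^ 2 + R * (h * dr h) + β ^ 2 + R * (β * dr β) + w * κ with he₁
  have ae₁ : Adm ρ 2 e₁ := (((ah.sq2.add (ah.mul2 ah.dr).R_mul).add ab.sq2).add
    (ab.mul2 ab.dr).R_mul).add (aw.mul2 ak)
  have hw := F.dr_w
  have her : dr (kinE h β w) = R * e₁ := by
    simp (maxDischargeDepth := 60) only [kinE, he₁, dr_smul, dr_add, dr_sq, dr_mul, dr_R, Sm.add,
      Sm.sq, Sm.mul, Sm.R, sh, sb, sw, hw]
    funext s q
    simp
    ring
  have i1 : Adm ρ 1 (φ * (R * (h * (dr (dr (R * h)) + dr h + dz (dz (R * h))))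
        + R * (β * (dr (dr (R * β)) + dr β + dz (dz (R * β))))
        + w * (dr (dr w) + κ + dz (dz w)) + dissE h β w)) := by
    refine aφ.mul ((((ah.mul2 ?_).R_mul.add (ab.mul2 ?_).R_mul).add (aw.mul2 ?_)).add aD)
    · exact (ah.R_mul.dr.dr.add ah.dr).add ah.R_mul.dz.dz
    · exact (ab.R_mul.dr.dr.add ab.dr).add ab.R_mul.dz.dz
    · exact (aw.dr.dr.add ak).add aw.dz.dz
  have i2 : Adm ρ 1 (kinE h β w * (2 * φ₁ + R * dr φ₁ + dz (dz φ))) :=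
    ae.mul (((aφ₁.ofNat_mul 2).add aφ₁.dr.R_mul).add aφ.dz.dz)
  have hdiv := integral_div_eq_zero B.pos (k := φ * e₁ - kinE h β w * φ₁)
    (K := φ * dz (kinE h β w) - kinE h β w * dz φ)
    ((aφ.mul ae₁).sub (ae.mul aφ₁)) ((aφ.mul ae.dz).sub (ae.mul aφ.dz))
    (fun s z => by simp [B.zero, B.zero₁]) s
  refine ⟨by simpa only [mul_assoc] using i1.integrable s, ?_⟩
  rw [← sub_eq_zero, ← hdiv]
  simp only [mul_assoc]
  rw [← integral_sub (i1.integrable s) (i2.integrable s)]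
  congr 1
  suffices hs : φ * (R * (h * (dr (dr (R * h)) + dr h + dz (dz (R * h))))
        + R * (β * (dr (dr (R * β)) + dr β + dz (dz (R * β))))
        + w * (dr (dr w) + κ + dz (dz w)) + dissE h β w)
        - kinE h β w * (2 * φ₁ + R * dr φ₁ + dz (dz φ))
      = 2 * (φ * e₁ - kinE h β w * φ₁) + R * dr (φ * e₁ - kinE h β w * φ₁)
      + dz (φ * dz (kinE h β w) - kinE h β w * dz φ) from congrFun hs s
  have hφ := B.dr_eq
  have hez : dz (kinE h β w) = R * R * h * dz h + R * R * β * dz β + w * dz w := by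
    simp (maxDischargeDepth := 60) only [kinE, dz_smul, dz_add, dz_sq, dz_mul, dz_R, Sm.add,
      Sm.sq, Sm.mul, Sm.R, sh, sb, sw]
    funext s q
    simp
    ring
  have hez2 : dz (dz (kinE h β w)) = R * R * (dz h ^ 2 + h * dz (dz h)) + R * R * (dz β ^ 2 + β * dz (dz β))
      + (dz w ^ 2 + w * dz (dz w)) := by
    rw [hez]
    simp (maxDischargeDepth := 60) only [dz_add, dz_mul, dz_R, Sm.add, Sm.dz, Sm.mul, Sm.R, sh, sb, sw]
    ring
  have hk : dr (dr w) = κ + R * dr κ := by rw [hw, dr_mul sR sk, dr_R]; ring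
  have e1 : dr (φ * e₁ - kinE h β w * φ₁) = dr φ * e₁ + φ * dr e₁ - dr (kinE h β w) * φ₁
      - kinE h β w * dr φ₁ := by
    rw [dr_sub (sφ.mul ae₁.sm) (ae.sm.mul sφ₁), dr_mul sφ ae₁.sm, dr_mul ae.sm sφ₁]; ring
  have e2 : dz (φ * dz (kinE h β w) - kinE h β w * dz φ) = φ * dz (dz (kinE h β w))
      - kinE h β w * dz (dz φ) := by
    rw [dz_sub (sφ.mul ae.dz.sm) (ae.sm.mul sφ.dz), dz_mul sφ ae.dz.sm, dz_mul ae.sm sφ.dz]; ring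
  have e3 : dr e₁ = 2 * h * dr h + h * dr h + R * (dr h * dr h + h * dr (dr h)) + 2 * β * dr β
      + β * dr β + R * (dr β * dr β + β * dr (dr β)) + dr w * κ + w * dr κ := by
    rw [he₁]
    simp (maxDischargeDepth := 60) only [dr_add, dr_sq, dr_mul, dr_R, Sm.add, Sm.sq, Sm.mul, Sm.R,
      Sm.dr, sh, sb, sw, sk]
    ring
  rw [e1, e2, e3, her, hez2, hφ, hk, he₁, dissE]
  simp (maxDischargeDepth := 60) only [dr_add, dr_mul, dr_R, dz_mul, dz_R, Sm.mul, Sm.R,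
    Sm.dr, Sm.dz, sh, sb, hw, zero_mul, zero_add, one_mul]
  ring

/-- The Stokes stream function of the flow is `r² A`. -/
lemma integral_energy_pressure (B : Bump ρ φ φ₁) (F : Flow ρ h β w κ l) {P : ℝ² → ℝ}
    (hP : 𝒞 P) (s : ℝ) :
    Integrable ((φ * (R * h * dr (fun _ => P) + w * dz (fun _ => P)) : Fam) s) (strip ρ) ∧
    ∫ q, (φ * (R * h * dr (fun _ => P) + w * dz (fun _ => P)) : Fam) s q ∂strip ρ
      = ∫ q, (R * avg 1 w * (dz φ * dr (fun _ => P) - dr φ * dz (fun _ => P)) : Fam) s q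
        ∂strip ρ := by
  have aφ := B.adm
  have ah := F.adm_h
  have aw := F.adm_w
  have sh := ah.sm
  have sw := aw.sm
  have sφ := aφ.sm
  have aA := aw.avg 1
  set A := avg 1 w with hA
  have sA := aA.sm
  have sP : Sm fun _ => P := fun _ => hP
  have aPr : Adm ρ 2 (φ * dr (fun _ => P)) := B.adm_mul _ (sP.dr 0) 2 one_le_two
  have aPz : Adm ρ 2 (φ * dz (fun _ => P)) := B.adm_mul _ (sP.dz 0) 2 one_le_two
  have aPzr : Adm ρ 2 (φ * dr (dz (fun _ => P))) := B.adm_mul _ (sP.dz.dr 0) 2 one_le_two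
  have h1 : 2 * A + R * dr A = w := by rw [hA, dr_avg sw]; exact two_avg_one_add sw
  have h2 : dz A = -h := by
    rw [hA, dz_avg sw, F.div]
    have : avg 1 (-(2 * h + R * dr h)) = -(2 * avg 1 h + R * avg 2 (dr h)) := by
      funext s q
      have c1 := (avg_integrand_continuous sh 1 s q).intervalIntegrable (μ := volume) 0 1
      have c2 := (avg_integrand_continuous sh.dr 2 s q).intervalIntegrable (μ := volume) 0 1
      simp only [avg, Pi.neg_apply, Pi.add_apply, Pi.mul_apply, ofNat_apply, R]
      rw [← intervalIntegral.integral_const_mul, ← intervalIntegral.integral_const_mul,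
        ← intervalIntegral.integral_add (c1.const_mul 2) (c2.const_mul _),
        ← intervalIntegral.integral_neg]
      refine intervalIntegral.integral_congr fun θ _ => ?_
      ring
    rw [this, two_avg_one_add sh]
  have i1 : Adm ρ 1 (R * (h * (φ * dr (fun _ => P))) + w * (φ * dz (fun _ => P))) :=
    (ah.mul aPr).R_mul.add (aw.mul aPz)
  have i2 : Adm ρ 1 (R * (A * ((dz (φ * dr (fun _ => P)) - φ * dr (dz (fun _ => P)))
      - (dr (φ * dz (fun _ => P)) - φ * dr (dz (fun _ => P)))))) :=
    (aA.mul ((aPr.dz.sub aPzr).sub (aPz.dr.sub aPzr))).R_mul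
  have hdiv := integral_div_eq_zero B.pos (k := A * (φ * dz (fun _ => P)))
    (K := -(R * (A * (φ * dr (fun _ => P)))))
    (aA.mul aPz) (aA.mul aPr).R_mul.neg (fun s z => by simp [B.zero]) s
  have E1 : φ * (R * h * dr (fun _ => P) + w * dz (fun _ => P))
      = R * (h * (φ * dr (fun _ => P))) + w * (φ * dz (fun _ => P)) := by ring
  have E2 : R * A * (dz φ * dr (fun _ => P) - dr φ * dz (fun _ => P))
      = R * (A * ((dz (φ * dr (fun _ => P)) - φ * dr (dz (fun _ => P)))
      - (dr (φ * dz (fun _ => P)) - φ * dr (dz (fun _ => P))))) := by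
    rw [dz_mul sφ sP.dr, dr_mul sφ sP.dz, dz_dr sP]; ring
  rw [E1]
  refine ⟨i1.integrable s, ?_⟩
  rw [E2, ← sub_eq_zero, ← hdiv, ← integral_sub (i1.integrable s) (i2.integrable s)]
  congr 1
  suffices hs : (R * (h * (φ * dr (fun _ => P))) + w * (φ * dz (fun _ => P)))
    - (R * (A * ((dz (φ * dr (fun _ => P)) - φ * dr (dz (fun _ => P)))
      - (dr (φ * dz (fun _ => P)) - φ * dr (dz (fun _ => P))))))
      = 2 * (A * (φ * dz (fun _ => P))) + R * dr (A * (φ * dz (fun _ => P)))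
      + dz (-(R * (A * (φ * dr (fun _ => P))))) from congrFun hs s
  simp (maxDischargeDepth := 60) only [dr_mul, dz_mul, dz_neg, dz_R, Sm.mul, Sm.R, Sm.dr, Sm.dz, sφ, sA, sP,
    dz_dr, zero_mul, zero_add, h2]
  linear_combination (-(φ * dz (fun _ => P))) * h1

end slice

end

/-! ### Energy balance with a cut-off -/

lemma JS.slice {I : Set ℝ} {g : Fam} (h : JS I univ g) {s : ℝ} (hs : s ∈ I) : 𝒞 (g s) := by
  rw [← contDiffOn_univ]
  exact ContDiffOn.comp h (f := fun q : ℝ² => (s, q)) (contDiff_prodMk_right s).contDiffOn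
    fun q _ => ⟨hs, mem_univ _⟩

/-- The pressure on the half-plane. -/
def presE (t : ℝ) (p : ℝ → E3 → ℝ) : Fam := onPlane ((Ioo 0 t).indicator p)

/-- The power of the force. -/
def powE (t : ℝ) (v f : ℝ → E3 → E3) : Fam :=
  compR ((Icc 0 t).indicator v) * compR ((Ioo 0 t).indicator f)
    + compPhi ((Icc 0 t).indicator v) * compPhi ((Ioo 0 t).indicator f)
    + compZ ((Icc 0 t).indicator v) * compZ ((Ioo 0 t).indicator f)

/-! ### Integration in time -/

lemma time_balance {s₁ s₂ : ℝ} (h12 : s₁ ≤ s₂) {E : ℝ → ℝ} {T : ℝ → ℝ} {N B : ℝ → ENNReal}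
    (hT : IntegrableOn T (Ioo s₁ s₂)) (hE : E s₂ - E s₁ = ∫ s in s₁..s₂, T s)
    (hE₁ : 0 ≤ E s₁) (hE₂ : 0 ≤ E s₂)
    (h : ∀ s ∈ Ioo s₁ s₂, ofReal (T s) + N s ≤ B s + ofReal (-T s)) :
    ofReal (E s₂) + ∫⁻ s in Ioo s₁ s₂, N s ≤ ofReal (E s₁) + ∫⁻ s in Ioo s₁ s₂, B s := by
  have m1 : AEMeasurable (fun s => ofReal (T s)) (volume.restrict (Ioo s₁ s₂)) :=
    hT.aestronglyMeasurable.aemeasurable.ennreal_ofReal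
  have m2 : AEMeasurable (fun s => ofReal (-T s)) (volume.restrict (Ioo s₁ s₂)) :=
    hT.aestronglyMeasurable.aemeasurable.neg.ennreal_ofReal
  have h1 : ∫⁻ s in Ioo s₁ s₂, (ofReal (T s) + N s) ≤ ∫⁻ s in Ioo s₁ s₂, (B s + ofReal (-T s)) :=
    setLIntegral_mono' measurableSet_Ioo h
  rw [lintegral_add_left' m1, lintegral_add_right' _ m2] at h1
  have h2 : ∫ s in s₁..s₂, T s = (∫⁻ s in Ioo s₁ s₂, ofReal (T s)).toReal
      - (∫⁻ s in Ioo s₁ s₂, ofReal (-T s)).toReal := by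
    rw [integral_of_le h12, integral_Ioc_eq_integral_Ioo,
      integral_eq_lintegral_pos_part_sub_lintegral_neg_part hT]
  have f1 : ∫⁻ s in Ioo s₁ s₂, ofReal (T s) ≠ ⊤ := hT.lintegral_lt_top.ne
  have f2 : ∫⁻ s in Ioo s₁ s₂, ofReal (-T s) ≠ ⊤ := hT.neg.lintegral_lt_top.ne
  set I₁ := ∫⁻ s in Ioo s₁ s₂, ofReal (T s)
  set I₂ := ∫⁻ s in Ioo s₁ s₂, ofReal (-T s)
  have h3 : ofReal (E s₂) + I₂ = ofReal (E s₁) + I₁ := by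
    rw [← ofReal_toReal f1, ← ofReal_toReal f2, ← ofReal_add hE₂
      toReal_nonneg, ← ofReal_add hE₁ toReal_nonneg]
    congr 1
    linarith
  rw [← ENNReal.add_le_add_iff_right f2, ← ENNReal.add_le_add_iff_right f1]
  calc (ofReal (E s₂) + ∫⁻ s in Ioo s₁ s₂, N s) + I₂ + I₁
      = (ofReal (E s₂) + I₂) + (I₁ + ∫⁻ s in Ioo s₁ s₂, N s) := by
        ac_rfl
    _ ≤ (ofReal (E s₁) + I₁) + ((∫⁻ s in Ioo s₁ s₂, B s) + I₂) := by rw [h3]; gcongr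
    _ = (ofReal (E s₁) + ∫⁻ s in Ioo s₁ s₂, B s) + I₂ + I₁ := by ac_rfl

lemma integral_time {t ρ L s₁ s₂ : ℝ} {g : Fam} (hg : JS (Ioo 0 t) univ g) {φ : ℝ² → ℝ}
    (hφ : Continuous φ) (hL : ∀ q : ℝ², L < |q.2| → φ q = 0) (h1 : 0 < s₁) (h12 : s₁ ≤ s₂)
    (h2 : s₂ < t) :
    IntegrableOn (fun s => ∫ q, φ q * dt g s q ∂strip ρ) (Ioo s₁ s₂) ∧
      ∫ q, φ q * g s₂ q ∂strip ρ - ∫ q, φ q * g s₁ q ∂strip ρ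
        = ∫ s in s₁..s₂, ∫ q, φ q * dt g s q ∂strip ρ := by
  set S : Set ℝ² := Ioo 0 ρ ×ˢ Icc (-L) L with hS
  have hsub : ∀ s ∈ Icc s₁ s₂, s ∈ Ioo 0 t := fun s hs => ⟨h1.trans_le hs.1, hs.2.trans_lt h2⟩
  have hSm : MeasurableSet S := measurableSet_Ioo.prod measurableSet_Icc
  have hred : ∀ k : ℝ² → ℝ, ∫ q, φ q * k q ∂strip ρ = ∫ q in S, q.1 * (φ q * k q) := by
    intro k
    rw [integral_strip]
    refine setIntegral_eq_of_subset_of_forall_sdiff_eq_zero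
      (measurableSet_Ioo.prod MeasurableSet.univ) (prod_mono subset_rfl (subset_univ _)) ?_
    rintro q ⟨hq1, hq2⟩
    have : L < |q.2| := by
      by_contra hc
      exact hq2 ⟨hq1.1, abs_le.1 (not_lt.1 hc)⟩
    rw [hL q this]; ring
  have hK : IsCompact (Icc s₁ s₂ ×ˢ (Icc 0 ρ ×ˢ Icc (-L) L)) :=
    isCompact_Icc.prod (isCompact_Icc.prod isCompact_Icc)
  have hdc : ContinuousOn (fun y : ℝ × ℝ² => y.2.1 * (φ y.2 * dt g y.1 y.2))
      (Icc s₁ s₂ ×ˢ (Icc 0 ρ ×ˢ Icc (-L) L)) := by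
    have h3 := (hg.dt isOpen_Ioo isOpen_univ).continuousOn.mono
      (prod_mono (fun s hs => hsub s hs) (subset_univ (Icc 0 ρ ×ˢ Icc (-L) L)))
    exact (by fun_prop : Continuous fun y : ℝ × ℝ² => y.2.1).continuousOn.mul
      ((hφ.comp continuous_snd).continuousOn.mul h3)
  have hI : IntegrableOn (fun y : ℝ × ℝ² => y.2.1 * (φ y.2 * dt g y.1 y.2)) (Ioc s₁ s₂ ×ˢ S) :=
    (hdc.integrableOn_compact hK).mono_set
      (prod_mono Ioc_subset_Icc_self (prod_mono Ioo_subset_Icc_self subset_rfl))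
  have hI' : Integrable (fun y : ℝ × ℝ² => y.2.1 * (φ y.2 * dt g y.1 y.2))
      ((volume.restrict (Ioc s₁ s₂)).prod (volume.restrict S)) := by
    rwa [prod_restrict, ← volume_eq_prod]
  simp only [hred]
  have hT : IntegrableOn (fun s => ∫ q in S, q.1 * (φ q * dt g s q)) (Ioc s₁ s₂) :=
    hI'.integral_prod_left
  refine ⟨hT.mono_set Ioo_subset_Ioc_self, ?_⟩
  rw [integral_of_le h12, integral_integral_swap hI']
  have hgi : ∀ s ∈ Icc s₁ s₂, IntegrableOn (fun q : ℝ² => q.1 * (φ q * g s q)) S := by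
    intro s hs
    have h3 := (hg.slice (hsub s hs)).continuous
    have h4 : Continuous fun q : ℝ² => q.1 * (φ q * g s q) := by fun_prop
    exact (h4.continuousOn.integrableOn_compact (isCompact_Icc.prod isCompact_Icc)).mono_set
      (prod_mono Ioo_subset_Icc_self subset_rfl)
  rw [← integral_sub (hgi s₂ (right_mem_Icc.2 h12)) (hgi s₁ (left_mem_Icc.2 h12))]
  refine integral_congr_ae (ae_of_all _ fun q => ?_)
  have h5 : ∫ s in s₁..s₂, dt g s q = g s₂ q - g s₁ q := by
    refine integral_eq_sub_of_hasDerivAt (f := fun s => g s q) (fun s hs => ?_) ?_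
    · rw [uIcc_of_le h12] at hs
      exact hg.hasDerivAt_t isOpen_Ioo (hsub s hs) (mem_univ q)
    · refine ContinuousOn.intervalIntegrable ?_
      rw [uIcc_of_le h12]
      exact ((hg.dt isOpen_Ioo isOpen_univ).continuousOn_time (mem_univ q)).mono
        fun s hs => hsub s hs
  simp only
  rw [integral_const_mul, integral_const_mul, ← integral_of_le h12, h5]
  ring

/-- Integration of a balance in time, starting from the initial time. -/
lemma weighted_balance {t ρ L C s₁ s₂ : ℝ} {g : Fam} (ht : 0 < t) (hg : JS (Icc 0 t) univ g)
    (hb : ∀ s q, 0 ≤ q.1 → q.1 ≤ ρ → |g s q| ≤ C) {φ : ℝ² → ℝ} (hφ : Continuous φ)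
    (hL : ∀ q : ℝ², L < |q.2| → φ q = 0) (hφi : Integrable φ (strip ρ))
    (h0 : ∀ s, 0 ≤ ∫ q, φ q * g s q ∂strip ρ) {N B : ℝ → ENNReal} {A : ENNReal}
    (h : ∀ s ∈ Ioo 0 t, ofReal (∫ q, φ q * dt g s q ∂strip ρ) + N s
      ≤ B s + ofReal (-∫ q, φ q * dt g s q ∂strip ρ)) (hA : ∫⁻ s in Ioo 0 t, B s ≤ A)
    (h1 : 0 < s₁) (h12 : s₁ ≤ s₂) (h2 : s₂ < t) :
    ofReal (∫ q, φ q * g s₂ q ∂strip ρ) + ∫⁻ s in Ioo s₁ s₂, N s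
      ≤ ofReal (∫ q, φ q * g 0 q ∂strip ρ) + A := by
  have hcont : ContinuousWithinAt (fun s => ∫ q, φ q * g s q ∂strip ρ) (Icc 0 t) 0 := by
    refine continuousWithinAt_of_dominated (bound := fun q => C * |φ q|) ?_ ?_
      (hφi.abs.const_mul C) (ae_of_all _ fun q => continuousWithinAt_const.mul
        (hg.continuousOn_time (mem_univ q) 0 (left_mem_Icc.2 ht.le)))
    · filter_upwards [self_mem_nhdsWithin] with s hs
      exact hφi.aestronglyMeasurable.mul (hg.slice hs).continuous.aestronglyMeasurable
    · refine Filter.Eventually.of_forall fun s => ae_strip fun q hq hq' => ?_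
      rw [norm_mul, mul_comm]
      exact mul_le_mul_of_nonneg_right (hb s q hq.le hq'.le) (norm_nonneg _)
  have : (nhdsWithin (0 : ℝ) (Ioo 0 s₁)).NeBot := left_nhdsWithin_Ioo_neBot h1
  refine ge_of_tendsto (((continuous_ofReal.tendsto _).comp (hcont.mono_left (nhdsWithin_mono _
    (Ioo_subset_Icc_self.trans (Icc_subset_Icc_right (h12.trans h2.le)))))).add_const A) ?_
  filter_upwards [self_mem_nhdsWithin] with s hs
  obtain ⟨i1, i2⟩ := integral_time (hg.restrict) hφ hL hs.1
    (hs.2.le.trans h12) h2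
  refine le_trans ?_ ((time_balance (hs.2.le.trans h12) (E := fun s => ∫ q, φ q * g s q ∂strip ρ)
    i1 i2 (h0 _) (h0 _) fun x hx => h x ⟨hs.1.trans hx.1, hx.2.trans h2⟩).trans (add_le_add le_rfl
      ((lintegral_mono_set (Ioo_subset_Ioo hs.1.le h2.le)).trans hA)))
  gcongr
  exact hs.2.le

/-- The bound for the stream function. -/
lemma sq_R_avg_one_le {g : Fam} (hg : Sm g) (s : ℝ) {q : ℝ²} (hq : 0 ≤ q.1) :
    ofReal (((R * avg 1 g : Fam) s q) ^ 2)
      ≤ ∫⁻ r in Ioi 0, ofReal r * ofReal (g s (r, q.2) ^ 2) := by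
  have hc : Continuous fun θ : ℝ => g s (θ * q.1, q.2) := by
    have := (hg s).continuous
    fun_prop
  set m := ∫ θ in (0 : ℝ)..1, θ ^ 1 * g s (θ * q.1, q.2) with hm
  have h1 : 0 ≤ ∫ θ in (0 : ℝ)..1, θ * (g s (θ * q.1, q.2) - 2 * m) ^ 2 :=
    intervalIntegral.integral_nonneg zero_le_one fun θ hθ => mul_nonneg hθ.1 (sq_nonneg _)
  have h2 : ∫ θ in (0 : ℝ)..1, θ * (g s (θ * q.1, q.2) - 2 * m) ^ 2
      = (∫ θ in (0 : ℝ)..1, θ * g s (θ * q.1, q.2) ^ 2) - 2 * m ^ 2 := by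
    have e : (fun θ : ℝ => θ * (g s (θ * q.1, q.2) - 2 * m) ^ 2)
        = fun θ => (θ * g s (θ * q.1, q.2) ^ 2 - 4 * m * (θ ^ 1 * g s (θ * q.1, q.2)))
          + 4 * m ^ 2 * θ := by funext θ; ring
    rw [e, intervalIntegral.integral_add, intervalIntegral.integral_sub,
      intervalIntegral.integral_const_mul, intervalIntegral.integral_const_mul, ← hm, integral_id]
    · ring
    · exact Continuous.intervalIntegrable (continuous_id.mul (hc.pow 2)) _ _
    · exact Continuous.intervalIntegrable (continuous_const.mul ((continuous_id.pow 1).mul hc)) _ _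
    · exact Continuous.intervalIntegrable ((continuous_id.mul (hc.pow 2)).sub
        (continuous_const.mul ((continuous_id.pow 1).mul hc))) _ _
    · exact Continuous.intervalIntegrable (by fun_prop) _ _
  have h3 : q.1 ^ 2 * ∫ θ in (0 : ℝ)..1, θ * g s (θ * q.1, q.2) ^ 2
      = ∫ r in (0 : ℝ)..q.1, r * g s (r, q.2) ^ 2 := by
    have := intervalIntegral.smul_integral_comp_mul_right (a := 0) (b := 1)
      (fun r => r * g s (r, q.2) ^ 2) q.1
    rw [zero_mul, one_mul, smul_eq_mul] at this
    rw [← this, pow_two, mul_assoc, ← intervalIntegral.integral_const_mul]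
    congr 1
    refine intervalIntegral.integral_congr fun θ _ => ?_
    ring
  have h4 : ((R * avg 1 g : Fam) s q) ^ 2 ≤ ∫ r in (0 : ℝ)..q.1, r * g s (r, q.2) ^ 2 := by
    rw [← h3]
    have : ((R * avg 1 g : Fam) s q) = q.1 * m := rfl
    rw [this, mul_pow]
    exact mul_le_mul_of_nonneg_left (by nlinarith [sq_nonneg m]) (sq_nonneg _)
  refine (ofReal_le_ofReal h4).trans ?_
  have hc2 : Continuous fun r : ℝ => r * g s (r, q.2) ^ 2 := by
    have := (hg s).continuous
    fun_prop
  rw [integral_of_le hq, ofReal_integral_eq_lintegral_ofReal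
    ((hc2.integrableOn_Icc).mono_set Ioc_subset_Icc_self)
    (by filter_upwards [ae_restrict_mem measurableSet_Ioc] with r hr
        exact mul_nonneg hr.1.le (sq_nonneg _))]
  refine (lintegral_mono_set (Ioc_subset_Ioi_self)).trans ?_
  exact (setLIntegral_mono' measurableSet_Ioi fun r hr => by
    rw [ofReal_mul (le_of_lt hr)])

/-! ### Cut-off functions with small gradients -/

/-- The profile of the cut-off functions. -/
def stepDown (x : ℝ) : ℝ := Real.smoothTransition (2 - x)

lemma stepDown_smooth : 𝒞 stepDown :=
  Real.smoothTransition.contDiff.comp (contDiff_const.sub contDiff_id)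

lemma isCutoff_stepDown : IsCutoff 1 stepDown :=
  ⟨stepDown_smooth, fun r hr => Real.smoothTransition.one_of_one_le (by linarith),
    fun r hr => Real.smoothTransition.zero_of_nonpos (by linarith)⟩

lemma stepDown_mem (x : ℝ) : 0 ≤ stepDown x ∧ stepDown x ≤ 1 :=
  ⟨Real.smoothTransition.nonneg _, Real.smoothTransition.le_one _⟩

/-- A cut-off function of one variable. -/
def bump1 (x : ℝ) : ℝ := stepDown x * stepDown (-x)

lemma bump1_smooth : 𝒞 bump1 := stepDown_smooth.mul (stepDown_smooth.comp contDiff_neg)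

lemma bump1_mem (x : ℝ) : 0 ≤ bump1 x ∧ bump1 x ≤ 1 :=
  ⟨mul_nonneg (stepDown_mem _).1 (stepDown_mem _).1,
    mul_le_one₀ (stepDown_mem _).2 (stepDown_mem _).1 (stepDown_mem _).2⟩

lemma bump1_one {x : ℝ} (hx : |x| ≤ 1) : bump1 x = 1 := by
  rw [abs_le] at hx
  rw [bump1, isCutoff_stepDown.one x hx.2, isCutoff_stepDown.one (-x) (by linarith), one_mul]

lemma bump1_zero {x : ℝ} (hx : 2 ≤ |x|) : bump1 x = 0 := by
  rcases le_abs.1 hx with h | h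
  · rw [bump1, isCutoff_stepDown.zero x (by linarith), zero_mul]
  · rw [bump1, isCutoff_stepDown.zero (-x) (by linarith), mul_zero]

lemma bump1_hasCompactSupport : HasCompactSupport bump1 :=
  HasCompactSupport.of_support_subset_isCompact (isCompact_Icc (a := (-2 : ℝ)) (b := 2)) fun x hx => by
    rw [Function.mem_support] at hx
    by_contra h
    refine hx (bump1_zero (le_of_not_gt fun hc => h ?_))
    exact ⟨(abs_lt.1 hc).1.le, (abs_lt.1 hc).2.le⟩

/-- The dilated cut-off function in `z`. -/
def bumpX (c : ℝ) (x : ℝ) : ℝ := bump1 (c * x)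

lemma bumpX_smooth (c : ℝ) : 𝒞 (bumpX c) := bump1_smooth.comp (contDiff_const.mul contDiff_id)

lemma bumpX_zero {c x : ℝ} (hc : 0 < c) (hx : 2 / c ≤ |x|) : bumpX c x = 0 := by
  refine bump1_zero ?_
  rw [abs_mul, abs_of_pos hc, mul_comm]
  rwa [div_le_iff₀ hc] at hx

lemma bumpX_one {c x : ℝ} (hc : 0 < c) (hx : |x| ≤ 1 / c) : bumpX c x = 1 := by
  refine bump1_one ?_
  rw [abs_mul, abs_of_pos hc, mul_comm]
  rwa [le_div_iff₀ hc] at hx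

lemma bumpX_hasCompactSupport {c : ℝ} (hc : 0 < c) : HasCompactSupport (bumpX c) :=
  HasCompactSupport.of_support_subset_isCompact (isCompact_Icc (a := -(2 / c)) (b := 2 / c)) fun x hx => by
    rw [Function.mem_support] at hx
    by_contra h
    refine hx (bumpX_zero hc (le_of_not_gt fun hc => h ?_))
    exact ⟨(abs_lt.1 hc).1.le, (abs_lt.1 hc).2.le⟩

lemma deriv_comp_const_mul (φ : ℝ → ℝ) (c x : ℝ) :
    deriv (fun x => φ (c * x)) x = c * deriv φ (c * x) := by
  rw [deriv_comp_mul_left, smul_eq_mul]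

lemma exists_bumpX_bound : ∃ C : ℝ, 0 ≤ C ∧ ∀ c : ℝ, 0 < c → ∀ x, |deriv (bumpX c) x| ≤ C * c ∧
    |deriv (deriv (bumpX c)) x| ≤ C * c ^ 2 ∧ (|x| < 1 / c → deriv (bumpX c) x = 0) := by
  obtain ⟨C₁, h1⟩ := bump1_hasCompactSupport.deriv.exists_bound_of_continuous
    (contDiff_deriv bump1_smooth).continuous
  obtain ⟨C₂, h2⟩ := bump1_hasCompactSupport.deriv.deriv.exists_bound_of_continuous
    (contDiff_deriv (contDiff_deriv bump1_smooth)).continuous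
  have p1 : 0 ≤ C₁ := (norm_nonneg _).trans (h1 0)
  refine ⟨max C₁ C₂, le_max_of_le_left p1, fun c hc x => ⟨?_, ?_, fun hx => ?_⟩⟩
  · have e : deriv (bumpX c) x = c * deriv bump1 (c * x) := deriv_comp_const_mul _ _ _
    rw [e, abs_mul, abs_of_pos hc, mul_comm]
    exact mul_le_mul_of_nonneg_right ((h1 _).trans (le_max_left _ _)) hc.le
  · have e : deriv (bumpX c) = fun x => c * deriv bump1 (c * x) :=
      funext fun x => deriv_comp_const_mul _ _ _
    have e2 : deriv (deriv (bumpX c)) x = c * (c * deriv (deriv bump1) (c * x)) := by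
      rw [e, deriv_const_mul_field, deriv_comp_const_mul]
    rw [e2, ← mul_assoc, ← pow_two, abs_mul, abs_of_pos (by positivity), mul_comm]
    exact mul_le_mul_of_nonneg_right ((h2 _).trans (le_max_right _ _)) (by positivity)
  · have : bumpX c =ᶠ[nhds x] fun _ => 1 := by
      filter_upwards [(isOpen_lt continuous_abs continuous_const).mem_nhds hx] with y hy
      exact bumpX_one hc (le_of_lt hy)
    rw [this.deriv_eq, deriv_const]

/-- The dilated cut-off function on the half-plane. -/
def bumpF (c : ℝ) : Fam := Z (fun r => stepDown (c * r)) * X (bumpX c)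

lemma bumpF_mem (c s : ℝ) (q : ℝ²) : 0 ≤ bumpF c s q ∧ bumpF c s q ≤ 1 :=
  ⟨mul_nonneg (stepDown_mem _).1 (bump1_mem _).1,
    mul_le_one₀ (stepDown_mem _).2 (bump1_mem _).1 (bump1_mem _).2⟩

lemma bumpF_one {c s : ℝ} (hc : 0 < c) {q : ℝ²} (h1 : q.1 ≤ 1 / c) (h2 : |q.2| ≤ 1 / c) :
    bumpF c s q = 1 := by
  have e1 : stepDown (c * q.1) = 1 := isCutoff_stepDown.one _ (by
    rw [le_div_iff₀ hc] at h1; linarith)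
  have : bumpF c s q = stepDown (c * q.1) * bumpX c q.2 := rfl
  rw [this, e1, bumpX_one hc h2, one_mul]

lemma exists_bumpF_bound : ∃ C : ℝ, 0 ≤ C ∧ ∀ c : ℝ, 0 < c → c ≤ 1 → ∃ φ₁ : Fam,
    Bump (3 / c) (bumpF c) φ₁ ∧ ∀ s q, 0 ≤ q.1 → q.1 ≤ 3 / c →
      |dr (bumpF c) s q| ≤ C * c ∧ |dz (bumpF c) s q| ≤ C * c
      ∧ |(2 * φ₁ + R * dr φ₁ + dz (dz (bumpF c)) : Fam) s q| ≤ C * c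
      ∧ (q.1 < 1 / c → |q.2| < 1 / c → dr (bumpF c) s q = 0 ∧ dz (bumpF c) s q = 0) := by
  obtain ⟨η₁, C, D⟩ := isCutoff_stepDown.exists_cutData one_pos
  obtain ⟨C', hC', hX⟩ := exists_bumpX_bound
  have C1 := D.C_ge
  refine ⟨11 * C + C' , by linarith, fun c hc hc1 => ?_⟩
  have sθ : 𝒞 fun r : ℝ => stepDown (c * r) := stepDown_smooth.comp (contDiff_const.mul contDiff_id)
  have sη : 𝒞 fun r : ℝ => c ^ 2 * η₁ (c * r) :=
    contDiff_const.mul (D.smooth₁.comp (contDiff_const.mul contDiff_id))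
  have aX : ∀ p, 1 ≤ p → Adm (3 / c) p (X (bumpX c)) := fun p hp =>
    Adm.X hp (bumpX_smooth c) (bumpX_hasCompactSupport hc)
  have dθ : deriv (fun r => stepDown (c * r)) = fun r => c * deriv stepDown (c * r) :=
    funext fun r => deriv_comp_const_mul _ _ _
  have c3 : c * (3 / c) = 3 := by field_simp
  have e1 : dr (bumpF c) = Z (fun r => c * deriv stepDown (c * r)) * X (bumpX c) := by
    rw [bumpF, dr_mul (Sm.Z sθ) (Sm.X (bumpX_smooth c)), dr_X, dr_Z, dθ]; ring
  have e2 : dz (bumpF c) = Z (fun r => stepDown (c * r)) * X (deriv (bumpX c)) := by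
    rw [bumpF, dz_mul (Sm.Z sθ) (Sm.X (bumpX_smooth c)), dz_X, dz_Z]; ring
  have e3 : dz (dz (bumpF c)) = Z (fun r => stepDown (c * r)) * X (deriv (deriv (bumpX c))) := by
    rw [e2, dz_mul (Sm.Z sθ) (Sm.X (contDiff_deriv (bumpX_smooth c))), dz_X, dz_Z]; ring
  have e4 : dr (Z (fun r => c ^ 2 * η₁ (c * r)) * X (bumpX c))
      = Z (fun r => c ^ 3 * deriv η₁ (c * r)) * X (bumpX c) := by
    have : deriv (fun r => c ^ 2 * η₁ (c * r)) = fun r => c ^ 3 * deriv η₁ (c * r) := by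
      funext r
      rw [deriv_const_mul_field, deriv_comp_const_mul]; ring
    rw [dr_mul (Sm.Z sη) (Sm.X (bumpX_smooth c)), dr_X, dr_Z, this]; ring
  have hd0 : ∀ x : ℝ, 2 < x → deriv stepDown x = 0 := fun x hx => by
    have : stepDown =ᶠ[nhds x] fun _ => 0 := by
      filter_upwards [isOpen_Ioi.mem_nhds hx] with y hy
      exact isCutoff_stepDown.zero y (by linarith [mem_Ioi.1 hy])
    rw [this.deriv_eq, deriv_const]
  refine ⟨Z (fun r => c ^ 2 * η₁ (c * r)) * X (bumpX c),
    ⟨by positivity, (aX 2 one_le_two).Z_mul sθ, (aX 2 one_le_two).Z_mul sη, ?_, ?_, ?_, ?_⟩, ?_⟩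
  · rw [e1]
    funext s q
    simp only [Pi.mul_apply, Z, X, R, D.deriv_eq]
    ring
  · intro s z
    have : stepDown (c * (3 / c)) = 0 := isCutoff_stepDown.zero _ (by rw [c3]; norm_num)
    simp [bumpF, Z, this]
  · intro s z
    have h3 := hd0 3 (by norm_num)
    rw [D.deriv_eq] at h3
    have : η₁ (c * (3 / c)) = 0 := by rw [c3]; linarith
    simp [Z, this]
  · intro g hg p hp
    rw [bumpF, mul_assoc]
    exact (Adm.X_mul hp (bumpX_smooth c) (bumpX_hasCompactSupport hc) hg).Z_mul sθ
  · intro s q hq hq3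
    obtain ⟨x1, x2, x3⟩ := hX c hc q.2
    have b0 := bump1_mem (c * q.2)
    have bX : |bumpX c q.2| ≤ 1 := by
      rw [bumpX, abs_of_nonneg b0.1]; exact b0.2
    have bθ : |stepDown (c * q.1)| ≤ 1 := by
      rw [abs_of_nonneg (stepDown_mem _).1]; exact (stepDown_mem _).2
    have hcq : 0 ≤ c * q.1 := by positivity
    have hcq3 : c * q.1 ≤ 3 := by rw [← c3]; gcongr
    have cc : c ^ 2 ≤ c := by nlinarith
    refine ⟨?_, ?_, ?_, fun h1 h2 => ⟨?_, ?_⟩⟩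
    · rw [e1]
      simp only [Pi.mul_apply, Z, X, abs_mul, abs_of_pos hc]
      have := D.bd_deriv (c * q.1)
      calc c * |deriv stepDown (c * q.1)| * |bumpX c q.2| ≤ c * C * 1 := by gcongr
        _ ≤ _ := by nlinarith
    · rw [e2]
      simp only [Pi.mul_apply, Z, X, abs_mul]
      calc |stepDown (c * q.1)| * |deriv (bumpX c) q.2| ≤ 1 * (C' * c) := by gcongr
        _ ≤ _ := by nlinarith
    · rw [e3, e4]
      simp only [Pi.add_apply, Pi.mul_apply, ofNat_apply, Z, X, R]
      have h1 := D.bd₁ (c * q.1)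
      have h2 := D.bd_deriv₁ (c * q.1) hcq
      have g1 : |2 * (c ^ 2 * η₁ (c * q.1) * bumpX c q.2)| ≤ 2 * (c ^ 2 * C * 1) := by
        simp only [abs_mul, abs_two, abs_of_pos (pow_pos hc 2)]; gcongr
      have g2 : |q.1 * (c ^ 3 * deriv η₁ (c * q.1) * bumpX c q.2)| ≤ 9 * C * c ^ 2 := by
        have : q.1 * (c ^ 3 * deriv η₁ (c * q.1) * bumpX c q.2)
            = c ^ 2 * ((c * q.1) * deriv η₁ (c * q.1)) * bumpX c q.2 := by ring
        rw [this]
        simp only [abs_mul, abs_of_pos (pow_pos hc 2), abs_of_nonneg hcq]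
        calc c ^ 2 * (c * q.1 * |deriv η₁ (c * q.1)|) * |bumpX c q.2|
            ≤ c ^ 2 * (3 * (C * 3)) * 1 := by
              gcongr
              exact h2.trans (by gcongr)
          _ = _ := by ring
      have g3 : |stepDown (c * q.1) * deriv (deriv (bumpX c)) q.2| ≤ 1 * (C' * c ^ 2) := by
        rw [abs_mul]; gcongr
      refine (abs_add_three _ _ _).trans ?_
      have : (11 * C + C') * c ^ 2 ≤ (11 * C + C') * c := by gcongr
      linarith
    · rw [e1]
      have : c * q.1 < 1 := by rw [lt_div_iff₀ hc] at h1; linarith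
      have : deriv stepDown (c * q.1) = 0 := by
        have h : stepDown =ᶠ[nhds (c * q.1)] fun _ => 1 := by
          filter_upwards [isOpen_Iio.mem_nhds this] with y hy
          exact isCutoff_stepDown.one y (le_of_lt hy)
        rw [h.deriv_eq, deriv_const]
      simp [Z, this]
    · rw [e2]
      simp [X, x3 h2]

section

/-! ### Bounds for the terms of the energy balance -/

lemma JS.measurable_indicator {I : Set ℝ} {O : Set ℝ²} {g : Fam} (h : JS I O g)
    (hI : MeasurableSet I) (hO : MeasurableSet O) :
    Measurable ((I ×ˢ O).indicator fun y : ℝ × ℝ² => g y.1 y.2) := by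
  classical
  rw [← piecewise_eq_indicator]
  exact ContinuousOn.measurable_piecewise h.continuousOn continuousOn_const (hI.prod hO)

/-- Rotations about the axis as linear maps. -/
def rotL (θ : ℝ) : E3 →ₗᵢ[ℝ] E3 where
  toFun := rotZ θ
  map_add' x y := by ext i; fin_cases i <;> simp [rotZ] <;> ring
  map_smul' c x := by ext i; fin_cases i <;> simp [rotZ] <;> ring
  norm_map' x := by
    rw [EuclideanSpace.norm_eq, EuclideanSpace.norm_eq]
    congr 1
    simp [Fin.sum_univ_three, rotZ]
    linear_combination (x 0 ^ 2 + x 1 ^ 2) * Real.sin_sq_add_cos_sq θ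

lemma rotZ_neg_rotZ (θ : ℝ) (x : E3) : rotZ (-θ) (rotZ θ x) = x := by
  ext i; fin_cases i <;> simp [rotZ]
  · linear_combination x 0 * Real.sin_sq_add_cos_sq θ
  · linear_combination x 1 * Real.sin_sq_add_cos_sq θ

lemma norm_fderiv_rotZ_le {g : E3 → ℝ} (hg : Differentiable ℝ g) (h : AxisymScal g) (θ : ℝ) (x : E3) :
    ‖fderiv ℝ g x‖ ≤ ‖fderiv ℝ g (rotZ θ x)‖ := by
  have h1 : HasFDerivAt (fun x => g (rotZ θ x))
      ((fderiv ℝ g (rotZ θ x)).comp (rotL θ).toContinuousLinearMap) x :=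
    (hg (rotZ θ x)).hasFDerivAt.comp x (rotL θ).toContinuousLinearMap.hasFDerivAt
  have e : (fun x => g (rotZ θ x)) = g := funext fun x => h θ x
  rw [e] at h1
  rw [h1.fderiv]
  exact (ContinuousLinearMap.opNorm_comp_le _ _).trans
    (mul_le_of_le_one_right (norm_nonneg _) (LinearIsometry.norm_toContinuousLinearMap_le _))

lemma norm_fderiv_rotZ {g : E3 → ℝ} (hg : Differentiable ℝ g) (h : AxisymScal g) (θ : ℝ) (x : E3) :
    ‖fderiv ℝ g (rotZ θ x)‖ = ‖fderiv ℝ g x‖ := by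
  refine le_antisymm ?_ (norm_fderiv_rotZ_le hg h θ x)
  have := norm_fderiv_rotZ_le hg h (-θ) (rotZ θ x)
  rwa [rotZ_neg_rotZ] at this

/-- The squared pressure gradient on the half-plane. -/
def presGrad (t : ℝ) (p : ℝ → E3 → ℝ) (s : ℝ) (q : ℝ²) : ENNReal :=
  ofReal ((|dr (presE t p) s q| + |dz (presE t p) s q|) ^ 2)

/-- The part of the half-plane outside of a large box. -/
def outBox (c : ℝ) : Set ℝ² := {q | q.1 < 1 / c ∧ |q.2| < 1 / c}ᶜ

lemma measurableSet_outBox (c : ℝ) : MeasurableSet (outBox c) :=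
  ((isOpen_lt continuous_fst continuous_const).inter
    (isOpen_lt (continuous_abs.comp continuous_snd) continuous_const)).measurableSet.compl

lemma two_le_two_pi : (4 : ENNReal) ≤ ofReal (2 * Real.pi) := by
  rw [show (4 : ENNReal) = ofReal 4 by norm_num]
  exact ofReal_le_ofReal (by linarith [Real.pi_gt_three])

namespace IsRegularSolution

variable {ν t : ℝ} {v : ℝ → E3 → E3} {p : ℝ → E3 → ℝ} {f : ℝ → E3 → E3}
  (H : IsRegularSolution ν t v p f)
include H

lemma lintegral_presGrad_le {s : ℝ} (hs : s ∈ Ioo 0 t) : (∫⁻ q, presGrad t p s q ∂cyl) ^ (1 / 2 : ℝ)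
      ≤ eLpNorm (fun x => ‖fderiv ℝ (p s) x‖) 2 volume := by
  have hp : 𝒞 (p s) := by
    have := H.smooth_p_slice s
    rwa [indicator_of_mem hs] at this
  have hd : Differentiable ℝ (p s) := hp.differentiable (by simp)
  have hm : Measurable fun x => ‖fderiv ℝ (p s) x‖ₑ ^ 2 :=
    ((hp.continuous_fderiv (by simp)).measurable.enorm).pow_const 2
  have h1 := lintegral_space_eq_cyl hm fun θ x => by
    rw [← ofReal_norm, ← ofReal_norm, norm_fderiv_rotZ hd (H.axisym_p s hs)]
  have h2 : ∫⁻ q, presGrad t p s q ∂cyl ≤ ∫⁻ x, ‖fderiv ℝ (p s) x‖ₑ ^ 2 := by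
    rw [h1]
    refine le_trans ?_ (mul_le_mul_left two_le_two_pi _)
    rw [← lintegral_const_mul' _ _ (by norm_num)]
    refine lintegral_mono fun q => ?_
    have e1 : dr (presE t p) s q = pd 0 (p s) (pt q) := by
      rw [presE, dr_onPlane H.smooth_p_slice, onPlane, indicator_of_mem hs]
    have e2 : dz (presE t p) s q = pd 2 (p s) (pt q) := by
      rw [presE, dz_onPlane H.smooth_p_slice, onPlane, indicator_of_mem hs]
    have b : ∀ j, |pd j (p s) (pt q)| ≤ ‖fderiv ℝ (p s) (pt q)‖ := fun j => by
      have := (fderiv ℝ (p s) (pt q)).le_opNorm (single j 1)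
      simpa [pd] using this
    rw [presGrad, e1, e2, show (4 : ENNReal) = ofReal 4 by norm_num, ← ofReal_norm,
      ← ofReal_pow (norm_nonneg _), ← ofReal_mul (by norm_num)]
    refine ofReal_le_ofReal ?_
    calc _ ≤ (‖fderiv ℝ (p s) (pt q)‖ + ‖fderiv ℝ (p s) (pt q)‖) ^ 2 := by
          gcongr <;> exact b _
      _ = _ := by ring
  rw [← sq_rpow_half (eLpNorm _ 2 _), eLpNorm_two_sq]
  simp only [enorm_norm]
  exact rpow_le_rpow h2 (by norm_num)

lemma js_presE : JS (Ioo 0 t) univ (presE t p) := by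
  have h2 : ContDiffOn ℝ ∞ (fun y : ℝ × ℝ² => p y.1 (pt y.2)) (Ioo 0 t ×ˢ univ) :=
    H.smooth_p.comp (f := fun y : ℝ × ℝ² => (y.1, pt y.2))
      (contDiff_fst.prodMk (contDiff_pt.comp contDiff_snd)).contDiffOn
      fun y hy => ⟨hy.1, mem_univ _⟩
  exact h2.congr fun y hy => by rw [presE, onPlane, indicator_of_mem hy.1]

lemma measurable_presGrad : Measurable fun y : ℝ × ℝ² => presGrad t p y.1 y.2 := by
  have key : ∀ {g : Fam}, JS (Ioo 0 t) univ g → (∀ s ∉ Ioo 0 t, ∀ q, g s q = 0) →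
      Measurable fun y : ℝ × ℝ² => g y.1 y.2 := fun {g} hg h0 => by
    have h1 := hg.measurable_indicator measurableSet_Ioo .univ
    have e : (Ioo 0 t ×ˢ univ).indicator (fun y : ℝ × ℝ² => g y.1 y.2) = fun y => g y.1 y.2 :=
      indicator_eq_self.2 fun y hy => ⟨by_contra fun hc => hy (h0 _ hc _), mem_univ _⟩
    rwa [e] at h1
  have h1 := key (H.js_presE.dr isOpen_Ioo.uniqueDiffOn isOpen_univ) fun s hs q => by
    simp [dr, presE, onPlane, indicator_of_notMem hs]
  have h2 := key (H.js_presE.dz isOpen_Ioo.uniqueDiffOn isOpen_univ) fun s hs q => by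
    simp [dz, presE, onPlane, indicator_of_notMem hs]
  exact ((h1.norm.add h2.norm).pow_const 2).ennreal_ofReal

lemma measurable_presGrad_outBox (c : ℝ) :
    Measurable fun s => ∫⁻ q in outBox c, presGrad t p s q ∂cyl := by
  have hsf : SFinite (cyl.restrict (outBox c)) := by rw [cyl]; infer_instance
  exact Measurable.lintegral_prod_right' (f := fun y : ℝ × ℝ² => presGrad t p y.1 y.2)
    H.measurable_presGrad

lemma tendsto_presGrad_slice {s : ℝ} (hs : ∫⁻ q, presGrad t p s q ∂cyl ≠ ⊤) :
    Tendsto (fun n : ℕ => ∫⁻ q in outBox (1 / ((n : ℝ) + 1)), presGrad t p s q ∂cyl)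
      atTop (nhds 0) := by
  have e0 : (∫⁻ q, (0 : ENNReal) ∂cyl) = 0 := by simp
  rw [← e0]
  simp only [← lintegral_indicator (measurableSet_outBox _)]
  have ms : Measurable (presGrad t p s) :=
    Measurable.of_uncurry_left (f := presGrad t p) H.measurable_presGrad
  refine tendsto_lintegral_of_dominated_convergence (presGrad t p s)
    (fun n => ms.indicator (measurableSet_outBox _))
    (fun n => ae_of_all _ fun q => indicator_le_self _ _ q) hs (ae_of_all _ fun q => ?_)
  refine tendsto_const_nhds.congr' ?_
  obtain ⟨k, hk⟩ := exists_nat_gt (max q.1 |q.2|)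
  filter_upwards [Filter.eventually_ge_atTop k] with n hn
  have hkn : (k : ℝ) ≤ n := by exact_mod_cast hn
  rw [indicator_of_notMem]
  simp only [outBox, one_div_one_div, mem_compl_iff, mem_ofPred_eq, not_not]
  exact ⟨by linarith [le_max_left q.1 |q.2|], by linarith [le_max_right q.1 |q.2|]⟩

/-- The tails of the pressure gradient are negligible. -/
lemma tendsto_presGrad : Tendsto (fun n : ℕ => ∫⁻ s in Ioo 0 t,
    (∫⁻ q in outBox (1 / ((n : ℝ) + 1)), presGrad t p s q ∂cyl) ^ (1 / 2 : ℝ)) atTop (nhds 0) := by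
  have e0 : (∫⁻ s in Ioo 0 t, (0 : ENNReal)) = 0 := by simp
  rw [← e0]
  have hsf : SFinite cyl := by rw [cyl]; infer_instance
  have m1 : Measurable fun s => (∫⁻ q, presGrad t p s q ∂cyl) ^ (1 / 2 : ℝ) :=
    (Measurable.lintegral_prod_right' (f := fun y : ℝ × ℝ² => presGrad t p y.1 y.2)
      H.measurable_presGrad).pow_const _
  have hfin : ∫⁻ s in Ioo 0 t, (∫⁻ q, presGrad t p s q ∂cyl) ^ (1 / 2 : ℝ) < ⊤ :=
    (setLIntegral_mono' measurableSet_Ioo fun s hs => H.lintegral_presGrad_le hs).trans_lt H.grad_p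
  refine tendsto_lintegral_of_dominated_convergence
    (fun s => (∫⁻ q, presGrad t p s q ∂cyl) ^ (1 / 2 : ℝ))
    (fun n => (H.measurable_presGrad_outBox _).pow_const _) (fun n => ?_) hfin.ne ?_
  · refine ae_of_all _ fun s => rpow_le_rpow ?_ (by norm_num)
    exact lintegral_mono' Measure.restrict_le_self le_rfl
  · filter_upwards [ae_lt_top m1 hfin.ne] with s hs
    have hfs : ∫⁻ q, presGrad t p s q ∂cyl ≠ ⊤ := by
      intro hc
      rw [hc, ENNReal.top_rpow_of_pos (by norm_num)] at hs
      exact lt_irrefl _ hs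
    have := (H.tendsto_presGrad_slice hfs).ennrpow_const (1 / 2)
    simpa using this

end IsRegularSolution

/-! ### The energy inequality -/

lemma ofReal_add_le_of_add_eq {T x y : ℝ} (hx : 0 ≤ x) (h : T + x = y) :
    ofReal T + ofReal x ≤ ofReal |y| + ofReal (-T) := by
  rcases le_total 0 T with hT | hT
  · rw [← ofReal_add hT hx, h]
    exact (ofReal_le_ofReal (le_abs_self y)).trans le_self_add
  · rw [ENNReal.ofReal_of_nonpos hT, zero_add, ← ofReal_add (abs_nonneg _) (by linarith)]
    exact ofReal_le_ofReal (by linarith [le_abs_self y])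

lemma strip_le_cyl (ρ : ℝ) : strip ρ ≤ cyl := Measure.restrict_le_self

/-- The kinetic energy. -/
def enE (h β w : Fam) (s : ℝ) : ENNReal := ∫⁻ q, ofReal (kinE h β w s q) ∂cyl

lemma kinE_nonneg (h β w : Fam) (s : ℝ) (q : ℝ²) : 0 ≤ kinE h β w s q := by
  simp only [kinE, Pi.smul_apply, Pi.add_apply, Pi.pow_apply, smul_eq_mul]; positivity

lemma dissE_nonneg (h β w : Fam) (s : ℝ) (q : ℝ²) : 0 ≤ dissE h β w s q := by
  simp only [dissE, Pi.add_apply, Pi.pow_apply]; positivity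

/-! ### The energy inequality in the whole half-plane -/

lemma JS.aemeasurable_lintegral {I : Set ℝ} {g : Fam} (hg : JS I ℝ²₊ g)
    (hI : MeasurableSet I) (A : Set ℝ²) {Φ : ℝ → ENNReal} (hΦ : Measurable Φ) :
    AEMeasurable (fun s => ∫⁻ q in A, Φ (g s q) ∂cyl) (volume.restrict I) := by
  have hsf : SFinite (cyl.restrict A) := by rw [cyl]; infer_instance
  refine ⟨_, Measurable.lintegral_prod_right' (ν := cyl.restrict A) (f := fun y : ℝ × ℝ² => Φ
      (((I ×ˢ ℝ²₊).indicator fun y : ℝ × ℝ² => g y.1 y.2) y))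
    (hΦ.comp (hg.measurable_indicator hI (measurableSet_Ioi.prod MeasurableSet.univ))), ?_⟩
  filter_upwards [ae_restrict_mem hI] with s hs
  refine lintegral_congr_ae (ae_restrict_of_ae (ae_cyl fun q hq => ?_))
  simp only
  rw [indicator_of_mem]
  exact ⟨hs, hq, mem_univ _⟩

/-- Boxes that exhaust the half-plane. -/
def inBox (k : ℕ) : Set ℝ² := {q | q.1 < (k : ℝ) + 1 ∧ |q.2| < (k : ℝ) + 1}

lemma monotone_inBox : Monotone inBox := fun k n hkn q hq => by
  have : (k : ℝ) ≤ n := by exact_mod_cast hkn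
  exact ⟨by linarith [hq.1], by linarith [hq.2]⟩

lemma iUnion_inBox : ⋃ k, inBox k = univ := by
  refine eq_univ_of_forall fun q => ?_
  obtain ⟨k, hk⟩ := exists_nat_gt (max q.1 |q.2|)
  exact mem_iUnion.2 ⟨k, by linarith [le_max_left q.1 |q.2|], by linarith [le_max_right q.1 |q.2|]⟩

lemma iSup_inBox (g : ℝ² → ENNReal) : ⨆ k, ∫⁻ q in inBox k, g q ∂cyl = ∫⁻ q, g q ∂cyl := by
  rw [← setLIntegral_iUnion_of_directed _ monotone_inBox.directed_le, iUnion_inBox,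
    restrict_univ]

lemma tendsto_inBox (g : ℝ² → ENNReal) :
    Tendsto (fun k => ∫⁻ q in inBox k, g q ∂cyl) atTop (nhds (∫⁻ q, g q ∂cyl)) := by
  rw [← iSup_inBox]
  exact tendsto_atTop_iSup fun k n hkn => lintegral_mono_set (monotone_inBox hkn)

lemma tendsto_time_inBox {I J : Set ℝ} {g : Fam} (hg : JS I ℝ²₊ g) (hI : MeasurableSet I)
    (hJI : J ⊆ I) : Tendsto (fun k => ∫⁻ s in J, ∫⁻ q in inBox k, ofReal (g s q) ∂cyl) atTop
      (nhds (∫⁻ s in J, ∫⁻ q, ofReal (g s q) ∂cyl)) := by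
  rw [(lintegral_congr fun s => (iSup_inBox _).symm).trans (lintegral_iSup'
    (fun k => (hg.aemeasurable_lintegral hI _ measurable_ofReal).mono_measure
      (Measure.restrict_mono hJI le_rfl))
    (ae_of_all _ fun s k n hkn => lintegral_mono_set (monotone_inBox hkn)))]
  exact tendsto_atTop_iSup fun k n hkn => lintegral_mono fun s => lintegral_mono_set (monotone_inBox hkn)

lemma inBox_subset (k n : ℕ) (h : k ≤ n) {s : ℝ} {q : ℝ²} (hq : q ∈ inBox k) :
    bumpF (1 / ((n : ℝ) + 1)) s q = 1 := by
  have : (k : ℝ) ≤ n := by exact_mod_cast h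
  refine bumpF_one (by positivity) ?_ ?_ <;> rw [one_div_one_div]
  · linarith [hq.1]
  · linarith [hq.2]

lemma measurableSet_inBox (k : ℕ) : MeasurableSet (inBox k) :=
  ((isOpen_lt continuous_fst continuous_const).inter
    (isOpen_lt (continuous_abs.comp continuous_snd) continuous_const)).measurableSet

lemma lintegral_inBox_le {k n : ℕ} (h : k ≤ n) {g : Fam} {s : ℝ} (hg : ∀ q, 0 ≤ g s q) :
    ∫⁻ q in inBox k, ofReal (g s q) ∂cyl
      ≤ ∫⁻ q, ofReal ((bumpF (1 / ((n : ℝ) + 1)) * g) s q) ∂strip (3 / (1 / ((n : ℝ) + 1))) := by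
  have hkn : (k : ℝ) ≤ n := by exact_mod_cast h
  have h1 : inBox k ⊆ Iio (3 / (1 / ((n : ℝ) + 1))) ×ˢ univ := fun q hq => ⟨by
    rw [div_div_eq_mul_div, div_one]
    show q.1 < _
    have h0 : (0 : ℝ) ≤ n := by positivity
    linarith [hq.1], mem_univ _⟩
  have h2 : cyl.restrict (inBox k) ≤ strip (3 / (1 / ((n : ℝ) + 1))) := Measure.restrict_mono h1 le_rfl
  calc _ ≤ ∫⁻ q in inBox k, ofReal ((bumpF (1 / ((n : ℝ) + 1)) * g) s q) ∂cyl := by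
        refine setLIntegral_mono' (measurableSet_inBox k) fun q hq => ?_
        rw [Pi.mul_apply, Pi.mul_apply, inBox_subset k n h hq, one_mul]
    _ ≤ _ := lintegral_mono' h2 le_rfl

end

lemma second_deriv_test {g : ℝ → ℝ} {x A k : ℝ} (hg : 𝒞 g)
    (h : IsLocalMax (fun r => g r - (A + k * r ^ 2)) x) :
    deriv g x = 2 * k * x ∧ deriv (deriv g) x ≤ 2 * k := by
  have d1 : deriv (fun r => g r - (A + k * r ^ 2)) = fun r => deriv g r - 2 * k * r := by
    funext r
    have h1 := ((hg.differentiable (by simp)) r).hasDerivAt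
    have h2 := (((hasDerivAt_id r).pow 2).const_mul k).const_add A
    refine (h1.sub h2).deriv.trans ?_
    simp; ring
  have d2 : deriv (deriv fun r => g r - (A + k * r ^ 2)) x = deriv (deriv g) x - 2 * k := by
    rw [d1]
    have h1 := (((contDiff_deriv hg).differentiable (by simp)) x).hasDerivAt
    have h2 := (hasDerivAt_id x).const_mul (2 * k)
    refine (h1.sub h2).deriv.trans ?_
    simp
  have e1 := h.deriv_eq_zero
  refine ⟨by rw [d1] at e1; linarith, ?_⟩
  by_contra hc
  have hmin : IsLocalMin (fun r => g r - (A + k * r ^ 2)) x :=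
    isLocalMin_of_deriv_deriv_pos (by rw [d2]; linarith [not_le.1 hc]) e1
      (hg.continuous.sub (by fun_prop)).continuousAt
  have hconst : (fun r => g r - (A + k * r ^ 2)) =ᶠ[nhds x] fun _ => g x - (A + k * x ^ 2) := by
    filter_upwards [h, hmin] with r h1 h2 using le_antisymm h1 h2
  have := hconst.deriv.deriv_eq
  rw [d2] at this
  simp at this
  linarith [not_le.1 hc]

lemma toReal_lintegral_Ioc {N : ℝ → ENNReal} {T s₁ s₂ : ℝ} (hN : ∫⁻ τ in Ioc 0 T, N τ ≠ ⊤)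
    (h1 : 0 ≤ s₁) (h12 : s₁ ≤ s₂) (h2 : s₂ ≤ T) :
    (∫⁻ τ in Ioc 0 s₂, N τ).toReal
      = (∫⁻ τ in Ioc 0 s₁, N τ).toReal + (∫⁻ τ in Ioc s₁ s₂, N τ).toReal := by
  have hd : Disjoint (Ioc 0 s₁) (Ioc s₁ s₂) :=
    Set.disjoint_left.2 fun x hx hx' => absurd hx.2 (not_le.2 hx'.1)
  rw [← Ioc_union_Ioc_eq_Ioc h1 h12, lintegral_union measurableSet_Ioc hd, ENNReal.toReal_add]
  · exact ne_top_of_le_ne_top hN (lintegral_mono_set (Ioc_subset_Ioc_right (h12.trans h2)))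
  · exact ne_top_of_le_ne_top hN (lintegral_mono_set (Ioc_subset_Ioc h1 h2))

lemma continuousOn_toReal_lintegral {N : ℝ → ENNReal} {T : ℝ} (hN : ∫⁻ τ in Ioc 0 T, N τ ≠ ⊤) :
    ContinuousOn (fun s => (∫⁻ τ in Ioc 0 s, N τ).toReal) (Icc 0 T) := by
  intro s₀ hs₀
  have hz : Tendsto (fun s => ∫⁻ τ in uIoc s₀ s, N τ ∂(volume.restrict (Ioc 0 T)))
      (nhdsWithin s₀ (Icc 0 T)) (nhds 0) := by
    refine tendsto_setLIntegral_zero hN ?_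
    have h1 : Tendsto (fun s => ofReal |s - s₀|) (nhdsWithin s₀ (Icc 0 T)) (nhds 0) := by
      have : Continuous fun s => ofReal |s - s₀| := continuous_ofReal.comp (by fun_prop)
      have h2 := (this.tendsto s₀).mono_left (nhdsWithin_le_nhds (s := Icc 0 T))
      simpa using h2
    refine tendsto_of_tendsto_of_tendsto_of_le_of_le tendsto_const_nhds h1 (fun _ => zero_le)
      fun s => ?_
    exact (Measure.restrict_apply_le _ _).trans (by rw [Real.volume_uIoc])
  have hz' := (ENNReal.tendsto_toReal ENNReal.zero_ne_top).comp hz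
  rw [ENNReal.toReal_zero] at hz'
  rw [ContinuousWithinAt, tendsto_iff_dist_tendsto_zero]
  refine hz'.congr' ?_
  filter_upwards [self_mem_nhdsWithin] with s hs
  have key : ∀ a b : ℝ, 0 ≤ a → a ≤ b → b ≤ T →
      (∫⁻ τ in uIoc a b, N τ ∂(volume.restrict (Ioc 0 T))).toReal
        = |(∫⁻ τ in Ioc 0 b, N τ).toReal - (∫⁻ τ in Ioc 0 a, N τ).toReal| := by
    intro a b ha hab hb
    rw [toReal_lintegral_Ioc hN ha hab hb, add_sub_cancel_left, abs_of_nonneg toReal_nonneg,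
      Measure.restrict_restrict measurableSet_uIoc, uIoc_of_le hab,
      inter_eq_left.2 (Ioc_subset_Ioc ha hb)]
  rw [Real.dist_eq]
  simp only [Function.comp_apply]
  rcases le_total s₀ s with hle | hle
  · rw [key s₀ s hs₀.1 hle hs.2]
  · rw [uIoc_comm, key s s₀ hs.1 hle hs₀.2, abs_sub_comm]

lemma le_deriv_of_lintegral {φ : ℝ → ℝ} {φ' F s : ℝ} {N : ℝ → ENNReal} {f : ℝ → ℝ} (hs : 0 < s)
    (hφ : HasDerivAt φ φ' s) (hf : ContinuousAt f s) (hF : f s = F)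
    (hN : ∀ τ ∈ Ioc 0 s, ofReal (f τ) ≤ N τ) (hfin : ∫⁻ τ in Ioc 0 s, N τ ≠ ⊤)
    (h : ∀ τ, 0 ≤ τ → τ < s → φ τ + (∫⁻ τ in Ioc τ s, N τ).toReal ≤ φ s) : F ≤ φ' := by
  refine le_of_forall_lt fun c hc => ?_
  obtain ⟨c', hc1, hc2⟩ := exists_between hc
  refine hc1.trans_le ?_
  have hslope := (hasDerivAt_iff_tendsto_slope.1 hφ).mono_left
    (nhdsWithin_mono s (fun x (hx : x ∈ Iio s) => ne_of_lt hx))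
  refine ge_of_tendsto hslope ?_
  have hev : ∀ᶠ τ in nhds s, c' < f τ := hf.eventually (lt_mem_nhds (hF ▸ hc2))
  obtain ⟨δ, hδ, hball⟩ := Metric.eventually_nhds_iff.1 hev
  filter_upwards [self_mem_nhdsWithin,
    nhdsWithin_le_nhds (isOpen_Ioi.mem_nhds (max_lt hs (sub_lt_self s hδ) : max 0 (s - δ) < s))]
    with τ h1 h2
  have h1 : τ < s := h1
  obtain ⟨h3, h4⟩ := max_lt_iff.1 (mem_Ioi.1 h2)
  have h5 : ofReal c' * ofReal (s - τ) ≤ ∫⁻ τ in Ioc τ s, N τ := by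
    rw [← Real.volume_Ioc, ← setLIntegral_const]
    refine setLIntegral_mono' measurableSet_Ioc fun x hx => ?_
    refine (ofReal_le_ofReal (hball ?_).le).trans (hN x ⟨h3.trans hx.1, hx.2⟩)
    rw [Real.dist_eq, abs_lt]
    constructor <;> linarith [hx.1, hx.2]
  have h6 : c' * (s - τ) ≤ (∫⁻ τ in Ioc τ s, N τ).toReal := by
    have hft : ∫⁻ τ in Ioc τ s, N τ ≠ ⊤ :=
      ne_top_of_le_ne_top hfin (lintegral_mono_set (Ioc_subset_Ioc_left h3.le))
    have := toReal_mono hft h5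
    rw [ENNReal.toReal_mul, toReal_ofReal (sub_nonneg.2 h1.le), ENNReal.toReal_ofReal'] at this
    exact (mul_le_mul_of_nonneg_right (le_max_left _ _) (sub_nonneg.2 h1.le)).trans this
  have h7 := h τ h3.le h1
  rw [slope_def_field, ← neg_div_neg_eq, le_div_iff₀ (by linarith)]
  linarith

lemma penalty_contra {k K W M ν ρ z a w d D E : ℝ} (hk : 0 < k) (hρ : 0 ≤ ρ) (hM : 0 ≤ M) (hν : 0 < ν)
    (hW : W = 1 + ρ ^ 2 + z ^ 2) (hK : K = 2 * M + 2 * ν + 1) (ha : |a| ≤ M) (hw : |w| ≤ M)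
    (hD : D ≤ 2 * k) (hE : E ≤ 2 * k)
    (h : d + a * (2 * k * ρ) + w * (2 * k * z) - ν * (D - 2 * k + E) ≤ d - K * (k * W)) : False := by
  have h5 : ν * (D - 2 * k + E) ≤ ν * (2 * k) := mul_le_mul_of_nonneg_left (by linarith) hν.le
  have h6 : -(M * ρ) ≤ a * ρ := by
    have := mul_le_mul_of_nonneg_right (abs_le.1 ha).1 hρ; linarith
  have h7 : -(M * |z|) ≤ w * z := by
    have : |w * z| ≤ M * |z| := by
      rw [abs_mul]; exact mul_le_mul_of_nonneg_right hw (abs_nonneg _)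
    exact (abs_le.1 this).1
  have h8 : K * W ≤ 2 * M * (ρ + |z|) + 2 * ν := by
    have h9 : k * (K * W) ≤ k * (2 * M * (ρ + |z|) + 2 * ν) := by
      have i6 := mul_le_mul_of_nonneg_left h6 hk.le
      have i7 := mul_le_mul_of_nonneg_left h7 hk.le
      linarith
    exact le_of_mul_le_mul_left h9 hk
  have hW1 : 1 ≤ W := by nlinarith
  have h10 : ρ + |z| ≤ W := by
    nlinarith [sq_nonneg (ρ - 1), sq_nonneg (|z| - 1), sq_abs z]
  have h11 : 2 * M * (ρ + |z|) ≤ 2 * M * W := mul_le_mul_of_nonneg_left h10 (by linarith)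
  have h12 : 2 * ν ≤ 2 * ν * W := le_mul_of_one_le_right (by linarith) hW1
  have h13 : K * W = 2 * M * W + 2 * ν * W + W := by rw [hK]; ring
  linarith

/-- The maximum principle for the equation of the swirl. -/
lemma swirl_le {T ν M e₀ : ℝ} {U a w F : Fam} {N : ℝ → ENNReal} (hν : 0 < ν) (hM : 0 ≤ M) (he : 0 ≤ e₀)
    (hc : ContinuousOn (fun y : ℝ × ℝ² => U y.1 y.2) (Icc 0 T ×ˢ univ)) (hU : Sm U)
    (ht : ∀ s ∈ Ioc 0 T, ∀ q : ℝ², HasDerivAt (fun τ => U τ q) (dt U s q) s)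
    (ha : ∀ s q, |a s q| ≤ M) (hw : ∀ s q, |w s q| ≤ M)
    (hF : ∀ s ∈ Ioc 0 T, ∀ q : ℝ², 0 < q.1 → F s q = dt U s q + a s q * dr U s q + w s q * dz U s q
      - ν * (dr (dr U) s q - dr U s q / q.1 + dz (dz U) s q))
    (hFc : ∀ s ∈ Ioc 0 T, ∀ q : ℝ², 0 < q.1 → ContinuousAt (fun τ => F τ q) s)
    (hFN : ∀ s ∈ Ioc 0 T, ∀ q : ℝ², 0 < q.1 → ofReal (F s q) ≤ N s)
    (hN : ∫⁻ τ in Ioc 0 T, N τ ≠ ⊤) (hUM : ∀ s q, 0 ≤ q.1 → U s q ≤ M * q.1)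
    (hU₀ : ∀ q : ℝ², 0 ≤ q.1 → U 0 q ≤ e₀) {s : ℝ} (hs : s ∈ Icc 0 T) {q : ℝ²}
    (hq : 0 ≤ q.1) : U s q ≤ e₀ + (∫⁻ τ in Ioc 0 s, N τ).toReal := by
  by_contra hcon
  rw [not_le] at hcon
  set I : ℝ → ℝ := fun s => (∫⁻ τ in Ioc 0 s, N τ).toReal with hI
  have hI0 : ∀ s, 0 ≤ I s := fun s => toReal_nonneg
  set K : ℝ := 2 * M + 2 * ν + 1 with hK
  set W : ℝ² → ℝ := fun q => 1 + q.1 ^ 2 + q.2 ^ 2 with hW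
  have hW1 : ∀ q, 1 ≤ W q := fun q => by rw [hW]; nlinarith [sq_nonneg q.1, sq_nonneg q.2]
  set η := U s q - (e₀ + I s) with hη
  have hη0 : 0 < η := sub_pos.2 hcon
  set δ := η / (2 * (exp (K * s) * W q)) with hδ
  have hpos : 0 < exp (K * s) * W q := mul_pos (Real.exp_pos _) (by linarith [hW1 q])
  have hδ0 : 0 < δ := by positivity
  have hδη : δ * (exp (K * s) * W q) = η / 2 := by
    rw [hδ]
    field_simp [hpos.ne', (zero_lt_one.trans_le (hW1 q)).ne']
  set Λ : ℝ := max (max q.1 |q.2|) (M / δ) + 1 with hΛ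
  have hΛ1 : q.1 ≤ Λ := by
    linarith [(le_max_left q.1 |q.2|).trans (le_max_left (max q.1 |q.2|) (M / δ))]
  have hΛ2 : |q.2| ≤ Λ := by
    linarith [(le_max_right q.1 |q.2|).trans (le_max_left (max q.1 |q.2|) (M / δ))]
  have hΛ3 : M ≤ δ * Λ := by
    have : M / δ ≤ Λ := by linarith [le_max_right (max q.1 |q.2|) (M / δ)]
    rw [div_le_iff₀ hδ0] at this; linarith
  have hΛ0 : 0 ≤ Λ := hq.trans hΛ1
  set G : ℝ × ℝ² → ℝ := fun y => U y.1 y.2 - I y.1 - δ * (exp (K * y.1) * W y.2) with hG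
  set B : Set (ℝ × ℝ²) := Icc 0 T ×ˢ (Icc 0 Λ ×ˢ Icc (-Λ) Λ) with hB
  have hBc : IsCompact B := isCompact_Icc.prod (isCompact_Icc.prod isCompact_Icc)
  have hmem : (s, q) ∈ B := ⟨hs, ⟨hq, hΛ1⟩, abs_le.1 hΛ2⟩
  have hGc : ContinuousOn G B := by
    refine ((hc.mono (prod_mono_right (subset_univ _))).sub
      ((continuousOn_toReal_lintegral hN).comp continuousOn_fst fun y hy => hy.1)).sub ?_
    rw [hW]
    fun_prop
  obtain ⟨⟨σ, ρ⟩, hσ, hmax⟩ := hBc.exists_isMaxOn ⟨_, hmem⟩ hGc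
  have hGe : e₀ < G (σ, ρ) := by
    have h1 : G (s, q) ≤ G (σ, ρ) := hmax hmem
    have h2 : G (s, q) = e₀ + η / 2 := by rw [hG]; simp only; rw [hδη]; ring
    linarith
  obtain ⟨⟨hσ0, hσT⟩, ⟨hρ0, hρΛ⟩, hzΛ⟩ := hσ
  have hpen : δ * W ρ ≤ δ * (exp (K * σ) * W ρ) := by
    refine mul_le_mul_of_nonneg_left (le_mul_of_one_le_left (by linarith [hW1 ρ]) ?_) hδ0.le
    exact Real.one_le_exp (mul_nonneg (by positivity) hσ0)
  have hGdef : G (σ, ρ) = U σ ρ - I σ - δ * (exp (K * σ) * W ρ) := rfl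
  have hbig : ∀ L : ℝ, L = ρ.1 ∨ L = |ρ.2| → L ≠ Λ := by
    rintro L hL rfl
    have h1 : U σ ρ ≤ M * Λ := (hUM σ ρ hρ0).trans (mul_le_mul_of_nonneg_left hρΛ hM)
    have h2 : Λ ^ 2 ≤ W ρ := by
      rw [hW]
      rcases hL with hL | hL
      · rw [hL]; nlinarith [sq_nonneg ρ.2]
      · rw [hL, sq_abs]; nlinarith [sq_nonneg ρ.1]
    have h3 : M * Λ ≤ δ * Λ ^ 2 := by nlinarith
    have h4 := mul_le_mul_of_nonneg_left h2 hδ0.le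
    linarith [hI0 σ]
  have hσ1 : 0 < σ := by
    refine lt_of_le_of_ne hσ0 fun h0 => ?_
    have h1 := hU₀ ρ hρ0
    rw [h0] at h1
    have : 0 ≤ δ * W ρ := mul_nonneg hδ0.le (by linarith [hW1 ρ])
    linarith [hI0 σ]
  have hρ1 : 0 < ρ.1 := by
    refine lt_of_le_of_ne hρ0 fun h0 => ?_
    have h1 := hUM σ ρ hρ0
    rw [← h0, mul_zero] at h1
    have : 0 ≤ δ * W ρ := mul_nonneg hδ0.le (by linarith [hW1 ρ])
    linarith [hI0 σ]
  have hρ2 : ρ.1 < Λ := lt_of_le_of_ne hρΛ (hbig _ (Or.inl rfl))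
  have hz2 : |ρ.2| < Λ := lt_of_le_of_ne (abs_le.2 hzΛ) (hbig _ (Or.inr rfl))
  set k := δ * exp (K * σ) with hk
  have hk0 : 0 < k := mul_pos hδ0 (Real.exp_pos _)
  have hsl : 𝒞 (U σ) := hU σ
  obtain ⟨r1, r2⟩ := second_deriv_test (g := fun r => U σ (r, ρ.2)) (x := ρ.1)
    (A := I σ + k * (1 + ρ.2 ^ 2)) (k := k) (hsl.comp (contDiff_id.prodMk contDiff_const)) (by
      filter_upwards [isOpen_Ioo.mem_nhds (⟨hρ1, hρ2⟩ : ρ.1 ∈ Ioo 0 Λ)] with r hr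
      have h1 : G (σ, (r, ρ.2)) ≤ G (σ, ρ) := hmax ⟨⟨hσ0, hσT⟩, ⟨hr.1.le, hr.2.le⟩, hzΛ⟩
      rw [hG] at h1
      simp only [hW] at h1
      rw [hk]
      linarith)
  obtain ⟨z1, z2⟩ := second_deriv_test (g := fun z => U σ (ρ.1, z)) (x := ρ.2)
    (A := I σ + k * (1 + ρ.1 ^ 2)) (k := k) (hsl.comp (contDiff_const.prodMk contDiff_id)) (by
      filter_upwards [isOpen_Ioo.mem_nhds (abs_lt.1 hz2 : ρ.2 ∈ Ioo (-Λ) Λ)] with z hz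
      have h1 : G (σ, (ρ.1, z)) ≤ G (σ, ρ) := hmax ⟨⟨hσ0, hσT⟩, ⟨hρ0, hρΛ⟩, ⟨hz.1.le, hz.2.le⟩⟩
      rw [hG] at h1
      simp only [hW] at h1
      rw [hk]
      linarith)
  have hE : HasDerivAt (fun τ => U τ ρ - δ * (exp (K * τ) * W ρ))
      (dt U σ ρ - K * (k * W ρ)) σ := by
    have h1 := ((((hasDerivAt_id σ).const_mul K).exp).mul_const (W ρ)).const_mul δ
    refine ((ht σ ⟨hσ1, hσT⟩ ρ).sub h1).congr_deriv ?_
    rw [hk]; simp; ring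
  have htime : F σ ρ ≤ dt U σ ρ - K * (k * W ρ) := by
    refine le_deriv_of_lintegral (f := fun τ => F τ ρ) (N := N) hσ1 hE (hFc σ ⟨hσ1, hσT⟩ ρ hρ1) rfl
      (fun τ hτ => hFN τ ⟨hτ.1, hτ.2.trans hσT⟩ ρ hρ1)
      (ne_top_of_le_ne_top hN (lintegral_mono_set (Ioc_subset_Ioc_right hσT))) fun τ h0 h1 => ?_
    have h2 : G (τ, ρ) ≤ G (σ, ρ) := hmax ⟨⟨h0, h1.le.trans hσT⟩, ⟨hρ0, hρΛ⟩, hzΛ⟩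
    have h3 := toReal_lintegral_Ioc hN h0 h1.le hσT
    rw [hG] at h2
    simp only at h2
    have h4 : I σ = I τ + (∫⁻ τ in Ioc τ σ, N τ).toReal := h3
    linarith
  have e1 : dr U σ ρ = 2 * k * ρ.1 := r1
  have e2 : dz U σ ρ = 2 * k * ρ.2 := z1
  have e3 : dr (dr U) σ ρ ≤ 2 * k := r2
  have e4 : dz (dz U) σ ρ ≤ 2 * k := z2
  rw [hF σ ⟨hσ1, hσT⟩ ρ hρ1, e1, e2, mul_div_assoc, div_self hρ1.ne', mul_one] at htime
  exact penalty_contra hk0 hρ0 hM hν rfl hK (ha σ ρ) (hw σ ρ) e3 e4 htime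

lemma enorm_le_spNorm_top {g : ℝ² → ℝ} (hg : ContinuousOn g ℝ²₊) {q : ℝ²}
    (hq : 0 < q.1) : ‖g q‖ₑ ≤ spNorm ∞ g := by
  by_contra hc
  rw [not_le] at hc
  have hS := isOpen_half
  have hae : ∀ᵐ q ∂cyl, ‖g q‖ₑ ≤ spNorm ∞ g := by
    rw [spNorm, eLpNorm_exponent_top]
    exact ae_le_eLpNormEssSup
  have hac : (volume : Measure (ℝ²)).restrict ℝ²₊ ≪ cyl := by
    refine withDensity_absolutelyContinuous' (by fun_prop) ?_
    filter_upwards [ae_restrict_mem hS.measurableSet] with q hq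
    exact (ENNReal.ofReal_pos.2 hq.1).ne'
  have hU : IsOpen (ℝ²₊ ∩ g ⁻¹' {x | spNorm ∞ g < ‖x‖ₑ}) :=
    hg.isOpen_inter_preimage hS (isOpen_lt continuous_const continuous_enorm)
  have h0 : (volume : Measure (ℝ²)) (ℝ²₊ ∩ g ⁻¹' {x | spNorm ∞ g < ‖x‖ₑ}) = 0 := by
    have := (ae_restrict_iff' hS.measurableSet).1 (hac.ae_le hae)
    refine measure_mono_null ?_ this
    intro x hx hx'
    exact absurd (hx' hx.1) (not_le.2 hx.2)
  rw [hU.measure_eq_zero_iff volume] at h0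
  exact (eq_empty_iff_forall_notMem.1 h0 q) ⟨⟨hq, mem_univ _⟩, hc⟩

/-- The angular component of the momentum equation without the time derivative, divided by `r`. -/
def angRate (ν : ℝ) (h β w m : Fam) : Fam :=
  h * η[β] + w * dz β - ν • (4 * m + R * dr m + dz (dz β))

/-- The density of the enstrophy that comes from the swirl. -/
def enst (β : Fam) : Fam := (1 / 2 : ℝ) • (ξ[β] ^ 2 + η[β] ^ 2)

/-- The radial flux of the enstrophy, divided by the radius. -/
def enstFluxR (ν : ℝ) (ζ : ℝ → ℝ) (h β m : Fam) : Fam :=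
  ν • (Z ζ ^ 2 * (dz β * (dz β + R * dz (R * m)) + (2 * β + R * (R * m)) * (4 * m + R * dr m)))
    - Z ζ ^ 2 * (h * enst β)

/-- The axial flux of the enstrophy. -/
def enstFluxZ (ν : ℝ) (ζ : ℝ → ℝ) (β w : Fam) : Fam :=
  ν • (Z ζ ^ 2 * dz (enst β)) - Z ζ ^ 2 * (w * enst β)

set_option maxHeartbeats 1000000 in
lemma enstrophy_identity {ρ ν : ℝ} {ζ : ℝ → ℝ} {h β w κ l m : Fam} (hζ : 𝒞 ζ)
    (F : Flow ρ h β w κ l) (hm : dr β = R * m) (sm : Sm m) :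
    Z ζ ^ 2 * (ξ[β] * (R * dz (angRate ν h β w m))
        - η[β] * (2 * angRate ν h β w m + R * dr (angRate ν h β w m)))
      = vortRate ν ζ h β κ + (2 * enstFluxR ν ζ h β m + R * dr (enstFluxR ν ζ h β m)
        + dz (enstFluxZ ν ζ β w)) := by
  have sh := F.adm_h.sm
  have sb := F.adm_b.sm
  have sw := F.adm_w.sm
  have sk := F.adm_k.sm
  have sζ := Sm.Z hζ
  have z1 : dr (0 : Fam) = 0 := by funext s q; exact deriv_const q.1 _
  have z2 : dz (0 : Fam) = 0 := by funext s q; exact deriv_const q.2 _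
  have hrz : dr (dz β) = R * dz m := by
    rw [dr_dz sb, hm, dz_mul Sm.R sm, dz_R]; ring
  have hrzz : dr (dz (dz β)) = R * dz (dz m) := by
    rw [dr_dz sb.dz, hrz, dz_mul Sm.R sm.dz, dz_R]; ring
  have hmz : dr (dz m) = dz (dr m) := dr_dz sm
  simp (maxDischargeDepth := 60) only [vortRate, stretch, enstFluxR, enstFluxZ, angRate, enst, hm, hrz,
    hrzz, hmz, z1, z2, F.div, F.dr_w,
    dr_smul, dr_add, dr_sub, dr_neg, dr_sq, dr_mul, dr_R, dr_Z, dr_ofNat, dz_smul, dz_add, dz_sub, dz_neg,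
    dz_sq, dz_mul, dz_R, dz_Z, dz_ofNat, Sm.smul, Sm.add, Sm.neg, Sm.ofNat,
    Sm.sq, Sm.mul, Sm.R, Sm.dr, Sm.dz, Sm.zero, sh, sb, sw, sm, sζ]
  funext s q
  simp only [Pi.add_apply, Pi.mul_apply, Pi.sub_apply, Pi.neg_apply, Pi.smul_apply, Pi.pow_apply,
    smul_eq_mul, ofNat_apply]
  ring

lemma adm_enstFlux {ρ ν : ℝ} {ζ : ℝ → ℝ} {h β w κ l m : Fam} (hζ : 𝒞 ζ)
    (F : Flow ρ h β w κ l) (am : Adm ρ 2 m) :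
    Adm ρ 2 (enstFluxR ν ζ h β m) ∧ Adm ρ 2 (enstFluxZ ν ζ β w) ∧ Adm ρ 2 (enst β)
      ∧ Adm ρ 1 (enst β) := by
  have ah := F.adm_h
  have ab := F.adm_b
  have aw := F.adm_w
  have ax : Adm ρ 2 ξ[β] := ab.dz.R_mul.neg
  have ay : Adm ρ 2 η[β] := (ab.ofNat_mul 2).add ab.dr.R_mul
  have ae : Adm ρ 2 (enst β) := (ax.sq2.add ay.sq2).smul _
  refine ⟨?_, ?_, ae, (ax.sq.add ay.sq).smul _⟩
  · rw [enstFluxR, pow_two, mul_assoc, mul_assoc]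
    exact ((((ab.dz.mul2 (ab.dz.add am.R_mul.dz.R_mul)).add (((ab.ofNat_mul 2).add
      am.R_mul.R_mul).mul2 ((am.ofNat_mul 4).add am.dr.R_mul))).Z_mul hζ).Z_mul hζ |>.smul ν).sub
      (((ah.mul2 ae).Z_mul hζ).Z_mul hζ)
  · rw [enstFluxZ, pow_two, mul_assoc, mul_assoc]
    exact ((ae.dz.Z_mul hζ).Z_mul hζ |>.smul ν).sub (((aw.mul2 ae).Z_mul hζ).Z_mul hζ)

lemma IsRegularSolution.js_pd {ν t : ℝ} {v : ℝ → E3 → E3} {p : ℝ → E3 → ℝ} {f : ℝ → E3 → E3}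
    (H : IsRegularSolution ν t v p f) (ht : 0 < t) (i j : Fin 3) :
    JS (Icc 0 t) univ (onPlane fun s => pd j fun x => (Icc 0 t).indicator v s x i) := by
  have hU : UniqueDiffOn ℝ (Icc 0 t ×ˢ (univ : Set E3)) :=
    (uniqueDiffOn_Icc ht).prod uniqueDiffOn_univ
  have h1 : ContDiffOn ℝ ∞ (fun y : ℝ × E3 => v y.1 y.2 i) (Icc 0 t ×ˢ univ) :=
    (proj i : E3 →L[ℝ] ℝ).contDiff.comp_contDiffOn H.smooth_v
  have h2 := (h1.fderivWithin (m := ∞) hU (by simp)).clm_apply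
    (contDiffOn_const (c := ((0 : ℝ), (single j (1 : ℝ) : E3))))
  have h3 : ContDiffOn ℝ ∞ (fun y : ℝ × ℝ² => fderivWithin ℝ (fun y : ℝ × E3 => v y.1 y.2 i)
      (Icc 0 t ×ˢ univ) (y.1, pt y.2) ((0 : ℝ), (single j (1 : ℝ) : E3)))
      (Icc 0 t ×ˢ univ) :=
    h2.comp (f := fun y : ℝ × ℝ² => (y.1, pt y.2))
      (contDiff_fst.prodMk (contDiff_pt.comp contDiff_snd)).contDiffOn fun y hy => ⟨hy.1, mem_univ _⟩
  refine h3.congr fun y hy => ?_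
  have hd := (h1.differentiableOn (by simp) (y.1, pt y.2) ⟨hy.1, mem_univ _⟩).hasFDerivWithinAt
  have hi : HasFDerivAt (fun x : E3 => (y.1, x)) (ContinuousLinearMap.inr ℝ ℝ E3) (pt y.2) :=
    hasFDerivAt_prodMk_right y.1 (pt y.2)
  have hc := hd.comp (s := univ) (pt y.2) hi.hasFDerivWithinAt fun x _ => ⟨hy.1, mem_univ _⟩
  rw [hasFDerivWithinAt_univ] at hc
  simp only [onPlane, pd, indicator_of_mem hy.1]
  have e : (fun x => v y.1 x i) = (fun y : ℝ × E3 => v y.1 y.2 i) ∘ fun x => (y.1, x) := rfl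
  rw [e, hc.fderiv]
  simp

section

lemma Adm.exists_lintegral_le {ρ : ℝ} {g : Fam} (hg : Adm ρ 1 g) :
    ∃ C : ℝ≥0, ∀ s, ∫⁻ q, ‖g s q‖ₑ ∂strip ρ ≤ C := by
  obtain ⟨C, m, h1, h2, h3, h4⟩ := hg.dec
  refine ⟨(ρ * ρ * C).toNNReal, fun s => ?_⟩
  have hm : Measurable fun q : ℝ² => ofReal (m s q.2) := ((h1 s).comp measurable_snd).ennreal_ofReal
  have hle : ∫⁻ q, ‖g s q‖ₑ ∂strip ρ ≤ ∫⁻ q, ofReal (m s q.2) ∂strip ρ := by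
    refine lintegral_mono_ae (ae_strip fun q hq hq' => ?_)
    rw [← ofReal_norm]
    exact ofReal_le_ofReal (h4 s q hq.le hq'.le)
  refine hle.trans ?_
  rw [lintegral_strip ρ hm]
  rcases le_or_gt ρ 0 with hρ | hρ
  · simp [Ioo_eq_empty (not_lt.2 hρ)]
  calc _ ≤ ∫⁻ z, ofReal (ρ * ρ) * ofReal (m s z) := by
        refine lintegral_mono fun z => ?_
        refine (setLIntegral_mono' measurableSet_Ioo (g := fun _ => ofReal ρ * ofReal (m s z))
          fun r hr => mul_le_mul_left (ofReal_le_ofReal hr.2.le) _).trans ?_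
        rw [setLIntegral_const, volume_Ioo, sub_zero, ofReal_mul hρ.le]
        exact le_of_eq (by ring)
    _ = ofReal (ρ * ρ) * ofReal (∫ z, m s z) := by
        rw [lintegral_const_mul _ ((h1 s).ennreal_ofReal), ofReal_integral_eq_lintegral_ofReal
          (by simpa using (h3 s).1) (ae_of_all _ fun z => (h2 s z).1)]
    _ ≤ ofReal (ρ * ρ * C) := by
        rw [← ofReal_mul (by positivity)]
        refine ofReal_le_ofReal (mul_le_mul_of_nonneg_left ?_ (by positivity))
        simpa using (h3 s).2

lemma ofReal_add_le_of_add_le {T x y : ℝ} (hx : 0 ≤ x) (h : T + x ≤ y) :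
    ofReal T + ofReal x ≤ ofReal y + ofReal (-T) := by
  rcases le_total 0 T with hT | hT
  · rw [← ofReal_add hT hx]
    exact (ofReal_le_ofReal h).trans le_self_add
  · rw [ENNReal.ofReal_of_nonpos hT, zero_add]
    refine le_trans (ofReal_le_ofReal (by linarith : x ≤ y + -T)) ofReal_add_le

lemma lintegral_mul_le_six {α : Type*} [MeasurableSpace α] {μ : Measure α} {f g : α → ℝ}
    (hf : AEStronglyMeasurable f μ) (hg : AEStronglyMeasurable g μ) :
    ∫⁻ x, ‖f x * g x‖ₑ ∂μ ≤ eLpNorm f 6 μ * eLpNorm g (6 / 5) μ := by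
  have hc : (6 : ℝ).HolderConjugate (6 / 5) := by constructor <;> norm_num
  have h := lintegral_mul_le_Lp_mul_Lq μ hc hf.enorm hg.enorm
  have e6 : ((6 / 5 : ENNReal)).toReal = 6 / 5 := by simp [ENNReal.toReal_div]
  rw [eLpNorm_eq_lintegral_rpow_enorm_toReal (by norm_num) (by simp),
    eLpNorm_eq_lintegral_rpow_enorm_toReal (by simp) (by finiteness), e6]
  simp only [enorm_mul]
  exact h

/-- The work of the curl of the force against the vorticity. -/
def forceE (β : Fam) (f : ℝ → E3 → E3) : Fam := ξ[β] * compR (rot f) + η[β] * compZ (rot f)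

/-- The bound for the production of enstrophy. -/
def enstBd (ν C K D d g : ℝ) : ℝ :=
  1000 * C ^ 2 * (1 + ν + 1 / ν) * (K ^ 2 * (d * (g + d)) + K * (d * (g + d)) + D * (d * g)
    + (1 + D + D ^ 2) * d ^ 2)

lemma four_mul_le {ν n : ℝ} (hν : 0 < ν) (hn : 0 ≤ n) (a : ENNReal) :
    4 * ofReal n * a ≤ ofReal (ν / 16 * n ^ 2) + ofReal (64 / ν) * a ^ 2 := by
  by_cases ha : a = ⊤
  · rw [ha, ENNReal.top_pow two_ne_zero, ENNReal.mul_top (ENNReal.ofReal_pos.2 (by positivity)).ne', add_top]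
    exact le_top
  · lift a to ℝ≥0 using ha
    have h4 : (4 : ENNReal) = ofReal 4 := by simp
    rw [h4, ← ENNReal.ofReal_coe_nnreal, ← ofReal_mul (by norm_num),
      ← ofReal_mul (by positivity), ← ofReal_pow (by positivity),
      ← ofReal_mul (by positivity), ← ofReal_add (by positivity) (by positivity)]
    refine ofReal_le_ofReal ?_
    have h := sq_nonneg (ν * n - 32 * a)
    have e : ν / 16 * n ^ 2 + 64 / ν * (a : ℝ) ^ 2 - 4 * n * a = (ν * n - 32 * a) ^ 2 / (16 * ν) := by
      field_simp; ring
    have : 0 ≤ (ν * n - 32 * a) ^ 2 / (16 * ν) := by positivity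
    linarith

section bounds

variable {ρ : ℝ} {ζ ζ₁ : ℝ → ℝ} {C : ℝ} {h β w κ l : Fam} {s d g : ℝ}
  (B : Bounds ρ ζ ζ₁ C h β w κ l s d g)
include B

lemma Bounds.lintegral_mul_le {ν Y : ℝ} (hν : 0 < ν) {u : Fam} (au : Adm ρ 2 u)
    (hn : nn ρ (u s) ≤ 2 * d)
    (hY : nn ρ ((Z ζ * AxiNS.dr u) s) ^ 2 + nn ρ ((Z ζ * AxiNS.dz u) s) ^ 2 ≤ Y)
    {G : ℝ² → ℝ} (hG : AEStronglyMeasurable G (strip ρ)) :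
    ∫⁻ q, ‖(Z ζ * u) s q * G q‖ₑ ∂strip ρ ≤ ofReal (ν / 8 * Y + ν / 2 * C ^ 2 * d ^ 2)
      + ofReal (64 / ν) * eLpNorm G (6 / 5) (strip ρ) ^ 2 := by
  have hζ := B.cut.smooth
  have hC := B.C_pos
  have hd := B.d_nonneg
  have hY0 : 0 ≤ Y := le_trans (by positivity) hY
  set n := √Y + 2 * C * d with hn'
  have hn0 : 0 ≤ n := by positivity
  have key : ∀ {k : ℝ² → ℝ}, MemLp k 2 (strip ρ) → nn ρ k ≤ n →
      eLpNorm k 2 (strip ρ) ≤ ofReal n := fun {k} hk hkn => by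
    rw [← ofReal_toReal hk.2.ne]; exact ofReal_le_ofReal hkn
  have hsob : eLpNorm ((Z ζ * u) s) 6 (strip ρ) ≤ 4 * ofReal n := by
    refine sobolev B.r_pos (au.Z_mul hζ) (fun s z => ?_) s ?_ ?_
    · exact B.cut.Z_mul_eq_zero u s le_rfl
    · refine key ((au.Z_mul hζ).dr.memLp s) ?_
      rw [dr_mul (Sm.Z hζ) au.sm, dr_Z]
      refine (nn_add_le ((au.Z_mul (contDiff_deriv hζ)).memLp s) ((au.dr.Z_mul hζ).memLp s)).trans ?_
      have h1 : nn ρ ((Z (deriv ζ) * u) s) ≤ C * nn ρ (u s) :=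
        nn_le_mul hC.le (au.memLp s) fun q _ _ => by
          have : (Z (deriv ζ) * u) s q = deriv ζ q.1 * u s q := rfl
          rw [this, abs_mul]
          exact mul_le_mul_of_nonneg_right (B.cut.bd_deriv _) (abs_nonneg _)
      have h2 : nn ρ ((Z ζ * AxiNS.dr u) s) ≤ √Y :=
        Real.le_sqrt_of_sq_le (by nlinarith [sq_nonneg (nn ρ ((Z ζ * AxiNS.dz u) s))])
      have h3 := mul_le_mul_of_nonneg_left hn hC.le
      linarith
    · refine key ((au.Z_mul hζ).dz.memLp s) ?_
      rw [dz_mul (Sm.Z hζ) au.sm, dz_Z, zero_mul, zero_add]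
      have h2 : nn ρ ((Z ζ * AxiNS.dz u) s) ≤ √Y :=
        Real.le_sqrt_of_sq_le (by nlinarith [sq_nonneg (nn ρ ((Z ζ * AxiNS.dr u) s))])
      have : 0 ≤ 2 * C * d := by positivity
      linarith
  refine (lintegral_mul_le_six ((au.Z_mul hζ).memLp s).1 hG).trans
    ((mul_le_mul' hsob le_rfl).trans ((four_mul_le hν hn0 _).trans ?_))
  gcongr
  have h5 : n ^ 2 ≤ 2 * Y + 8 * C ^ 2 * d ^ 2 := by
    nlinarith [sq_sqrt hY0, sq_nonneg (√Y - 2 * C * d)]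
  nlinarith

end bounds

/-- The dilated cut-off functions of the height. -/
def heightCut (n : ℕ) : ℝ → ℝ := bumpX (1 / ((n : ℝ) + 1))

lemma heightCut_smooth (n : ℕ) : 𝒞 (heightCut n) := bumpX_smooth _

lemma heightCut_compact (n : ℕ) : HasCompactSupport (heightCut n) :=
  bumpX_hasCompactSupport (by positivity)

lemma heightCut_mem (n : ℕ) (z : ℝ) : 0 ≤ heightCut n z ∧ heightCut n z ≤ 1 := bump1_mem _

lemma heightCut_eventually (z : ℝ) : ∀ᶠ n : ℕ in atTop, heightCut n z = 1 := by
  obtain ⟨k, hk⟩ := exists_nat_gt |z|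
  filter_upwards [Filter.eventually_ge_atTop k] with n hn
  refine bumpX_one (by positivity) ?_
  rw [one_div_one_div]
  have : (k : ℝ) ≤ n := by exact_mod_cast hn
  linarith

/-- The norm in `L_2` over a strip of the square root of a family. -/
def half (ρ : ℝ) (D : Fam) (s : ℝ) : ENNReal := (∫⁻ q, ofReal (D s q) ∂strip ρ) ^ (1 / 2 : ℝ)

lemma half_sq (ρ : ℝ) (D : Fam) (s : ℝ) :
    half ρ D s ^ 2 = ∫⁻ q, ofReal (D s q) ∂strip ρ := rpow_half_sq _

lemma half_ne_top {ρ : ℝ} {D : Fam} (hD : Adm ρ 1 D) (s : ℝ) : half ρ D s ≠ ⊤ := by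
  obtain ⟨C, hC⟩ := hD.exists_lintegral_le
  refine ENNReal.rpow_ne_top_of_nonneg (by norm_num) (ne_top_of_le_ne_top coe_ne_top
    (le_trans (lintegral_mono fun q => ?_) (hC s)))
  rw [← ofReal_norm]
  exact ofReal_le_ofReal (le_abs_self _)

lemma nn_le_half {ρ : ℝ} {D : Fam} (hD : Adm ρ 1 D) {s : ℝ} {f : ℝ² → ℝ}
    (h : ∀ q, f q ^ 2 ≤ D s q) : nn ρ f ≤ (half ρ D s).toReal := by
  refine toReal_mono (half_ne_top hD s) (le_rpow_half ?_)
  rw [eLpNorm_two_sq]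
  refine lintegral_mono fun q => ?_
  rw [← ofReal_norm, ← ofReal_pow (norm_nonneg _), norm_eq_abs, sq_abs]
  exact ofReal_le_ofReal (h q)

/-- The square of the gradient of the localized angular vorticity divided by the radius. -/
def gradSq (ζ : ℝ → ℝ) (h κ : Fam) : Fam := dr (Z ζ * (dz h - κ)) ^ 2 + dz (Z ζ * (dz h - κ)) ^ 2

lemma bounds_half {ρ C : ℝ} {ζ ζ₁ : ℝ → ℝ} {h β w κ l : Fam} (K : CutData ρ ζ ζ₁ C)
    (F : Flow ρ h β w κ l) (s : ℝ) : Bounds ρ ζ ζ₁ C h β w κ l s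
      (half ρ (dissE h β w) s).toReal (half ρ (gradSq ζ h κ) s).toReal := by
  have aD := (adm_sq_sum F).2.2.1
  have aΓ := (F.adm_h.dz.sub F.adm_k).Z_mul K.smooth
  have aG : Adm ρ 1 (gradSq ζ h κ) := aΓ.dr.sq.add aΓ.dz.sq
  have hp : ∀ q, dissE h β w s q = dr (R * h) s q ^ 2 + dz (R * h) s q ^ 2 + dr (R * β) s q ^ 2
      + dz (R * β) s q ^ 2 + dr w s q ^ 2 + dz w s q ^ 2 + h s q ^ 2 + β s q ^ 2 := fun q => rfl
  have hg : ∀ q, gradSq ζ h κ s q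
      = dr (Z ζ * (dz h - κ)) s q ^ 2 + dz (Z ζ * (dz h - κ)) s q ^ 2 := fun q => rfl
  refine ⟨K, F, ?_, ?_, ?_, ?_, ?_, ?_, ?_, nn_le_half aG fun q => ?_, nn_le_half aG fun q => ?_⟩
  iterate 7
    refine nn_le_half aD fun q => ?_
    rw [hp]
    linarith [sq_nonneg (dr (R * h) s q), sq_nonneg (dz (R * h) s q), sq_nonneg (dr (R * β) s q),
      sq_nonneg (dz (R * β) s q), sq_nonneg (dr w s q), sq_nonneg (dz w s q), sq_nonneg (h s q),
      sq_nonneg (β s q)]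
  all_goals
    rw [hg]
    linarith [sq_nonneg (dr (Z ζ * (dz h - κ)) s q), sq_nonneg (dz (Z ζ * (dz h - κ)) s q)]

lemma ofReal_enstBd {ν : ℝ} (hν : 0 < ν) (C : ℝ) (k δ a b : ℝ≥0) : ofReal (enstBd ν C k δ a b)
    = ofReal (1000 * C ^ 2 * (1 + ν + 1 / ν)) * (((k : ENNReal) ^ 2 + k + δ) * (a * b)
      + (k ^ 2 + k + 1 + δ + δ ^ 2) * a ^ 2) := by
  rw [enstBd, ofReal_mul (by positivity)]
  have e : (k : ℝ) ^ 2 * (a * (b + a)) + k * (a * (b + a)) + δ * (a * b) + (1 + δ + δ ^ 2) * a ^ 2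
      = (((k ^ 2 + k + δ) * (a * b) + (k ^ 2 + k + 1 + δ + δ ^ 2) * a ^ 2 : ℝ≥0) : ℝ) := by
    push_cast; ring
  rw [e, ENNReal.ofReal_coe_nnreal]
  push_cast
  rfl

lemma abs_le_weight {b r D M ε : ℝ} (hr : 0 < r) (h1 : r * |b| ≤ D) (h2 : |b| ≤ M) (hε : 0 < ε)
    (hε1 : ε ≤ 1) : |b| ≤ D ^ (1 - ε) * M ^ ε * r ^ (ε - 1) := by
  rcases (abs_nonneg b).eq_or_lt with h0 | h0
  · have hD : 0 ≤ D := le_trans (by positivity) h1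
    have hM : 0 ≤ M := h0.trans_le h2
    rw [← h0]; positivity
  have h3 : |b| ≤ D / r := by rw [le_div_iff₀ hr]; linarith
  have e : |b| = |b| ^ (1 - ε) * |b| ^ ε := by rw [← Real.rpow_add h0]; simp
  have hD : 0 ≤ D := le_trans (by positivity) h1
  have e2 : (D / r) ^ (1 - ε) = D ^ (1 - ε) * r ^ (ε - 1) := by
    rw [Real.div_rpow hD hr.le, div_eq_mul_inv, ← Real.rpow_neg hr.le, neg_sub]
  calc |b| = |b| ^ (1 - ε) * |b| ^ ε := e
    _ ≤ (D / r) ^ (1 - ε) * M ^ ε := mul_le_mul (Real.rpow_le_rpow h0.le h3 (by linarith))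
        (Real.rpow_le_rpow h0.le h2 hε.le) (by positivity) (by positivity)
    _ = _ := by rw [e2]; ring

lemma mixNorm_two_sq {F : Type*} [NormedAddCommGroup F] (p : ENNReal) (t : ℝ) (g : ℝ → ℝ² → F) :
    mixNorm p 2 t g ^ 2 = ∫⁻ s in Ioo 0 t, spNorm p (g s) ^ 2 := eLpNorm_two_sq _

lemma ennreal_add_sq_le (a b : ENNReal) : (a + b) ^ 2 ≤ 2 * (a ^ 2 + b ^ 2) := by
  rcases eq_or_ne a ⊤ with rfl | ha
  · simp
  rcases eq_or_ne b ⊤ with rfl | hb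
  · simp
  lift a to ℝ≥0 using ha
  lift b to ℝ≥0 using hb
  exact_mod_cast add_sq_le (a := a) (b := b)

lemma lintegral_cyl_eq_strip {ρ : ℝ} {F : ℝ² → ENNReal} (hF : ∀ q : ℝ², ρ ≤ q.1 → F q = 0) :
    ∫⁻ q, F q ∂cyl = ∫⁻ q, F q ∂strip ρ := by
  rw [strip, ← lintegral_indicator (measurableSet_Iio.prod MeasurableSet.univ)]
  refine lintegral_congr fun q => ?_
  by_cases hq : q ∈ Iio ρ ×ˢ (univ : Set ℝ)
  · rw [indicator_of_mem hq]
  · rw [indicator_of_notMem hq]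
    exact hF q (not_lt.1 fun h => hq ⟨h, mem_univ _⟩)

lemma ofReal_nn_sq {ρ : ℝ} {f : ℝ² → ℝ} (hf : MemLp f 2 (strip ρ)) :
    ofReal (nn ρ f ^ 2) = ∫⁻ q, ofReal (f q ^ 2) ∂strip ρ := by
  rw [nn, ofReal_pow toReal_nonneg, ofReal_toReal hf.2.ne, eLpNorm_two_sq]
  exact lintegral_congr fun q => real_enorm_sq _

lemma gradAbs_congr {f g : Fam} {s : ℝ} (h : ∀ q : ℝ², 0 < q.1 → f s q = g s q) {q : ℝ²}
    (hq : 0 < q.1) : gradAbs f s q = gradAbs g s q := by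
  have h1 : AxiNS.dr f s q = AxiNS.dr g s q := Filter.EventuallyEq.deriv_eq (by
    filter_upwards [Ioi_mem_nhds hq] with r hr using h (r, q.2) hr)
  have h2 : AxiNS.dz f s q = AxiNS.dz g s q := by
    rw [AxiNS.dz, AxiNS.dz, funext fun z => h (q.1, z) hq]
  rw [gradAbs, gradAbs, h1, h2]

lemma enorm_gradAbs_sq (g : Fam) (s : ℝ) (q : ℝ²) :
    ‖gradAbs g s q‖ₑ ^ 2 = ofReal (dr g s q ^ 2 + dz g s q ^ 2) := by
  rw [real_enorm_sq, gradAbs, sq_sqrt (by positivity)]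

lemma vNorm_sq_le {t : ℝ} {g W : Fam} (hg : ∀ s ∈ Ioo 0 t, ∀ q : ℝ², 0 < q.1 → g s q = W s q)
    {A B : ENNReal} (hA : ∀ s ∈ Ioo 0 t, ∫⁻ q, ofReal (W s q ^ 2) ∂cyl ≤ A)
    (hB : ∫⁻ s in Ioo 0 t, ∫⁻ q, ofReal (dr W s q ^ 2 + dz W s q ^ 2) ∂cyl ≤ B) :
    vNorm t g ^ 2 ≤ 2 * (A + B) := by
  refine (ennreal_add_sq_le _ _).trans (mul_le_mul' le_rfl (add_le_add ?_ ?_))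
  · rw [← rpow_half_sq A]
    refine pow_le_pow_left' (eLpNorm_exponent_top.trans_le (essSup_le_of_ae_le _ ?_)) 2
    filter_upwards [ae_restrict_mem measurableSet_Ioo] with s hs
    refine le_rpow_half ?_
    rw [enorm_eq_self, spNorm, eLpNorm_two_sq]
    refine (lintegral_mono_ae (ae_cyl fun q hq => ?_)).trans (hA s hs)
    rw [hg s hs q hq, real_enorm_sq]
  · rw [mixNorm_two_sq]
    refine (setLIntegral_mono' measurableSet_Ioo fun s hs => ?_).trans hB
    rw [spNorm, eLpNorm_two_sq]
    refine lintegral_mono_ae (ae_cyl fun q hq => ?_)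
    rw [gradAbs_congr (hg s hs) hq, enorm_gradAbs_sq]

lemma lintegral_grad_cut_le {ρ C : ℝ} {ζ ζ₁ : ℝ → ℝ} (K : CutData ρ ζ ζ₁ C) {u D : Fam}
    (ar : Adm ρ 2 (dr u)) (az : Adm ρ 2 (dz u)) (su : Sm u) {s : ℝ}
    (hD : Measurable (D s)) (hu : ∀ q, u s q ^ 2 ≤ 2 * D s q) :
    ∫⁻ q, ofReal (dr (Z ζ * u) s q ^ 2 + dz (Z ζ * u) s q ^ 2) ∂cyl
      ≤ 2 * ofReal (nn ρ ((Z ζ * dr u) s) ^ 2 + nn ρ ((Z ζ * dz u) s) ^ 2)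
        + 4 * ofReal (C ^ 2) * ∫⁻ q, ofReal (D s q) ∂cyl := by
  have br := ar.Z_mul K.smooth
  have bz := az.Z_mul K.smooth
  have mr : Measurable fun q => ofReal ((Z ζ * dr u) s q ^ 2) :=
    measurable_ofReal.comp ((br.cont s).measurable.pow_const 2)
  have mD : Measurable fun q => 4 * ofReal (C ^ 2) * ofReal (D s q) :=
    (measurable_ofReal.comp hD).const_mul _
  have e0 : ∀ g : Fam, ∀ q : ℝ², ρ ≤ q.1 → ofReal ((Z ζ * g) s q ^ 2) = 0 := fun g q hq => by
    rw [K.Z_mul_eq_zero g s hq]; simp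
  rw [ofReal_add (sq_nonneg _) (sq_nonneg _), ofReal_nn_sq (br.memLp s),
    ofReal_nn_sq (bz.memLp s), ← lintegral_cyl_eq_strip (e0 _), ← lintegral_cyl_eq_strip (e0 _),
    ← lintegral_add_left mr, ← lintegral_const_mul' _ _ (by finiteness),
    ← lintegral_const_mul' _ _ (by finiteness),
    ← lintegral_add_right _ mD]
  refine lintegral_mono fun q => ?_
  have d1 : dr (Z ζ * u) s q = deriv ζ q.1 * u s q + ζ q.1 * dr u s q := by
    rw [dr_mul (Sm.Z K.smooth) su, dr_Z]; rfl
  have d2 : dz (Z ζ * u) s q = ζ q.1 * dz u s q := by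
    rw [dz_mul (Sm.Z K.smooth) su, dz_Z, zero_mul, zero_add]; rfl
  have e1 : (Z ζ * dr u) s q = ζ q.1 * dr u s q := rfl
  have e2 : (Z ζ * dz u) s q = ζ q.1 * dz u s q := rfl
  have hD0 : 0 ≤ D s q := by linarith [hu q, sq_nonneg (u s q)]
  have h2 : (2 : ENNReal) = ofReal 2 := by simp
  have h4 : (4 : ENNReal) = ofReal 4 := by simp
  rw [← ofReal_add (sq_nonneg _) (sq_nonneg _), h2, h4, ← ofReal_mul (by norm_num),
    ← ofReal_mul (by norm_num), ← ofReal_mul (by positivity),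
    ← ofReal_add (by positivity) (by positivity)]
  refine ofReal_le_ofReal ?_
  have h3 : (deriv ζ q.1 * u s q) ^ 2 ≤ C ^ 2 * (2 * D s q) := by
    rw [mul_pow]
    exact mul_le_mul (sq_le_sq' (abs_le.1 (K.bd_deriv _)).1 (abs_le.1 (K.bd_deriv _)).2) (hu q)
      (sq_nonneg _) (sq_nonneg _)
  rw [d1, d2, e1, e2]
  nlinarith [sq_nonneg (deriv ζ q.1 * u s q - ζ q.1 * dr u s q), sq_nonneg (ζ q.1 * dz u s q)]

end

lemma mul_rpow_le_data {r₀ ε : ℝ} (hr : 0 < r₀) (hε : 0 < ε) (hε1 : ε < 1) {t : ℝ}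
    {v f : ℝ → E3 → E3} (M : ENNReal) :
    D1 t v f * (D2 t v f ^ (1 - ε) * M ^ ε * ofReal ((2 * r₀) ^ ε / ε))
        ≤ 2 * (D12 r₀ ε t v f * M ^ ε)
      ∧ D1 t v f * (D2 t v f ^ (1 - ε) * M ^ ε * ofReal ((2 * r₀) ^ ε / ε)) ^ 2
        ≤ 4 * (D9 r₀ ε t v f * M ^ (2 * ε)) := by
  have h2 : (2 * r₀) ^ ε ≤ 2 * r₀ ^ ε := by
    rw [Real.mul_rpow two_pos.le hr.le]
    refine mul_le_mul_of_nonneg_right ?_ (by positivity)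
    simpa using Real.rpow_le_rpow_of_exponent_le one_le_two hε1.le
  have h1 : ofReal ((2 * r₀) ^ ε / ε) ≤ 2 * ofReal (r₀ ^ ε / ε) := by
    rw [show (2 : ENNReal) = ofReal 2 by simp, ← ofReal_mul two_pos.le, ← mul_div_assoc]
    exact ofReal_le_ofReal (div_le_div_of_nonneg_right h2 hε.le)
  have hs : ∀ (x : ENNReal) (a : ℝ), x ^ (2 * a) = (x ^ a) ^ 2 := fun x a => by
    rw [← rpow_natCast, ← rpow_mul, mul_comm, Nat.cast_ofNat]
  have h3 : ofReal (r₀ ^ (2 * ε) / ε ^ 2) = ofReal (r₀ ^ ε / ε) ^ 2 := by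
    rw [← ofReal_pow (by positivity), div_pow, ← Real.rpow_natCast (r₀ ^ ε), ← Real.rpow_mul hr.le,
      mul_comm ε, Nat.cast_ofNat]
  constructor
  · rw [D12]
    calc _ ≤ D1 t v f * (D2 t v f ^ (1 - ε) * M ^ ε * (2 * ofReal (r₀ ^ ε / ε))) := by gcongr
      _ = 2 * (D1 t v f * D2 t v f ^ (1 - ε) * ofReal (r₀ ^ ε / ε) * M ^ ε) := by ring
      _ ≤ _ := by gcongr; exact le_self_add
  · rw [D9, hs, hs, h3]
    calc _ ≤ D1 t v f * (D2 t v f ^ (1 - ε) * M ^ ε * (2 * ofReal (r₀ ^ ε / ε))) ^ 2 := by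
          gcongr
      _ = _ := by ring

lemma sq_mul_sq_le_data (ζ : ℝ → ℝ) (t : ℝ) (v f : ℝ → E3 → E3) :
    (1 + D2 t v f + D2 t v f ^ 2) * D1 t v f ^ 2 + (mixNorm (6 / 5) 2 t (cut ζ (compR (rot f))) ^ 2
        + mixNorm (6 / 5) 2 t (cut ζ (compZ (rot f))) ^ 2)
      + (spNorm 2 (omR ζ v 0) ^ 2 + spNorm 2 (omZ ζ v 0) ^ 2) ≤ D8 ζ t v f := by
  have h4 : D1 t v f * D2 t v f ≤ D4 t v f := by
    rw [D4, add_assoc]; exact le_self_add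
  have h11 : D1 t v f * D2 t v f ^ 2 ≤ D11 t v f := by
    rw [D11, pow_two, ← mul_assoc]
    gcongr
    exact h4.trans (le_add_self.trans le_self_add)
  rw [D8]
  calc _ = D1 t v f * (D1 t v f * D2 t v f ^ 2) + D1 t v f * D1 t v f * (D2 t v f + 1)
        + mixNorm (6 / 5) 2 t (cut ζ (compR (rot f))) ^ 2
        + mixNorm (6 / 5) 2 t (cut ζ (compZ (rot f))) ^ 2
        + spNorm 2 (omR ζ v 0) ^ 2 + spNorm 2 (omZ ζ v 0) ^ 2 := by ring
    _ ≤ _ := by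
      gcongr
      rw [add_assoc]; exact le_self_add

/-- The right-hand side of the estimate, up to a constant. -/
def dataBd (r₀ : ℝ) (ζ : ℝ → ℝ) (ε t : ℝ) (v f : ℝ → E3 → E3) (M G : ENNReal) : ENNReal :=
  (D11 t v f + D12 r₀ ε t v f * M ^ ε + D9 r₀ ε t v f * M ^ (2 * ε)) * G
    + (D12 r₀ ε t v f * D1 t v f * M ^ ε + D9 r₀ ε t v f * D1 t v f * M ^ (2 * ε)) + D8 ζ t v f

lemma dataBd_le (r₀ : ℝ) (ζ : ℝ → ℝ) (ε t : ℝ) (v f : ℝ → E3 → E3) (M G : ENNReal) (hε : 0 < ε) :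
    dataBd r₀ ζ ε t v f M G ≤ (1 + ∑ i, data r₀ ζ ε t v f i) ^ 2 * (1 + M ^ (2 * ε)) * (G + 1) := by
  have hm : M ^ ε ≤ 1 + M ^ (2 * ε) := by
    rcases le_total M 1 with h | h
    · exact (ENNReal.rpow_le_one h hε.le).trans le_self_add
    · exact (ENNReal.rpow_le_rpow_of_exponent_le h (by linarith)).trans le_add_self
  have e : ∑ i, data r₀ ζ ε t v f i = D1 t v f + D2 t v f + D4 t v f + D5 t v f + D8 ζ t v f
      + D9 r₀ ε t v f + D11 t v f + D12 r₀ ε t v f := by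
    simp [data, Fin.sum_univ_eight]
  rw [dataBd, e]
  generalize M ^ (2 * ε) = m2 at *
  generalize M ^ ε = m at *
  generalize D1 t v f = a; generalize D2 t v f = b; generalize D4 t v f = c
  generalize D5 t v f = d; generalize D8 ζ t v f = i; generalize D9 r₀ ε t v f = j
  generalize D11 t v f = k; generalize D12 r₀ ε t v f = l
  calc _ ≤ (k * (1 + m2) + l * (1 + m2) + j * (1 + m2)) * G
        + (l * a * (1 + m2) + j * a * (1 + m2)) + i * (1 + m2) := by
        have h1 : (1 : ENNReal) ≤ 1 + m2 := le_self_add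
        have h2 : m2 ≤ 1 + m2 := le_add_self
        gcongr
        · exact le_mul_of_one_le_right' h1
        · exact le_mul_of_one_le_right' h1
    _ = (k + l + j) * (1 + m2) * G + (l * a + j * a + i) * (1 + m2) * 1 := by ring
    _ ≤ (1 + (a + b + c + d + i + j + k + l)) ^ 2 * (1 + m2) * G
        + (1 + (a + b + c + d + i + j + k + l)) ^ 2 * (1 + m2) * 1 := by
        gcongr
        · refine le_trans ?_ (le_self_pow₀ le_self_add two_ne_zero)
          exact le_trans (le_add_self (b := 1 + (a + b + c + d + i))) (by ring_nf; rfl)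
        · rw [pow_two]
          calc l * a + j * a + i ≤ (l * a + j * a + i) + (l + j + i * a) := le_self_add
            _ = (l + j + i) * (1 + a) := by ring
            _ ≤ (l + j + i + (1 + a + b + c + d + k)) * (1 + a + (b + c + d + i + j + k + l)) :=
              mul_le_mul' le_self_add le_self_add
            _ = _ := by ring
    _ = _ := by ring

section solution

variable {ν t : ℝ} {v : ℝ → E3 → E3} {p : ℝ → E3 → ℝ} {f : ℝ → E3 → E3}
  (H : IsRegularSolution ν t v p f) {w h β κ l m : Fam} (hw : w = compZ ((Icc 0 t).indicator v))
  (L : Parts (compR ((Icc 0 t).indicator v)) (compPhi ((Icc 0 t).indicator v)) w h β κ l m)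

local notation "V₀" => indicator (Icc 0 t) v
include H hw L

lemma js_Rh : JS (Icc 0 t) univ (R * h) := L.a_eq ▸ H.js_R
lemma js_Rb : JS (Icc 0 t) univ (R * β) := L.b_eq ▸ H.js_Phi
lemma js_w : JS (Icc 0 t) univ w := hw ▸ H.js_Z

lemma momentum_radial {s : ℝ} (hs : s ∈ Ioo 0 t) {q : ℝ²} (hq : 0 < q.1) :
    compR f s q = dt (R * h) s q + (R * h * dr (R * h) + w * dz (R * h) - R * β * β : Fam) s q
      - ν * (dr (dr (R * h)) + dr h + dz (dz (R * h)) : Fam) s q + dr (presE t p) s q := by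
  have F := L.flow 0
  rw [H.momentum_R hs hq.ne' L.a_eq.symm L.b_eq.symm hw rfl]
  have e1 : dr (R * h) s q = h s q + q.1 * dr h s q := by
    rw [dr_mul Sm.R F.adm_h.sm, dr_R]; simp [R]
  rw [e1]
  have := hq.ne'
  simp only [Pi.add_apply, Pi.mul_apply, Pi.sub_apply, R, e1, presE]
  field_simp
  ring

lemma momentum_angular {s : ℝ} (hs : s ∈ Ioo 0 t) {q : ℝ²} (hq : 0 < q.1) :
    compPhi f s q = dt (R * β) s q + (R * h * dr (R * β) + w * dz (R * β) + R * h * β : Fam) s q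
      - ν * (dr (dr (R * β)) + dr β + dz (dz (R * β)) : Fam) s q := by
  have F := L.flow 0
  rw [H.momentum_Phi hs hq.ne' L.a_eq.symm L.b_eq.symm hw]
  have e1 : dr (R * β) s q = β s q + q.1 * dr β s q := by
    rw [dr_mul Sm.R F.adm_b.sm, dr_R]; simp [R]
  rw [e1]
  have := hq.ne'
  simp only [Pi.add_apply, Pi.mul_apply, R, e1]
  field_simp
  ring

lemma momentum_axial {s : ℝ} (hs : s ∈ Ioo 0 t) {q : ℝ²} (hq : 0 < q.1) :
    compZ f s q = dt w s q + (R * h * dr w + w * dz w : Fam) s q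
      - ν * (dr (dr w) + κ + dz (dz w) : Fam) s q + dz (presE t p) s q := by
  have F := L.flow 0
  rw [H.momentum_Z hs hq.ne' L.a_eq.symm hw rfl]
  have e1 : dr w s q = q.1 * κ s q := by
    rw [F.dr_w]; simp [R]
  rw [e1]
  have := hq.ne'
  simp only [Pi.add_apply, Pi.mul_apply, R, e1, presE]
  field_simp
  ring

lemma js_kinE : JS (Icc 0 t) univ (kinE h β w) := by
  have h1 := js_Rh H hw L
  have h2 := js_Rb H hw L
  have h3 := js_w H hw L
  refine JS.smul (((?_ : JS _ _ _).add ?_).add ?_) _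
  · rw [pow_two]; exact h1.mul h1
  · rw [pow_two]; exact h2.mul h2
  · rw [pow_two]; exact h3.mul h3

lemma dt_kinE {s : ℝ} (hs : s ∈ Ioo 0 t) (q : ℝ²) :
    dt (kinE h β w) s q = (R * h) s q * dt (R * h) s q + (R * β) s q * dt (R * β) s q
      + w s q * dt w s q := by
  have h1 := (js_Rh H hw L).restrict.hasDerivAt_t isOpen_Ioo hs
    (mem_univ q)
  have h2 := (js_Rb H hw L).restrict.hasDerivAt_t isOpen_Ioo hs
    (mem_univ q)
  have h3 := (js_w H hw L).restrict.hasDerivAt_t isOpen_Ioo hs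
    (mem_univ q)
  have := (((h1.fun_pow 2).add (h2.fun_pow 2)).add (h3.fun_pow 2)).const_mul (1 / 2)
  refine (this.congr_deriv ?_).deriv
  simp only [Nat.cast_ofNat, Nat.add_one_sub_one, pow_one]
  ring

/-- The energy balance at a fixed time, with a cut-off `φ`. -/
lemma energy_slice {ρ : ℝ} {φ φ₁ : Fam} (B : Bump ρ φ φ₁) {s : ℝ} (hs : s ∈ Ioo 0 t) :
    ∫ q, (φ * dt (kinE h β w)) s q ∂strip ρ + ν * ∫ q, (φ * dissE h β w) s q ∂strip ρ
      = ∫ q, (φ * powE t v f) s q ∂strip ρ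
        + ∫ q, (kinE h β w * (R * h * dr φ + w * dz φ) : Fam) s q ∂strip ρ
        + ν * ∫ q, (kinE h β w * (2 * φ₁ + R * dr φ₁ + dz (dz φ)) : Fam) s q ∂strip ρ
        - ∫ q, (R * avg 1 w * (dz φ * dr (fun _ => presE t p s) - dr φ * dz (fun _ => presE t p s))
          : Fam) s q ∂strip ρ := by
  have F := L.flow ρ
  have hP : 𝒞 (presE t p s) := (H.smooth_p_slice s).comp contDiff_pt
  obtain ⟨i1, e1⟩ := integral_energy_transport B F s
  obtain ⟨i2, e2⟩ := integral_energy_viscous B F s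
  obtain ⟨i3, e3⟩ := integral_energy_pressure B F hP s
  have sχ := Adm.integrable (ρ := ρ) (s := s) (g := φ * dissE h β w)
    (B.adm.mul (adm_sq_sum F).2.2.2)
  have A := H.axiField
  have Af := H.axiField_f
  have hpow : 𝒞 (powE t v f s) :=
    (((A.sm_R s).mul (Af.sm_R s)).add ((A.sm_Phi s).mul (Af.sm_Phi s))).add
      ((A.sm_Z s).mul (Af.sm_Z s))
  have i4 : Integrable ((φ * powE t v f) s) (strip ρ) := (B.adm_mul _ hpow 1 le_rfl).integrable s
  have hφ : Sm φ := B.adm.sm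
  rw [← e2, ← e3, eq_sub_iff_add_eq, ← integral_const_mul, ← integral_const_mul]
  have hT : Integrable ((φ * dt (kinE h β w)) s) (strip ρ) :=
    (B.adm_mul _ ((js_kinE H hw L).restrict.dt isOpen_Ioo isOpen_univ
      |>.slice hs) 1 le_rfl).integrable s
  rw [← neg_eq_iff_eq_neg] at e1
  have i5 : Integrable (fun q => (φ * dt (kinE h β w)) s q + ν * (φ * dissE h β w) s q) (strip ρ) :=
    hT.add (sχ.const_mul ν)
  have i6 : Integrable (fun q => (φ * powE t v f) s q
      - (φ * (R * h * dr (kinE h β w) + w * dz (kinE h β w)) : Fam) s q) (strip ρ) := i4.sub i1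
  rw [← e1, ← sub_eq_add_neg, ← integral_add hT (sχ.const_mul ν), ← integral_add i5 i3,
    ← integral_sub i4 i1, ← integral_add i6 (i2.const_mul ν)]
  refine integral_congr_ae (ae_strip fun q hq _ => ?_)
  have hR := momentum_radial H hw L hs hq
  have hΦ := momentum_angular H hw L hs hq
  have hZ := momentum_axial H hw L hs hq
  have hE := dt_kinE H hw L hs q
  have er : dr (kinE h β w) = R * h * dr (R * h) + R * β * dr (R * β) + w * dr w := by
    simp (maxDischargeDepth := 60) only [kinE, dr_smul, dr_add, dr_sq, Sm.add,
      Sm.sq, Sm.mul, Sm.R, F.adm_h.sm, F.adm_b.sm, F.adm_w.sm]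
    funext s q
    simp
    ring
  have ez : dz (kinE h β w) = R * h * dz (R * h) + R * β * dz (R * β) + w * dz w := by
    simp (maxDischargeDepth := 60) only [kinE, dz_smul, dz_add, dz_sq, Sm.add,
      Sm.sq, Sm.mul, Sm.R, F.adm_h.sm, F.adm_b.sm, F.adm_w.sm]
    funext s q
    simp
    ring
  have ef : powE t v f s q = (R * h) s q * compR f s q + (R * β) s q * compPhi f s q
      + w s q * compZ f s q := by
    rw [← L.a_eq, ← L.b_eq, hw]
    simp only [powE, Pi.add_apply, Pi.mul_apply, compR, compPhi, compZ, indicator_of_mem hs]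
  have p1 : dr (fun _ => presE t p s) s q = dr (presE t p) s q := rfl
  have p2 : dz (fun _ => presE t p s) s q = dz (presE t p) s q := rfl
  rw [er, ez]
  simp only [Pi.add_apply, Pi.mul_apply, Pi.sub_apply, ef, hE, hR, hΦ, hZ, p1, p2, R]
  ring


lemma two_kinE (s : ℝ) (q : ℝ²) : ofReal (2 * kinE h β w s q) = ‖V₀ s (pt q)‖ₑ ^ 2 := by
  rw [← ofReal_norm, ← ofReal_pow (norm_nonneg _), EuclideanSpace.norm_eq,
    sq_sqrt (by positivity), Fin.sum_univ_three]
  congr 1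
  rw [kinE, ← L.a_eq, ← L.b_eq, hw]
  simp [compR, compPhi, compZ]

lemma two_enE (s : ℝ) : 2 * enE h β w s = spNorm 2 (fun q => V₀ s (pt q)) ^ 2 := by
  rw [spNorm, eLpNorm_two_sq, enE, ← lintegral_const_mul' _ _ (by norm_num)]
  refine lintegral_congr fun q => ?_
  rw [← two_kinE H hw L, ofReal_mul (by norm_num)]
  simp

lemma exists_enE_bound : ∃ E : ℝ≥0, ∀ s, enE h β w s ≤ E := by
  obtain ⟨C₀, h0⟩ := (H.sobU 0).lintegral_sq
  obtain ⟨C₁, h1⟩ := (H.sobU 1).lintegral_sq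
  obtain ⟨C₂, h2⟩ := (H.sobU 2).lintegral_sq
  refine ⟨C₀ + C₁ + C₂, fun s => ?_⟩
  have A := H.axiField
  set V := V₀
  have m : ∀ i, Measurable fun x => ‖V s x i‖ₑ ^ 2 := fun i =>
    ((A.coord i s).continuous.measurable.enorm).pow_const 2
  have mV : Measurable fun x => ‖V s x‖ₑ ^ 2 := ((A.smooth s).continuous.measurable.enorm).pow_const 2
  have e : ∀ x, ‖V s x‖ₑ ^ 2 = ‖V s x 0‖ₑ ^ 2 + ‖V s x 1‖ₑ ^ 2 + ‖V s x 2‖ₑ ^ 2 := fun x => by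
    simp only [← ofReal_norm, ← ofReal_pow (norm_nonneg _)]
    rw [← ofReal_add (by positivity) (by positivity), ← ofReal_add (by positivity)
      (by positivity), EuclideanSpace.norm_eq, sq_sqrt (by positivity), Fin.sum_univ_three]
  have h3 : ∫⁻ x, ‖V s x‖ₑ ^ 2 ≤ C₀ + C₁ + C₂ := by
    simp only [e]
    have m01 : Measurable fun x => ‖V s x 0‖ₑ ^ 2 + ‖V s x 1‖ₑ ^ 2 := (m 0).add (m 1)
    rw [lintegral_add_left m01, lintegral_add_left (m 0)]
    exact add_le_add (add_le_add (h0 s) (h1 s)) (h2 s)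
  have h4 := lintegral_space_eq_cyl mV fun θ x => by
    rw [A.axi s θ x, ← ofReal_norm, ← ofReal_norm]
    congr 2
    exact (rotL θ).norm_map _
  have h5 : enE h β w s ≤ ∫⁻ q, ‖V s (pt q)‖ₑ ^ 2 ∂cyl := lintegral_mono fun q => by
    rw [← two_kinE H hw L]
    exact ofReal_le_ofReal (by linarith [kinE_nonneg h β w s q])
  push_cast
  refine (h5.trans ?_).trans (h4.symm.trans_le h3)
  refine le_mul_of_one_le_left' (le_trans (by norm_num) two_le_two_pi)

lemma exists_sup_bound : ∃ M : ℝ, 0 ≤ M ∧ ∀ s q, |(R * h) s q| ≤ M ∧ |(R * β) s q| ≤ M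
    ∧ |w s q| ≤ M := by
  obtain ⟨C₀, h0⟩ := (H.sobU 0).bounded
  obtain ⟨C₁, h1⟩ := (H.sobU 1).bounded
  obtain ⟨C₂, h2⟩ := (H.sobU 2).bounded
  have key : ∀ (C : ℝ≥0) (x : ℝ), ‖x‖ₑ ^ 2 ≤ C → |x| ≤ C + 1 := fun C x hx => by
    rw [← ofReal_norm, ← ofReal_pow (norm_nonneg _), ← ENNReal.ofReal_coe_nnreal] at hx
    have := (ENNReal.ofReal_le_ofReal_iff C.coe_nonneg).1 hx
    rw [norm_eq_abs] at this
    nlinarith [abs_nonneg x, C.2]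
  refine ⟨(C₀ + 1) + (C₁ + 1) + (C₂ + 1), by positivity, fun s q => ?_⟩
  rw [← L.a_eq, ← L.b_eq, hw]
  have p0 := C₀.2
  have p1 := C₁.2
  have p2 := C₂.2
  refine ⟨(key C₀ _ (h0 s (pt q))).trans ?_, (key C₁ _ (h1 s (pt q))).trans ?_,
    (key C₂ _ (h2 s (pt q))).trans ?_⟩ <;> linarith

lemma power_bound {φ : Fam} {s : ℝ} (hs : s ∈ Ioo 0 t) (ρ : ℝ) (hφ : ∀ q, 0 ≤ φ s q ∧ φ s q ≤ 1) :
    ofReal |∫ q, (φ * powE t v f) s q ∂strip ρ|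
      ≤ spNorm 2 (fun q => f s (pt q)) * spNorm 2 (fun q => v s (pt q)) := by
  have hs' := Ioo_subset_Icc_self hs
  have A := H.axiField
  have Af := H.axiField_f
  rw [← norm_eq_abs, ofReal_norm]
  refine (enorm_integral_le_lintegral_enorm _).trans ((lintegral_mono' (strip_le_cyl ρ) le_rfl).trans ?_)
  have m1 : Measurable fun q => ‖f s (pt q)‖ₑ := by
    have := (Af.smooth s).continuous.measurable.comp measurable_pt
    rw [indicator_of_mem hs] at this
    exact this.enorm
  have m2 : Measurable fun q => ‖v s (pt q)‖ₑ := by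
    have := (A.smooth s).continuous.measurable.comp measurable_pt
    rw [indicator_of_mem hs'] at this
    exact this.enorm
  have h1 := lintegral_mul_le_sqrt (μ := cyl) m1.aemeasurable m2.aemeasurable
  rw [← eLpNorm_two_sq, ← eLpNorm_two_sq, ← rpow_natCast, ← rpow_natCast,
    ← rpow_mul, ← rpow_mul] at h1
  norm_num at h1
  refine le_trans (lintegral_mono fun q => ?_) h1
  have e : powE t v f s q = inner ℝ (f s (pt q)) (v s (pt q)) := by
    simp only [powE, Pi.add_apply, Pi.mul_apply, compR, compPhi, compZ, indicator_of_mem hs,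
      indicator_of_mem hs', PiLp.inner_apply, Fin.sum_univ_three]
    rfl
  have : ‖(φ * powE t v f) s q‖ ≤ ‖f s (pt q)‖ * ‖v s (pt q)‖ := by
    rw [Pi.mul_apply, Pi.mul_apply, norm_mul, e, norm_of_nonneg (hφ q).1]
    refine (mul_le_of_le_one_left (norm_nonneg _) (hφ q).2).trans (norm_inner_le_norm _ _)
  simp only [← ofReal_norm]
  rw [← ofReal_mul (norm_nonneg _)]
  exact ofReal_le_ofReal this

lemma kinE_bound {g : Fam} {s ρ c : ℝ} (hg : ∀ q : ℝ², 0 ≤ q.1 → q.1 ≤ ρ → |g s q| ≤ c) :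
    ofReal |∫ q, (kinE h β w * g) s q ∂strip ρ| ≤ ofReal c * enE h β w s := by
  rw [← norm_eq_abs, ofReal_norm, enE, ← lintegral_const_mul' _ _ ofReal_ne_top]
  refine (enorm_integral_le_lintegral_enorm _).trans
    (le_trans (lintegral_mono_ae (ae_strip fun q hq hq' => ?_)) (lintegral_mono' (strip_le_cyl ρ) le_rfl))
  rw [← ENNReal.ofReal_mul' (kinE_nonneg h β w s q), ← ofReal_norm, Pi.mul_apply, Pi.mul_apply,
    norm_mul, norm_of_nonneg (kinE_nonneg h β w s q), mul_comm]
  exact ofReal_le_ofReal (mul_le_mul_of_nonneg_right (hg q hq.le hq'.le) (kinE_nonneg h β w s q))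

/-- The contribution of the pressure to the energy balance. -/
lemma pressure_bound {φ : Fam} {s c C : ℝ} (hC : 0 ≤ C) (hc : 0 < c)
    (hφ : ∀ q : ℝ², 0 ≤ q.1 → q.1 ≤ 3 / c → |dr φ s q| ≤ C * c ∧ |dz φ s q| ≤ C * c
      ∧ (q.1 < 1 / c → |q.2| < 1 / c → dr φ s q = 0 ∧ dz φ s q = 0)) :
    ofReal |∫ q, (R * avg 1 w * (dz φ * dr (fun _ => presE t p s)
        - dr φ * dz (fun _ => presE t p s)) : Fam) s q ∂strip (3 / c)|
      ≤ (ofReal (9 * C ^ 2) * enE h β w s) ^ (1 / 2 : ℝ)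
        * (∫⁻ q in outBox c, presGrad t p s q ∂cyl) ^ (1 / 2 : ℝ) := by
  have F := L.flow 0
  have sw := F.adm_w.sm
  set ρ := 3 / c with hρ
  rw [← norm_eq_abs, ofReal_norm]
  set k : ℝ² → ENNReal := fun q => ofReal (C * c) * ofReal |(R * avg 1 w : Fam) s q| with hk
  set g : ℝ² → ENNReal := (outBox c).indicator
    fun q => ofReal (|dr (presE t p) s q| + |dz (presE t p) s q|) with hg
  have hP : Sm (presE t p) := fun s => (H.smooth_p_slice s).comp contDiff_pt
  have mA : Measurable fun q => ofReal |(R * avg 1 w : Fam) s q| :=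
    ((Sm.R.mul (sw.avg 1)) s).continuous.abs.measurable.ennreal_ofReal
  have mk : Measurable k := mA.const_mul _
  have mg : Measurable g := ((((hP.dr s).continuous.abs).add
    ((hP.dz s).continuous.abs)).measurable.ennreal_ofReal).indicator (measurableSet_outBox c)
  have h1 : ∫⁻ q, ‖(R * avg 1 w * (dz φ * dr (fun _ => presE t p s)
      - dr φ * dz (fun _ => presE t p s)) : Fam) s q‖ₑ ∂strip ρ ≤ ∫⁻ q, k q * g q ∂strip ρ := by
    refine lintegral_mono_ae (ae_strip fun q hq hq' => ?_)
    obtain ⟨b1, b2, b3⟩ := hφ q hq.le hq'.le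
    have p1 : dr (fun _ => presE t p s) s q = dr (presE t p) s q := rfl
    have p2 : dz (fun _ => presE t p s) s q = dz (presE t p) s q := rfl
    have e : (R * avg 1 w * (dz φ * dr (fun _ => presE t p s)
        - dr φ * dz (fun _ => presE t p s)) : Fam) s q = (R * avg 1 w : Fam) s q
        * (dz φ s q * dr (presE t p) s q - dr φ s q * dz (presE t p) s q) := by
      simp only [Pi.mul_apply, Pi.sub_apply, p1, p2]
    rw [e, ← ofReal_norm]
    by_cases hq2 : q ∈ outBox c
    · rw [hg, indicator_of_mem hq2, hk]
      simp only
      rw [← ofReal_mul (by positivity), ← ofReal_mul (by positivity)]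
      refine ofReal_le_ofReal ?_
      rw [norm_eq_abs, abs_mul, mul_comm (C * c), mul_assoc]
      refine mul_le_mul_of_nonneg_left ?_ (abs_nonneg _)
      refine (abs_sub _ _).trans ?_
      rw [abs_mul, abs_mul, mul_add]
      gcongr
    · rw [outBox, mem_compl_iff, not_not] at hq2
      rw [(b3 hq2.1 hq2.2).1, (b3 hq2.1 hq2.2).2]
      simp
  have h2 := lintegral_mul_le_sqrt (μ := strip ρ) mk.aemeasurable mg.aemeasurable
  refine (enorm_integral_le_lintegral_enorm _).trans (h1.trans (h2.trans
    (mul_le_mul' (rpow_le_rpow ?_ (by norm_num)) (rpow_le_rpow ?_ (by norm_num)))))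
  · have hk2 : ∀ q, k q ^ 2 = ofReal ((C * c) ^ 2)
        * ofReal (((R * avg 1 w : Fam) s q) ^ 2) := fun q => by
      rw [hk, mul_pow, ← ofReal_pow (by positivity), ← ofReal_pow (abs_nonneg _), sq_abs]
    simp only [hk2]
    rw [lintegral_const_mul' _ _ ofReal_ne_top]
    have mW : Measurable fun q : ℝ² => ofReal (w s q ^ 2) :=
      ((sw s).continuous.pow 2).measurable.ennreal_ofReal
    set W : ℝ → ENNReal := fun z => ∫⁻ r in Ioi 0, ofReal r * ofReal (w s (r, z) ^ 2) with hW
    have hWi : ∫⁻ z, W z ≤ 2 * enE h β w s := by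
      rw [hW, ← lintegral_cyl mW, enE, ← lintegral_const_mul' _ _ (by norm_num)]
      refine lintegral_mono fun q => ?_
      rw [show (2 : ENNReal) = ofReal 2 by norm_num, ← ofReal_mul (by norm_num)]
      refine ofReal_le_ofReal ?_
      simp only [kinE, Pi.smul_apply, Pi.add_apply, Pi.pow_apply, smul_eq_mul]
      nlinarith [sq_nonneg ((R * h) s q), sq_nonneg ((R * β) s q)]
    have h3 : ∫⁻ q, ofReal (((R * avg 1 w : Fam) s q) ^ 2) ∂strip ρ
        ≤ ofReal (ρ ^ 2 / 2) * ∫⁻ z, W z := by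
      have mA2 : Measurable fun q => ofReal (((R * avg 1 w : Fam) s q) ^ 2) :=
        (((Sm.R.mul (sw.avg 1)) s).continuous.pow 2).measurable.ennreal_ofReal
      rw [lintegral_strip ρ mA2, ← lintegral_const_mul' _ _ ofReal_ne_top]
      refine lintegral_mono fun z => ?_
      calc _ ≤ ∫⁻ r in Ioo 0 ρ, ofReal r * W z := by
            refine setLIntegral_mono' measurableSet_Ioo fun r hr => ?_
            gcongr
            exact sq_R_avg_one_le sw s (q := (r, z)) hr.1.le
        _ = ofReal (ρ ^ 2 / 2) * W z := by
            have hm : Measurable fun r : ℝ => ofReal r := by fun_prop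
            rw [lintegral_mul_const _ hm]
            congr 1
            have hρ0 : 0 ≤ ρ := by positivity
            rw [← ofReal_integral_eq_lintegral_ofReal
              ((continuous_id'.integrableOn_Icc (a := 0) (b := ρ)).mono_set Ioo_subset_Icc_self)
              (by filter_upwards [ae_restrict_mem measurableSet_Ioo] with r hr using hr.1.le),
              ← integral_Ioc_eq_integral_Ioo, ← integral_of_le hρ0]
            simp [integral_id]
    calc _ ≤ ofReal ((C * c) ^ 2) * (ofReal (ρ ^ 2 / 2) * (2 * enE h β w s)) := by
          gcongr
          exact h3.trans (by gcongr)
      _ = ofReal (9 * C ^ 2) * enE h β w s := by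
          rw [show (2 : ENNReal) = ofReal 2 by norm_num, ← mul_assoc, ← mul_assoc,
            ← ofReal_mul (by positivity), ← ofReal_mul (by positivity)]
          congr 2
          rw [hρ]
          field_simp
          ring
  · have hg2 : ∀ q, g q ^ 2 = (outBox c).indicator (presGrad t p s) q := fun q => by
      by_cases hq2 : q ∈ outBox c
      · rw [hg, indicator_of_mem hq2, indicator_of_mem hq2, presGrad, ofReal_pow (by positivity)]
      · rw [hg, indicator_of_notMem hq2, indicator_of_notMem hq2]; simp
    simp only [hg2]
    rw [← lintegral_indicator (measurableSet_outBox c)]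
    exact lintegral_mono' (strip_le_cyl ρ) le_rfl


lemma energy_slice_le (hν : 0 < ν) : ∃ K₁ K₂ : ℝ≥0, ∀ c : ℝ, 0 < c → c ≤ 1 → ∀ s ∈ Ioo 0 t,
    ofReal (∫ q, (bumpF c * dt (kinE h β w)) s q ∂strip (3 / c))
      + ofReal ν * ∫⁻ q, ofReal ((bumpF c * dissE h β w) s q) ∂strip (3 / c)
      ≤ (spNorm 2 (fun q => f s (pt q)) * spNorm 2 (fun q => v s (pt q)) + (ofReal c * K₁
          + K₂ * (∫⁻ q in outBox c, presGrad t p s q ∂cyl) ^ (1 / 2 : ℝ)))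
        + ofReal (-∫ q, (bumpF c * dt (kinE h β w)) s q ∂strip (3 / c)) := by
  obtain ⟨C, hC, hB⟩ := exists_bumpF_bound
  obtain ⟨E, hE⟩ := exists_enE_bound H hw L
  obtain ⟨M, hM, hsup⟩ := exists_sup_bound H hw L
  refine ⟨((2 * M + ν) * C).toNNReal * E, ((9 * C ^ 2).toNNReal * E) ^ (1 / 2 : ℝ), fun c hc hc1 s hs => ?_⟩
  obtain ⟨φ₁, B, hφ⟩ := hB c hc hc1
  have hen := energy_slice H hw L B hs
  set φ := bumpF c with hφdef
  have hφD : ∀ q, 0 ≤ (φ * dissE h β w) s q := fun q =>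
    mul_nonneg (bumpF_mem c s q).1 (dissE_nonneg h β w s q)
  have iD : Integrable ((φ * dissE h β w) s) (strip (3 / c)) :=
    (B.adm.mul (adm_sq_sum (L.flow _)).2.2.2).integrable s
  have eD : ofReal ν * ∫⁻ q, ofReal ((φ * dissE h β w) s q) ∂strip (3 / c)
      = ofReal (ν * ∫ q, (φ * dissE h β w) s q ∂strip (3 / c)) := by
    rw [ofReal_mul hν.le, ofReal_integral_eq_lintegral_ofReal iD (ae_of_all _ hφD)]
  rw [eD]
  refine (ofReal_add_le_of_add_eq (mul_nonneg hν.le (integral_nonneg hφD)) hen).trans ?_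
  refine add_le_add_left ?_ _
  have b1 := power_bound H hw L hs (3 / c) (φ := φ) (bumpF_mem c s)
  have b2 := kinE_bound H hw L (g := R * h * dr φ + w * dz φ) (s := s) (ρ := 3 / c) (c := 2 * M * C * c)
    fun q hq hq' => by
      obtain ⟨x1, x2, -, -⟩ := hφ s q hq hq'
      obtain ⟨y1, -, y2⟩ := hsup s q
      simp only [Pi.add_apply, Pi.mul_apply] at y1 ⊢
      refine (abs_add_le _ _).trans ?_
      rw [abs_mul _ (dr φ s q), abs_mul _ (dz φ s q)]
      have := mul_le_mul y1 x1 (abs_nonneg _) hM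
      have := mul_le_mul y2 x2 (abs_nonneg _) hM
      linarith
  have b3 := kinE_bound H hw L (g := 2 * φ₁ + R * dr φ₁ + dz (dz φ)) (s := s) (ρ := 3 / c) (c := C * c)
    fun q hq hq' => (hφ s q hq hq').2.2.1
  have b4 := pressure_bound H hw L (φ := φ) (s := s) hC hc fun q hq hq' =>
    ⟨(hφ s q hq hq').1, (hφ s q hq hq').2.1, (hφ s q hq hq').2.2.2⟩
  set i₁ := ∫ q, (φ * powE t v f) s q ∂strip (3 / c)
  set i₂ := ∫ q, (kinE h β w * (R * h * dr φ + w * dz φ) : Fam) s q ∂strip (3 / c)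
  set i₃ := ∫ q, (kinE h β w * (2 * φ₁ + R * dr φ₁ + dz (dz φ)) : Fam) s q ∂strip (3 / c)
  set i₄ := ∫ q, (R * avg 1 w * (dz φ * dr (fun _ => presE t p s)
        - dr φ * dz (fun _ => presE t p s)) : Fam) s q ∂strip (3 / c)
  have habs : |i₁ + i₂ + ν * i₃ - i₄| ≤ |i₁| + (|i₂| + ν * |i₃| + |i₄|) := by
    have h1 := abs_sub (i₁ + i₂ + ν * i₃) i₄
    have h2 := abs_add_three i₁ i₂ (ν * i₃)
    rw [abs_mul, abs_of_pos hν] at h2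
    linarith
  refine (ofReal_le_ofReal habs).trans ?_
  rw [ofReal_add (abs_nonneg _) (by positivity),
    ofReal_add (by positivity) (abs_nonneg _), ofReal_add (abs_nonneg _)
      (by positivity), ofReal_mul hν.le]
  refine add_le_add b1 (add_le_add ?_ ?_)
  · calc _ ≤ ofReal (2 * M * C * c) * enE h β w s
          + ofReal ν * (ofReal (C * c) * enE h β w s) := by gcongr
      _ = ofReal c * (ofReal ((2 * M + ν) * C) * enE h β w s) := by
          rw [← mul_assoc, ← mul_assoc, ← add_mul, ← ofReal_mul hν.le,
            ← ofReal_add (by positivity) (by positivity), ← ofReal_mul hc.le]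
          congr 2; ring
      _ ≤ _ := by
          push_cast
          exact mul_le_mul' le_rfl (mul_le_mul' le_rfl (hE s))
  · refine b4.trans ?_
    rw [coe_rpow_of_nonneg _ (by norm_num)]
    push_cast
    exact mul_le_mul' (rpow_le_rpow (mul_le_mul' le_rfl (hE s)) (by norm_num)) le_rfl

lemma js_h : JS (Icc 0 t) ℝ²₊ h := (js_Rh H hw L).of_R_mul

lemma js_b : JS (Icc 0 t) ℝ²₊ β := (js_Rb H hw L).of_R_mul

lemma js_dissE : JS (Ioo 0 t) ℝ²₊ (dissE h β w) := by
  have hI : UniqueDiffOn ℝ (Ioo 0 t) := isOpen_Ioo.uniqueDiffOn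
  have hO := isOpen_half
  have h1 := (js_Rh H hw L).restrict.onHalf
  have h2 := (js_Rb H hw L).restrict.onHalf
  have h3 := (js_w H hw L).restrict.onHalf
  exact (((((h1.dr hI hO).sq.add (h1.dz hI hO).sq).add (h2.dr hI hO).sq).add
    (h2.dz hI hO).sq).add (h3.dr hI hO).sq).add (h3.dz hI hO).sq |>.add (js_h H hw L).restrict.sq
    |>.add (js_b H hw L).restrict.sq


lemma energy_ineq (hν : 0 < ν) (ht : 0 < t) {S : ENNReal} (hS : S ≠ ⊤)
    (hv : ∀ s ∈ Ioo 0 t, spNorm 2 (fun q => v s (pt q)) ≤ S) {s₁ s₂ : ℝ} (h1 : 0 < s₁)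
    (h12 : s₁ ≤ s₂) (h2 : s₂ < t) :
    enE h β w s₂ + ofReal ν * ∫⁻ s in Ioo s₁ s₂, ∫⁻ q, ofReal (dissE h β w s q) ∂cyl
      ≤ enE h β w 0 + (∫⁻ s in Ioo 0 t, spNorm 2 (fun q => f s (pt q))) * S := by
  obtain ⟨K₁, K₂, hK⟩ := energy_slice_le H hw L hν
  set c : ℕ → ℝ := fun n => 1 / ((n : ℝ) + 1) with hc
  have c0 : ∀ n, 0 < c n := fun n => by positivity
  have c1 : ∀ n, c n ≤ 1 := fun n => by
    rw [hc]; simp only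
    rw [div_le_one (by positivity)]
    have : (0 : ℝ) ≤ n := by positivity
    linarith
  set err : ℕ → ENNReal := fun n => ofReal (c n) * K₁ * ofReal t
    + K₂ * ∫⁻ s in Ioo 0 t, (∫⁻ q in outBox (c n), presGrad t p s q ∂cyl) ^ (1 / 2 : ℝ) with herr
  set E : ℕ → ℝ → ℝ := fun n s => ∫ q, (bumpF (c n) * kinE h β w) s q ∂strip (3 / c n) with hE
  have hE0 : ∀ n s, 0 ≤ E n s := fun n s => integral_nonneg fun q =>
    mul_nonneg (bumpF_mem _ s q).1 (kinE_nonneg h β w s q)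
  obtain ⟨C₀, -, hB⟩ := exists_bumpF_bound
  have hEn : ∀ n s, E n s = (∫⁻ q, ofReal ((bumpF (c n) * kinE h β w) s q)
      ∂strip (3 / c n)).toReal := fun n s => by
    obtain ⟨φ₁, B, -⟩ := hB (c n) (c0 n) (c1 n)
    exact integral_eq_lintegral_of_nonneg_ae (ae_of_all _ fun q =>
      mul_nonneg (bumpF_mem _ s q).1 (kinE_nonneg h β w s q))
      ((B.adm.mul (adm_sq_sum (L.flow _)).2.1).integrable s).aestronglyMeasurable
  have hEle : ∀ n s, ofReal (E n s) ≤ enE h β w s := fun n s => by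
    rw [hEn]
    refine ENNReal.ofReal_toReal_le.trans ((lintegral_mono' (strip_le_cyl _) le_rfl).trans
      (lintegral_mono fun q => ofReal_le_ofReal ?_))
    exact mul_le_of_le_one_left (kinE_nonneg h β w s q) (bumpF_mem _ s q).2
  have herr_int : ∀ n, ∫⁻ s in Ioo 0 t, (spNorm 2 (fun q => f s (pt q)) * spNorm 2 (fun q => v s (pt q))
      + (ofReal (c n) * K₁ + K₂ * (∫⁻ q in outBox (c n), presGrad t p s q ∂cyl) ^ (1 / 2 : ℝ)))
      ≤ (∫⁻ s in Ioo 0 t, spNorm 2 (fun q => f s (pt q))) * S + err n := by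
    intro n
    have m1 : Measurable fun s => (∫⁻ q in outBox (c n), presGrad t p s q ∂cyl) ^ (1 / 2 : ℝ) :=
      (H.measurable_presGrad_outBox _).pow_const _
    have m2 : Measurable fun s => ofReal (c n) * K₁
          + K₂ * (∫⁻ q in outBox (c n), presGrad t p s q ∂cyl) ^ (1 / 2 : ℝ) :=
      measurable_const.add (m1.const_mul _)
    rw [lintegral_add_right _ m2, lintegral_add_left measurable_const, lintegral_const_mul _ m1,
      setLIntegral_const, volume_Ioo, sub_zero, ← lintegral_mul_const' _ _ hS]
    refine add_le_add_left (setLIntegral_mono' measurableSet_Ioo fun s hs => ?_) _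
    gcongr
    exact hv s hs
  have hstep : ∀ n, ofReal (E n s₂) + ofReal ν * ∫⁻ s in Ioo s₁ s₂,
      ∫⁻ q, ofReal ((bumpF (c n) * dissE h β w) s q) ∂strip (3 / c n)
      ≤ enE h β w 0 + ((∫⁻ s in Ioo 0 t, spNorm 2 (fun q => f s (pt q))) * S + err n) := by
    intro n
    obtain ⟨φ₁, B, -⟩ := hB (c n) (c0 n) (c1 n)
    obtain ⟨C, m', -, k2, -, k4⟩ := (adm_sq_sum (L.flow (3 / c n))).1.dec
    refine (weighted_balance ht (js_kinE H hw L)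
      (fun s q hq hq' => (k4 s q hq hq').trans (k2 s q.2).2) (B.adm.cont 0) (L := 2 / c n)
      (fun q hq => ?_) ?_ (hE0 n) (fun s hs => hK (c n) (c0 n) (c1 n) s hs) (herr_int n) h1 h12
      h2).trans (add_le_add (hEle n 0) le_rfl) |> le_trans (le_of_eq ?_)
    · rw [lintegral_const_mul' _ _ ofReal_ne_top]; rfl
    · rw [show bumpF (c n) 0 q = stepDown (c n * q.1) * bumpX (c n) q.2 from rfl,
        bumpX_zero (c0 n) hq.le, mul_zero]
    · exact ((B.adm_mul (fun _ => 1) contDiff_const 1 le_rfl).integrable 0).congr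
        (ae_of_all _ fun q => by simp)
  have herr0 : Tendsto err atTop (nhds 0) := by
    have e1 : Tendsto (fun n => ofReal (c n)) atTop (nhds 0) := by
      rw [← ENNReal.ofReal_zero]
      exact (continuous_ofReal.tendsto 0).comp tendsto_one_div_add_atTop_nhds_zero_nat
    have e2 : Tendsto (fun n => ofReal (c n) * K₁ * ofReal t) atTop (nhds (0 * K₁ * ofReal t)) :=
      ENNReal.Tendsto.mul_const (ENNReal.Tendsto.mul_const e1 (Or.inr coe_ne_top))
        (Or.inr ofReal_ne_top)
    have e3 := ENNReal.Tendsto.const_mul (a := (K₂ : ENNReal)) H.tendsto_presGrad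
      (Or.inr coe_ne_top)
    have := e2.add e3
    rwa [zero_mul, zero_mul, mul_zero, add_zero] at this
  have hbox : ∀ k : ℕ, ∫⁻ q in inBox k, ofReal (kinE h β w s₂ q) ∂cyl
      + ofReal ν * ∫⁻ s in Ioo s₁ s₂, ∫⁻ q in inBox k, ofReal (dissE h β w s q) ∂cyl
      ≤ enE h β w 0 + (∫⁻ s in Ioo 0 t, spNorm 2 (fun q => f s (pt q))) * S := by
    intro k
    have hlim : Tendsto (fun n => enE h β w 0
        + ((∫⁻ s in Ioo 0 t, spNorm 2 (fun q => f s (pt q))) * S + err n)) atTop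
        (nhds (enE h β w 0 + ((∫⁻ s in Ioo 0 t, spNorm 2 (fun q => f s (pt q))) * S + 0))) :=
      (herr0.const_add _).const_add _
    rw [add_zero] at hlim
    refine ge_of_tendsto hlim ?_
    filter_upwards [Filter.eventually_ge_atTop k] with n hn
    refine le_trans ?_ (hstep n)
    refine add_le_add ?_ (mul_le_mul' le_rfl (lintegral_mono fun s =>
      lintegral_inBox_le hn (dissE_nonneg h β w s)))
    rw [hEn, ofReal_toReal]
    · exact lintegral_inBox_le hn (kinE_nonneg h β w s₂)
    · obtain ⟨E', hE'⟩ := exists_enE_bound H hw L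
      refine ne_top_of_le_ne_top coe_ne_top (le_trans ?_ (hE' s₂))
      refine (lintegral_mono' (strip_le_cyl _) le_rfl).trans
        (lintegral_mono fun q => ofReal_le_ofReal ?_)
      exact mul_le_of_le_one_left (kinE_nonneg h β w s₂ q) (bumpF_mem _ s₂ q).2
  have hlim := (tendsto_inBox fun q => ofReal (kinE h β w s₂ q)).add
    (ENNReal.Tendsto.const_mul (a := ofReal ν)
      (tendsto_time_inBox (js_dissE H hw L) measurableSet_Ioo
        (Ioo_subset_Ioo h1.le h2.le)) (Or.inr ofReal_ne_top))
  exact le_of_tendsto' hlim hbox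

lemma lintegral_Ioo_le {N : ℝ → ENNReal} {B : ENNReal} (h : ∀ s₁ s₂, 0 < s₁ → s₁ ≤ s₂ → s₂ < t →
    ∫⁻ s in Ioo s₁ s₂, N s ≤ B) : ∫⁻ s in Ioo 0 t, N s ≤ B := by
  have e : Ioo 0 t = ⋃ n : ℕ, Ioo (1 / ((n : ℝ) + 1)) (t - 1 / ((n : ℝ) + 1)) := by
    ext s
    simp only [mem_iUnion, mem_Ioo]
    constructor
    · rintro ⟨k1, k2⟩
      obtain ⟨n, hn⟩ := exists_nat_one_div_lt (lt_min k1 (sub_pos.2 k2))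
      exact ⟨n, hn.trans_le (min_le_left _ _), by linarith [hn.trans_le (min_le_right s (t - s))]⟩
    · rintro ⟨n, k1, k2⟩
      have : 0 < 1 / ((n : ℝ) + 1) := by positivity
      exact ⟨this.trans k1, by linarith⟩
  have hmono : Monotone fun n : ℕ => Ioo (1 / ((n : ℝ) + 1)) (t - 1 / ((n : ℝ) + 1)) := by
    intro k n hkn
    have h1 := Nat.one_div_le_one_div (α := ℝ) hkn
    exact Ioo_subset_Ioo h1 (by linarith)
  rw [e, setLIntegral_iUnion_of_directed _ hmono.directed_le]
  refine iSup_le fun n => ?_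
  have h0 : 0 < 1 / ((n : ℝ) + 1) := by positivity
  rcases le_total (1 / ((n : ℝ) + 1)) (t - 1 / ((n : ℝ) + 1)) with hle | hle
  · exact h _ _ h0 hle (by linarith)
  · rw [Ioo_eq_empty (not_lt.2 hle)]; simp

/-- The basic energy estimate. -/
lemma energy_estimate (hν : 0 < ν) (ht : 0 < t) (hD : D1 t v f ≠ ⊤) :
    ofReal ν * ∫⁻ s in Ioo 0 t, ∫⁻ q, ofReal (dissE h β w s q) ∂cyl ≤ D1 t v f ^ 2 := by
  set F := ∫⁻ s in Ioo 0 t, spNorm 2 (fun q => f s (pt q)) with hF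
  set e₀ := spNorm 2 (fun q => v 0 (pt q)) with he₀
  have hmix : mixNorm 2 1 t (fun s q => f s (pt q)) = F := by
    rw [mixNorm, eLpNorm_one_eq_lintegral_enorm]; rfl
  have hD1 : D1 t v f ^ 2 = 3 * F ^ 2 + 2 * e₀ ^ 2 := by
    rw [D1, hmix, ← rpow_natCast, ← rpow_mul]
    norm_num
    rfl
  have hfin : 3 * F ^ 2 + 2 * e₀ ^ 2 ≠ ⊤ := by rw [← hD1]; exact ENNReal.pow_ne_top hD
  have hFt : F ≠ ⊤ := fun hc => by simp [hc] at hfin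
  have het : e₀ ≠ ⊤ := fun hc => by simp [hc] at hfin
  obtain ⟨E, hE⟩ := exists_enE_bound H hw L
  have hvE : ∀ s ∈ Icc 0 t, spNorm 2 (fun q => v s (pt q)) ^ 2 = 2 * enE h β w s := fun s hs => by
    rw [two_enE H hw L, indicator_of_mem hs]
  set S := ⨆ s ∈ Ioo 0 t, spNorm 2 (fun q => v s (pt q)) with hS
  have hSle : ∀ s ∈ Ioo 0 t, spNorm 2 (fun q => v s (pt q)) ≤ S := fun s hs =>
    le_iSup₂ (f := fun s (_ : s ∈ Ioo 0 t) => spNorm 2 (fun q => v s (pt q))) s hs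
  have hSt : S ≠ ⊤ := by
    refine ne_top_of_le_ne_top (b := ((2 * E : ENNReal)) ^ (1 / 2 : ℝ))
      (ENNReal.rpow_ne_top_of_nonneg (by norm_num) (by finiteness)) (iSup₂_le fun s hs => le_rpow_half ?_)
    rw [hvE s (Ioo_subset_Icc_self hs)]
    gcongr
    exact hE s
  have hmain := fun s₁ s₂ h1 h12 h2 => energy_ineq H hw L hν ht hSt hSle (s₁ := s₁) (s₂ := s₂) h1 h12 h2
  rw [← hF] at hmain
  have h0 : 2 * enE h β w 0 = e₀ ^ 2 := (hvE 0 (left_mem_Icc.2 ht.le)).symm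
  have hS2 : S ^ 2 ≤ e₀ ^ 2 + 2 * (F * S) := by
    rw [← rpow_half_sq (e₀ ^ 2 + _)]
    refine pow_le_pow_left' (iSup₂_le fun s hs => le_rpow_half ?_) 2
    rw [hvE s (Ioo_subset_Icc_self hs), ← h0, ← mul_add]
    gcongr
    exact le_self_add.trans (hmain s s hs.1 le_rfl hs.2)
  have hfinal : ofReal ν * ∫⁻ s in Ioo 0 t, ∫⁻ q, ofReal (dissE h β w s q) ∂cyl
      ≤ enE h β w 0 + F * S := by
    rw [← lintegral_const_mul' _ _ ofReal_ne_top]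
    refine lintegral_Ioo_le H hw L fun s₁ s₂ h1 h12 h2 => ?_
    rw [lintegral_const_mul' _ _ ofReal_ne_top]
    exact le_add_self.trans (hmain s₁ s₂ h1 h12 h2)
  refine hfinal.trans ?_
  rw [hD1]
  have e0t : enE h β w 0 ≠ ⊤ := ne_top_of_le_ne_top coe_ne_top (hE 0)
  clear hD1 hmix hmain hfinal hSle hvE hfin
  clear_value F S e₀
  generalize enE h β w 0 = e1 at *
  lift F to ℝ≥0 using hFt
  lift S to ℝ≥0 using hSt
  lift e₀ to ℝ≥0 using het
  lift e1 to ℝ≥0 using e0t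
  norm_cast at hS2 h0 ⊢
  have a1 : (S : ℝ) ^ 2 ≤ e₀ ^ 2 + 2 * (F * S) := by exact_mod_cast hS2
  have a2 : 2 * (e1 : ℝ) = e₀ ^ 2 := by exact_mod_cast h0
  have : (e1 : ℝ) + F * S ≤ 3 * F ^ 2 + 2 * e₀ ^ 2 := by
    nlinarith [sq_nonneg ((S : ℝ) - 2 * F)]
  exact_mod_cast this


lemma compPhi_eq {s : ℝ} (hs : s ∈ Icc 0 t) : compPhi v s = (R * β) s := by
  rw [← L.b_eq]
  funext q
  show v s (pt q) 1 = V₀ s (pt q) 1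
  rw [indicator_of_mem hs]

lemma js_fPhi : JS (Ioo 0 t) ℝ²₊ (compPhi f) := by
  have hO := isOpen_half
  have hI : UniqueDiffOn ℝ (Ioo 0 t) := isOpen_Ioo.uniqueDiffOn
  have j1 := (js_Rb H hw L).restrict.onHalf
  have j2 := (js_Rh H hw L).restrict.onHalf
  have j3 := (js_w H hw L).restrict.onHalf
  have j4 := (js_b H hw L).restrict
  refine JS.congr ((((j1.dt isOpen_Ioo hO).add (((j2.mul (j1.dr hI hO)).add
    (j3.mul (j1.dz hI hO))).add (j2.mul j4))).sub
    (((((j1.dr hI hO).dr hI hO).add (j4.dr hI hO)).add ((j1.dz hI hO).dz hI hO)).smul ν))) ?_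
  intro s hs q hq
  rw [momentum_angular H hw L hs hq.1]
  rfl

/-- The equation of the swirl. -/
lemma momentum_swirl {s : ℝ} (hs : s ∈ Ioo 0 t) {q : ℝ²} (hq : 0 < q.1) :
    f0 f s q = dt (R * (R * β)) s q + (R * h) s q * dr (R * (R * β)) s q
      + w s q * dz (R * (R * β)) s q
      - ν * (dr (dr (R * (R * β))) s q - dr (R * (R * β)) s q / q.1 + dz (dz (R * (R * β))) s q) := by
  have sb : Sm β := (L.flow 1).adm_b.sm
  have sR := Sm.R
  have e1 : dr (R * (R * β)) = R * β + R * (β + R * dr β) := by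
    simp only [dr_mul, dr_R, sb, sR, sR.mul sb]; ring
  have e0 : dr (R * β) = β + R * dr β := by
    simp only [dr_mul, dr_R, sb, sR]; ring
  have e2 : dr (dr (R * (R * β))) = 2 * (β + R * dr β) + R * dr (β + R * dr β) := by
    rw [e1, dr_add (sR.mul sb) (sR.mul (sb.add (sR.mul sb.dr))), dr_mul sR (sb.add (sR.mul sb.dr)),
      e0, dr_R]; ring
  have e3 : dz (R * (R * β)) = R * dz (R * β) := by rw [dz_mul sR (sR.mul sb), dz_R]; ring
  have e4 : dz (dz (R * (R * β))) = R * dz (dz (R * β)) := by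
    rw [e3, dz_mul sR (sR.mul sb).dz, dz_R]; ring
  have e5 : dt (R * (R * β)) s q = q.1 * dt (R * β) s q := by
    have hj := (js_Rb H hw L).restrict
    exact ((hj.hasDerivAt_t isOpen_Ioo hs (mem_univ q)).const_mul q.1).deriv
  have e6 : dr (β + R * dr β) = 2 * dr β + R * dr (dr β) := by
    rw [dr_add sb (sR.mul sb.dr), dr_mul sR sb.dr, dr_R]; ring
  have e7 : dr (dr (R * β)) = 2 * dr β + R * dr (dr β) := by rw [e0, e6]
  show q.1 * compPhi f s q = _
  rw [momentum_angular H hw L hs hq, e2, e1, e4, e3, e5, e6, e7, e0]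
  simp only [Pi.add_apply, Pi.mul_apply, ofNat_apply, show R s q = q.1 from rfl]
  field_simp
  ring

/-- The swirl is bounded by the data. -/
lemma swirl_bound (hν : 0 < ν) (hD : D2 t v f ≠ ⊤) {s : ℝ} (hs : s ∈ Ico 0 t)
    {q : ℝ²} (hq : 0 ≤ q.1) : |(R * (R * β)) s q| ≤ (D2 t v f).toReal := by
  obtain ⟨M, hM0, hM⟩ := exists_sup_bound H hw L
  have hj := js_Rb H hw L
  have hsb : Sm (R * (R * β)) := Sm.R.mul (Sm.R.mul (L.flow 1).adm_b.sm)
  have ht0 : (0 : ℝ) ∈ Icc 0 t := ⟨le_rfl, hs.1.trans hs.2.le⟩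
  set N : ℝ → ENNReal := fun s => spNorm ∞ (f0 f s) with hN
  set e₀ := (spNorm ∞ (swirl v 0)).toReal with he₀
  have hmix : mixNorm ∞ 1 t (f0 f) = ∫⁻ s in Ioo 0 t, N s := by
    rw [mixNorm, eLpNorm_one_eq_lintegral_enorm]; rfl
  have hD2 : D2 t v f = (∫⁻ s in Ioo 0 t, N s) + spNorm ∞ (swirl v 0) := by rw [D2, hmix]
  rw [hD2] at hD ⊢
  obtain ⟨hNt, het⟩ := ENNReal.add_ne_top.1 hD
  rw [ENNReal.toReal_add hNt het]
  have hsub : Ioc 0 s ⊆ Ioo 0 t := fun x hx => ⟨hx.1, hx.2.trans_lt hs.2⟩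
  have hle : (∫⁻ τ in Ioc 0 s, N τ).toReal ≤ (∫⁻ s in Ioo 0 t, N s).toReal :=
    toReal_mono hNt (lintegral_mono_set hsub)
  have hN' : ∫⁻ τ in Ioc 0 s, N τ ≠ ⊤ := ne_top_of_le_ne_top hNt (lintegral_mono_set hsub)
  have hjU : JS (Icc 0 t) univ (R * (R * β)) := JS.R.mul hj
  have hjU' := hjU.restrict
  have hF := js_fPhi H hw L
  have hFj : JS (Ioo 0 t) ℝ²₊ (f0 f) := JS.R.mul hF
  have hfN : ∀ τ ∈ Ioc 0 s, ∀ q : ℝ², 0 < q.1 → ‖f0 f τ q‖ₑ ≤ N τ := fun τ hτ q hq =>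
    enorm_le_spNorm_top (hFj.continuousOn.comp (f := fun q => (τ, q)) (by fun_prop)
      fun x hx => ⟨hsub hτ, hx⟩) hq
  have hcF : ∀ τ ∈ Ioc 0 s, ∀ q : ℝ², 0 < q.1 → ContinuousAt (fun τ => f0 f τ q) τ :=
    fun τ hτ q hq => (hFj.continuousOn_time ⟨hq, mem_univ _⟩).continuousAt
      (isOpen_Ioo.mem_nhds (hsub hτ))
  have hinit : ∀ q : ℝ², 0 ≤ q.1 → |(R * (R * β)) 0 q| ≤ e₀ := by
    intro q hq
    have hsw : swirl v 0 = (R * (R * β)) 0 := by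
      funext q
      rw [Pi.mul_apply, Pi.mul_apply, ← compPhi_eq H hw L ht0]; rfl
    rcases hq.eq_or_lt with h0 | h0
    · have : (R * (R * β)) 0 q = 0 := by
        show q.1 * _ = 0
        rw [← h0, zero_mul]
      rw [this, abs_zero]; exact toReal_nonneg
    · have := enorm_le_spNorm_top (hsb 0).continuous.continuousOn h0
      rw [← hsw] at this ⊢
      have h2 := toReal_mono het this
      simpa using h2
  have hMU : ∀ s (q : ℝ²), 0 ≤ q.1 → |(R * (R * β)) s q| ≤ M * q.1 := fun s q hq => by
    have : (R * (R * β)) s q = q.1 * (R * β) s q := rfl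
    rw [this, abs_mul, abs_of_nonneg hq, mul_comm]
    exact mul_le_mul_of_nonneg_right (hM s q).2.1 hq
  have hdt : ∀ σ ∈ Ioc 0 s, ∀ q : ℝ²,
      HasDerivAt (fun τ => (R * (R * β)) τ q) (dt (R * (R * β)) σ q) σ := fun σ hσ q =>
    hjU'.hasDerivAt_t isOpen_Ioo (hsub hσ) (mem_univ q)
  have hcon : ContinuousOn (fun y : ℝ × ℝ² => (R * (R * β)) y.1 y.2) (Icc 0 s ×ˢ univ) :=
    hjU.continuousOn.mono (prod_mono_left (Icc_subset_Icc_right hs.2.le))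
  have hup : (R * (R * β)) s q ≤ e₀ + (∫⁻ τ in Ioc 0 s, N τ).toReal :=
    swirl_le (T := s) (ν := ν) (a := R * h) (w := w) (F := f0 f) hν hM0 toReal_nonneg hcon hsb
      hdt (fun s q => (hM s q).1) (fun s q => (hM s q).2.2)
      (fun σ hσ q hq => momentum_swirl H hw L (hsub hσ) hq) hcF
      (fun σ hσ q hq => (ofReal_le_ofReal (le_abs_self _)).trans (by
        rw [← norm_eq_abs, ofReal_norm]; exact hfN σ hσ q hq)) hN'
      (fun s q hq => (le_abs_self _).trans (hMU s q hq))
      (fun q hq => (le_abs_self _).trans (hinit q hq)) ⟨hs.1, le_rfl⟩ hq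
  have hneg : ∀ σ q, dt (-(R * (R * β))) σ q = -dt (R * (R * β)) σ q := fun σ q => by
    show deriv (fun τ => -((R * (R * β)) τ q)) σ = _
    exact deriv.fun_neg
  have hdn : (-(R * (R * β))) s q ≤ e₀ + (∫⁻ τ in Ioc 0 s, N τ).toReal :=
    swirl_le (T := s) (ν := ν) (a := R * h) (w := w) (F := -f0 f) hν hM0 toReal_nonneg
      hcon.neg hsb.neg (fun σ hσ q => by rw [hneg]; exact (hdt σ hσ q).neg)
      (fun s q => (hM s q).1) (fun s q => (hM s q).2.2)
      (fun σ hσ q hq => by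
        have := momentum_swirl H hw L (hsub hσ) hq
        rw [dr_neg hsb, dz_neg hsb, dr_neg hsb.dr, dz_neg hsb.dz, hneg]
        simp only [Pi.neg_apply]
        rw [this]; ring)
      (fun σ hσ q hq => (hcF σ hσ q hq).neg)
      (fun σ hσ q hq => (ofReal_le_ofReal (neg_le_abs _)).trans (by
        rw [← norm_eq_abs, ofReal_norm]; exact hfN σ hσ q hq)) hN'
      (fun s q hq => (neg_le_abs _).trans (hMU s q hq))
      (fun q hq => (neg_le_abs _).trans (hinit q hq)) ⟨hs.1, le_rfl⟩ hq
  rw [abs_le]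
  have : (-(R * (R * β))) s q = -((R * (R * β)) s q) := rfl
  constructor <;> linarith

lemma enorm_compPhi_le {s : ℝ} (hs : s ∈ Ioo 0 t) {q : ℝ²} (hq : 0 < q.1) :
    ‖(R * β) s q‖ₑ ≤ supVphi t v := by
  have h1 : ∀ᵐ s ∂volume.restrict (Ioo 0 t), ‖spNorm ∞ (compPhi v s)‖ₑ ≤ supVphi t v := by
    rw [supVphi, mixNorm, eLpNorm_exponent_top]
    exact ae_le_eLpNormEssSup
  have h2 : ∀ᵐ s ∂volume.restrict (Ioo 0 t), ‖(R * β) s q‖ₑ ≤ supVphi t v := by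
    filter_upwards [h1, ae_restrict_mem measurableSet_Ioo] with s hs hst
    rw [compPhi_eq H hw L (Ioo_subset_Icc_self hst)] at hs
    exact (enorm_le_spNorm_top
      ((Sm.R.mul (L.flow 1).adm_b.sm) s).continuous.continuousOn hq).trans hs
  by_contra hc
  have hcont : ContinuousOn (fun s => (R * β) s q) (Ioo 0 t) :=
    ((js_Rb H hw L).continuousOn_time (mem_univ q)).mono Ioo_subset_Icc_self
  have hU : IsOpen (Ioo 0 t ∩ (fun s => (R * β) s q) ⁻¹' {x | supVphi t v < ‖x‖ₑ}) :=
    hcont.isOpen_inter_preimage isOpen_Ioo (isOpen_lt continuous_const continuous_enorm)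
  have h0 : volume (Ioo 0 t ∩ (fun s => (R * β) s q) ⁻¹' {x | supVphi t v < ‖x‖ₑ}) = 0 := by
    refine measure_mono_null ?_ ((ae_restrict_iff' measurableSet_Ioo).1 h2)
    intro x hx hx'
    exact absurd (hx' hx.1) (not_le.2 hx.2)
  rw [hU.measure_eq_zero_iff volume] at h0
  exact (eq_empty_iff_forall_notMem.1 h0 s) ⟨hs, not_le.1 hc⟩


lemma js_x (ht : 0 < t) : JS (Icc 0 t) univ ξ[β] := by
  have := ((js_Rb H hw L).dz (uniqueDiffOn_Icc ht) isOpen_univ).neg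
  rwa [dz_mul Sm.R (L.flow 1).adm_b.sm, dz_R, zero_mul, zero_add] at this

lemma vort_axial {s : ℝ} {q : ℝ²} (hq : q.1 ≠ 0) : compZ (rot V₀) s q = η[β] s q := by
  have sb := (L.flow 1).adm_b.sm
  rw [H.axiField.rot_Z hq, L.b_eq, dr_mul Sm.R sb, dr_R]
  simp only [Pi.add_apply, Pi.mul_apply, ofNat_apply, show R s q = q.1 from rfl]
  field_simp
  ring

lemma vort_radial {s : ℝ} {q : ℝ²} (hq : q.1 ≠ 0) : compR (rot V₀) s q = ξ[β] s q := by
  have sb := (L.flow 1).adm_b.sm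
  rw [H.axiField.rot_R hq, L.b_eq, dz_mul Sm.R sb, dz_R, zero_mul, zero_add]
  rfl

lemma vort_angular (s : ℝ) (q : ℝ²) : compPhi (rot V₀) s q = (R * (dz h - κ)) s q := by
  have sh := (L.flow 1).adm_h.sm
  rw [H.axiField.rot_Phi, L.a_eq, dz_mul Sm.R sh, dz_R, ← hw, (L.flow 1).dr_w]
  simp only [Pi.add_apply, Pi.mul_apply, Pi.zero_apply, Pi.sub_apply]
  ring

lemma js_y (ht : 0 < t) : JS (Icc 0 t) univ η[β] := by
  have sb := (L.flow 1).adm_b.sm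
  have e : η[β] = (onPlane fun s => pd 0 fun x => V₀ s x 1)
      - onPlane fun s => pd 1 fun x => V₀ s x 0 := by
    refine eq_of_eq_off_axis (((Sm.ofNat 2).mul sb).add (Sm.R.mul sb.dr))
      ((Sm.onPlane fun s => contDiff_pd (H.axiField.coord 1 s) 0).sub
        (Sm.onPlane fun s => contDiff_pd (H.axiField.coord 0 s) 1)) fun s q hq => ?_
    rw [← vort_axial H hw L hq]
    simp [compZ, rot, curl, onPlane]
  rw [e]
  exact (H.js_pd ht 1 0).sub (H.js_pd ht 0 1)

lemma js_enst (ht : 0 < t) : JS (Icc 0 t) univ (enst β) :=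
  ((js_x H hw L ht).sq.add (js_y H hw L ht).sq).smul _

lemma fPhi_eq {s : ℝ} (hs : s ∈ Ioo 0 t) {q : ℝ²} (hq : 0 < q.1) :
    compPhi f s q = (dt (R * β) + R * angRate ν h β w m) s q := by
  have sb := (L.flow 1).adm_b.sm
  have sm := (L.adm_m 1).sm
  rw [momentum_angular H hw L hs hq]
  have e1 : dr (R * β) = β + R * dr β := by rw [dr_mul Sm.R sb, dr_R]; ring
  have e2 : dr (dr (R * β)) = 3 * (R * m) + R * (R * dr m) := by
    rw [e1, dr_add sb (Sm.R.mul sb.dr), dr_mul Sm.R sb.dr, dr_R, L.dr_β, dr_mul Sm.R sm, dr_R]; ring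
  have e3 : dz (R * β) = R * dz β := by rw [dz_mul Sm.R sb, dz_R]; ring
  have e4 : dz (dz (R * β)) = R * dz (dz β) := by rw [e3, dz_mul Sm.R sb.dz, dz_R]; ring
  rw [e2, e1, e4, e3, L.dr_β, angRate, L.dr_β]
  simp only [Pi.add_apply, Pi.mul_apply, Pi.sub_apply, Pi.smul_apply, smul_eq_mul, ofNat_apply]
  ring

/-- The curl of the force in terms of the vorticity. -/
lemma rot_force {s : ℝ} (hs : s ∈ Ioo 0 t) {q : ℝ²} (hq : 0 < q.1) :
    compR (rot f) s q = dt ξ[β] s q - (R * dz (angRate ν h β w m)) s q ∧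
    compZ (rot f) s q = dt η[β] s q + (2 * angRate ν h β w m + R * dr (angRate ν h β w m)) s q := by
  have hO := isOpen_half
  have hqO : q ∈ ℝ²₊ := ⟨hq, mem_univ _⟩
  have hU : UniqueDiffOn ℝ (Ioo 0 t) := isOpen_Ioo.uniqueDiffOn
  have sb := (L.flow 1).adm_b.sm
  have sm := (L.adm_m 1).sm
  have sN : Sm (angRate ν h β w m) := by
    have sh := (L.flow 1).adm_h.sm
    have sw := (L.flow 1).adm_w.sm
    exact ((sh.mul (((Sm.ofNat 2).mul sb).add (Sm.R.mul sb.dr))).add (sw.mul sb.dz)).sub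
      (((((Sm.ofNat 4).mul sm).add (Sm.R.mul sm.dr)).add sb.dz.dz).smul ν)
  have hj := (js_Rb H hw L).restrict
  have hjb := (js_b H hw L).restrict
  have hjt := hj.dt isOpen_Ioo isOpen_univ
  have dfr : DifferentiableAt ℝ (dt (R * β) s) q :=
    ((hjt.slice hs).differentiable (by simp)).differentiableAt
  have hsm : 𝒞 (dt (R * β) s) := hjt.slice hs
  set N := angRate ν h β w m with hN
  have hV : compPhi f s = compPhi ((Ioo 0 t).indicator f) s := by
    funext q; simp only [compPhi, indicator_of_mem hs]
  have hr : ∀ q : ℝ², compR (rot f) s q = compR (rot ((Ioo 0 t).indicator f)) s q ∧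
      compZ (rot f) s q = compZ (rot ((Ioo 0 t).indicator f)) s q := fun q => by
    simp only [compR, compZ, rot, indicator_of_mem hs, and_self]
  have hline_r : (fun r => compPhi f s (r, q.2))
      =ᶠ[nhds q.1] fun r => (dt (R * β) + R * N) s (r, q.2) := by
    filter_upwards [isOpen_Ioi.mem_nhds hq] with r hr using fPhi_eq H hw L hs hr
  have hline_z : (fun z => compPhi f s (q.1, z)) = fun z => (dt (R * β) + R * N) s (q.1, z) :=
    funext fun z => fPhi_eq H hw L hs hq
  have hdz : dz (compPhi ((Ioo 0 t).indicator f)) s q = dz (dt (R * β)) s q + (R * dz N) s q := by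
    show deriv (fun z => compPhi ((Ioo 0 t).indicator f) s (q.1, z)) q.2 = _
    rw [← hV, hline_z]
    have h1 : HasDerivAt (fun z => dt (R * β) s (q.1, z)) (dz (dt (R * β)) s q) q.2 :=
      ((hsm.comp (contDiff_const.prodMk contDiff_id)).differentiable (by simp) q.2).hasDerivAt
    have h2 := (sN.hasDerivAt_z s q).const_mul q.1
    exact (h1.add h2).deriv
  have hdr : dr (compPhi ((Ioo 0 t).indicator f)) s q
      = dr (dt (R * β)) s q + (N + R * dr N) s q := by
    show deriv (fun r => compPhi ((Ioo 0 t).indicator f) s (r, q.2)) q.1 = _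
    rw [← hV, hline_r.deriv_eq]
    have h1 : HasDerivAt (fun r => dt (R * β) s (r, q.2)) (dr (dt (R * β)) s q) q.1 :=
      ((hsm.comp (contDiff_id.prodMk contDiff_const)).differentiable (by simp) q.1).hasDerivAt
    have h2 := (hasDerivAt_id q.1).mul (sN.hasDerivAt_r s q)
    refine (h1.add h2).deriv.trans ?_
    simp [R]
  constructor
  · rw [(hr q).1, H.axiField_f.rot_R hq.ne', hdz, ← hj.dt_dz isOpen_Ioo isOpen_univ hs (mem_univ q),
      dz_mul Sm.R sb, dz_R, zero_mul, zero_add]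
    have : dt ξ[β] s q = -dt (R * dz β) s q := deriv.fun_neg
    rw [this]; ring
  · have hb : dt (R * β) s q = q.1 * dt β s q :=
      ((hjb.hasDerivAt_t isOpen_Ioo hs hqO).const_mul q.1).deriv
    have hyt : dt η[β] s q = dt (dr (R * β)) s q + dt β s q := by
      have e : η[β] = dr (R * β) + β := by rw [dr_mul Sm.R sb, dr_R]; ring
      rw [e]
      exact (((hj.dr hU isOpen_univ).hasDerivAt_t isOpen_Ioo hs (mem_univ q)).add
        (hjb.hasDerivAt_t isOpen_Ioo hs hqO)).deriv
    rw [(hr q).2, H.axiField_f.rot_Z hq.ne', hdr, ← hV, fPhi_eq H hw L hs hq, hyt,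
      hj.dt_dr isOpen_Ioo isOpen_univ hs (mem_univ q)]
    simp only [Pi.add_apply, Pi.mul_apply, ofNat_apply, show R s q = q.1 from rfl]
    rw [hb, ← hN]
    field_simp
    ring

lemma dt_enst (ht : 0 < t) {s : ℝ} (hs : s ∈ Ioo 0 t) {q : ℝ²} (hq : 0 < q.1) :
    dt (enst β) s q = ξ[β] s q * compR (rot f) s q + η[β] s q * compZ (rot f) s q
      + (ξ[β] * (R * dz (angRate ν h β w m))
        - η[β] * (2 * angRate ν h β w m + R * dr (angRate ν h β w m)) : Fam) s q := by
  have hx := (js_x H hw L ht).restrict.hasDerivAt_t isOpen_Ioo hs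
    (mem_univ q)
  have hy := (js_y H hw L ht).restrict.hasDerivAt_t isOpen_Ioo hs
    (mem_univ q)
  have h1 : dt (enst β) s q = ξ[β] s q * dt ξ[β] s q + η[β] s q * dt η[β] s q := by
    refine ((((hx.pow 2).add (hy.pow 2)).const_mul (1 / 2 : ℝ)).deriv).trans ?_
    simp only [Nat.cast_ofNat, Nat.add_one_sub_one, pow_one]
    ring
  obtain ⟨e1, e2⟩ := rot_force H hw L hs hq
  rw [h1, e1, e2]
  simp only [Pi.mul_apply, Pi.sub_apply]
  ring


lemma adm_sq_enst {ζ : ℝ → ℝ} (hζ : 𝒞 ζ) (ρ : ℝ) : Adm ρ 1 (Z ζ ^ 2 * enst β) := by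
  rw [pow_two, mul_assoc]
  exact ((adm_enstFlux (ν := 1) (w := w) hζ (L.flow ρ) (L.adm_m _)).2.2.2.Z_mul hζ).Z_mul hζ

lemma enst_slice (ht : 0 < t) {ρ : ℝ} (hρ : 0 < ρ) {ζ : ℝ → ℝ} (hζ : 𝒞 ζ) (hζ0 : ζ ρ = 0)
    {χ : ℝ → ℝ} (hχ : 𝒞 χ) (hχs : HasCompactSupport χ) {s : ℝ} (hs : s ∈ Ioo 0 t) :
    ∫ q, (X χ * Z ζ ^ 2 : Fam) 0 q * dt (enst β) s q ∂strip ρ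
      = ∫ q, (X χ * vortRate ν ζ h β κ) s q ∂strip ρ
        + ∫ q, (X χ * Z ζ ^ 2 * forceE β f) s q ∂strip ρ
        - ∫ q, (X (deriv χ) * enstFluxZ ν ζ β w) s q ∂strip ρ := by
  have F := L.flow ρ
  obtain ⟨a1, a2, -, -⟩ := adm_enstFlux (ν := ν) (w := w) hζ F (L.adm_m ρ)
  have av := (adm_vortRate (ρ := ρ) hζ F.adm_h F.adm_b F.adm_k ν).2.2.2
  have aX : Adm ρ 2 (X χ) := Adm.X (by norm_num) hχ hχs
  have hid := enstrophy_identity (ν := ν) hζ F L.dr_β (L.adm_m ρ).sm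
  set k := enstFluxR ν ζ h β m with hk
  set K := enstFluxZ ν ζ β w with hK
  set V := vortRate ν ζ h β κ with hV
  have iV : Integrable (fun q => (X χ * V) s q) (strip ρ) :=
    (Adm.X_mul (p := 1) le_rfl hχ hχs (av.sm s)).integrable s
  have iK : Integrable (fun q => (X (deriv χ) * K) s q) (strip ρ) :=
    (Adm.X_mul (p := 1) le_rfl (contDiff_deriv hχ) hχs.deriv (a2.sm s)).integrable s
  have sdiv : Sm (2 * k + R * dr k + dz K) :=
    (((Sm.ofNat 2).mul a1.sm).add (Sm.R.mul a1.sm.dr)).add a2.sm.dz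
  have iD : Integrable (fun q => (X χ * (2 * k + R * dr k + dz K)) s q) (strip ρ) :=
    (Adm.X_mul (p := 1) le_rfl hχ hχs (sdiv s)).integrable s
  have hst : 𝒞 (dt (enst β) s) :=
    ((js_enst H hw L ht).restrict.dt isOpen_Ioo isOpen_univ).slice hs
  have iT : Integrable (fun q => (X χ * Z ζ ^ 2 : Fam) 0 q * dt (enst β) s q) (strip ρ) := by
    have hg : 𝒞 fun q : ℝ² => (Z ζ ^ 2 : Fam) s q * dt (enst β) s q := ((Sm.Z hζ).sq s).mul hst
    refine ((Adm.X_mul (p := 1) (ρ := ρ) le_rfl hχ hχs hg).integrable s).congr (ae_of_all _ fun q => ?_)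
    simp only [Pi.mul_apply, Pi.pow_apply, X, Z]
    ring
  have hdiv := integral_div_eq_zero hρ (k := X χ * k) (K := X χ * K) (aX.mul a1) (aX.mul a2)
    (fun s z => by
      have : (X χ * k) s (ρ, z) = χ z * k s (ρ, z) := rfl
      rw [this, hk]
      simp [enstFluxR, Z, hζ0]) s
  have hdiv' : ∫ q, (X χ * (2 * k + R * dr k + dz K)) s q ∂strip ρ
      = -∫ q, (X (deriv χ) * K) s q ∂strip ρ := by
    rw [eq_neg_iff_add_eq_zero, ← integral_add iD iK, ← hdiv]
    congr 1
    suffices hh : X χ * (2 * k + R * dr k + dz K) + X (deriv χ) * K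
        = 2 * (X χ * k) + R * dr (X χ * k) + dz (X χ * K) from congrFun hh s
    rw [dr_mul aX.sm a1.sm, dz_mul aX.sm a2.sm, dr_X, dz_X]
    ring
  have hF : ∀ q : ℝ², 0 < q.1 → (X χ * Z ζ ^ 2 * forceE β f) s q
      = (X χ * Z ζ ^ 2 : Fam) 0 q * dt (enst β) s q - (X χ * V) s q
        - (X χ * (2 * k + R * dr k + dz K)) s q := fun q hq => by
    have h1 := dt_enst H hw L ht hs hq
    have h2 := congrFun (congrFun hid s) q
    rw [Pi.mul_apply, Pi.mul_apply, Pi.add_apply (f := V), Pi.add_apply] at h2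
    change χ q.2 * (Z ζ ^ 2 : Fam) s q * (ξ[β] s q * compR (rot f) s q + η[β] s q * compZ (rot f) s q)
      = χ q.2 * (Z ζ ^ 2 : Fam) s q * dt (enst β) s q - χ q.2 * V s q
        - χ q.2 * (2 * k + R * dr k + dz K) s q
    rw [h1]
    linear_combination (-χ q.2) * h2
  have iTV : Integrable (fun q => (X χ * Z ζ ^ 2 : Fam) 0 q * dt (enst β) s q - (X χ * V) s q)
      (strip ρ) := iT.sub iV
  rw [integral_congr_ae (ae_strip fun q hq _ => hF q hq), integral_sub iTV iD,
    integral_sub iT iV, hdiv']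
  ring

lemma enst_slice_le (hν : 0 < ν) (ht : 0 < t) {ρ C : ℝ} {ζ ζ₁ : ℝ → ℝ} {χ : ℝ → ℝ}
    (hχ : 𝒞 χ) (hχs : HasCompactSupport χ) (hχ1 : ∀ z, |χ z| ≤ 1) {s d g K D ε : ℝ}
    (hs : s ∈ Ioo 0 t) (B : Bounds ρ ζ ζ₁ C h β w κ l s d g) (hε : 0 < ε) (hε1 : ε ≤ 1)
    (hK0 : 0 ≤ K) (hK : ∀ q : ℝ², 0 < q.1 → q.1 < ρ → |(R * β) s q| ≤ K * q.1 ^ (ε - 1))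
    (hD0 : 0 ≤ D) (hD : ∀ q : ℝ², 0 < q.1 → q.1 < ρ → q.1 * |(R * β) s q| ≤ D) {T : ℝ}
    (hT : T = ∫ q, (X χ * Z ζ ^ 2 : Fam) 0 q * dt (enst β) s q ∂strip ρ) :
    ofReal T + ofReal (ν / 4 * vortDiss ρ ζ β s)
      ≤ (ofReal (enstBd ν C (K * (ρ ^ ε / ε)) D d g) + ofReal (ν * C ^ 2 * d ^ 2)
        + ofReal (64 / ν) * (spNorm (6 / 5) (cut ζ (compR (rot f)) s) ^ 2
          + spNorm (6 / 5) (cut ζ (compZ (rot f)) s) ^ 2)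
        + ∫⁻ q, ‖(vortRate ν ζ h β κ - X χ * vortRate ν ζ h β κ) s q‖ₑ ∂strip ρ
        + ∫⁻ q, ‖(X (deriv χ) * enstFluxZ ν ζ β w) s q‖ₑ ∂strip ρ) + ofReal (-T) := by
  have hζ := B.cut.smooth
  have F := L.flow ρ
  have ab := F.adm_b
  have av := (adm_vortRate (ρ := ρ) hζ F.adm_h ab F.adm_k ν).2.2.2
  have hsl := enst_slice H hw L ht B.r_pos hζ (B.cut.zero _ le_rfl) hχ hχs hs
  rw [← hT] at hsl
  have hvb := B.vortRate_bound hε hε1 hν hK0 hK hD0 hD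
  rw [← enstBd] at hvb
  obtain ⟨hY0, hYx, hYy, -⟩ := vortDiss_bounds ρ ζ β s
  set Y := vortDiss ρ ζ β s with hY
  set V := vortRate ν ζ h β κ with hV
  have iXV : Integrable (fun q => (X χ * V) s q) (strip ρ) :=
    (Adm.X_mul (p := 1) le_rfl hχ hχs (av.sm s)).integrable s
  have hsub : ∫ q, (V - X χ * V) s q ∂strip ρ = ∫ q, V s q ∂strip ρ - ∫ q, (X χ * V) s q ∂strip ρ :=
    integral_sub (av.integrable s) iXV
  set x₁ := ∫ q, (X χ * Z ζ ^ 2 * forceE β f) s q ∂strip ρ with hx₁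
  set x₂ := ∫ q, (X (deriv χ) * enstFluxZ ν ζ β w) s q ∂strip ρ with hx₂
  set x₃ := ∫ q, (V - X χ * V) s q ∂strip ρ with hx₃
  have hmain : T + ν / 2 * Y ≤ enstBd ν C (K * (ρ ^ ε / ε)) D d g + |x₁| + |x₂| + |x₃| := by
    linarith [le_abs_self x₁, neg_le_abs x₂, neg_le_abs x₃]
  have ax : Adm ρ 2 ξ[β] := ab.dz.R_mul.neg
  have ay : Adm ρ 2 η[β] := (ab.ofNat_mul 2).add ab.dr.R_mul
  have hfc : Continuous (compR (rot ((Ioo 0 t).indicator f)) s)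
      ∧ Continuous (compZ (rot ((Ioo 0 t).indicator f)) s) := by
    have c := fun i j => (contDiff_pd (H.axiField_f.coord i s) j).continuous.comp contDiff_pt.continuous
    constructor
    · exact (c 2 1).sub (c 1 2)
    · exact (c 1 0).sub (c 0 1)
  have hind : compR (rot ((Ioo 0 t).indicator f)) s = compR (rot f) s
      ∧ compZ (rot ((Ioo 0 t).indicator f)) s = compZ (rot f) s := by
    constructor <;> funext q <;> simp only [compR, compZ, rot, indicator_of_mem hs]
  rw [hind.1, hind.2] at hfc
  have hζc : Continuous fun q : ℝ² => ζ q.1 := hζ.continuous.comp continuous_fst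
  have hGr : AEStronglyMeasurable (cut ζ (compR (rot f)) s) (strip ρ) :=
    (hfc.1.mul hζc).aestronglyMeasurable
  have hGz : AEStronglyMeasurable (cut ζ (compZ (rot f)) s) (strip ρ) :=
    (hfc.2.mul hζc).aestronglyMeasurable
  have l1 := B.lintegral_mul_le (Y := Y) hν ax (B.nn_x.trans (by linarith [B.d_nonneg])) hYx hGr
  have l2 := B.lintegral_mul_le (Y := Y) hν ay B.nn_y hYy hGz
  have lle : ∀ G : ℝ² → ℝ, eLpNorm G (6 / 5) (strip ρ) ≤ spNorm (6 / 5) G := fun G =>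
    eLpNorm_mono_measure G (strip_le_cyl _)
  have h1 : ‖x₁‖ₑ ≤ ofReal (ν / 4 * Y) + ofReal (ν * C ^ 2 * d ^ 2)
      + ofReal (64 / ν) * (spNorm (6 / 5) (cut ζ (compR (rot f)) s) ^ 2
          + spNorm (6 / 5) (cut ζ (compZ (rot f)) s) ^ 2) := by
    have hp : ∀ q, ‖(X χ * Z ζ ^ 2 * forceE β f) s q‖ₑ
        ≤ ‖(Z ζ * ξ[β]) s q * cut ζ (compR (rot f)) s q‖ₑ
          + ‖(Z ζ * η[β]) s q * cut ζ (compZ (rot f)) s q‖ₑ := fun q => by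
      have e : (X χ * Z ζ ^ 2 * forceE β f) s q = χ q.2 * ((Z ζ * ξ[β]) s q
          * cut ζ (compR (rot f)) s q + (Z ζ * η[β]) s q * cut ζ (compZ (rot f)) s q) := by
        simp only [forceE, cut, Pi.mul_apply, Pi.add_apply, Pi.pow_apply, X, Z]
        ring
      rw [e, enorm_mul]
      have : ‖χ q.2‖ₑ ≤ 1 := by
        rw [← ofReal_norm, ← ofReal_one]; exact ofReal_le_ofReal (hχ1 _)
      exact (mul_le_of_le_one_left' this).trans (enorm_add_le _ _)
    refine (enorm_integral_le_lintegral_enorm _).trans ((lintegral_mono hp).trans ?_)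
    have hm : AEMeasurable (fun q => ‖(Z ζ * ξ[β]) s q * cut ζ (compR (rot f)) s q‖ₑ)
        (strip ρ) := (((ax.Z_mul hζ).memLp s).1.mul hGr).enorm
    rw [lintegral_add_left' hm]
    refine (add_le_add l1 l2).trans ?_
    have e2 : ofReal (ν / 4 * Y) + ofReal (ν * C ^ 2 * d ^ 2)
        = ofReal (ν / 8 * Y + ν / 2 * C ^ 2 * d ^ 2)
          + ofReal (ν / 8 * Y + ν / 2 * C ^ 2 * d ^ 2) := by
      rw [← ofReal_add (by positivity) (by positivity),
        ← ofReal_add (by positivity) (by positivity)]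
      congr 1; ring
    rw [e2, mul_add, add_add_add_comm]
    gcongr <;> exact lle _
  have h2 : ‖x₂‖ₑ ≤ ∫⁻ q, ‖(X (deriv χ) * enstFluxZ ν ζ β w) s q‖ₑ ∂strip ρ :=
    enorm_integral_le_lintegral_enorm _
  have h3 : ‖x₃‖ₑ ≤ ∫⁻ q, ‖(V - X χ * V) s q‖ₑ ∂strip ρ := enorm_integral_le_lintegral_enorm _
  have habs : ∀ x : ℝ, ofReal |x| = ‖x‖ₑ := fun x => by rw [← norm_eq_abs, ofReal_norm]
  have h4 := ofReal_add_le_of_add_le (by positivity) hmain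
  have h5 : ofReal (enstBd ν C (K * (ρ ^ ε / ε)) D d g + |x₁| + |x₂| + |x₃|)
      ≤ ofReal (enstBd ν C (K * (ρ ^ ε / ε)) D d g) + ‖x₁‖ₑ + ‖x₂‖ₑ + ‖x₃‖ₑ := by
    rw [← habs, ← habs, ← habs]
    exact ofReal_add_le.trans (add_le_add_left (ofReal_add_le.trans
      (add_le_add_left ofReal_add_le _)) _)
  have e3 : ofReal (ν / 2 * Y) = ofReal (ν / 4 * Y) + ofReal (ν / 4 * Y) := by
    rw [← ofReal_add (by positivity) (by positivity)]; congr 1; ring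
  refine (ENNReal.add_le_add_iff_right (ofReal_ne_top (r := ν / 4 * Y))).1 ?_
  rw [add_assoc, ← e3]
  refine h4.trans ((add_le_add_left (h5.trans (add_le_add (add_le_add (add_le_add le_rfl h1) h2) h3))
    _).trans (le_of_eq ?_))
  ring


lemma js_k : JS (Icc 0 t) ℝ²₊ κ := by
  rcases lt_or_ge 0 t with ht | ht
  · have h1 := (js_w H hw L).dr (uniqueDiffOn_Icc ht) isOpen_univ
    rw [(L.flow 1).dr_w] at h1
    exact h1.of_R_mul
  · have hsub : ∀ y ∈ Icc 0 t ×ˢ ℝ²₊, y.1 = 0 := fun y hy => le_antisymm (hy.1.2.trans ht) hy.1.1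
    have h1 : ContDiffOn ℝ ∞ (fun y : ℝ × ℝ² => κ 0 y.2) (Icc 0 t ×ˢ ℝ²₊) :=
      (((L.flow 1).adm_k.sm 0).comp contDiff_snd).contDiffOn
    exact h1.congr fun y hy => by rw [hsub y hy]

lemma js_vortRate {ζ : ℝ → ℝ} (hζ : 𝒞 ζ) : JS (Ioo 0 t) ℝ²₊ (vortRate ν ζ h β κ) := by
  have hI : UniqueDiffOn ℝ (Ioo 0 t) := isOpen_Ioo.uniqueDiffOn
  have hO := isOpen_half
  have jh := (js_h H hw L).restrict
  have jb := (js_b H hw L).restrict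
  have jk := (js_k H hw L).restrict
  have jr : ∀ {g : Fam}, JS (Ioo 0 t) ℝ²₊ g → JS (Ioo 0 t) ℝ²₊ (dr g) := fun hg => hg.dr hI hO
  have jz : ∀ {g : Fam}, JS (Ioo 0 t) ℝ²₊ g → JS (Ioo 0 t) ℝ²₊ (dz g) := fun hg => hg.dz hI hO
  have j2 : JS (Ioo 0 t) ℝ²₊ (2 : Fam) := contDiffOn_const
  have jR : JS (Ioo 0 t) ℝ²₊ R := JS.R
  have jx : JS (Ioo 0 t) ℝ²₊ ξ[β] := (jR.mul (jz jb)).neg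
  have jy : JS (Ioo 0 t) ℝ²₊ η[β] := (j2.mul jb).add (jR.mul (jr jb))
  have jζ : JS (Ioo 0 t) ℝ²₊ (Z ζ) := JS.Z hζ
  have jζ' : JS (Ioo 0 t) ℝ²₊ (Z (deriv ζ)) := JS.Z (contDiff_deriv hζ)
  have ja : JS (Ioo 0 t) ℝ²₊ (h + R * dr h) := jh.add (jR.mul (jr jh))
  refine (((jζ.sq.mul (((jx.sq.mul ja).add ((jx.mul jy).mul ((jR.mul (jz jh)).add
    (jR.mul jk)))).sub (jy.sq.mul ((j2.mul jh).add (jR.mul (jr jh)))))).add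
    ((jζ.mul jζ').mul ((jR.mul jh).mul (jx.sq.add jy.sq)))).sub (JS.smul (jζ.sq.mul
    (((((jr jx).sq.add (jz jx).sq).add (jr jy).sq).add (jz jy).sq).add (jz jb).sq)) ν)).sub
    (JS.smul ((jζ.mul jζ').mul ((jx.mul (jr jx)).add (jy.mul (jr jy)))) (2 * ν))

/-- Integration in time of the enstrophy balance. -/
lemma enst_ineq (ht : 0 < t) {ρ : ℝ} (hρ : 0 < ρ) {ζ : ℝ → ℝ} (hζ : 𝒞 ζ) {N B : ℝ → ENNReal}
    (hB : ∀ n : ℕ, ∀ s ∈ Ioo 0 t, ∀ T : ℝ,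
      T = ∫ q, (X (heightCut n) * Z ζ ^ 2 : Fam) 0 q * dt (enst β) s q ∂strip ρ →
      ofReal T + N s ≤ (B s
        + ∫⁻ q, ‖(vortRate ν ζ h β κ - X (heightCut n) * vortRate ν ζ h β κ) s q‖ₑ ∂strip ρ
        + ∫⁻ q, ‖(X (deriv (heightCut n)) * enstFluxZ ν ζ β w) s q‖ₑ ∂strip ρ) + ofReal (-T))
    {s₁ s₂ : ℝ} (h1 : 0 < s₁) (h12 : s₁ ≤ s₂) (h2 : s₂ < t) :
    ofReal (∫ q, (Z ζ ^ 2 * enst β) s₂ q ∂strip ρ) + ∫⁻ s in Ioo s₁ s₂, N s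
      ≤ ofReal (∫ q, (Z ζ ^ 2 * enst β) 0 q ∂strip ρ) + ∫⁻ s in Ioo 0 t, B s := by
  have F := L.flow ρ
  have av := (adm_vortRate (ρ := ρ) hζ F.adm_h F.adm_b F.adm_k ν).2.2.2
  obtain ⟨-, -, a3, a4⟩ := adm_enstFlux (ν := ν) (w := w) hζ F (L.adm_m ρ)
  have aK : Adm ρ 1 (enstFluxZ ν ζ β w) := by
    rw [enstFluxZ, pow_two, mul_assoc, mul_assoc]
    exact ((a4.dz.Z_mul hζ).Z_mul hζ |>.smul ν).sub (((F.adm_w.mul a3).Z_mul hζ).Z_mul hζ)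
  have aE := adm_sq_enst H hw L hζ ρ
  obtain ⟨C₁, hC₁⟩ := aK.exists_lintegral_le
  obtain ⟨C₂, hC₂⟩ := av.exists_lintegral_le
  obtain ⟨C₀, hC₀, hC₀'⟩ := exists_bumpX_bound
  have hjs := js_enst H hw L ht
  set V := vortRate ν ζ h β κ with hV
  set φ : ℕ → Fam := fun n => X (heightCut n) * Z ζ ^ 2 with hφ
  set E : ℕ → ℝ → ℝ := fun n s => ∫ q, φ n 0 q * enst β s q ∂strip ρ with hE
  set tail : ℕ → ℝ → ENNReal := fun n s => ∫⁻ q, ‖(V - X (heightCut n) * V) s q‖ₑ ∂strip ρ with htail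
  set c : ℕ → ℝ := fun n => 1 / ((n : ℝ) + 1) with hc
  have c0 : ∀ n, 0 < c n := fun n => by positivity
  have en0 : ∀ s q, 0 ≤ enst β s q := fun s q =>
    mul_nonneg (by norm_num) (add_nonneg (sq_nonneg _) (sq_nonneg _))
  have hφ1 : ∀ n q, φ n 0 q = heightCut n q.2 * ζ q.1 ^ 2 := fun n q => rfl
  have hφE : ∀ n s q, φ n 0 q * enst β s q = heightCut n q.2 * (Z ζ ^ 2 * enst β) s q := fun n s q => by
    rw [hφ1, mul_assoc]; rfl
  have hZE0 : ∀ s q, 0 ≤ (Z ζ ^ 2 * enst β) s q := fun s q => mul_nonneg (sq_nonneg (ζ q.1)) (en0 s q)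
  have iφ : ∀ n s, Integrable (fun q => φ n 0 q * enst β s q) (strip ρ) := fun n s => by
    have := ((Adm.X (p := 2) (ρ := ρ) (by norm_num) (heightCut_smooth n) (heightCut_compact n)).mul
      (by rw [pow_two, mul_assoc]; exact (a3.Z_mul hζ).Z_mul hζ : Adm ρ 2 (Z ζ ^ 2 * enst β))).integrable s
    exact this.congr (ae_of_all _ fun q => (hφE n s q).symm)
  have hE0 : ∀ n s, 0 ≤ E n s := fun n s => integral_nonneg fun q => by
    rw [hφE]; exact mul_nonneg (heightCut_mem n _).1 (hZE0 s q)
  have hEle : ∀ n s, E n s ≤ ∫ q, (Z ζ ^ 2 * enst β) s q ∂strip ρ := fun n s =>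
    integral_mono (iφ n s) (aE.integrable s) fun q => by
      simp only [hφE]
      exact mul_le_of_le_one_left (hZE0 s q) (heightCut_mem n _).2
  have hflux : ∀ n s, ∫⁻ q, ‖(X (deriv (heightCut n)) * enstFluxZ ν ζ β w) s q‖ₑ ∂strip ρ
      ≤ ofReal (C₀ * c n) * C₁ := fun n s => by
    refine le_trans (lintegral_mono fun q => ?_) ((lintegral_const_mul' _ _ ofReal_ne_top).trans_le
      (mul_le_mul' le_rfl (hC₁ s)))
    rw [Pi.mul_apply, Pi.mul_apply, enorm_mul]
    refine mul_le_mul' ?_ le_rfl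
    rw [← ofReal_norm]
    exact ofReal_le_ofReal (hC₀' (c n) (c0 n) q.2).1
  have hVe : ∀ n s q, (V - X (heightCut n) * V) s q = (1 - heightCut n q.2) * V s q := fun n s q => by
    rw [sub_mul, one_mul]; rfl
  have htV : ∀ n s q, ‖(V - X (heightCut n) * V) s q‖ₑ ≤ ‖V s q‖ₑ := fun n s q => by
    rw [hVe, enorm_mul]
    refine mul_le_of_le_one_left' ?_
    rw [← ofReal_norm, ← ofReal_one, norm_eq_abs]
    have := heightCut_mem n q.2
    exact ofReal_le_ofReal (abs_le.2 ⟨by linarith, by linarith⟩)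
  have htail_le : ∀ n s, tail n s ≤ C₂ := fun n s => (lintegral_mono (htV n s)).trans (hC₂ s)
  have htail_meas : ∀ n, AEMeasurable (tail n) (volume.restrict (Ioo 0 t)) := fun n =>
    JS.aemeasurable_lintegral ((js_vortRate H hw L hζ).sub
      ((JS.X (heightCut_smooth n)).mul (js_vortRate H hw L hζ))) measurableSet_Ioo _ measurable_enorm
  have htail_s : ∀ s, Tendsto (fun n => tail n s) atTop (nhds 0) := fun s => by
    have h0 : ∫⁻ q : ℝ², (0 : ENNReal) ∂strip ρ = 0 := lintegral_zero
    rw [← h0]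
    refine tendsto_lintegral_of_dominated_convergence (fun q => ‖V s q‖ₑ) (fun n => ?_)
      (fun n => ae_of_all _ (htV n s)) (ne_top_of_le_ne_top coe_ne_top (hC₂ s))
      (ae_of_all _ fun q => ?_)
    · exact ((av.cont s).sub (((Sm.X (heightCut_smooth n)).mul av.sm) s).continuous).measurable.enorm
    · refine tendsto_const_nhds.congr' ?_
      filter_upwards [heightCut_eventually q.2] with n hn
      rw [hVe, hn, sub_self, zero_mul, enorm_zero]
  set err : ℕ → ENNReal := fun n => (∫⁻ s in Ioo 0 t, tail n s)
    + ofReal (C₀ * c n) * C₁ * ofReal t with herr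
  have herr0 : Tendsto err atTop (nhds 0) := by
    have e1 : Tendsto (fun n => ∫⁻ s in Ioo 0 t, tail n s) atTop (nhds 0) := by
      have h0 : ∫⁻ s in Ioo 0 t, (0 : ENNReal) = 0 := lintegral_zero
      rw [← h0]
      refine tendsto_lintegral_of_dominated_convergence' (fun _ => (C₂ : ENNReal)) htail_meas
        (fun n => ae_of_all _ (htail_le n)) ?_ (ae_of_all _ htail_s)
      rw [setLIntegral_const, volume_Ioo]
      exact ENNReal.mul_ne_top coe_ne_top ofReal_ne_top
    have e2 : Tendsto (fun n => ofReal (C₀ * c n)) atTop (nhds 0) := by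
      have := (tendsto_one_div_add_atTop_nhds_zero_nat (𝕜 := ℝ)).const_mul C₀
      rw [mul_zero] at this
      rw [← ENNReal.ofReal_zero]
      exact (continuous_ofReal.tendsto 0).comp this
    have e3 : Tendsto (fun n => ofReal (C₀ * c n) * C₁ * ofReal t) atTop
        (nhds (0 * C₁ * ofReal t)) :=
      ENNReal.Tendsto.mul_const (ENNReal.Tendsto.mul_const e2 (Or.inr coe_ne_top))
        (Or.inr ofReal_ne_top)
    have := e1.add e3
    rwa [zero_mul, zero_mul, add_zero] at this
  have hint : ∀ n, ∫⁻ s in Ioo 0 t, (B s + tail n s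
      + ∫⁻ q, ‖(X (deriv (heightCut n)) * enstFluxZ ν ζ β w) s q‖ₑ ∂strip ρ)
      ≤ (∫⁻ s in Ioo 0 t, B s) + err n := fun n => by
    calc _ ≤ ∫⁻ s in Ioo 0 t, (B s + tail n s + ofReal (C₀ * c n) * C₁) :=
          lintegral_mono fun s => add_le_add_right (hflux n s) _
      _ = _ := by
          rw [lintegral_add_right _ measurable_const, lintegral_add_right' _ (htail_meas n),
            setLIntegral_const, volume_Ioo, sub_zero, herr]
          ring
  have hstep : ∀ n, ofReal (E n s₂) + ∫⁻ s in Ioo s₁ s₂, N s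
      ≤ ofReal (∫ q, (Z ζ ^ 2 * enst β) 0 q ∂strip ρ) + ((∫⁻ s in Ioo 0 t, B s) + err n) := by
    intro n
    have hφc : Continuous (φ n 0) := by
      have : φ n 0 = fun q => heightCut n q.2 * ζ q.1 ^ 2 := funext fun q => hφ1 n q
      rw [this]
      exact ((heightCut_smooth n).continuous.comp continuous_snd).mul
        ((hζ.continuous.comp continuous_fst).pow 2)
    obtain ⟨C, m', -, k2, -, k4⟩ := a3.dec
    have hg : 𝒞 fun q : ℝ² => (Z ζ ^ 2 : Fam) 0 q := (Sm.Z hζ).sq 0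
    exact (weighted_balance ht hjs (fun s q hq hq' => (k4 s q hq hq').trans (k2 s q.2).2) hφc
      (L := 2 / c n) (fun q hq => by rw [hφ1, heightCut, bumpX_zero (c0 n) hq.le, zero_mul])
      ((Adm.X_mul (p := 1) le_rfl (heightCut_smooth n) (heightCut_compact n) hg).integrable 0)
      (hE0 n) (fun s hs => hB n s hs _ rfl) (hint n) h1 h12 h2).trans
        (add_le_add (ofReal_le_ofReal (hEle n 0)) le_rfl)
  have hElim : Tendsto (fun n => E n s₂) atTop (nhds (∫ q, (Z ζ ^ 2 * enst β) s₂ q ∂strip ρ)) := by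
    refine tendsto_integral_of_dominated_convergence (fun q => (Z ζ ^ 2 * enst β) s₂ q)
      (fun n => (iφ n s₂).aestronglyMeasurable) (aE.integrable s₂)
      (fun n => ae_of_all _ fun q => ?_) (ae_of_all _ fun q => ?_)
    · rw [hφE, norm_of_nonneg (mul_nonneg (heightCut_mem n _).1 (hZE0 s₂ q))]
      exact mul_le_of_le_one_left (hZE0 s₂ q) (heightCut_mem n _).2
    · refine tendsto_const_nhds.congr' ?_
      filter_upwards [heightCut_eventually q.2] with n hn
      rw [hφE, hn, one_mul]
  have hlim1 := ((continuous_ofReal.tendsto _).comp hElim).add_const (∫⁻ s in Ioo s₁ s₂, N s)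
  have hlim2 := (herr0.const_add (∫⁻ s in Ioo 0 t, B s)).const_add
    (ofReal (∫ q, (Z ζ ^ 2 * enst β) 0 q ∂strip ρ))
  rw [add_zero] at hlim2
  exact le_of_tendsto_of_tendsto' hlim1 hlim2 hstep


lemma supVphi_ne_top : supVphi t v ≠ ⊤ := by
  obtain ⟨M, -, hM⟩ := exists_sup_bound H hw L
  refine ne_top_of_le_ne_top (ofReal_ne_top (r := M)) ?_
  rw [supVphi, mixNorm, eLpNorm_exponent_top]
  refine essSup_le_of_ae_le _ ?_
  filter_upwards [ae_restrict_mem measurableSet_Ioo] with s hs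
  refine (eLpNorm_exponent_top (μ := cyl) (f := compPhi v s)).trans_le (essSup_le_of_ae_le _
    (ae_of_all _ fun q => ?_))
  simp only
  rw [compPhi_eq H hw L (Ioo_subset_Icc_self hs), ← ofReal_norm]
  exact ofReal_le_ofReal (hM s q).2.1

lemma aemeasurable_diss : AEMeasurable (fun s => ∫⁻ q, ofReal (dissE h β w s q) ∂cyl)
    (volume.restrict (Ioo 0 t)) := by
  have := (js_dissE H hw L).aemeasurable_lintegral measurableSet_Ioo univ measurable_ofReal
  simpa only [restrict_univ] using this

lemma aemeasurable_half {ζ : ℝ → ℝ} (hζ : 𝒞 ζ) (ρ : ℝ) :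
    AEMeasurable (half ρ (dissE h β w)) (volume.restrict (Ioo 0 t)) ∧
    AEMeasurable (half ρ (gradSq ζ h κ)) (volume.restrict (Ioo 0 t)) ∧
    AEMeasurable (fun s => spNorm (6 / 5) (cut ζ (compR (rot f)) s) ^ 2)
      (volume.restrict (Ioo 0 t)) := by
  have hI : UniqueDiffOn ℝ (Ioo 0 t) := isOpen_Ioo.uniqueDiffOn
  have hO := isOpen_half
  have jg := (JS.Z hζ).mul (((js_h H hw L).restrict.dz hI hO).sub
    (js_k H hw L).restrict)
  have jG : JS (Ioo 0 t) ℝ²₊ (gradSq ζ h κ) :=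
     (jg.dr hI hO).sq.add (jg.dz hI hO).sq
  have jF : JS (Ioo 0 t) ℝ²₊ (cut ζ (compR (rot f))) := by
    refine (((js_fPhi H hw L).dz hI hO).neg.mul (JS.Z hζ)).congr fun s hs q hq => ?_
    have h1 := H.axiField_f.rot_R (s := s) (q := q) (ne_of_gt hq.1)
    simp only [compR, rot, dz, compPhi, indicator_of_mem hs] at h1
    simp only [cut, compR, rot, Pi.mul_apply, Pi.neg_apply, Z, dz, compPhi, h1]
  refine ⟨((js_dissE H hw L).aemeasurable_lintegral measurableSet_Ioo _
    measurable_ofReal).pow_const _, (jG.aemeasurable_lintegral measurableSet_Ioo _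
    measurable_ofReal).pow_const _, AEMeasurable.pow_const ?_ _⟩
  have e6 : ((6 / 5 : ENNReal)).toReal = 6 / 5 := by simp [ENNReal.toReal_div]
  have h1 := jF.aemeasurable_lintegral measurableSet_Ioo univ
    (Φ := fun x => ‖x‖ₑ ^ (6 / 5 : ℝ)) (measurable_enorm.pow_const _)
  simp only [restrict_univ] at h1
  simp only [spNorm, eLpNorm_eq_lintegral_rpow_enorm_toReal (show (6 / 5 : ENNReal) ≠ 0 by simp)
    (show (6 / 5 : ENNReal) ≠ ⊤ by finiteness), e6]
  exact h1.pow_const _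

/-- The localized enstrophy estimate. -/
lemma enstrophy_estimate (hν : 0 < ν) (ht : 0 < t) {ρ C ε : ℝ} {ζ ζ₁ : ℝ → ℝ}
    (K : CutData ρ ζ ζ₁ C) (hε : 0 < ε) (hε1 : ε < 1) (hD2 : D2 t v f ≠ ⊤) {k J Γ : ENNReal}
    (hk : k = D2 t v f ^ (1 - ε) * supVphi t v ^ ε * ofReal (ρ ^ ε / ε))
    (hJ : ∫⁻ s in Ioo 0 t, ∫⁻ q, ofReal (dissE h β w s q) ∂cyl ≤ J ^ 2)
    (hΓ : ∫⁻ s in Ioo 0 t, half ρ (gradSq ζ h κ) s ^ 2 ≤ Γ ^ 2) {s₁ s₂ : ℝ} (h1 : 0 < s₁)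
    (h12 : s₁ ≤ s₂) (h2 : s₂ < t) :
    ofReal (∫ q, (Z ζ ^ 2 * enst β) s₂ q ∂strip ρ)
      + ∫⁻ s in Ioo s₁ s₂, ofReal (ν / 4 * vortDiss ρ ζ β s)
      ≤ ofReal (∫ q, (Z ζ ^ 2 * enst β) 0 q ∂strip ρ)
        + (ofReal (1000 * C ^ 2 * (1 + ν + 1 / ν)) * ((k ^ 2 + k + D2 t v f) * (J * Γ)
          + (k ^ 2 + k + 1 + D2 t v f + D2 t v f ^ 2) * J ^ 2) + ofReal (ν * C ^ 2) * J ^ 2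
        + ofReal (64 / ν) * (mixNorm (6 / 5) 2 t (cut ζ (compR (rot f))) ^ 2
          + mixNorm (6 / 5) 2 t (cut ζ (compZ (rot f))) ^ 2)) := by
  have F := L.flow ρ
  have hr := K.pos
  have hsw := fun s (hs : s ∈ Ico 0 t) q hq => swirl_bound H hw L hν hD2 (s := s) hs (q := q) hq
  have hsup := fun s (hs : s ∈ Ioo 0 t) q hq => enorm_compPhi_le H hw L hs (q := q) hq
  have hM := supVphi_ne_top H hw L
  obtain ⟨mD, mG, mF⟩ := aemeasurable_half H hw L K.smooth ρ
  set a := half ρ (dissE h β w) with ha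
  set b := half ρ (gradSq ζ h κ) with hb
  have aΓ := (F.adm_h.dz.sub F.adm_k).Z_mul K.smooth
  have fa : ∀ s, a s ≠ ⊤ := half_ne_top (adm_sq_sum F).2.2.1
  have fb : ∀ s, b s ≠ ⊤ := half_ne_top (aΓ.dr.sq.add aΓ.dz.sq : Adm ρ 1 (gradSq ζ h κ))
  have hIa : ∫⁻ s in Ioo 0 t, a s ^ 2 ≤ J ^ 2 := by
    refine le_trans (lintegral_mono fun s => ?_) hJ
    rw [ha, half_sq]
    exact lintegral_mono' (strip_le_cyl _) le_rfl
  have hIab : ∫⁻ s in Ioo 0 t, a s * b s ≤ J * Γ := by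
    refine (lintegral_mul_le_sqrt mD mG).trans ?_
    rw [← sq_rpow_half J, ← sq_rpow_half Γ]
    gcongr
  generalize D2 t v f = δ at *
  generalize supVphi t v = M at *
  lift δ to ℝ≥0 using hD2
  lift M to ℝ≥0 using hM
  have hw0 : 0 ≤ ρ ^ ε / ε := by positivity
  set k' : ℝ≥0 := δ ^ (1 - ε) * M ^ ε * (ρ ^ ε / ε).toNNReal with hk'
  have hkk : k = k' := by
    rw [hk, hk', coe_mul, coe_mul, coe_rpow_of_nonneg _ (by linarith), coe_rpow_of_nonneg _ hε.le]
    rfl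
  have hkr : (δ : ℝ) ^ (1 - ε) * (M : ℝ) ^ ε * (ρ ^ ε / ε) = k' := by
    rw [hk', NNReal.coe_mul, NNReal.coe_mul, NNReal.coe_rpow, NNReal.coe_rpow,
      Real.coe_toNNReal _ hw0]
  have hbal := enst_ineq H hw L ht (by linarith : 0 < ρ) K.smooth
    (N := fun s => ofReal (ν / 4 * vortDiss ρ ζ β s))
    (B := fun s => ofReal (1000 * C ^ 2 * (1 + ν + 1 / ν)) * (((k' : ENNReal) ^ 2 + k' + δ) * (a s * b s)
      + ((k' : ENNReal) ^ 2 + k' + 1 + δ + δ ^ 2) * a s ^ 2) + ofReal (ν * C ^ 2) * a s ^ 2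
      + ofReal (64 / ν) * (spNorm (6 / 5) (cut ζ (compR (rot f)) s) ^ 2
          + spNorm (6 / 5) (cut ζ (compZ (rot f)) s) ^ 2)) (fun n s hs T hT => by
    have hb1 : ∀ q : ℝ², 0 < q.1 → q.1 * |(R * β) s q| ≤ δ := fun q hq => by
      have := hsw s (Ioo_subset_Ico_self hs) q hq.le
      have e : (R * (R * β)) s q = q.1 * (R * β) s q := rfl
      rwa [e, abs_mul, abs_of_pos hq] at this
    have hb2 : ∀ q : ℝ², 0 < q.1 → |(R * β) s q| ≤ M := fun q hq => by
      have := toReal_mono coe_ne_top (hsup s hs q hq)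
      simpa using this
    have := enst_slice_le H hw L hν ht (heightCut_smooth n) (heightCut_compact n)
      (fun z => abs_le.2 ⟨by linarith [(heightCut_mem n z).1], (heightCut_mem n z).2⟩) hs
      (bounds_half K F s) hε hε1.le (by positivity)
      (fun q hq _ => abs_le_weight hq (hb1 q hq) (hb2 q hq) hε hε1.le) δ.coe_nonneg
      (fun q hq _ => hb1 q hq) hT
    rw [hkr] at this
    have e1 := ofReal_enstBd hν C k' δ (a s).toNNReal (b s).toNNReal
    rw [ENNReal.coe_toNNReal (fa s), ENNReal.coe_toNNReal (fb s)] at e1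
    have e2 : ofReal (ν * C ^ 2 * (a s).toReal ^ 2) = ofReal (ν * C ^ 2) * a s ^ 2 := by
      rw [ofReal_mul (by positivity), ofReal_pow toReal_nonneg, ofReal_toReal (fa s)]
    rw [← e1, ← e2]
    exact this) h1 h12 h2
  refine hbal.trans (add_le_add le_rfl ?_)
  rw [lintegral_add_left', lintegral_add_left', lintegral_const_mul'', lintegral_const_mul'',
    lintegral_add_left', lintegral_const_mul'', lintegral_const_mul'',
    lintegral_const_mul' _ _ ofReal_ne_top, lintegral_add_left' mF, mixNorm_two_sq, mixNorm_two_sq,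
    hkk]
  · gcongr
  all_goals fun_prop


lemma om_eq (ζ : ℝ → ℝ) {s : ℝ} (hs : s ∈ Icc 0 t) {q : ℝ²} (hq : 0 < q.1) :
    omR ζ v s q = (Z ζ * ξ[β]) s q ∧ omZ ζ v s q = (Z ζ * η[β]) s q
      ∧ GammaT ζ v s q = (Z ζ * (dz h - κ)) s q := by
  have h1 := vort_radial H hw L (s := s) (ne_of_gt hq)
  have h2 := vort_axial H hw L (s := s) (ne_of_gt hq)
  have h3 := vort_angular H hw L s q
  simp only [compR, compZ, compPhi, rot, indicator_of_mem hs] at h1 h2 h3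
  have e : (R * (dz h - κ)) s q = q.1 * (dz h - κ) s q := rfl
  refine ⟨?_, ?_, ?_⟩
  · simp only [omR, cut, compR, rot, h1, mul_comm, Pi.mul_apply, Z]
  · simp only [omZ, cut, compZ, rot, h2, mul_comm, Pi.mul_apply, Z]
  · simp only [GammaT, cut, overR, compPhi, rot, h3]
    rw [e, mul_div_cancel_left₀ _ (ne_of_gt hq), mul_comm]
    rfl

/-- The left-hand side is controlled by the terms of the enstrophy estimate. -/
lemma lhs_le (hν : 0 < ν) {ρ C : ℝ} {ζ ζ₁ : ℝ → ℝ} (K : CutData ρ ζ ζ₁ C) {J A : ENNReal}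
    (hJ : ∫⁻ s in Ioo 0 t, ∫⁻ q, ofReal (dissE h β w s q) ∂cyl ≤ J ^ 2)
    (hA : ∀ s₁ s₂, 0 < s₁ → s₁ ≤ s₂ → s₂ < t → ofReal (∫ q, (Z ζ ^ 2 * enst β) s₂ q ∂strip ρ)
      + ∫⁻ s in Ioo s₁ s₂, ofReal (ν / 4 * vortDiss ρ ζ β s) ≤ A) :
    lhs ν ζ t v ≤ (12 + 32 * ofReal (1 / ν)) * A + 16 * ofReal (C ^ 2) * J ^ 2 := by
  have F := L.flow ρ
  have ab := F.adm_b
  have sb := ab.sm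
  have ax := ab.dz.R_mul.neg
  have ay := (ab.ofNat_mul 2).add ab.dr.R_mul
  have hV : ∫⁻ s in Ioo 0 t, ofReal (ν / 4 * vortDiss ρ ζ β s) ≤ A :=
    lintegral_Ioo_le H hw L fun s₁ s₂ h1 h12 h2 => le_add_self.trans (hA s₁ s₂ h1 h12 h2)
  set I := ∫⁻ s in Ioo 0 t, ofReal (vortDiss ρ ζ β s) with hI
  have hVI : ofReal ν * I ≤ 4 * A := by
    have e : (4 : ENNReal) * ofReal (ν / 4) = ofReal ν := by
      rw [show (4 : ENNReal) = ofReal 4 by simp, ← ofReal_mul (by norm_num)]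
      congr 1; ring
    refine le_trans (le_of_eq ?_) (mul_le_mul' le_rfl hV)
    rw [← e, hI, mul_assoc, ← lintegral_const_mul' _ _ (by finiteness)]
    congr 1
    exact lintegral_congr fun s => (ofReal_mul (by positivity)).symm
  have hN : ofReal (1 / ν) * ofReal ν = 1 := by
    rw [← ofReal_mul (by positivity), one_div_mul_cancel hν.ne', ofReal_one]
  have hI4 : I ≤ 4 * ofReal (1 / ν) * A := by
    calc I = ofReal (1 / ν) * (ofReal ν * I) := by rw [← mul_assoc, hN, one_mul]
      _ ≤ ofReal (1 / ν) * (4 * A) := by gcongr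
      _ = _ := by ring
  have hsup : ∀ u : Fam, Adm ρ 2 u → (∀ s q, u s q ^ 2 ≤ 2 * enst β s q) → ∀ s ∈ Ioo 0 t,
      ∫⁻ q, ofReal ((Z ζ * u) s q ^ 2) ∂cyl ≤ 2 * A := fun u au hu s hs => by
    have aE := adm_sq_enst H hw L K.smooth ρ
    have e0 : ∀ q, 0 ≤ (Z ζ ^ 2 * enst β) s q := fun q =>
      mul_nonneg (sq_nonneg _) (by linarith [hu s q, sq_nonneg (u s q)])
    rw [lintegral_cyl_eq_strip (ρ := ρ) fun q hq => by
      rw [K.Z_mul_eq_zero u s hq]; simp]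
    refine le_trans ?_ (mul_le_mul' le_rfl (le_self_add.trans (hA s s hs.1 le_rfl hs.2)))
    rw [ofReal_integral_eq_lintegral_ofReal (aE.integrable s) (ae_of_all _ e0),
      ← lintegral_const_mul' _ _ (by finiteness)]
    refine lintegral_mono fun q => ?_
    rw [show (2 : ENNReal) = ofReal 2 by simp, ← ofReal_mul (by norm_num)]
    refine ofReal_le_ofReal ?_
    change (ζ q.1 * u s q) ^ 2 ≤ 2 * (ζ q.1 ^ 2 * enst β s q)
    nlinarith [mul_le_mul_of_nonneg_left (hu s q) (sq_nonneg (ζ q.1))]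
  have hgrad : ∀ u : Fam, Adm ρ 2 u → (∀ s q, u s q ^ 2 ≤ 2 * dissE h β w s q) →
      (∀ s, nn ρ ((Z ζ * dr u) s) ^ 2 + nn ρ ((Z ζ * dz u) s) ^ 2 ≤ vortDiss ρ ζ β s) →
      ∫⁻ s in Ioo 0 t, ∫⁻ q, ofReal (dr (Z ζ * u) s q ^ 2 + dz (Z ζ * u) s q ^ 2) ∂cyl
        ≤ 8 * ofReal (1 / ν) * A + 4 * ofReal (C ^ 2) * J ^ 2 := fun u au hu hd => by
    calc _ ≤ ∫⁻ s in Ioo 0 t, (2 * ofReal (vortDiss ρ ζ β s)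
          + 4 * ofReal (C ^ 2) * ∫⁻ q, ofReal (dissE h β w s q) ∂cyl) := by
          refine lintegral_mono fun s => (lintegral_grad_cut_le K au.dr au.dz au.sm
            ((adm_sq_sum F).2.2.1.cont s).measurable (hu s)).trans ?_
          gcongr
          exact hd s
      _ = 2 * I + 4 * ofReal (C ^ 2) * ∫⁻ s in Ioo 0 t, ∫⁻ q, ofReal (dissE h β w s q) ∂cyl := by
          have mD : AEMeasurable (fun s => 4 * ofReal (C ^ 2)
              * ∫⁻ q, ofReal (dissE h β w s q) ∂cyl) (volume.restrict (Ioo 0 t)) :=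
            (aemeasurable_diss H hw L).const_mul _
          rw [lintegral_add_right' _ mD, lintegral_const_mul' _ _ (by finiteness),
            lintegral_const_mul' _ _ (by finiteness)]
      _ ≤ 2 * (4 * ofReal (1 / ν) * A) + 4 * ofReal (C ^ 2) * J ^ 2 := by gcongr
      _ = _ := by ring
  have hen : ∀ s q, 2 * enst β s q = ξ[β] s q ^ 2 + η[β] s q ^ 2 := fun s q => by
    simp only [enst, Pi.smul_apply, Pi.add_apply, Pi.pow_apply, smul_eq_mul]; ring
  have ex : ∀ s q, ξ[β] s q = -(dz (R * β) s q) := fun s q => by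
    rw [dz_mul Sm.R sb, dz_R, zero_mul, zero_add]; rfl
  have ey : ∀ s q, η[β] s q = dr (R * β) s q + β s q := fun s q => by
    rw [dr_mul Sm.R sb, dr_R, one_mul]
    simp only [Pi.add_apply, Pi.mul_apply, ofNat_apply]; ring
  have hdE : ∀ s q, ξ[β] s q ^ 2 ≤ 2 * dissE h β w s q ∧ η[β] s q ^ 2 ≤ 2 * dissE h β w s q := by
    intro s q
    rw [ex, ey, show dissE h β w s q = dr (R * h) s q ^ 2 + dz (R * h) s q ^ 2 + dr (R * β) s q ^ 2
      + dz (R * β) s q ^ 2 + dr w s q ^ 2 + dz w s q ^ 2 + h s q ^ 2 + β s q ^ 2 from rfl]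
    constructor <;> linarith [sq_nonneg (dr (R * h) s q), sq_nonneg (dz (R * h) s q),
      sq_nonneg (dr (R * β) s q - β s q), sq_nonneg (dr (R * β) s q), sq_nonneg (dz (R * β) s q),
      sq_nonneg (dr w s q), sq_nonneg (dz w s q), sq_nonneg (h s q), sq_nonneg (β s q)]
  have hx := vNorm_sq_le (fun s hs q hq => (om_eq H hw L ζ (Ioo_subset_Icc_self hs) hq).1)
    (hsup _ ax fun s q => by rw [hen]; linarith [sq_nonneg (η[β] s q)])
    (hgrad _ ax (fun s q => (hdE s q).1) fun s => (vortDiss_bounds ρ ζ β s).2.1)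
  have hy := vNorm_sq_le (fun s hs q hq => (om_eq H hw L ζ (Ioo_subset_Icc_self hs) hq).2.1)
    (hsup _ ay fun s q => by rw [hen]; linarith [sq_nonneg (ξ[β] s q)])
    (hgrad _ ay (fun s q => (hdE s q).2) fun s => (vortDiss_bounds ρ ζ β s).2.2.1)
  have hz : ofReal ν * mixNorm 2 2 t (overR (omR ζ v)) ^ 2 ≤ 4 * A := by
    refine le_trans (mul_le_mul' le_rfl ?_) hVI
    rw [mixNorm_two_sq]
    refine setLIntegral_mono' measurableSet_Ioo fun s hs => ?_
    have bz := ab.dz.Z_mul K.smooth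
    calc spNorm 2 (overR (omR ζ v) s) ^ 2
        = ∫⁻ q, ofReal ((Z ζ * dz β) s q ^ 2) ∂cyl := by
          rw [spNorm, eLpNorm_two_sq]
          refine lintegral_congr_ae (ae_cyl fun q hq => ?_)
          have e2 : overR (omR ζ v) s q = -(Z ζ * dz β) s q := by
            rw [overR, (om_eq H hw L ζ (Ioo_subset_Icc_self hs) hq).1]
            change ζ q.1 * -(q.1 * dz β s q) / q.1 = -(ζ q.1 * dz β s q)
            field_simp
          simp only [e2, real_enorm_sq, neg_sq]
      _ = ofReal (nn ρ ((Z ζ * dz β) s) ^ 2) := by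
          rw [ofReal_nn_sq (bz.memLp s)]
          refine lintegral_cyl_eq_strip fun q hq => ?_
          rw [K.Z_mul_eq_zero _ s hq]; simp
      _ ≤ _ := ofReal_le_ofReal (vortDiss_bounds ρ ζ β s).2.2.2
  calc lhs ν ζ t v ≤ _ := add_le_add (add_le_add hx hy) hz
    _ = _ := by ring


lemma initial_enst_le (ht : 0 < t) {r₀ C : ℝ} {ζ ζ₁ : ℝ → ℝ} (K : CutData (2 * r₀) ζ ζ₁ C) :
    ofReal (∫ q, (Z ζ ^ 2 * enst β) 0 q ∂strip (2 * r₀))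
      ≤ spNorm 2 (omR ζ v 0) ^ 2 + spNorm 2 (omZ ζ v 0) ^ 2 := by
  have F := L.flow (2 * r₀)
  have ax := (F.adm_b.dz.R_mul.neg.Z_mul K.smooth).cont 0
  have aE := adm_sq_enst H hw L K.smooth (2 * r₀)
  have hq : ∀ q : ℝ², (Z ζ ^ 2 * enst β) 0 q = 1 / 2 * ((Z ζ * ξ[β]) 0 q ^ 2
      + (Z ζ * η[β]) 0 q ^ 2) := fun q => by
    simp only [enst, Pi.smul_apply, Pi.add_apply, Pi.pow_apply, Pi.mul_apply, smul_eq_mul]; ring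
  rw [ofReal_integral_eq_lintegral_ofReal (aE.integrable 0)
    (ae_of_all _ fun q => by rw [hq]; positivity)]
  refine (lintegral_mono' (strip_le_cyl _) le_rfl).trans ?_
  rw [spNorm, spNorm, eLpNorm_two_sq, eLpNorm_two_sq]
  have e1 : ∫⁻ q, ‖omR ζ v 0 q‖ₑ ^ 2 ∂cyl = ∫⁻ q, ofReal ((Z ζ * ξ[β]) 0 q ^ 2) ∂cyl :=
    lintegral_congr_ae (ae_cyl fun q hq => by
      simp only [(om_eq H hw L ζ (left_mem_Icc.2 ht.le) hq).1, real_enorm_sq])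
  have e2 : ∫⁻ q, ‖omZ ζ v 0 q‖ₑ ^ 2 ∂cyl = ∫⁻ q, ofReal ((Z ζ * η[β]) 0 q ^ 2) ∂cyl :=
    lintegral_congr_ae (ae_cyl fun q hq => by
      simp only [(om_eq H hw L ζ (left_mem_Icc.2 ht.le) hq).2.1, real_enorm_sq])
  have mx : Measurable fun q => ofReal ((Z ζ * ξ[β]) 0 q ^ 2) :=
    measurable_ofReal.comp (ax.measurable.pow_const 2)
  rw [e1, e2, ← lintegral_add_left mx]
  refine lintegral_mono fun q => ?_
  rw [← ofReal_add (sq_nonneg _) (sq_nonneg _)]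
  refine ofReal_le_ofReal ?_
  rw [hq]
  linarith [sq_nonneg ((Z ζ * ξ[β]) 0 q), sq_nonneg ((Z ζ * η[β]) 0 q)]

lemma lintegral_gradSq_le {r₀ : ℝ} (ζ : ℝ → ℝ) : ∫⁻ s in Ioo 0 t, half (2 * r₀) (gradSq ζ h κ) s ^ 2
      ≤ mixNorm 2 2 t (gradAbs (GammaT ζ v)) ^ 2 := by
  rw [mixNorm_two_sq]
  refine setLIntegral_mono' measurableSet_Ioo fun s hs => ?_
  rw [half_sq, spNorm, eLpNorm_two_sq]
  refine (lintegral_mono' (strip_le_cyl _) le_rfl).trans (lintegral_mono_ae (ae_cyl fun q hq => ?_))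
  rw [gradAbs_congr (fun q hq => (om_eq H hw L ζ (Ioo_subset_Icc_self hs) hq).2.2) hq,
    enorm_gradAbs_sq]
  exact le_rfl

/-- The constant of the final estimate. -/
def constBd (ν C : ℝ) : ENNReal :=
  (12 + 32 * ofReal (1 / ν)) * (1 + ofReal (1000 * C ^ 2 * (1 + ν + 1 / ν))
      * (4 * ofReal √(1 / ν) + 4 * ofReal (1 / ν))
    + ofReal (ν * C ^ 2) * ofReal (1 / ν) + ofReal (64 / ν))
  + 16 * ofReal (C ^ 2) * ofReal (1 / ν)

lemma lhs_le_dataBd (hν : 0 < ν) (ht : 0 < t) {r₀ C ε : ℝ} {ζ ζ₁ : ℝ → ℝ}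
    (K : CutData (2 * r₀) ζ ζ₁ C) (hε : 0 < ε) (hε1 : ε < 1) (hD1 : D1 t v f ≠ ⊤) (hD2 : D2 t v f ≠ ⊤) :
    lhs ν ζ t v ≤ constBd ν C
      * dataBd r₀ ζ ε t v f (supVphi t v) (mixNorm 2 2 t (gradAbs (GammaT ζ v))) := by
  set G := mixNorm 2 2 t (gradAbs (GammaT ζ v)) with hG
  set n := ofReal √(1 / ν) with hn
  set N := ofReal (1 / ν) with hN
  have hnN : n ^ 2 = N := by
    rw [hn, hN, ← ofReal_pow (sqrt_nonneg _), sq_sqrt (by positivity)]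
  have hNν : N * ofReal ν = 1 := by
    rw [hN, ← ofReal_mul (by positivity), one_div_mul_cancel hν.ne', ofReal_one]
  have hJ : ∫⁻ s in Ioo 0 t, ∫⁻ q, ofReal (dissE h β w s q) ∂cyl ≤ (n * D1 t v f) ^ 2 := by
    have := mul_le_mul' (le_refl N) (energy_estimate H hw L hν ht hD1)
    rw [← mul_assoc, hNν, one_mul] at this
    rwa [mul_pow, hnN]
  have hΓ := lintegral_gradSq_le H hw L (r₀ := r₀) ζ
  rw [← hG] at hΓ
  set k := D2 t v f ^ (1 - ε) * supVphi t v ^ ε * ofReal ((2 * r₀) ^ ε / ε) with hk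
  have hA := fun s₁ s₂ h1 h12 h2 => (enstrophy_estimate H hw L hν ht K hε hε1 hD2 hk hJ hΓ
    (s₁ := s₁) (s₂ := s₂) h1 h12 h2).trans (add_le_add (initial_enst_le H hw L ht K) le_rfl)
  refine (lhs_le H hw L hν K hJ hA).trans ?_
  obtain ⟨hk1, hk2⟩ := mul_rpow_le_data (ε := ε) (r₀ := r₀) (by linarith [K.pos]) hε hε1 (t := t) (v := v) (f := f) (supVphi t v)
  rw [← hk] at hk1 hk2
  have h8 := sq_mul_sq_le_data ζ t v f
  have h11 : D1 t v f * D2 t v f ≤ D11 t v f := by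
    rw [D11, add_assoc]; exact mul_le_mul' le_self_add le_rfl
  set Q := dataBd r₀ ζ ε t v f (supVphi t v) G with hQ
  rw [constBd, ← hn, ← hN]
  have hQ1 : (D11 t v f + D12 r₀ ε t v f * supVphi t v ^ ε
      + D9 r₀ ε t v f * supVphi t v ^ (2 * ε)) * G ≤ Q := by
    rw [hQ, dataBd]; exact le_self_add.trans le_self_add
  have hQ2 : D12 r₀ ε t v f * D1 t v f * supVphi t v ^ ε
      + D9 r₀ ε t v f * D1 t v f * supVphi t v ^ (2 * ε) + D8 ζ t v f ≤ Q := by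
    rw [hQ, dataBd]; exact add_le_add le_add_self le_rfl
  have h8Q : D8 ζ t v f ≤ Q := le_add_self
  clear_value Q k n N G
  generalize supVphi t v ^ ε = m at *
  generalize supVphi t v ^ (2 * ε) = m2 at *
  generalize D8 ζ t v f = d8 at *
  generalize D9 r₀ ε t v f = d9 at *
  generalize D12 r₀ ε t v f = d12 at *
  generalize D11 t v f = d11 at *
  generalize D1 t v f = a at *
  generalize D2 t v f = b at *
  generalize mixNorm (6 / 5) 2 t (cut ζ (compR (rot f))) ^ 2
    + mixNorm (6 / 5) 2 t (cut ζ (compZ (rot f))) ^ 2 = fF at *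
  generalize spNorm 2 (omR ζ v 0) ^ 2 + spNorm 2 (omZ ζ v 0) ^ 2 = e0 at *
  generalize ofReal (1000 * C ^ 2 * (1 + ν + 1 / ν)) = c0
  generalize ofReal (ν * C ^ 2) = c1
  generalize ofReal (64 / ν) = c2
  have i1 : (k ^ 2 + k + b) * (a * G) ≤ 4 * Q := by
    calc _ = (a * k ^ 2 + a * k + a * b) * G := by ring
      _ ≤ (4 * (d9 * m2) + 4 * (d12 * m) + 4 * d11) * G := by
        gcongr ?_ * _
        refine add_le_add (add_le_add hk2 (hk1.trans ?_)) (h11.trans ?_)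
        · gcongr; norm_num
        · exact le_mul_of_one_le_left' (by norm_num)
      _ = 4 * ((d11 + d12 * m + d9 * m2) * G) := by ring
      _ ≤ _ := by gcongr
  have i2 : (k ^ 2 + k + 1 + b + b ^ 2) * a ^ 2 ≤ 4 * Q := by
    calc _ = a * k ^ 2 * a + a * k * a + (1 + b + b ^ 2) * a ^ 2 := by ring
      _ ≤ 4 * (d9 * m2) * a + 4 * (d12 * m) * a + 4 * d8 := by
        refine add_le_add (add_le_add (mul_le_mul' hk2 le_rfl)
          (mul_le_mul' (hk1.trans ?_) le_rfl)) ?_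
        · gcongr; norm_num
        · refine le_trans ?_ (le_mul_of_one_le_left' (by norm_num : (1 : ENNReal) ≤ 4))
          exact (le_self_add.trans le_self_add).trans h8
      _ = 4 * (d12 * a * m + d9 * a * m2 + d8) := by ring
      _ ≤ _ := by gcongr
  have i3 : a ^ 2 ≤ Q := by
    refine le_trans ?_ h8Q
    refine le_trans ?_ ((le_self_add.trans le_self_add).trans h8)
    exact le_mul_of_one_le_left' (by rw [add_assoc]; exact le_self_add)
  have i4 : fF ≤ Q := (le_add_self.trans (le_self_add.trans h8)).trans h8Q
  have i5 : e0 ≤ Q := (le_add_self.trans h8).trans h8Q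
  calc _ = (12 + 32 * N) * (e0 + (c0 * (n * ((k ^ 2 + k + b) * (a * G))
        + n ^ 2 * ((k ^ 2 + k + 1 + b + b ^ 2) * a ^ 2)) + c1 * (n ^ 2 * a ^ 2) + c2 * fF))
        + 16 * ofReal (C ^ 2) * (n ^ 2 * a ^ 2) := by ring
    _ ≤ (12 + 32 * N) * (Q + (c0 * (n * (4 * Q) + n ^ 2 * (4 * Q)) + c1 * (n ^ 2 * Q) + c2 * Q))
        + 16 * ofReal (C ^ 2) * (n ^ 2 * Q) := by gcongr
    _ = _ := by rw [hnN]; ring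

end solution

end AxiNS

end

theorem lemma5p1 (ν r₀ : ℝ) (hν : 0 < ν) (hr₀ : 0 < r₀) (ζ : ℝ → ℝ) (hζ : IsCutoff r₀ ζ) :
    ∃ c : ℝ, 0 < c ∧ ∃ φ : (Fin 8 → ℝ) → ℝ, Monotone φ ∧ (∀ d, 0 < φ d) ∧
      ∀ (ε₀ : ℝ), 0 < ε₀ → ε₀ < 1 → ∀ (t : ℝ), 0 < t →
      ∀ (v f : ℝ → E3 → E3) (p : ℝ → E3 → ℝ), IsRegularSolution ν t v p f →
      (∀ i, data r₀ ζ ε₀ t v f i ≠ ⊤) →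
      ∀ (M G A B : ℝ≥0∞), M = supVphi t v → G = mixNorm 2 2 t (gradAbs (GammaT ζ v)) →
      A = ENNReal.ofReal c
        * ((D11 t v f + D12 r₀ ε₀ t v f * M ^ ε₀ + D9 r₀ ε₀ t v f * M ^ (2 * ε₀)) * G
          + (D12 r₀ ε₀ t v f * D1 t v f * M ^ ε₀ + D9 r₀ ε₀ t v f * D1 t v f * M ^ (2 * ε₀))
          + D8 ζ t v f) →
      B = ENNReal.ofReal (φ (fun i => (data r₀ ζ ε₀ t v f i).toReal)) * (1 + M ^ (2 * ε₀)) →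
      lhs ν ζ t v ≤ A ∧ A ≤ B * G + B ∧
        mixNorm 2 2 t (PhiT ζ v) ^ 2 ≤ B * (XT ζ t v + 1) := by
  obtain ⟨ζ₁, C, K⟩ := hζ.exists_cutData hr₀
  have hcf : constBd ν C ≠ ⊤ := by rw [constBd]; finiteness
  set c := (constBd ν C).toReal with hc
  have hc0 : 0 < c := ENNReal.toReal_pos (by simp [constBd]) hcf
  have hcC : ENNReal.ofReal c = constBd ν C := ENNReal.ofReal_toReal hcf
  have hpos : ∀ d : Fin 8 → ℝ, 0 < 1 + ∑ i, max (d i) 0 := fun d =>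
    add_pos_of_pos_of_nonneg one_pos (Finset.sum_nonneg fun i _ => le_max_right _ _)
  refine ⟨c, hc0, fun d => c * (1 + 1 / ν) * (1 + ∑ i, max (d i) 0) ^ 2, fun d d' hd => ?_,
    fun d => by have := hpos d; positivity, ?_⟩
  · have := (hpos d).le
    have h2 : ∑ i, max (d i) 0 ≤ ∑ i, max (d' i) 0 :=
      Finset.sum_le_sum fun i _ => max_le_max (hd i) le_rfl
    dsimp only
    gcongr
  intro ε hε hε1 t ht v f p H hdata M G A B hM hG hA hB
  obtain ⟨h, β, κ, l, m, L⟩ := H.exists_parts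
  have hlhs : lhs ν ζ t v ≤ A := by
    rw [hA, hM, hG, hcC]
    exact lhs_le_dataBd H rfl L hν ht K hε hε1 (hdata 0) (hdata 1)
  have hS : ENNReal.ofReal (1 + ∑ i, max (data r₀ ζ ε t v f i).toReal 0)
      = 1 + ∑ i, data r₀ ζ ε t v f i := by
    rw [ENNReal.ofReal_add zero_le_one (Finset.sum_nonneg fun i _ => le_max_right _ _),
      ENNReal.ofReal_one, ENNReal.ofReal_sum_of_nonneg fun i _ => le_max_right _ _]
    congr 1
    exact Finset.sum_congr rfl fun i _ => by
      rw [max_eq_left ENNReal.toReal_nonneg, ENNReal.ofReal_toReal (hdata i)]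
  set P := (1 + ∑ i, data r₀ ζ ε t v f i) ^ 2 * (1 + M ^ (2 * ε)) with hP
  have hAP : A ≤ ENNReal.ofReal c * (P * (G + 1)) := by
    rw [hA, hP]
    exact mul_le_mul' le_rfl (dataBd_le r₀ ζ ε t v f M G hε)
  have hBP : B = ENNReal.ofReal c * (1 + ENNReal.ofReal (1 / ν)) * P := by
    rw [hB, hP, ENNReal.ofReal_mul (by positivity), ENNReal.ofReal_mul hc0.le,
      ENNReal.ofReal_pow (hpos _).le, hS, ENNReal.ofReal_add zero_le_one (by positivity),
      ENNReal.ofReal_one]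
    ring
  refine ⟨hlhs, ?_, ?_⟩
  · rw [hBP]
    calc A ≤ _ := hAP
      _ ≤ _ := le_self_add (b := ENNReal.ofReal c * ENNReal.ofReal (1 / ν) * P * (G + 1))
      _ = _ := by ring
  · have e : PhiT ζ v = overR (omR ζ v) := by
      funext s q
      simp only [PhiT, omR, cut, overR, div_mul_eq_mul_div]
    have hGX : G ≤ XT ζ t v := by
      rw [hG]
      exact le_add_self.trans (le_rpow_half le_add_self)
    have hN : ENNReal.ofReal (1 / ν) * ENNReal.ofReal ν = 1 := by
      rw [← ENNReal.ofReal_mul (by positivity), one_div_mul_cancel hν.ne', ENNReal.ofReal_one]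
    calc mixNorm 2 2 t (PhiT ζ v) ^ 2
        = ENNReal.ofReal (1 / ν) * (ENNReal.ofReal ν * mixNorm 2 2 t (overR (omR ζ v)) ^ 2) := by
          rw [← mul_assoc, hN, one_mul, e]
      _ ≤ ENNReal.ofReal (1 / ν) * (ENNReal.ofReal c * (P * (XT ζ t v + 1))) := by
          refine mul_le_mul' le_rfl ((le_add_self.trans hlhs).trans (hAP.trans ?_))
          gcongr
      _ ≤ _ := le_self_add (b := ENNReal.ofReal c * P * (XT ζ t v + 1))
      _ = _ := by rw [hBP]; ring
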